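/- **Setting.** Let $\mathfrak h$ be a finite-dimensional complex vector space, $W\subset GL(\mathfrak h)$ a finite subgroup, $R\subset W$ the set of elements whose fixed space has codimension one, and $c=(c_r)_{r\in R}$ complex numbers with $c_{wrw^{-1}}=c_r$ for all $w\in W$, $r\in R$. Let $\mathbf C[\mathfrak h]$ be the ring of polynomial functions on $\mathfrak h$, on which $W$ acts by $(wf)(y)=f(w^{-1}y)$. For $r\in R$ let $\alpha_r\in\mathfrak h^*$ be a linear form with zero set the fixed space of $r$, and for $v\in\mathfrak h$ let $$D_v(f)=\partial_v(f)-\sum_{r\in R}c_r\,\alpha_r(v)\,\frac{f-r(f)}{\alpha_r}.$$ $H_c$ is the algebra of operators on $\mathbf C[\mathfrak h]$ generated by $W$, $\mathbf C[\mathfrak h]$ (acting by multiplication) and the $D_v$, and $\mathcal O_c$ is the category of finitely generated $H_c$-modules on which every $D_v$ acts locally nilpotently. For $M\in\mathcal O_c$ and $d\in\mathbf C$, $M_d$ is the generalized eigenspace with eigenvalue $d$ of $\mathrm{eu}=\sum_i x_iD_{y_i}+\sum_{r}c_r(1-r)$ on $M$ ($y_i$ a basis of $\mathfrak h$ with dual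 basis $x_i$). For an irreducible $\mathbf CW$-module $E$, $c_E$ is the scalar by which $\sum_r c_r(1-r)$ acts on $E$, and $\Delta_c(E)$ is the $H_c$-module induced from $E$, regarded as a module over the subalgebra generated by $W$ and the $D_v$ on which the $D_v$ act by $0$. $H_0(\mathfrak h^*,M)=M/\mathfrak h^*M$ and $H^0(\mathfrak h,M)=\{m\in M: D_v m=0\text{ for all }v\in\mathfrak h\}$ are functors from $\mathcal O_c$ to $\mathbf C$-graded $\mathbf CW$-modules; $H_i(\mathfrak h^*,\cdot)$ denotes the left derived functors of the former and $H^i(\mathfrak h,\cdot)$ the right derived functors of the latter. $\mathrm{Tor}_i(M,\mathbf C)$ is taken over $\mathbf C[\mathfrak h]$, which acts on $\mathbf C$ by evaluation at $0$; its structure of graded $\mathbf CW$-module is that of the $i$-th homology of the Koszul complex $M\otimes\Lambda^\bullet\mathfrak h^*$ with differential $\sum_i x_i\otimes y_i$ ($y_i$ acting by contraction), in which $M_j\otimes\Lambda^i\mathfrak h^*$ has degree $i+j$. **Theorem (Hodge decomposition).** 1. For every $M\in\mathcal O_c$ and $i\ge0$, the $i$-th homology of this Koszul complex is isomorphic, as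 a vector space, to $\mathrm{Tor}_i^{\mathbf C[\mathfrak h]}(M,\mathbf C)$; moreover $\mathcal O_c$ has enough projectives and enough injectives, and $H_i(\mathfrak h^*,M)\cong\mathrm{Tor}_i(M,\mathbf C)$ as graded $\mathbf CW$-modules. 2. (Equivariant purity.) For every $M\in\mathcal O_c$, $i\ge 0$, $d\in\mathbf C$ and irreducible $\mathbf CW$-module $E$: if the $E$-isotypic part of the degree $d$ piece of $\mathrm{Tor}_i(M,\mathbf C)$ is not zero, then $d=c_E$. Suppose from now on that $c_{r^{-1}}=\overline{c_r}$ for all $r\in R$, and let $L$ be an irreducible object of $\mathcal O_c$ and $i\ge0$. 3. $H_i(\mathfrak h^*,L)\cong H^i(\mathfrak h,L)$ as graded $\mathbf CW$-modules. 4. As graded $\mathbf CW$-modules, $$\mathrm{Tor}_i(L,\mathbf C)\cong\bigoplus_{E\in\mathrm{Irr}(\mathbf CW)}\mathrm{Ext}^i_{\mathcal O_c}(\Delta_c(E),L)\otimes_{\mathbf C}E,$$ where the summand indexed by $E$ is placed in degree $c_E$ and $W$ acts on the factor $E$. 5. Let $v\mapsto\overline v$ be the conjugate linear isomorphism $\mathfrak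 h\to\mathfrak h^*$ given by a positive definite $W$-invariant Hermitian form on $\mathfrak h$. If $L$ is unitary, that is, if there is a positive definite $W$-invariant Hermitian form on $L$ for which $D_v$ is adjoint to multiplication by $\overline v$ for every $v\in\mathfrak h$, then for every irreducible $\mathbf CW$-module $E$ $$\mathrm{Ext}^i_{\mathcal O_c}(\Delta_c(E),L)\cong\mathrm{Hom}_{\mathbf CW}(E,\,L_{c_E-i}\otimes\Lambda^i\mathfrak h^*).$$ -/

import Mathlib

set_option linter.unusedSectionVars false

open CategoryTheory
open scoped TensorProduct DirectSum ModuleCat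

universe u

noncomputable section

namespace Cherednik

section Polynomials

variable (𝔥 : Type u) [AddCommGroup 𝔥] [Module ℂ 𝔥]

/-- `ℂ[𝔥]`: the ring of polynomial functions on `𝔥`, that is, the algebra of functions generated by
the linear forms. -/
def polyFun : Subalgebra ℂ (𝔥 → ℂ) :=
  Algebra.adjoin ℂ (Set.range fun x : Module.Dual ℂ 𝔥 => (x : 𝔥 → ℂ))

/-- The polynomial ring `ℂ[𝔥]` as a type. -/
def Poly : Type u := polyFun 𝔥

instance : CommRing (Poly 𝔥) := inferInstanceAs (CommRing (polyFun 𝔥))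

instance : Algebra ℂ (Poly 𝔥) := inferInstanceAs (Algebra ℂ (polyFun 𝔥))

variable {𝔥}

lemma poly_ext {f g : Poly 𝔥} (h : ∀ y, f.1 y = g.1 y) : f = g := Subtype.ext (funext h)

@[simp] lemma poly_add_apply (f g : Poly 𝔥) (y : 𝔥) : (f + g).1 y = f.1 y + g.1 y := rfl

@[simp] lemma poly_sub_apply (f g : Poly 𝔥) (y : 𝔥) : (f - g).1 y = f.1 y - g.1 y := rfl

@[simp] lemma poly_mul_apply (f g : Poly 𝔥) (y : 𝔥) : (f * g).1 y = f.1 y * g.1 y := rfl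

@[simp] lemma poly_smul_apply (a : ℂ) (f : Poly 𝔥) (y : 𝔥) : (a • f).1 y = a * f.1 y := rfl

@[simp] lemma poly_const_apply (a : ℂ) (y : 𝔥) : (algebraMap ℂ (Poly 𝔥) a).1 y = a := rfl

/-- A linear form, as a polynomial function. -/
def lin (x : Module.Dual ℂ 𝔥) : Poly 𝔥 :=
  ⟨x, Algebra.subset_adjoin ⟨x, rfl⟩⟩

@[simp] lemma lin_apply (x : Module.Dual ℂ 𝔥) (y : 𝔥) : (lin x).1 y = x y := rfl

lemma polyFun_induction {p : Poly 𝔥 → Prop}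
    (hlin : ∀ x, p (lin x)) (hconst : ∀ a : ℂ, p (algebraMap ℂ _ a))
    (hadd : ∀ f g, p f → p g → p (f + g)) (hmul : ∀ f g, p f → p g → p (f * g))
    (f : Poly 𝔥) : p f := by
  obtain ⟨f, hf⟩ := f
  induction hf using Algebra.adjoin_induction with
  | mem x hx => obtain ⟨x, rfl⟩ := hx; exact hlin x
  | algebraMap r => exact hconst r
  | add x y hx hy h1 h2 => exact hadd ⟨x, hx⟩ ⟨y, hy⟩ h1 h2
  | mul x y hx hy h1 h2 => exact hmul ⟨x, hx⟩ ⟨y, hy⟩ h1 h2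

lemma polyFun_lineDifferentiable (f : Poly 𝔥) (y v : 𝔥) :
    LineDifferentiableAt ℂ f.1 y v := by
  induction f using polyFun_induction with
  | hlin x =>
    unfold LineDifferentiableAt
    have : (fun t : ℂ => (lin x).1 (y + t • v)) = fun t => x y + t * x v := by
      ext t; simp
    rw [this]; fun_prop
  | hconst a =>
    unfold LineDifferentiableAt
    exact differentiableAt_const a
  | hadd f g hf hg => exact DifferentiableAt.add hf hg
  | hmul f g hf hg => exact DifferentiableAt.mul hf hg

lemma lineDeriv_lin (x : Module.Dual ℂ 𝔥) (y v : 𝔥) :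
    lineDeriv ℂ (lin x).1 y v = x v := by
  unfold lineDeriv
  have : (fun t : ℂ => (lin x).1 (y + t • v)) = fun t => x y + t * x v := by
    ext t; simp
  rw [this]
  simp

lemma lineDeriv_add' (f g : Poly 𝔥) (y v : 𝔥) :
    lineDeriv ℂ (f + g).1 y v = lineDeriv ℂ f.1 y v + lineDeriv ℂ g.1 y v :=
  deriv_add (polyFun_lineDifferentiable f y v) (polyFun_lineDifferentiable g y v)

lemma lineDeriv_mul' (f g : Poly 𝔥) (y v : 𝔥) :
    lineDeriv ℂ (f * g).1 y v =
      lineDeriv ℂ f.1 y v * g.1 y + f.1 y * lineDeriv ℂ g.1 y v := by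
  have := deriv_fun_mul (polyFun_lineDifferentiable f y v) (polyFun_lineDifferentiable g y v)
  simpa only [lineDeriv, poly_mul_apply, zero_smul, add_zero] using this

lemma lineDeriv_const' (a : ℂ) (y v : 𝔥) :
    lineDeriv ℂ (algebraMap ℂ (Poly 𝔥) a).1 y v = 0 :=
  deriv_const 0 a

lemma lineDeriv_mem (f : Poly 𝔥) (v : 𝔥) :
    (fun y => lineDeriv ℂ f.1 y v) ∈ polyFun 𝔥 := by
  induction f using polyFun_induction with
  | hlin x =>
    simp only [lineDeriv_lin]
    exact (algebraMap ℂ (Poly 𝔥) (x v)).2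
  | hconst a =>
    simp only [lineDeriv_const']
    exact (0 : Poly 𝔥).2
  | hadd f g hf hg =>
    have : (fun y => lineDeriv ℂ (f + g).1 y v) =
      (fun y => lineDeriv ℂ f.1 y v) + fun y => lineDeriv ℂ g.1 y v := by
      ext y; exact lineDeriv_add' f g y v
    rw [this]; exact add_mem hf hg
  | hmul f g hf hg =>
    have : (fun y => lineDeriv ℂ (f * g).1 y v) =
      (fun y => lineDeriv ℂ f.1 y v) * g.1 +
        f.1 * fun y => lineDeriv ℂ g.1 y v := by
      ext y; exact lineDeriv_mul' f g y v
    rw [this]; exact add_mem (mul_mem hf g.2) (mul_mem f.2 hg)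

/-- The derivative `∂_v` of polynomial functions in the direction `v`. -/
def dirDeriv (v : 𝔥) : Poly 𝔥 →ₗ[ℂ] Poly 𝔥 where
  toFun f := ⟨fun y => lineDeriv ℂ f.1 y v, lineDeriv_mem f v⟩
  map_add' f g := poly_ext fun y => by exact lineDeriv_add' f g y v
  map_smul' a f := by
    refine poly_ext fun y => ?_
    have := lineDeriv_mul' (algebraMap ℂ (Poly 𝔥) a) f y v
    rw [lineDeriv_const', zero_mul, zero_add] at this
    exact this

lemma dirDeriv_apply (v : 𝔥) (f : Poly 𝔥) (y : 𝔥) :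
    (dirDeriv v f).1 y = lineDeriv ℂ f.1 y v := rfl

lemma dirDeriv_mul (v : 𝔥) (f g : Poly 𝔥) :
    dirDeriv v (f * g) = dirDeriv v f * g + f * dirDeriv v g := by
  refine poly_ext fun y => ?_; exact lineDeriv_mul' f g y v

lemma dirDeriv_lin (v : 𝔥) (x : Module.Dual ℂ 𝔥) :
    dirDeriv v (lin x) = algebraMap ℂ _ (x v) := by
  refine poly_ext fun y => ?_; exact lineDeriv_lin x y v

lemma dirDeriv_const (v : 𝔥) (a : ℂ) : dirDeriv v (algebraMap ℂ (Poly 𝔥) a) = 0 := by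
  refine poly_ext fun y => ?_; exact lineDeriv_const' a y v

lemma dirDeriv_add_dir (u v : 𝔥) (f : Poly 𝔥) :
    dirDeriv (u + v) f = dirDeriv u f + dirDeriv v f := by
  induction f using polyFun_induction with
  | hlin x => simp [dirDeriv_lin]
  | hconst a => simp [dirDeriv_const]
  | hadd f g hf hg => simp only [map_add, hf, hg]; ring
  | hmul f g hf hg => simp only [dirDeriv_mul, hf, hg]; ring

lemma dirDeriv_smul_dir (a : ℂ) (v : 𝔥) (f : Poly 𝔥) :
    dirDeriv (a • v) f = a • dirDeriv v f := by
  induction f using polyFun_induction with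
  | hlin x => simp [dirDeriv_lin, Algebra.smul_def]
  | hconst a => simp [dirDeriv_const]
  | hadd f g hf hg => simp only [map_add, hf, hg, smul_add]
  | hmul f g hf hg => simp only [dirDeriv_mul, hf, hg, Algebra.smul_def]; ring

/-- The action of a linear automorphism on polynomial functions, `(w f)(y) = f (w⁻¹ y)`. -/
def polyAct (w : 𝔥 ≃ₗ[ℂ] 𝔥) : Poly 𝔥 →ₐ[ℂ] Poly 𝔥 where
  toFun f := ⟨fun y => f.1 (w.symm y), by
    induction f using polyFun_induction with
    | hlin x => exact (lin (x ∘ₗ w.symm.toLinearMap)).2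
    | hconst a => exact (algebraMap ℂ (Poly 𝔥) a).2
    | hadd f g hf hg => exact add_mem hf hg
    | hmul f g hf hg => exact mul_mem hf hg⟩
  map_one' := rfl
  map_mul' _ _ := rfl
  map_zero' := rfl
  map_add' _ _ := rfl
  commutes' _ := rfl

@[simp] lemma polyAct_apply (w : 𝔥 ≃ₗ[ℂ] 𝔥) (f : Poly 𝔥) (y : 𝔥) :
    (polyAct w f).1 y = f.1 (w.symm y) := rfl

lemma polyAct_mul (w w' : 𝔥 ≃ₗ[ℂ] 𝔥) (f : Poly 𝔥) :
    polyAct (w * w') f = polyAct w (polyAct w' f) := rfl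

lemma polyAct_one (f : Poly 𝔥) : polyAct 1 f = f := rfl

lemma polyAct_lin (w : 𝔥 ≃ₗ[ℂ] 𝔥) (x : Module.Dual ℂ 𝔥) :
    polyAct w (lin x) = lin (x ∘ₗ w.symm.toLinearMap) := rfl

lemma polyAct_dirDeriv (w : 𝔥 ≃ₗ[ℂ] 𝔥) (v : 𝔥) (f : Poly 𝔥) :
    polyAct w (dirDeriv v f) = dirDeriv (w v) (polyAct w f) := by
  refine poly_ext fun y => ?_
  simp only [polyAct_apply, dirDeriv_apply, lineDeriv, map_add, map_smul,
    LinearEquiv.symm_apply_apply]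

/-- A nonzero linear form is not a zero divisor among polynomial functions. -/
lemma lin_mul_eq_zero {x : Module.Dual ℂ 𝔥} (hx : x ≠ 0) {g : Poly 𝔥}
    (h : lin x * g = 0) : g = 0 := by
  obtain ⟨v, hv⟩ : ∃ v, x v ≠ 0 := by
    by_contra! hcon
    exact hx (LinearMap.ext hcon)
  have hval : ∀ y, x y * g.1 y = 0 := fun y => congrFun (congrArg Subtype.val h) y
  refine poly_ext fun y => ?_
  by_cases hy : x y = 0
  · have hc : ContinuousAt (fun t : ℂ => g.1 (y + t • v)) 0 :=
      (polyFun_lineDifferentiable g y v).continuousAt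
    have h0 : Filter.Tendsto (fun t : ℂ => g.1 (y + t • v)) (nhdsWithin 0 {0}ᶜ)
        (nhds (g.1 y)) := by
      have := hc.tendsto.mono_left (nhdsWithin_le_nhds (s := {0}ᶜ))
      simpa using this
    have h1 : Filter.Tendsto (fun t : ℂ => g.1 (y + t • v)) (nhdsWithin 0 {0}ᶜ)
        (nhds 0) := by
      refine Filter.Tendsto.congr' ?_ tendsto_const_nhds
      filter_upwards [self_mem_nhdsWithin] with t ht
      have := hval (y + t • v)
      have hne : x (y + t • v) ≠ 0 := by
        simpa [hy] using ⟨ht, hv⟩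
      exact ((mul_eq_zero.mp this).resolve_left hne).symm
    exact tendsto_nhds_unique h0 h1
  · exact (mul_eq_zero.mp (hval y)).resolve_left hy

lemma lin_mul_cancel {x : Module.Dual ℂ 𝔥} (hx : x ≠ 0) {f g : Poly 𝔥}
    (h : lin x * f = lin x * g) : f = g := by
  rw [← sub_eq_zero] at h ⊢
  rw [← mul_sub] at h
  exact lin_mul_eq_zero hx h

end Polynomials

section Dunkl

variable {𝔥 : Type u} [AddCommGroup 𝔥] [Module ℂ 𝔥]

/-- The fixed space of a linear automorphism. -/
def fixedSpace (w : 𝔥 ≃ₗ[ℂ] 𝔥) : Submodule ℂ 𝔥 :=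
  LinearMap.eqLocus w.toLinearMap LinearMap.id

lemma mem_fixedSpace {w : 𝔥 ≃ₗ[ℂ] 𝔥} {v : 𝔥} : v ∈ fixedSpace w ↔ w v = v := Iff.rfl

/-- The set `R` of reflections of `W`: the elements whose fixed space has codimension one. -/
def Refl (W : Subgroup (𝔥 ≃ₗ[ℂ] 𝔥)) : Type u :=
  {r : W // Module.finrank ℂ (𝔥 ⧸ fixedSpace (r : 𝔥 ≃ₗ[ℂ] 𝔥)) = 1}

variable {W : Subgroup (𝔥 ≃ₗ[ℂ] 𝔥)}

/-- The linear automorphism underlying a reflection. -/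
def Refl.toEquiv (r : Refl W) : 𝔥 ≃ₗ[ℂ] 𝔥 := (r.1 : 𝔥 ≃ₗ[ℂ] 𝔥)

instance [Finite W] : Finite (Refl W) := Subtype.finite

instance [Finite W] : Fintype (Refl W) := Fintype.ofFinite _

lemma Refl.exists_form (r : Refl W) :
    ∃ α : Module.Dual ℂ 𝔥, LinearMap.ker α = fixedSpace r.toEquiv := by
  have : Module.Finite ℂ (𝔥 ⧸ fixedSpace r.toEquiv) :=
    Module.finite_of_finrank_eq_succ r.2
  have e : (𝔥 ⧸ fixedSpace r.toEquiv) ≃ₗ[ℂ] ℂ :=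
    LinearEquiv.ofFinrankEq _ _ (by rw [Module.finrank_self]; exact r.2)
  refine ⟨e.toLinearMap ∘ₗ (fixedSpace r.toEquiv).mkQ, ?_⟩
  rw [LinearEquiv.ker_comp, Submodule.ker_mkQ]

/-- A linear form `α_r` whose zero set is the fixed space of `r`. It is unique up to a nonzero
scalar, and the Dunkl operators do not depend on that scalar. -/
def Refl.form (r : Refl W) : Module.Dual ℂ 𝔥 := r.exists_form.choose

lemma Refl.ker_form (r : Refl W) : LinearMap.ker r.form = fixedSpace r.toEquiv :=
  r.exists_form.choose_spec

lemma Refl.fixedSpace_ne_top (r : Refl W) : fixedSpace r.toEquiv ≠ ⊤ := by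
  intro h
  have h1 : Module.finrank ℂ (𝔥 ⧸ fixedSpace r.toEquiv) = 1 := r.2
  have : Subsingleton (𝔥 ⧸ fixedSpace r.toEquiv) := Submodule.Quotient.subsingleton_iff.mpr h
  rw [Module.finrank_zero_of_subsingleton] at h1
  exact absurd h1 (by norm_num)

lemma Refl.ne_zero_of_ker (r : Refl W) {l : Module.Dual ℂ 𝔥}
    (hl : LinearMap.ker l = fixedSpace r.toEquiv) : l ≠ 0 := by
  rintro rfl
  exact r.fixedSpace_ne_top (by rw [← hl, LinearMap.ker_zero])

lemma Refl.form_ne_zero (r : Refl W) : r.form ≠ 0 := r.ne_zero_of_ker r.ker_form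

lemma eq_smul_of_ker_le {M : Type*} [AddCommGroup M] [Module ℂ M]
    {l : Module.Dual ℂ 𝔥} (hl : l ≠ 0) {x : 𝔥 →ₗ[ℂ] M}
    (h : LinearMap.ker l ≤ LinearMap.ker x) : ∃ m : M, ∀ y, x y = l y • m := by
  obtain ⟨v, hv⟩ : ∃ v, l v ≠ 0 := by
    by_contra! hcon
    exact hl (LinearMap.ext hcon)
  refine ⟨(l v)⁻¹ • x v, fun y => ?_⟩
  have : y - (l y * (l v)⁻¹) • v ∈ LinearMap.ker x := h (by simp [hv])
  rw [LinearMap.mem_ker, map_sub, map_smul, sub_eq_zero] at this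
  rw [this, mul_smul]

lemma Refl.exists_divDiff (r : Refl W) (f : Poly 𝔥) :
    ∃ g, lin r.form * g = f - polyAct r.toEquiv f := by
  induction f using polyFun_induction with
  | hlin x =>
    obtain ⟨a, ha⟩ := eq_smul_of_ker_le (M := ℂ) r.form_ne_zero
      (x := x - x ∘ₗ r.toEquiv.symm.toLinearMap) (by
        intro y hy
        rw [r.ker_form, mem_fixedSpace] at hy
        have : r.toEquiv.symm y = y := by rw [LinearEquiv.symm_apply_eq]; exact hy.symm
        simp [this])
    refine ⟨algebraMap ℂ _ a, ?_⟩
    refine poly_ext fun y => ?_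
    simpa using (ha y).symm
  | hconst a => exact ⟨0, by simp⟩
  | hadd f g hf hg =>
    obtain ⟨f', hf⟩ := hf
    obtain ⟨g', hg⟩ := hg
    exact ⟨f' + g', by rw [mul_add, hf, hg, map_add]; ring⟩
  | hmul f g hf hg =>
    obtain ⟨f', hf⟩ := hf
    obtain ⟨g', hg⟩ := hg
    refine ⟨f' * g + polyAct r.toEquiv f * g', ?_⟩
    rw [mul_add, ← mul_assoc, hf, mul_left_comm, hg, map_mul]
    ring

/-- The divided difference `f ↦ (f - r(f)) / α_r`. -/
def Refl.divDiff (r : Refl W) : Poly 𝔥 →ₗ[ℂ] Poly 𝔥 where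
  toFun f := (r.exists_divDiff f).choose
  map_add' f g := by
    apply lin_mul_cancel r.form_ne_zero
    rw [mul_add, (r.exists_divDiff _).choose_spec, (r.exists_divDiff _).choose_spec,
      (r.exists_divDiff _).choose_spec, map_add]
    ring
  map_smul' a f := by
    apply lin_mul_cancel r.form_ne_zero
    rw [RingHom.id_apply, mul_smul_comm, (r.exists_divDiff _).choose_spec,
      (r.exists_divDiff _).choose_spec, map_smul, smul_sub]

lemma Refl.form_mul_divDiff (r : Refl W) (f : Poly 𝔥) :
    lin r.form * r.divDiff f = f - polyAct r.toEquiv f :=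
  (r.exists_divDiff f).choose_spec

lemma Refl.divDiff_mul (r : Refl W) (f g : Poly 𝔥) :
    r.divDiff (f * g) = f * r.divDiff g + r.divDiff f * polyAct r.toEquiv g := by
  apply lin_mul_cancel r.form_ne_zero
  rw [mul_add, mul_left_comm, ← mul_assoc (lin r.form), r.form_mul_divDiff, r.form_mul_divDiff,
    r.form_mul_divDiff, map_mul]
  ring

lemma Refl.divDiff_const (r : Refl W) (a : ℂ) :
    r.divDiff (algebraMap ℂ _ a) = 0 := by
  apply lin_mul_cancel r.form_ne_zero
  rw [r.form_mul_divDiff]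
  simp

lemma Refl.divDiff_lin (r : Refl W) (x : Module.Dual ℂ 𝔥) :
    ∃ a : ℂ, r.divDiff (lin x) = algebraMap ℂ _ a := by
  obtain ⟨a, ha⟩ := eq_smul_of_ker_le (M := ℂ) r.form_ne_zero
    (x := x - x ∘ₗ r.toEquiv.symm.toLinearMap) (by
      intro y hy
      rw [r.ker_form, mem_fixedSpace] at hy
      have : r.toEquiv.symm y = y := by rw [LinearEquiv.symm_apply_eq]; exact hy.symm
      simp [this])
  refine ⟨a, ?_⟩
  apply lin_mul_cancel r.form_ne_zero
  rw [r.form_mul_divDiff]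
  refine poly_ext fun y => ?_
  simpa using ha y

/-- The operator `f ↦ α_r(v) (f - r(f)) / α_r` may be computed with any linear form that has the
same zero set. -/
lemma Refl.divDiff_unique (r : Refl W) {l : Module.Dual ℂ 𝔥}
    (hl : LinearMap.ker l = fixedSpace r.toEquiv) (v : 𝔥) (f g : Poly 𝔥)
    (h : lin l * g = l v • (f - polyAct r.toEquiv f)) :
    g = r.form v • r.divDiff f := by
  obtain ⟨a, ha⟩ := eq_smul_of_ker_le (M := ℂ) (r.ne_zero_of_ker hl) (x := r.form)
    (by rw [hl, r.ker_form])
  have hform : lin r.form = a • lin l := by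
    refine poly_ext fun y => ?_; simp [ha, mul_comm]
  apply lin_mul_cancel r.form_ne_zero
  rw [mul_smul_comm, r.form_mul_divDiff, hform, smul_mul_assoc, h, smul_smul, ha v, smul_eq_mul,
    mul_comm]

lemma Refl.exists_coroot (r : Refl W) :
    ∃ b : 𝔥, ∀ u, u - r.toEquiv u = r.form u • b :=
  eq_smul_of_ker_le r.form_ne_zero (x := LinearMap.id - r.toEquiv.toLinearMap) (by
    intro y hy
    rw [r.ker_form, mem_fixedSpace] at hy
    simp [hy])

/-- The conjugate `w r w⁻¹` of a reflection. -/
def Refl.conj (w : W) (r : Refl W) : Refl W :=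
  ⟨w * r.1 * w⁻¹, by
    have hmap : (fixedSpace (r.1 : 𝔥 ≃ₗ[ℂ] 𝔥)).map (w : 𝔥 ≃ₗ[ℂ] 𝔥).toLinearMap =
        fixedSpace ((w * r.1 * w⁻¹ : W) : 𝔥 ≃ₗ[ℂ] 𝔥) := by
      ext y
      simp only [Submodule.mem_map, mem_fixedSpace]
      constructor
      · rintro ⟨x, hx, rfl⟩
        change w.1 (r.1.1 (w.1.symm (w.1 x))) = w.1 x
        rw [LinearEquiv.symm_apply_apply, hx]
      · intro hy
        change w.1 (r.1.1 (w.1.symm y)) = y at hy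
        exact ⟨w.1.symm y, (LinearEquiv.eq_symm_apply _).mpr hy, LinearEquiv.apply_symm_apply _ _⟩
    rw [← (Submodule.Quotient.equiv _ _ (w : 𝔥 ≃ₗ[ℂ] 𝔥) hmap).finrank_eq]
    exact r.2⟩

lemma Refl.conj_toEquiv (w : W) (r : Refl W) :
    (r.conj w).toEquiv = w.1 * r.toEquiv * w.1⁻¹ := rfl

/-- Conjugation by `w` permutes the reflections. -/
def Refl.conjEquiv (w : W) : Refl W ≃ Refl W where
  toFun := Refl.conj w
  invFun := Refl.conj w⁻¹
  left_inv r := Subtype.ext (by change w⁻¹ * (w * r.1 * w⁻¹) * w⁻¹⁻¹ = r.1; group)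
  right_inv r := Subtype.ext (by change w * (w⁻¹ * r.1 * w⁻¹⁻¹) * w⁻¹ = r.1; group)

variable (W) in
/-- A deformation parameter: a family `(c_r)` of complex numbers indexed by the reflections of `W`
which is constant on `W`-conjugacy classes. -/
structure Param where
  /-- the number `c_r` -/
  val : Refl W → ℂ
  /-- invariance under conjugation -/
  val_conj : ∀ (w : W) (r : Refl W), val (r.conj w) = val r

/-- The reality condition `c_{r⁻¹} = conj c_r`. -/
def Param.IsReal (c : Param W) : Prop :=
  ∀ r s : Refl W, s.1 = r.1⁻¹ → c.val s = starRingEnd ℂ (c.val r)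

variable [Finite W] (c : Param W)

/-- The Dunkl operator `D_v f = ∂_v f - ∑_r c_r α_r(v) (f - r(f)) / α_r`. -/
def dunkl (v : 𝔥) : Module.End ℂ (Poly 𝔥) :=
  dirDeriv v - ∑ r : Refl W, (c.val r * r.form v) • r.divDiff

lemma dunkl_apply (v : 𝔥) (f : Poly 𝔥) :
    dunkl c v f = dirDeriv v f - ∑ r : Refl W, (c.val r * r.form v) • r.divDiff f := by
  simp [dunkl, LinearMap.sum_apply]

lemma dunkl_add (u v : 𝔥) : dunkl c (u + v) = dunkl c u + dunkl c v := by
  ext1 f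
  simp only [dunkl_apply, LinearMap.add_apply, dirDeriv_add_dir, map_add, mul_add, add_smul,
    Finset.sum_add_distrib]
  abel

lemma dunkl_smul (a : ℂ) (v : 𝔥) : dunkl c (a • v) = a • dunkl c v := by
  ext1 f
  simp only [dunkl_apply, LinearMap.smul_apply, dirDeriv_smul_dir, map_smul, smul_sub,
    Finset.smul_sum, smul_smul, smul_eq_mul]
  congr 1
  refine Finset.sum_congr rfl fun r _ => ?_
  congr 1
  ring

lemma dunkl_mul (v : 𝔥) (f g : Poly 𝔥) :
    dunkl c v (f * g) = f * dunkl c v g + dirDeriv v f * g -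
      ∑ r : Refl W, (c.val r * r.form v) • (r.divDiff f * polyAct r.toEquiv g) := by
  simp only [dunkl_apply, dirDeriv_mul, Refl.divDiff_mul, smul_add, Finset.sum_add_distrib,
    mul_sub, Finset.mul_sum, mul_smul_comm]
  ring

lemma polyAct_dunkl (w : W) (v : 𝔥) (f : Poly 𝔥) :
    polyAct w.1 (dunkl c v f) = dunkl c (w.1 v) (polyAct w.1 f) := by
  rw [dunkl_apply, dunkl_apply, map_sub, polyAct_dirDeriv, map_sum]
  congr 1
  refine Finset.sum_equiv (Refl.conjEquiv w) (by simp) fun r _ => ?_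
  change _ = (c.val (r.conj w) * (r.conj w).form (w.1 v)) • (r.conj w).divDiff (polyAct w.1 f)
  rw [c.val_conj, mul_smul, mul_smul, map_smul]
  rw [map_smul]
  congr 1
  have key : r.form v • polyAct w.1 (r.divDiff f) =
      (r.conj w).form (w.1 v) • (r.conj w).divDiff (polyAct w.1 f) := by
    refine (r.conj w).divDiff_unique (l := r.form ∘ₗ w.1.symm.toLinearMap) ?_ _ _ _ ?_
    · ext y
      rw [LinearMap.mem_ker, LinearMap.comp_apply, ← LinearMap.mem_ker, r.ker_form, mem_fixedSpace,
        mem_fixedSpace, Refl.conj_toEquiv]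
      change r.toEquiv (w.1.symm y) = w.1.symm y ↔ w.1 (r.toEquiv (w.1.symm y)) = y
      rw [LinearEquiv.eq_symm_apply]
    · rw [← polyAct_lin, mul_smul_comm, ← map_mul, r.form_mul_divDiff, map_sub,
        Refl.conj_toEquiv, ← polyAct_mul, ← polyAct_mul]
      congr 1
      · simp
      · congr 2
        group
  exact key

/-- The Dunkl operators commute. -/
lemma dunkl_comm (u v : 𝔥) (f : Poly 𝔥) :
    dunkl c u (dunkl c v f) = dunkl c v (dunkl c u f) := by
  choose b hb using fun r : Refl W => r.exists_coroot
  have hconst : ∀ (a : ℂ) (v : 𝔥), dunkl c v (algebraMap ℂ _ a) = 0 := fun a v => by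
    simp [dunkl_apply, dirDeriv_const, Refl.divDiff_const]
  have hlin : ∀ (x : Module.Dual ℂ 𝔥) (g : Poly 𝔥),
      dunkl c u (dunkl c v (lin x * g)) - dunkl c v (dunkl c u (lin x * g)) =
        lin x * (dunkl c u (dunkl c v g) - dunkl c v (dunkl c u g)) := by
    intro x g
    choose a ha using fun r : Refl W => r.divDiff_lin x
    have hD : ∀ (v : 𝔥) (g : Poly 𝔥), dunkl c v (lin x * g) = lin x * dunkl c v g + x v • g -
        ∑ r : Refl W, (c.val r * r.form v * a r) • polyAct r.toEquiv g := by
      intro v g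
      rw [dunkl_mul, dirDeriv_lin]
      simp only [ha, ← Algebra.smul_def, smul_smul]
    have hr : ∀ (u : 𝔥) (r : Refl W) (g : Poly 𝔥), dunkl c u (polyAct r.toEquiv g) =
        polyAct r.toEquiv (dunkl c u g) + r.form u • dunkl c (b r) (polyAct r.toEquiv g) := by
      intro u r g
      have h1 := polyAct_dunkl c r.1 u g
      change polyAct r.toEquiv (dunkl c u g) = dunkl c (r.toEquiv u) (polyAct r.toEquiv g) at h1
      rw [h1, ← LinearMap.smul_apply, ← LinearMap.add_apply, ← dunkl_smul, ← dunkl_add, ← hb r u]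
      congr 2
      abel
    have hfull : ∀ u v : 𝔥, dunkl c u (dunkl c v (lin x * g)) =
        lin x * dunkl c u (dunkl c v g) + x u • dunkl c v g + x v • dunkl c u g -
        (∑ r : Refl W, (c.val r * r.form u * a r) • polyAct r.toEquiv (dunkl c v g)) -
        (∑ r : Refl W, (c.val r * r.form v * a r) • polyAct r.toEquiv (dunkl c u g)) -
        ∑ r : Refl W, (c.val r * r.form v * r.form u * a r) •
          dunkl c (b r) (polyAct r.toEquiv g) := by
      intro u v
      have hsum : dunkl c u (∑ r : Refl W, (c.val r * r.form v * a r) • polyAct r.toEquiv g) =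
          (∑ r : Refl W, (c.val r * r.form v * a r) • polyAct r.toEquiv (dunkl c u g)) +
          ∑ r : Refl W, (c.val r * r.form v * r.form u * a r) •
            dunkl c (b r) (polyAct r.toEquiv g) := by
        rw [map_sum, ← Finset.sum_add_distrib]
        refine Finset.sum_congr rfl fun r _ => ?_
        rw [map_smul, hr, smul_add, smul_smul]
        congr 2
        ring
      rw [hD v g, map_sub, map_add, hD u, map_smul, hsum]
      abel
    rw [hfull u v, hfull v u]
    have : ∀ r : Refl W, c.val r * r.form u * r.form v * a r =
        c.val r * r.form v * r.form u * a r := fun r => by ring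
    simp only [this, mul_sub]
    abel
  have hmul : ∀ (f g : Poly 𝔥),
      dunkl c u (dunkl c v (f * g)) - dunkl c v (dunkl c u (f * g)) =
        f * (dunkl c u (dunkl c v g) - dunkl c v (dunkl c u g)) := by
    intro f
    induction f using polyFun_induction with
    | hlin x => exact hlin x
    | hconst a =>
      intro g
      simp only [← Algebra.smul_def, map_smul, smul_sub]
    | hadd f f' hf hf' =>
      intro g
      simp only [add_mul, map_add]
      rw [← hf, ← hf']
      abel
    | hmul f f' hf hf' =>
      intro g
      rw [mul_assoc, hf, hf', mul_assoc]
  have h1 := hmul f 1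
  have h2 : ∀ v : 𝔥, dunkl c v 1 = 0 := fun v => by simpa using hconst 1 v
  rw [mul_one, h2, h2, map_zero, map_zero, sub_zero, mul_zero, sub_eq_zero] at h1
  exact h1

/-- The rational Cherednik algebra `H_c`, as a subalgebra of `End(ℂ[𝔥])`: the algebra of operators
on `ℂ[𝔥]` generated by `W`, by the multiplication operators and by the Dunkl operators. -/
def cherednik : Subalgebra ℂ (Module.End ℂ (Poly 𝔥)) :=
  Algebra.adjoin ℂ
    (Set.range (fun w : W => (polyAct w.1).toLinearMap) ∪
      Set.range (fun f : Poly 𝔥 => LinearMap.mulLeft ℂ f) ∪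
      Set.range (fun v : 𝔥 => dunkl c v))

/-- The rational Cherednik algebra `H_c` as a type. -/
def Cher : Type u := cherednik c

instance : Ring (Cher c) := inferInstanceAs (Ring (cherednik c))

instance : Algebra ℂ (Cher c) := inferInstanceAs (Algebra ℂ (cherednik c))

variable {c} in
lemma cher_ext {a b : Cher c} (h : ∀ f, a.1 f = b.1 f) : a = b := Subtype.ext (LinearMap.ext h)

/-- An element of the group `W`, in `H_c`. -/
def grp : W →* Cher c where
  toFun w := ⟨(polyAct w.1).toLinearMap, Algebra.subset_adjoin (Or.inl (Or.inl ⟨w, rfl⟩))⟩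
  map_one' := rfl
  map_mul' _ _ := rfl

/-- A polynomial function, in `H_c`. -/
def mulOp : Poly 𝔥 →ₐ[ℂ] Cher c where
  toFun f := ⟨LinearMap.mulLeft ℂ f, Algebra.subset_adjoin (Or.inl (Or.inr ⟨f, rfl⟩))⟩
  map_one' := cher_ext fun g => one_mul g
  map_mul' f f' := cher_ext fun g => mul_assoc f f' g
  map_zero' := cher_ext fun g => zero_mul g
  map_add' f f' := cher_ext fun g => add_mul f f' g
  commutes' a := cher_ext fun g => (Algebra.smul_def a g).symm

/-- The Dunkl operator `D_v`, in `H_c`. -/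
def dun : 𝔥 →ₗ[ℂ] Cher c where
  toFun v := ⟨dunkl c v, Algebra.subset_adjoin (Or.inr ⟨v, rfl⟩)⟩
  map_add' u v := cher_ext fun f => LinearMap.congr_fun (dunkl_add c u v) f
  map_smul' a v := cher_ext fun f => LinearMap.congr_fun (dunkl_smul c a v) f

lemma dun_comm (u v : 𝔥) : dun c u * dun c v = dun c v * dun c u :=
  cher_ext fun f => dunkl_comm c u v f

lemma grp_mul_dun (w : W) (v : 𝔥) : grp c w * dun c v = dun c (w.1 v) * grp c w :=
  cher_ext fun f => polyAct_dunkl c w v f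

lemma grp_mul_mulOp (w : W) (f : Poly 𝔥) :
    grp c w * mulOp c f = mulOp c (polyAct w.1 f) * grp c w :=
  cher_ext fun g => map_mul (polyAct w.1) f g

lemma cher_sum_apply {ι : Type*} (s : Finset ι) (a : ι → Cher c) (f : Poly 𝔥) :
    (∑ i ∈ s, a i).1 f = ∑ i ∈ s, (a i).1 f := by
  classical
  induction s using Finset.induction_on with
  | empty => rfl
  | insert i s hi ih =>
    rw [Finset.sum_insert hi, Finset.sum_insert hi, ← ih]
    rfl

lemma dun_mul_mulOp (v : 𝔥) (f : Poly 𝔥) :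
    dun c v * mulOp c f = mulOp c f * dun c v + mulOp c (dirDeriv v f) -
      ∑ r : Refl W, (c.val r * r.form v) • (mulOp c (r.divDiff f) * grp c r.1) := by
  refine cher_ext fun g => ?_
  have h1 := cher_sum_apply c Finset.univ
    (fun r : Refl W => (c.val r * r.form v) • (mulOp c (r.divDiff f) * grp c r.1)) g
  refine (dunkl_mul c v f g).trans ?_
  refine congrArg (fun t => f * dunkl c v g + dirDeriv v f * g - t) ?_
  exact h1.symm

lemma cherednik_induction {p : Cher c → Prop}
    (hgrp : ∀ w, p (grp c w)) (hmulOp : ∀ f, p (mulOp c f)) (hdun : ∀ v, p (dun c v))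
    (hadd : ∀ a b, p a → p b → p (a + b)) (hmul : ∀ a b, p a → p b → p (a * b))
    (a : Cher c) : p a := by
  obtain ⟨a, ha⟩ := a
  refine Algebra.adjoin_induction (p := fun x hx => p ⟨x, hx⟩) ?_ ?_ ?_ ?_ ha
  · rintro x ((⟨w, rfl⟩ | ⟨f, rfl⟩) | ⟨v, rfl⟩)
    · exact hgrp w
    · exact hmulOp f
    · exact hdun v
  · intro a
    have h := hmulOp (algebraMap ℂ _ a)
    rw [AlgHom.commutes] at h
    exact h
  · exact fun x y hx hy h1 h2 => hadd ⟨x, hx⟩ ⟨y, hy⟩ h1 h2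
  · exact fun x y hx hy h1 h2 => hmul ⟨x, hx⟩ ⟨y, hy⟩ h1 h2

end Dunkl

section CategoryO

variable {𝔥 : Type u} [AddCommGroup 𝔥] [Module ℂ 𝔥]

instance [FiniteDimensional ℂ 𝔥] : IsNoetherianRing (Poly 𝔥) := by
  let b := Module.finBasis ℂ (Module.Dual ℂ 𝔥)
  refine isNoetherianRing_of_surjective _ _
    (MvPolynomial.aeval (R := ℂ) fun i => lin (b i)).toRingHom ?_
  intro f
  change f ∈ (MvPolynomial.aeval (R := ℂ) fun i => lin (b i)).range
  induction f using polyFun_induction with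
  | hlin x =>
    have : lin x = ∑ i, b.repr x i • lin (b i) := by
      refine poly_ext fun y => ?_
      have h1 : x y = (∑ i, b.repr x i • b i) y := by rw [b.sum_repr]
      have h2 : ∀ (s : Finset (Fin _)), (∑ i ∈ s, b.repr x i • lin (b i)).1 y =
          (∑ i ∈ s, b.repr x i • b i) y := by
        intro s
        induction s using Finset.induction_on with
        | empty => rfl
        | insert i s hi ih => rw [Finset.sum_insert hi, Finset.sum_insert hi,
            poly_add_apply, ih]; rfl
      rw [h2, ← h1]; rfl
    rw [this]
    exact sum_mem fun i _ => Subalgebra.smul_mem _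
      ((AlgHom.mem_range _).mpr ⟨MvPolynomial.X i, by simp⟩) _
  | hconst a => exact algebraMap_mem _ a
  | hadd f g hf hg => exact add_mem hf hg
  | hmul f g hf hg => exact mul_mem hf hg

variable {W : Subgroup (𝔥 ≃ₗ[ℂ] 𝔥)} [Finite W] (c : Param W)

/-- The objects of category `O_c`: finitely generated `H_c`-modules on which each Dunkl operator
acts locally nilpotently. -/
def objO : ObjectProperty (ModuleCat.{u} (Cher c)) := fun M =>
  Module.Finite (Cher c) M ∧ ∀ (v : 𝔥) (m : M), ∃ N : ℕ, (dun c v ^ N) • m = 0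

section Finiteness

variable {c} {M : Type u} [AddCommGroup M] [Module ℂ M] [Module (Cher c) M]
  [IsScalarTower ℂ (Cher c) M]

lemma exists_fd_stable_single (T : Module.End ℂ M) (hT : ∀ m, ∃ N : ℕ, (T ^ N) m = 0)
    (U : Submodule ℂ M) (hU : U.FG) :
    ∃ U' : Submodule ℂ M, U ≤ U' ∧ U'.FG ∧ (∀ m ∈ U', T m ∈ U') ∧
      ∀ S : Module.End ℂ M, S * T = T * S → (∀ m ∈ U, S m ∈ U) → ∀ m ∈ U', S m ∈ U' := by
  obtain ⟨N, hN⟩ : ∃ N : ℕ, ∀ m ∈ U, (T ^ N) m = 0 := by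
    obtain ⟨s, rfl⟩ := hU
    choose n hn using hT
    refine ⟨s.sup n, fun m hm => ?_⟩
    have : Submodule.span ℂ (s : Set M) ≤ LinearMap.ker (T ^ s.sup n) := by
      rw [Submodule.span_le]
      intro x hx
      obtain ⟨k, hk⟩ := Nat.exists_eq_add_of_le (Finset.le_sup (f := n) hx)
      change (T ^ s.sup n) x = 0
      rw [hk, add_comm, pow_add, Module.End.mul_apply, hn, map_zero]
    exact this hm
  refine ⟨⨆ k : Fin (N + 1), U.map (T ^ (k : ℕ)), ?_, ?_, ?_, ?_⟩
  · refine le_trans ?_ (le_iSup _ (0 : Fin (N + 1)))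
    intro m hm
    exact ⟨m, hm, by simp⟩
  · exact Submodule.fg_iSup _ fun k => hU.map _
  · have hle : ∀ k : ℕ, U.map (T ^ k) ≤ ⨆ k : Fin (N + 1), U.map (T ^ (k : ℕ)) := by
      intro k
      by_cases hk : k < N + 1
      · exact le_iSup (fun k : Fin (N + 1) => U.map (T ^ (k : ℕ))) ⟨k, hk⟩
      · rintro _ ⟨m, hm, rfl⟩
        obtain ⟨j, hj⟩ := Nat.exists_eq_add_of_le (not_lt.mp hk)
        have : (T ^ k) m = 0 := by
          rw [show k = (j + 1) + N by omega, pow_add, Module.End.mul_apply, hN m hm, map_zero]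
        rw [this]
        exact zero_mem _
    suffices hs : ⨆ k : Fin (N + 1), U.map (T ^ (k : ℕ)) ≤
        Submodule.comap T (⨆ k : Fin (N + 1), U.map (T ^ (k : ℕ))) from fun m hm => hs hm
    refine iSup_le fun k => ?_
    rintro _ ⟨m, hm, rfl⟩
    refine hle (k + 1) ⟨m, hm, ?_⟩
    rw [pow_succ', Module.End.mul_apply]
  · intro S hS hSU
    suffices hs : ⨆ k : Fin (N + 1), U.map (T ^ (k : ℕ)) ≤
        Submodule.comap S (⨆ k : Fin (N + 1), U.map (T ^ (k : ℕ))) from fun m hm => hs hm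
    refine iSup_le fun k => ?_
    rintro _ ⟨m, hm, rfl⟩
    refine le_iSup (fun k : Fin (N + 1) => U.map (T ^ (k : ℕ))) k ⟨S m, hSU m hm, ?_⟩
    have : Commute S (T ^ (k : ℕ)) := Commute.pow_right hS _
    rw [← Module.End.mul_apply, ← Module.End.mul_apply, this.eq]

lemma poly_span_stable (U : Submodule ℂ M) (hd : ∀ (v : 𝔥), ∀ m ∈ U, dun c v • m ∈ U)
    (hw : ∀ (w : W), ∀ m ∈ U, grp c w • m ∈ U) (a : Cher c) :
    ∀ m ∈ Submodule.span ℂ {m | ∃ f, ∃ u ∈ U, mulOp c f • u = m},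
      a • m ∈ Submodule.span ℂ {m | ∃ f, ∃ u ∈ U, mulOp c f • u = m} := by
  have red : ∀ a : Cher c, (∀ f, ∀ u ∈ U, a • mulOp c f • u ∈
      Submodule.span ℂ {m | ∃ f, ∃ u ∈ U, mulOp c f • u = m}) →
      ∀ m ∈ Submodule.span ℂ {m | ∃ f, ∃ u ∈ U, mulOp c f • u = m},
      a • m ∈ Submodule.span ℂ {m | ∃ f, ∃ u ∈ U, mulOp c f • u = m} := by
    intro a ha
    have : Submodule.span ℂ {m | ∃ f, ∃ u ∈ U, mulOp c f • u = m} ≤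
        Submodule.comap (Algebra.lsmul ℂ ℂ M a)
          (Submodule.span ℂ {m | ∃ f, ∃ u ∈ U, mulOp c f • u = m}) := by
      rw [Submodule.span_le]
      rintro _ ⟨f, u, hu, rfl⟩
      exact ha f u hu
    exact this
  have hmem : ∀ f, ∀ u ∈ U, mulOp c f • u ∈
      Submodule.span ℂ {m | ∃ f, ∃ u ∈ U, mulOp c f • u = m} :=
    fun f u hu => Submodule.subset_span ⟨f, u, hu, rfl⟩
  induction a using cherednik_induction with
  | hgrp w =>
    refine red _ fun f u hu => ?_
    rw [← mul_smul, grp_mul_mulOp, mul_smul]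
    exact hmem _ _ (hw w u hu)
  | hmulOp g =>
    refine red _ fun f u hu => ?_
    rw [← mul_smul, ← map_mul]
    exact hmem _ _ hu
  | hdun v =>
    refine red _ fun f u hu => ?_
    rw [← mul_smul, dun_mul_mulOp, sub_smul, add_smul, Finset.sum_smul, mul_smul]
    refine sub_mem (add_mem (hmem _ _ (hd v u hu)) (hmem _ _ hu)) (sum_mem fun r _ => ?_)
    rw [smul_assoc, mul_smul (mulOp c _)]
    exact Submodule.smul_mem _ _ (hmem _ _ (hw r.1 u hu))
  | hadd a b ha hb =>
    intro m hm
    rw [add_smul]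
    exact add_mem (ha m hm) (hb m hm)
  | hmul a b ha hb =>
    intro m hm
    rw [mul_smul]
    exact ha _ (hb m hm)

variable [FiniteDimensional ℂ 𝔥]

lemma exists_fd_dun_stable (h : ∀ (v : 𝔥) (m : M), ∃ N : ℕ, (dun c v ^ N) • m = 0)
    (U : Submodule ℂ M) (hU : U.FG) :
    ∃ U' : Submodule ℂ M, U ≤ U' ∧ U'.FG ∧ ∀ (v : 𝔥), ∀ m ∈ U', dun c v • m ∈ U' := by
  let b := Module.finBasis ℂ 𝔥
  let A : Cher c →ₐ[ℂ] Module.End ℂ M := Algebra.lsmul ℂ ℂ M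
  have key : ∀ s : Finset (Fin (Module.finrank ℂ 𝔥)), ∃ U' : Submodule ℂ M, U ≤ U' ∧ U'.FG ∧
      ∀ i ∈ s, ∀ m ∈ U', A (dun c (b i)) m ∈ U' := by
    intro s
    induction s using Finset.induction_on with
    | empty => exact ⟨U, le_rfl, hU, by simp⟩
    | insert i s hi ih =>
      obtain ⟨U1, h1, h2, h3⟩ := ih
      obtain ⟨U2, h4, h5, h6, h7⟩ := exists_fd_stable_single (A (dun c (b i)))
        (fun m => by
          obtain ⟨N, hN⟩ := h (b i) m
          exact ⟨N, by rw [← map_pow]; exact hN⟩) U1 h2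
      refine ⟨U2, h1.trans h4, h5, fun j hj => ?_⟩
      rcases Finset.mem_insert.mp hj with rfl | hj
      · exact h6
      · exact h7 _ (by rw [← map_mul A, ← map_mul A, dun_comm]) (h3 j hj)
  obtain ⟨U', h1, h2, h3⟩ := key Finset.univ
  refine ⟨U', h1, h2, fun v m hm => ?_⟩
  have : dun c v = ∑ i, b.repr v i • dun c (b i) := by
    conv_lhs => rw [← b.sum_repr v]
    simp only [map_sum, map_smul]
  rw [this, Finset.sum_smul]
  refine sum_mem fun i _ => ?_
  rw [smul_assoc]
  exact U'.smul_mem _ (h3 i (Finset.mem_univ i) m hm)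

lemma exists_fd_stable (h : ∀ (v : 𝔥) (m : M), ∃ N : ℕ, (dun c v ^ N) • m = 0)
    (U : Submodule ℂ M) (hU : U.FG) :
    ∃ U' : Submodule ℂ M, U ≤ U' ∧ U'.FG ∧ (∀ (v : 𝔥), ∀ m ∈ U', dun c v • m ∈ U') ∧
      ∀ (w : W), ∀ m ∈ U', grp c w • m ∈ U' := by
  obtain ⟨U1, h1, h2, h3⟩ := exists_fd_dun_stable h U hU
  let A : Cher c →ₐ[ℂ] Module.End ℂ M := Algebra.lsmul ℂ ℂ M
  refine ⟨⨆ w : W, U1.map (A (grp c w)), ?_, ?_, ?_, ?_⟩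
  · refine le_trans (fun m hm => ?_) (le_iSup _ (1 : W))
    exact ⟨m, h1 hm, by simp⟩
  · exact Submodule.fg_iSup _ fun w => h2.map _
  · intro v
    suffices hs : ⨆ w : W, U1.map (A (grp c w)) ≤
        Submodule.comap (A (dun c v)) (⨆ w : W, U1.map (A (grp c w))) from fun m hm => hs hm
    refine iSup_le fun w => ?_
    rintro _ ⟨m, hm, rfl⟩
    refine le_iSup (fun w : W => U1.map (A (grp c w))) w ⟨dun c (w.1.symm v) • m, h3 _ _ hm, ?_⟩
    change grp c w • dun c (w.1.symm v) • m = dun c v • grp c w • m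
    rw [← mul_smul, ← mul_smul, grp_mul_dun, LinearEquiv.apply_symm_apply]
  · intro w
    suffices hs : ⨆ w : W, U1.map (A (grp c w)) ≤
        Submodule.comap (A (grp c w)) (⨆ w : W, U1.map (A (grp c w))) from fun m hm => hs hm
    refine iSup_le fun w' => ?_
    rintro _ ⟨m, hm, rfl⟩
    refine le_iSup (fun w : W => U1.map (A (grp c w))) (w * w') ⟨m, hm, ?_⟩
    change grp c (w * w') • m = grp c w • grp c w' • m
    rw [← mul_smul, map_mul]

/-- Objects of category `O_c` are noetherian `H_c`-modules. -/
lemma isNoetherian_of_O [Module.Finite (Cher c) M]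
    (h : ∀ (v : 𝔥) (m : M), ∃ N : ℕ, (dun c v ^ N) • m = 0) : IsNoetherian (Cher c) M := by
  obtain ⟨s, hs⟩ := Module.Finite.fg_top (R := Cher c) (M := M)
  obtain ⟨U, h1, h2, h3, h4⟩ := exists_fd_stable h (Submodule.span ℂ (s : Set M)) ⟨s, rfl⟩
  have htop : ∀ m : M, m ∈ Submodule.span ℂ {m | ∃ f, ∃ u ∈ U, mulOp c f • u = m} := by
    intro m
    have hm : m ∈ Submodule.span (Cher c) (s : Set M) := by rw [hs]; trivial
    induction hm using Submodule.span_induction with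
    | mem x hx =>
      exact Submodule.subset_span ⟨1, x, h1 (Submodule.subset_span hx), by simp⟩
    | zero => exact zero_mem _
    | add x y _ _ hx hy => exact add_mem hx hy
    | smul a x _ hx => exact poly_span_stable U h3 h4 a x hx
  obtain ⟨t, rfl⟩ := h2
  let _ : Module (Poly 𝔥) M := Module.compHom M (mulOp c).toRingHom
  have hsmul : ∀ (f : Poly 𝔥) (m : M), f • m = mulOp c f • m := fun _ _ => rfl
  have hC : ∀ (a : ℂ) (m : M), a • m = algebraMap ℂ (Poly 𝔥) a • m := by
    intro a m
    rw [hsmul, AlgHom.commutes, algebraMap_smul]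
  have hfin : Module.Finite (Poly 𝔥) M := by
    refine ⟨⟨t, ?_⟩⟩
    rw [eq_top_iff]
    rintro m -
    have hU : ∀ u ∈ Submodule.span ℂ (t : Set M), u ∈ Submodule.span (Poly 𝔥) (t : Set M) := by
      intro u hu
      induction hu using Submodule.span_induction with
      | mem x hx => exact Submodule.subset_span hx
      | zero => exact zero_mem _
      | add x y _ _ hx hy => exact add_mem hx hy
      | smul a x _ hx => rw [hC]; exact Submodule.smul_mem _ _ hx
    have hm := htop m
    induction hm using Submodule.span_induction with
    | mem x hx =>
      obtain ⟨f, u, hu, rfl⟩ := hx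
      exact Submodule.smul_mem _ f (hU u hu)
    | zero => exact zero_mem _
    | add x y _ _ hx hy => exact add_mem hx hy
    | smul a x _ hx => rw [hC]; exact Submodule.smul_mem _ _ hx
  have hnoeth : IsNoetherian (Poly 𝔥) M := isNoetherian_of_isNoetherianRing_of_finite _ _
  refine ⟨fun N => ?_⟩
  let N' : Submodule (Poly 𝔥) M :=
    { carrier := N
      add_mem' := fun ha hb => N.add_mem ha hb
      zero_mem' := N.zero_mem
      smul_mem' := fun f m hm => N.smul_mem (mulOp c f) hm }
  obtain ⟨t', ht'⟩ := hnoeth.noetherian N'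
  refine ⟨t', le_antisymm ?_ ?_⟩
  · rw [Submodule.span_le]
    intro x hx
    have : x ∈ N' := by rw [← ht']; exact Submodule.subset_span hx
    exact this
  · intro x hx
    have hx' : x ∈ Submodule.span (Poly 𝔥) (t' : Set M) := by rw [ht']; exact hx
    clear hx
    induction hx' using Submodule.span_induction with
    | mem x hx => exact Submodule.subset_span hx
    | zero => exact zero_mem _
    | add x y _ _ hx hy => exact add_mem hx hy
    | smul a x _ hx => rw [hsmul]; exact Submodule.smul_mem _ _ hx

end Finiteness

instance : (objO c).ContainsZero where
  exists_zero := ⟨ModuleCat.of (Cher c) PUnit, ModuleCat.isZero_of_subsingleton _,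
    inferInstanceAs (Module.Finite (Cher c) PUnit.{u + 1}), fun _ _ => ⟨0, Subsingleton.elim _ _⟩⟩

instance : (objO c).IsClosedUnderQuotients where
  prop_of_epi {X Y} f _ hX := by
    have hf := (ModuleCat.epi_iff_surjective f).mp inferInstance
    have := hX.1
    refine ⟨Module.Finite.of_surjective f.hom hf, fun v m => ?_⟩
    obtain ⟨x, rfl⟩ := hf m
    obtain ⟨N, hN⟩ := hX.2 v x
    exact ⟨N, by rw [← map_smul, hN, map_zero]⟩

instance [FiniteDimensional ℂ 𝔥] : (objO c).IsClosedUnderSubobjects where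
  prop_of_mono {X Y} f _ hY := by
    have hf := (ModuleCat.mono_iff_injective f).mp inferInstance
    have := hY.1
    have := isNoetherian_of_O hY.2
    refine ⟨Module.Finite.of_injective f.hom hf, fun v m => ?_⟩
    obtain ⟨N, hN⟩ := hY.2 v (f m)
    exact ⟨N, hf (by rw [map_smul, hN, map_zero])⟩

instance [FiniteDimensional ℂ 𝔥] : (objO c).IsClosedUnderFiniteProducts where
  isClosedUnderLimitsOfShape J _ := ⟨by
    rintro X ⟨p⟩
    let F : J → ModuleCat.{u} (Cher c) := fun j => p.diag.obj ⟨j⟩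
    have hF : ∀ j, objO c (F j) := fun j => p.prop_diag_obj ⟨j⟩
    have hP : objO c (ModuleCat.of (Cher c) (∀ j, F j)) := by
      have := fun j => (hF j).1
      refine ⟨inferInstanceAs (Module.Finite (Cher c) (∀ j, F j)), fun v m => ?_⟩
      have := Fintype.ofFinite J
      choose N hN using fun j => (hF j).2 v (m j)
      refine ⟨Finset.univ.sup N, funext fun j => ?_⟩
      obtain ⟨k, hk⟩ := Nat.exists_eq_add_of_le (Finset.le_sup (f := N) (Finset.mem_univ j))
      change (dun c v ^ Finset.univ.sup N) • m j = 0
      rw [hk, add_comm, pow_add, mul_smul, hN, smul_zero]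
    let g : X ⟶ ModuleCat.of (Cher c) (∀ j, F j) :=
      ModuleCat.ofHom (LinearMap.pi fun j => (p.π.app ⟨j⟩).hom)
    have : Mono g := ⟨fun {Z} a b hab => by
      refine p.isLimit.hom_ext fun ⟨j⟩ => ?_
      ext z
      exact congrFun (ConcreteCategory.congr_hom hab z) j⟩
    exact (objO c).prop_of_mono g hP⟩

/-- Category `O_c`, a full subcategory of the category of `H_c`-modules. -/
abbrev CatO : Type (u + 1) := (objO c).FullSubcategory

instance [FiniteDimensional ℂ 𝔥] : HasExt.{u + 1} (CatO c) := HasExt.standard _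

end CategoryO

section Modules

variable {𝔥 : Type u} [AddCommGroup 𝔥] [Module ℂ 𝔥] [FiniteDimensional ℂ 𝔥]
  {W : Subgroup (𝔥 ≃ₗ[ℂ] 𝔥)} [Finite W] (c : Param W)

/-- The Euler element `eu = ∑ x_i D_{y_i} + ∑_r c_r (1 - r)`, for dual bases `y_i` of `𝔥` and `x_i`
of `𝔥*`. -/
def euler : Cher c :=
  ∑ i, mulOp c (lin ((Module.finBasis ℂ 𝔥).coord i)) * dun c (Module.finBasis ℂ 𝔥 i) +
    ∑ r : Refl W, c.val r • (1 - grp c r.1)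

lemma poly_sum_apply {ι : Type*} (s : Finset ι) (f : ι → Poly 𝔥) (y : 𝔥) :
    (∑ i ∈ s, f i).1 y = ∑ i ∈ s, (f i).1 y := by
  classical
  induction s using Finset.induction_on with
  | empty => rfl
  | insert i s hi ih => rw [Finset.sum_insert hi, Finset.sum_insert hi, poly_add_apply, ih]

/-- The Euler element is the Euler vector field. -/
lemma euler_apply (f : Poly 𝔥) (y : 𝔥) : ((euler c).1 f).1 y = lineDeriv ℂ f.1 y y := by
  have h1 : (euler c).1 f =
      ∑ i, lin ((Module.finBasis ℂ 𝔥).coord i) * dunkl c (Module.finBasis ℂ 𝔥 i) f +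
      ∑ r : Refl W, c.val r • (f - polyAct r.toEquiv f) := by
    refine Eq.trans (b := (∑ i, mulOp c (lin ((Module.finBasis ℂ 𝔥).coord i)) *
      dun c (Module.finBasis ℂ 𝔥 i)).1 f + (∑ r : Refl W, c.val r • (1 - grp c r.1)).1 f) rfl ?_
    rw [cher_sum_apply, cher_sum_apply]
    rfl
  have h2 : (∑ i, lin ((Module.finBasis ℂ 𝔥).coord i) * dunkl c (Module.finBasis ℂ 𝔥 i) f).1 y =
      ((dun c y).1 f).1 y := by
    have h3 : dun c y = ∑ i, (Module.finBasis ℂ 𝔥).repr y i • dun c (Module.finBasis ℂ 𝔥 i) := by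
      conv_lhs => rw [← (Module.finBasis ℂ 𝔥).sum_repr y]
      simp only [map_sum, map_smul]
    rw [h3, cher_sum_apply, poly_sum_apply, poly_sum_apply]
    rfl
  have h4 : ((dun c y).1 f).1 y = lineDeriv ℂ f.1 y y -
      ∑ r : Refl W, c.val r * (f.1 y - (polyAct r.toEquiv f).1 y) := by
    change (dunkl c y f).1 y = _
    rw [dunkl_apply, poly_sub_apply, poly_sum_apply, dirDeriv_apply]
    congr 1
    refine Finset.sum_congr rfl fun r _ => ?_
    rw [← poly_sub_apply, ← r.form_mul_divDiff, poly_smul_apply, poly_mul_apply, lin_apply,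
      mul_assoc]
  rw [h1, poly_add_apply, h2, h4, poly_sum_apply]
  simp only [poly_smul_apply, poly_sub_apply, sub_add_cancel]

lemma grp_mul_euler (w : W) : grp c w * euler c = euler c * grp c w := by
  refine cher_ext fun f => poly_ext fun y => ?_
  have h1 : ((grp c w * euler c).1 f).1 y = ((euler c).1 f).1 (w.1.symm y) := rfl
  have h2 : ((euler c * grp c w).1 f).1 y = ((euler c).1 (polyAct w.1 f)).1 y := rfl
  rw [h1, h2, euler_apply, euler_apply]
  simp only [lineDeriv, polyAct_apply, map_add, map_smul]

variable (M : ModuleCat.{u} (Cher c))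

/-- The action of `H_c` on a module by `ℂ`-linear endomorphisms. -/
def act : Cher c →ₐ[ℂ] Module.End ℂ M := Algebra.lsmul ℂ ℂ M

variable {c M} in
@[simp] lemma act_apply (a : Cher c) (m : M) : act c M a m = a • m := rfl

/-- The representation of `W` on an `H_c`-module. -/
def wRep : Representation ℂ W M := (act c M : Cher c →* Module.End ℂ M).comp (grp c)

variable {c M} in
@[simp] lemma wRep_apply (w : W) (m : M) : wRep c M w m = grp c w • m := rfl

/-- The degree `d` subspace `M_d`: the generalized eigenspace of the Euler element with eigenvalue
`d`. -/
def wt (d : ℂ) : Submodule ℂ M := (act c M (euler c)).maxGenEigenspace d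

lemma wt_stable (d : ℂ) (w : W) : wt c M d ≤ (wt c M d).comap (wRep c M w) := by
  intro m hm
  refine Module.End.mapsTo_maxGenEigenspace_of_comm (f := act c M (euler c)) ?_ d hm
  change act c M (euler c) * act c M (grp c w) = act c M (grp c w) * act c M (euler c)
  rw [← map_mul, ← map_mul, grp_mul_euler]

variable {c M} in
lemma wt_map {N : ModuleCat.{u} (Cher c)} (f : M →ₗ[Cher c] N) (d : ℂ) {m : M}
    (hm : m ∈ wt c M d) : f m ∈ wt c N d := by
  rw [wt, Module.End.mem_maxGenEigenspace] at hm ⊢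
  obtain ⟨k, hk⟩ := hm
  refine ⟨k, ?_⟩
  have key : ∀ (k : ℕ) (m : M), ((act c N (euler c) - d • 1) ^ k) (f m) =
      f (((act c M (euler c) - d • 1) ^ k) m) := by
    intro k
    induction k with
    | zero => intro m; simp
    | succ k ih =>
      intro m
      rw [pow_succ, pow_succ, Module.End.mul_apply, Module.End.mul_apply, ← ih]
      congr 1
      have := (f.restrictScalars ℂ).map_smul d m
      simp only [LinearMap.sub_apply, act_apply, LinearMap.smul_apply, Module.End.one_apply,
        map_sub, map_smul]
      congr 1
      exact this.symm
  rw [key, hk, map_zero]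

/-- The subspace `𝔥* M` of `M`. -/
def hStar : Submodule ℂ M :=
  Submodule.span ℂ {m | ∃ (x : Module.Dual ℂ 𝔥) (n : M), mulOp c (lin x) • n = m}

lemma hStar_stable (w : W) : hStar c M ≤ (hStar c M).comap (wRep c M w) := by
  refine Submodule.span_le.mpr ?_
  rintro _ ⟨x, n, rfl⟩
  refine Submodule.subset_span ⟨x ∘ₗ w.1.symm.toLinearMap, grp c w • n, ?_⟩
  rw [wRep_apply, ← mul_smul, ← mul_smul, grp_mul_mulOp, polyAct_lin]

/-- The `W`-representation on `H_0(𝔥*, M) = ℂ ⊗_{ℂ[𝔥]} M = M / 𝔥* M`. -/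
def coinvRep : Representation ℂ W (M ⧸ hStar c M) := (wRep c M).quotient _ (hStar_stable c M)

/-- The degree `d` piece of `H_0(𝔥*, M)`, the image of `M_d`. -/
def coinvWt (d : ℂ) : Submodule ℂ (M ⧸ hStar c M) := (wt c M d).map (hStar c M).mkQ

lemma coinvWt_stable (d : ℂ) (w : W) :
    coinvWt c M d ≤ (coinvWt c M d).comap (coinvRep c M w) := by
  rintro _ ⟨m, hm, rfl⟩
  exact ⟨_, wt_stable c M d w hm, rfl⟩

variable {c M} in
/-- The map on `M / 𝔥* M` induced by a homomorphism of `H_c`-modules. -/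
def coinvMap {N : ModuleCat.{u} (Cher c)} (f : M →ₗ[Cher c] N) :
    (M ⧸ hStar c M) →ₗ[ℂ] (N ⧸ hStar c N) :=
  (hStar c M).mapQ (hStar c N) (f.restrictScalars ℂ) (by
    refine Submodule.span_le.mpr ?_
    rintro _ ⟨x, n, rfl⟩
    exact Submodule.subset_span ⟨x, f n, (f.map_smul _ _).symm⟩)

variable {c M} in
lemma coinvMap_mem {N : ModuleCat.{u} (Cher c)} (f : M →ₗ[Cher c] N) (d : ℂ) :
    ∀ m ∈ coinvWt c M d, coinvMap f m ∈ coinvWt c N d := by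
  rintro _ ⟨m, hm, rfl⟩
  exact ⟨f m, wt_map f d hm, rfl⟩

/-- The functor from `O_c` to representations of `W` sending `M` to the degree `d` piece of
`H_0(𝔥*, M)`. -/
def homologyZeroDeg (d : ℂ) : CatO c ⥤ Rep.{u} ℂ W where
  obj M := Rep.of ((coinvRep c M.obj).subrepresentation (coinvWt c M.obj d)
    (coinvWt_stable c M.obj d))
  map {M N} f := Rep.ofHom
    { toLinearMap := (coinvMap f.hom.hom).restrict (coinvMap_mem f.hom.hom d)
      isIntertwining' := fun w => by
        ext ⟨_, m, hm, rfl⟩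
        refine congrArg (hStar c N.obj).mkQ ?_
        exact f.hom.hom.map_smul (grp c w) m }
  map_id M := by
    ext ⟨_, m, hm, rfl⟩
    rfl
  map_comp f g := by
    ext ⟨_, m, hm, rfl⟩
    rfl

instance (d : ℂ) : (homologyZeroDeg c d).Additive where
  map_add {M N} f g := by
    ext ⟨_, m, hm, rfl⟩
    rfl

/-- The category of `ℂ`-graded representations of `W`. -/
abbrev GrRep (W : Subgroup (𝔥 ≃ₗ[ℂ] 𝔥)) : Type (u + 1) := Discrete ℂ ⥤ Rep.{u} ℂ W

/-- The functor `H_0(𝔥*, ·)` from `O_c` to graded representations of `W`. -/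
def homologyZero : CatO c ⥤ GrRep W := (Discrete.functor fun d => homologyZeroDeg c d).flip

instance : (homologyZero c).Additive where
  map_add {M N} f g := by
    ext ⟨d⟩ : 2
    exact (homologyZeroDeg c d).map_add

/-- The degree `d` piece of `H^0(𝔥, M) = {m | D_v m = 0 for all v}`. -/
def invWt (d : ℂ) : Submodule ℂ M := wt c M d ⊓ ⨅ v : 𝔥, LinearMap.ker (act c M (dun c v))

variable {c M} in
lemma mem_invWt {d : ℂ} {m : M} :
    m ∈ invWt c M d ↔ m ∈ wt c M d ∧ ∀ v : 𝔥, dun c v • m = 0 := by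
  simp [invWt]

lemma invWt_stable (d : ℂ) (w : W) : invWt c M d ≤ (invWt c M d).comap (wRep c M w) := by
  intro m hm
  rw [mem_invWt] at hm
  rw [Submodule.mem_comap, mem_invWt]
  refine ⟨wt_stable c M d w hm.1, fun v => ?_⟩
  have h := grp_mul_dun c w (w.1.symm v)
  rw [LinearEquiv.apply_symm_apply] at h
  rw [wRep_apply, ← mul_smul, ← h, mul_smul, hm.2, smul_zero]

variable {c M} in
lemma invWt_map {N : ModuleCat.{u} (Cher c)} (f : M →ₗ[Cher c] N) (d : ℂ) :
    ∀ m ∈ invWt c M d, f.restrictScalars ℂ m ∈ invWt c N d := by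
  intro m hm
  rw [mem_invWt] at hm ⊢
  exact ⟨wt_map f d hm.1, fun v => by
    rw [LinearMap.restrictScalars_apply, ← map_smul, hm.2, map_zero]⟩

/-- The functor from `O_c` to representations of `W` sending `M` to the degree `d` piece of
`H^0(𝔥, M)`. -/
def cohomologyZeroDeg (d : ℂ) : CatO c ⥤ Rep.{u} ℂ W where
  obj M := Rep.of ((wRep c M.obj).subrepresentation (invWt c M.obj d) (invWt_stable c M.obj d))
  map {M N} f := Rep.ofHom
    { toLinearMap := (f.hom.hom.restrictScalars ℂ).restrict (invWt_map f.hom.hom d)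
      isIntertwining' := fun w => by
        ext ⟨m, hm⟩
        exact f.hom.hom.map_smul (grp c w) m }
  map_id M := by
    ext ⟨m, hm⟩
    rfl
  map_comp f g := by
    ext ⟨m, hm⟩
    rfl

instance (d : ℂ) : (cohomologyZeroDeg c d).Additive where
  map_add {M N} f g := by
    ext ⟨m, hm⟩
    rfl

/-- The functor `H^0(𝔥, ·)` from `O_c` to graded representations of `W`. -/
def cohomologyZero : CatO c ⥤ GrRep W := (Discrete.functor fun d => cohomologyZeroDeg c d).flip

instance : (cohomologyZero c).Additive where
  map_add {M N} f g := by
    ext ⟨d⟩ : 2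
    exact (cohomologyZeroDeg c d).map_add

/-- `H_i(𝔥*, ·)`: the left derived functors of `H_0(𝔥*, ·)` on `O_c`. -/
def hStarHomology [EnoughProjectives (CatO c)] (i : ℕ) : CatO c ⥤ GrRep W :=
  (homologyZero c).leftDerived i

/-- `H^i(𝔥, ·)`: the right derived functors of `H^0(𝔥, ·)` on `O_c`. -/
def hCohomology [EnoughInjectives (CatO c)] (i : ℕ) : CatO c ⥤ GrRep W :=
  (cohomologyZero c).rightDerived i

end Modules

section Koszul

variable {𝔥 : Type u} [AddCommGroup 𝔥] [Module ℂ 𝔥]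

/-- The defining representation of `W` on `𝔥`. -/
def hRep (W : Subgroup (𝔥 ≃ₗ[ℂ] 𝔥)) : Representation ℂ W 𝔥 where
  toFun w := w.1.toLinearMap
  map_one' := rfl
  map_mul' _ _ := rfl

/-- The dual representation of `W` on `𝔥*`. -/
def dualRep (W : Subgroup (𝔥 ≃ₗ[ℂ] 𝔥)) : Representation ℂ W (Module.Dual ℂ 𝔥) := (hRep W).dual

/-- The representation of `W` on `Λ^i 𝔥*`. -/
def extPowRep (W : Subgroup (𝔥 ≃ₗ[ℂ] 𝔥)) (i : ℕ) :
    Representation ℂ W (⋀[ℂ]^i (Module.Dual ℂ 𝔥)) where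
  toFun w := exteriorPower.map i (dualRep W w)
  map_one' := by
    rw [map_one]
    exact exteriorPower.map_id (R := ℂ) (n := i) (M := Module.Dual ℂ 𝔥)
  map_mul' w w' := by
    rw [map_mul, Module.End.mul_eq_comp, Module.End.mul_eq_comp]
    exact exteriorPower.map_comp (n := i) (dualRep W w') (dualRep W w)

/-- The representation of `W` on the exterior algebra `Λ 𝔥*`. -/
def extRep (W : Subgroup (𝔥 ≃ₗ[ℂ] 𝔥)) :
    Representation ℂ W (ExteriorAlgebra ℂ (Module.Dual ℂ 𝔥)) where
  toFun w := (ExteriorAlgebra.map (dualRep W w)).toLinearMap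
  map_one' := by
    rw [map_one]
    exact congrArg AlgHom.toLinearMap ExteriorAlgebra.map_id
  map_mul' w w' := by
    rw [map_mul]
    exact congrArg AlgHom.toLinearMap (ExteriorAlgebra.map_comp_map (dualRep W w') (dualRep W w)).symm

/-- The contraction `Λ^i 𝔥* → Λ^{i-1} 𝔥*` with a vector `y` of `𝔥`. -/
def contr : 𝔥 →ₗ[ℂ] Module.End ℂ (ExteriorAlgebra ℂ (Module.Dual ℂ 𝔥)) :=
  (CliffordAlgebra.contractLeft (Q := (0 : QuadraticForm ℂ (Module.Dual ℂ 𝔥)))) ∘ₗ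
    Module.Dual.eval ℂ 𝔥

lemma contr_ι_mul (y : 𝔥) (x : Module.Dual ℂ 𝔥) (ω : ExteriorAlgebra ℂ (Module.Dual ℂ 𝔥)) :
    contr y (ExteriorAlgebra.ι ℂ x * ω) = x y • ω - ExteriorAlgebra.ι ℂ x * contr y ω :=
  CliffordAlgebra.contractLeft_ι_mul _ _ _

lemma contr_algebraMap (y : 𝔥) (a : ℂ) : contr y (algebraMap ℂ _ a) = 0 :=
  CliffordAlgebra.contractLeft_algebraMap (0 : QuadraticForm ℂ (Module.Dual ℂ 𝔥)) _ a

lemma extRep_contr (W : Subgroup (𝔥 ≃ₗ[ℂ] 𝔥)) (w : W) (y : 𝔥)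
    (ω : ExteriorAlgebra ℂ (Module.Dual ℂ 𝔥)) :
    extRep W w (contr y ω) = contr (w.1 y) (extRep W w ω) := by
  induction ω using CliffordAlgebra.left_induction with
  | algebraMap a =>
    have h : extRep W w (algebraMap ℂ _ a) = algebraMap ℂ _ a :=
      (ExteriorAlgebra.map (dualRep W w)).commutes a
    erw [contr_algebraMap, h, contr_algebraMap, map_zero]
  | add a b ha hb => rw [map_add, map_add, map_add, map_add, ha, hb]
  | ι_mul ω x ih =>
    have hm : ∀ ω, extRep W w (ExteriorAlgebra.ι ℂ x * ω) =
        ExteriorAlgebra.ι ℂ (dualRep W w x) * extRep W w ω := fun ω => by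
      have h1 := map_mul (ExteriorAlgebra.map (dualRep W w)) (ExteriorAlgebra.ι ℂ x) ω
      rw [ExteriorAlgebra.map_apply_ι] at h1
      exact h1
    have hx : dualRep W w x (w.1 y) = x y := by
      change x (w.1.symm (w.1 y)) = x y
      rw [LinearEquiv.symm_apply_apply]
    change extRep W w (contr y (ExteriorAlgebra.ι ℂ x * ω)) =
      contr (w.1 y) (extRep W w (ExteriorAlgebra.ι ℂ x * ω))
    rw [contr_ι_mul, map_sub, map_smul, hm, hm, contr_ι_mul, ih, hx]

variable [FiniteDimensional ℂ 𝔥] {W : Subgroup (𝔥 ≃ₗ[ℂ] 𝔥)} [Finite W] (c : Param W)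
  (M : ModuleCat.{u} (Cher c))

/-- The total space `M ⊗ Λ 𝔥*` of the Koszul complex of `M`. -/
abbrev Koszul : Type u := M ⊗[ℂ] ExteriorAlgebra ℂ (Module.Dual ℂ 𝔥)

/-- The representation of `W` on `M ⊗ Λ 𝔥*`. -/
def koszulRep : Representation ℂ W (Koszul c M) := (wRep c M).tprod (extRep W)

/-- The Koszul differential `∑ x_i ⊗ y_i` on `M ⊗ Λ 𝔥*`, where `y_i` is a basis of `𝔥` with dual
basis `x_i`, where `x_i` acts by multiplication and `y_i` by contraction. -/
def koszulD : Module.End ℂ (Koszul c M) :=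
  ∑ i, TensorProduct.map (act c M (mulOp c (lin ((Module.finBasis ℂ 𝔥).coord i))))
    (contr (Module.finBasis ℂ 𝔥 i))

variable {c M} in
lemma koszulD_tmul (m : M) (ω : ExteriorAlgebra ℂ (Module.Dual ℂ 𝔥)) :
    koszulD c M (m ⊗ₜ ω) = ∑ i, (mulOp c (lin ((Module.finBasis ℂ 𝔥).coord i)) • m) ⊗ₜ[ℂ]
      contr (Module.finBasis ℂ 𝔥 i) ω := by
  simp [koszulD, LinearMap.sum_apply]

lemma lin_add (x y : Module.Dual ℂ 𝔥) : lin (x + y) = lin x + lin y := rfl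

lemma lin_smul (a : ℂ) (x : Module.Dual ℂ 𝔥) : lin (a • x) = a • lin x := rfl

/-- The Koszul differential may be computed with any basis. -/
lemma koszulD_basis {ι : Type*} [Fintype ι] (b : Module.Basis ι ℂ 𝔥) (m : M)
    (ω : ExteriorAlgebra ℂ (Module.Dual ℂ 𝔥)) :
    koszulD c M (m ⊗ₜ ω) = ∑ i, (mulOp c (lin (b.coord i)) • m) ⊗ₜ[ℂ] contr (b i) ω := by
  let A : Module.Dual ℂ 𝔥 →ₗ[ℂ] M :=
    { toFun := fun x => mulOp c (lin x) • m
      map_add' := fun x y => by rw [lin_add, map_add, add_smul]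
      map_smul' := fun a x => by rw [lin_smul, map_smul, smul_assoc]; rfl }
  let C : 𝔥 →ₗ[ℂ] ExteriorAlgebra ℂ (Module.Dual ℂ 𝔥) := contr.flip ω
  let b' := Module.finBasis ℂ 𝔥
  have h1 : ∀ i, C (b i) = ∑ j, b'.coord j (b i) • C (b' j) := fun i => by
    conv_lhs => rw [← b'.sum_repr (b i)]
    simp only [map_sum, map_smul]
    rfl
  have h2 : ∀ j, A (b'.coord j) = ∑ i, b'.coord j (b i) • A (b.coord i) := fun j => by
    have : b'.coord j = ∑ i, b'.coord j (b i) • b.coord i := by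
      refine b.ext fun k => ?_
      classical
      simp [LinearMap.sum_apply, Module.Basis.repr_self, Finsupp.single_apply]
    conv_lhs => rw [this]
    simp only [map_sum, map_smul]
  rw [koszulD_tmul]
  change ∑ j, A (b'.coord j) ⊗ₜ[ℂ] C (b' j) = ∑ i, A (b.coord i) ⊗ₜ[ℂ] C (b i)
  simp only [h1, h2, TensorProduct.sum_tmul, TensorProduct.tmul_sum, TensorProduct.smul_tmul]
  exact Finset.sum_comm

/-- The Koszul differential is `W`-equivariant. -/
lemma koszulRep_koszulD (w : W) (t : Koszul c M) :
    koszulRep c M w (koszulD c M t) = koszulD c M (koszulRep c M w t) := by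
  induction t using TensorProduct.induction_on with
  | zero => simp only [map_zero]
  | add a b ha hb => simp only [map_add, ha, hb]
  | tmul m ω =>
    have h : ∀ (n : M) (ω : ExteriorAlgebra ℂ (Module.Dual ℂ 𝔥)),
        koszulRep c M w (n ⊗ₜ ω) = (grp c w • n) ⊗ₜ extRep W w ω := fun _ _ => rfl
    refine Eq.trans ?_ (koszulD_basis c M ((Module.finBasis ℂ 𝔥).map w.1) _ _).symm
    rw [koszulD_tmul, map_sum]
    refine Finset.sum_congr rfl fun i _ => ?_
    rw [h, extRep_contr, ← mul_smul, grp_mul_mulOp, polyAct_lin, mul_smul]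
    rfl

/-- The differential squares to zero. -/
lemma koszulD_koszulD (t : Koszul c M) : koszulD c M (koszulD c M t) = 0 := by
  induction t using TensorProduct.induction_on with
  | zero => simp only [map_zero]
  | add a b ha hb => simp only [map_add, ha, hb, add_zero]
  | tmul m ω =>
    have hanti : ∀ (y z : 𝔥), contr y (contr z ω) = -contr z (contr y ω) := fun y z =>
      CliffordAlgebra.contractLeft_comm _ _ _
    have key : koszulD c M (koszulD c M (m ⊗ₜ ω)) = -koszulD c M (koszulD c M (m ⊗ₜ ω)) := by
      simp only [koszulD_tmul, map_sum]
      conv_lhs => rw [Finset.sum_comm]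
      simp only [← Finset.sum_neg_distrib]
      refine Finset.sum_congr rfl fun i _ => Finset.sum_congr rfl fun j _ => ?_
      rw [hanti, TensorProduct.tmul_neg, ← mul_smul, ← mul_smul, ← map_mul, ← map_mul, mul_comm]
    have h2 : (2 : ℂ) • koszulD c M (koszulD c M (m ⊗ₜ ω)) = 0 := by
      rw [two_smul]
      nth_rewrite 1 [key]
      exact neg_add_cancel _
    exact (smul_eq_zero.mp h2).resolve_left two_ne_zero

/-- The subspace `M_{d - i} ⊗ Λ^i 𝔥*` of `M ⊗ Λ 𝔥*`: the part of homological degree `i` and of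
internal degree `d`. -/
def koszulPiece (i : ℕ) (d : ℂ) : Submodule ℂ (Koszul c M) :=
  LinearMap.range (TensorProduct.map (wt c M (d - i)).subtype
    (⋀[ℂ]^i (Module.Dual ℂ 𝔥)).subtype)

lemma extPowRep_coe (i : ℕ) (w : W) (ω : ⋀[ℂ]^i (Module.Dual ℂ 𝔥)) :
    (extPowRep W i w ω).1 = extRep W w ω.1 := by
  have h : (⋀[ℂ]^i (Module.Dual ℂ 𝔥)).subtype ∘ₗ extPowRep W i w =
      extRep W w ∘ₗ (⋀[ℂ]^i (Module.Dual ℂ 𝔥)).subtype := by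
    ext a
    have h1 : extPowRep W i w (exteriorPower.ιMulti ℂ i a) =
        exteriorPower.ιMulti ℂ i (dualRep W w ∘ a) := exteriorPower.map_apply_ιMulti _ _
    have h2 : extRep W w (ExteriorAlgebra.ιMulti ℂ i a) =
        ExteriorAlgebra.ιMulti ℂ i (dualRep W w ∘ a) := ExteriorAlgebra.map_apply_ιMulti _ _
    change (extPowRep W i w (exteriorPower.ιMulti ℂ i a)).1 =
      extRep W w (ExteriorAlgebra.ιMulti ℂ i a)
    rw [h1, h2]
    rfl
  exact LinearMap.congr_fun h ω

lemma koszulPiece_stable (i : ℕ) (d : ℂ) (w : W) :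
    koszulPiece c M i d ≤ (koszulPiece c M i d).comap (koszulRep c M w) := by
  rintro _ ⟨t, rfl⟩
  induction t using TensorProduct.induction_on with
  | zero => simp only [map_zero]; exact zero_mem _
  | add a b ha hb => rw [map_add]; exact add_mem ha hb
  | tmul m ω =>
    refine ⟨⟨grp c w • m.1, wt_stable c M _ w m.2⟩ ⊗ₜ extPowRep W i w ω, ?_⟩
    change (grp c w • m.1) ⊗ₜ[ℂ] (extPowRep W i w ω).1 = (grp c w • m.1) ⊗ₜ[ℂ] extRep W w ω.1
    rw [extPowRep_coe]

/-- The cycles of homological degree `i` and internal degree `d`. -/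
def koszulCycles (i : ℕ) (d : ℂ) : Submodule ℂ (Koszul c M) :=
  koszulPiece c M i d ⊓ LinearMap.ker (koszulD c M)

/-- The boundaries of homological degree `i` and internal degree `d`. -/
def koszulBoundaries (i : ℕ) (d : ℂ) : Submodule ℂ (Koszul c M) :=
  (koszulPiece c M (i + 1) d).map (koszulD c M)

lemma koszulCycles_stable (i : ℕ) (d : ℂ) (w : W) :
    koszulCycles c M i d ≤ (koszulCycles c M i d).comap (koszulRep c M w) := by
  rintro t ⟨h1, h2⟩
  refine ⟨koszulPiece_stable c M i d w h1, ?_⟩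
  change koszulD c M (koszulRep c M w t) = 0
  rw [← koszulRep_koszulD, LinearMap.mem_ker.mp h2, map_zero]

lemma koszulBoundaries_stable (i : ℕ) (d : ℂ) (w : W) :
    koszulBoundaries c M i d ≤ (koszulBoundaries c M i d).comap (koszulRep c M w) := by
  rintro _ ⟨t, ht, rfl⟩
  exact ⟨_, koszulPiece_stable c M (i + 1) d w ht, (koszulRep_koszulD c M w t).symm⟩

/-- The representation of `W` on the cycles. -/
def cyclesRep (i : ℕ) (d : ℂ) : Representation ℂ W (koszulCycles c M i d) :=
  (koszulRep c M).subrepresentation _ (koszulCycles_stable c M i d)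

/-- The degree `d` piece `Tor_i(M, ℂ)_d` of `Tor_i(M, ℂ)`, as a representation of `W`. It is the
homology of `M_{d-i-1} ⊗ Λ^{i+1} 𝔥* → M_{d-i} ⊗ Λ^i 𝔥* → M_{d-i+1} ⊗ Λ^{i-1} 𝔥*`. -/
def torDeg (i : ℕ) (d : ℂ) : Rep.{u} ℂ W :=
  Rep.of ((cyclesRep c M i d).quotient
    ((koszulBoundaries c M i d).comap (koszulCycles c M i d).subtype)
    fun w _ ht => koszulBoundaries_stable c M i d w ht)

/-- `Tor_i(M, ℂ)`, as a graded representation of `W`. -/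
def torGr (i : ℕ) : GrRep W := Discrete.functor fun d => torDeg c M i d

/-- An `H_c`-module, regarded as a `ℂ[𝔥]`-module. -/
def polyModule : ModuleCat.{u} (Poly 𝔥) := (ModuleCat.restrictScalars (mulOp c).toRingHom).obj M

end Koszul

section Residue

variable (𝔥 : Type u) [AddCommGroup 𝔥] [Module ℂ 𝔥]

/-- Evaluation of polynomial functions at the origin. -/
def evalZero : Poly 𝔥 →ₐ[ℂ] ℂ where
  toFun f := f.1 0
  map_one' := rfl
  map_mul' _ _ := rfl
  map_zero' := rfl
  map_add' _ _ := rfl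
  commutes' _ := rfl

/-- The `ℂ[𝔥]`-module `ℂ`, on which polynomial functions act via evaluation at the origin. -/
def residue : ModuleCat.{u} (Poly 𝔥) :=
  ModuleCat.of (Poly 𝔥) (Poly 𝔥 ⧸ RingHom.ker (evalZero 𝔥))

end Residue

section Standard

variable {𝔥 : Type u} [AddCommGroup 𝔥] [Module ℂ 𝔥] {W : Subgroup (𝔥 ≃ₗ[ℂ] 𝔥)} [Finite W]

lemma exists_span_orbit (E : Rep.{u} ℂ W) [E.ρ.IsIrreducible] :
    ∃ e : E, Submodule.span ℂ (Set.range fun w : W => E.ρ w e) = ⊤ := by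
  have hne : ∃ e : E, e ≠ 0 := by
    by_contra! h
    have : (⊥ : Subrepresentation E.ρ) = ⊤ := by
      ext e
      simp only [h e]
      exact ⟨fun _ => zero_mem _, fun _ => zero_mem _⟩
    exact bot_ne_top this
  obtain ⟨e, he⟩ := hne
  refine ⟨e, ?_⟩
  let S : Subrepresentation E.ρ :=
    ⟨Submodule.span ℂ (Set.range fun w : W => E.ρ w e), by
      intro w v hv
      have : Submodule.span ℂ (Set.range fun w : W => E.ρ w e) ≤
          (Submodule.span ℂ (Set.range fun w : W => E.ρ w e)).comap (E.ρ w) := by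
        rw [Submodule.span_le]
        rintro _ ⟨w', rfl⟩
        exact Submodule.subset_span ⟨w * w', by simp⟩
      exact this hv⟩
  have heS : e ∈ S.toSubmodule := Submodule.subset_span ⟨1, by simp⟩
  rcases eq_bot_or_eq_top S with h | h
  · rw [h] at heS
    exact absurd heS he
  · exact congrArg Subrepresentation.toSubmodule h

lemma finite_of_irreducible (E : Rep.{u} ℂ W) [E.ρ.IsIrreducible] : FiniteDimensional ℂ E := by
  obtain ⟨e, he⟩ := exists_span_orbit E
  exact ⟨he ▸ Submodule.fg_span (Set.finite_range _)⟩

variable (c : Param W)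

/-- The operator by which the element `z_c = ∑_r c_r (1 - r)` of `ℂ W` acts on a representation. -/
def zAct {V : Type*} [AddCommGroup V] [Module ℂ V] (ρ : Representation ℂ W V) : Module.End ℂ V :=
  ∑ r : Refl W, c.val r • (1 - ρ r.1)

lemma zAct_comm {V : Type*} [AddCommGroup V] [Module ℂ V] (ρ : Representation ℂ W V) (w : W) :
    zAct c ρ * ρ w = ρ w * zAct c ρ := by
  simp only [zAct, Finset.sum_mul, Finset.mul_sum]
  refine (Finset.sum_equiv (Refl.conjEquiv w) (by simp) fun r _ => ?_).symm
  change ρ w * (c.val r • (1 - ρ r.1)) = (c.val (r.conj w) • (1 - ρ (w * r.1 * w⁻¹))) * ρ w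
  rw [c.val_conj, mul_smul_comm, smul_mul_assoc, mul_sub, sub_mul, mul_one, one_mul, ← map_mul,
    ← map_mul, inv_mul_cancel_right]

/-- Schur's lemma for `z_c`. -/
lemma exists_cFun (E : Rep.{u} ℂ W) [E.ρ.IsIrreducible] :
    ∃ a : ℂ, ∀ e : E, zAct c E.ρ e = a • e := by
  have := finite_of_irreducible E
  let f : E.ρ.IntertwiningMap E.ρ := ⟨zAct c E.ρ, fun w => zAct_comm c E.ρ w⟩
  obtain ⟨a, ha⟩ :=
    (Representation.IsIrreducible.algebraMap_intertwiningMap_bijective_of_isAlgClosed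
      (ρ := E.ρ)).2 f
  exact ⟨a, fun e => (congrArg (fun g : E.ρ.IntertwiningMap E.ρ => g e) ha).symm⟩

/-- The `c`-function: `c_E` is the scalar by which `z_c` acts on the irreducible representation
`E`. -/
def cFun (E : Rep.{u} ℂ W) [E.ρ.IsIrreducible] : ℂ := (exists_cFun c E).choose

lemma cFun_spec (E : Rep.{u} ℂ W) [E.ρ.IsIrreducible] (e : E) :
    zAct c E.ρ e = cFun c E • e :=
  (exists_cFun c E).choose_spec e

/-- The relations defining `Δ_c(E)` as a quotient of `H_c ⊗ E`. -/
def stdRel (E : Rep.{u} ℂ W) : Submodule (Cher c) (Cher c ⊗[ℂ] E) :=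
  Submodule.span (Cher c)
    ({t | ∃ (w : W) (e : E), t = grp c w ⊗ₜ e - 1 ⊗ₜ E.ρ w e} ∪
      {t | ∃ (v : 𝔥) (e : E), t = dun c v ⊗ₜ e})

/-- The module induced from the representation `E` of `ℂ[𝔥*] ⋊ W` on which `𝔥` acts by zero. -/
abbrev Std (E : Rep.{u} ℂ W) : Type u := (Cher c ⊗[ℂ] E) ⧸ stdRel c E

/-- The image of `e` in `Δ_c(E)`. -/
def stdMk {E : Rep.{u} ℂ W} (e : E) : Std c E := (stdRel c E).mkQ (1 ⊗ₜ e)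

lemma grp_stdMk {E : Rep.{u} ℂ W} (w : W) (e : E) :
    grp c w • stdMk c e = stdMk c (E.ρ w e) := by
  rw [stdMk, ← map_smul, ← sub_eq_zero, stdMk, ← map_sub, Submodule.mkQ_apply,
    Submodule.Quotient.mk_eq_zero]
  refine Submodule.subset_span (Or.inl ⟨w, e, ?_⟩)
  rw [TensorProduct.smul_tmul', smul_eq_mul, mul_one]

lemma dun_stdMk {E : Rep.{u} ℂ W} (v : 𝔥) (e : E) : dun c v • stdMk c e = 0 := by
  rw [stdMk, ← map_smul, Submodule.mkQ_apply, Submodule.Quotient.mk_eq_zero]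
  refine Submodule.subset_span (Or.inr ⟨v, e, ?_⟩)
  rw [TensorProduct.smul_tmul', smul_eq_mul, mul_one]

lemma std_induction {E : Rep.{u} ℂ W} {p : Std c E → Prop} (hadd : ∀ s t, p s → p t → p (s + t))
    (hzero : p 0) (hmk : ∀ (a : Cher c) (e : E), p (a • stdMk c e)) (t : Std c E) : p t := by
  obtain ⟨t, rfl⟩ := (stdRel c E).mkQ_surjective t
  induction t using TensorProduct.induction_on with
  | zero => rw [map_zero]; exact hzero
  | add a b ha hb => rw [map_add]; exact hadd _ _ ha hb
  | tmul a e =>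
    have := hmk a e
    rw [stdMk, ← map_smul, TensorProduct.smul_tmul', smul_eq_mul, mul_one] at this
    exact this

section Nilpotency

variable {c} {M : Type u} [AddCommGroup M] [Module ℂ M] [Module (Cher c) M]
  [IsScalarTower ℂ (Cher c) M]

variable (c M) in
/-- The elements killed by all products of `k` Dunkl operators. -/
def nilp : ℕ → Submodule ℂ M
  | 0 => ⊥
  | k + 1 => ⨅ v : 𝔥, (nilp k).comap (Algebra.lsmul ℂ ℂ M (dun c v))

lemma mem_nilp_succ {k : ℕ} {m : M} :
    m ∈ nilp c M (k + 1) ↔ ∀ v : 𝔥, dun c v • m ∈ nilp c M k := by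
  simp [nilp]

lemma nilp_le_succ (k : ℕ) : nilp c M k ≤ nilp c M (k + 1) := by
  induction k with
  | zero => exact bot_le
  | succ k ih =>
    intro m hm
    rw [mem_nilp_succ] at hm ⊢
    exact fun v => ih (hm v)

lemma nilp_mono {k l : ℕ} (h : k ≤ l) : nilp c M k ≤ nilp c M l :=
  monotone_nat_of_le_succ nilp_le_succ h

lemma grp_nilp (w : W) {k : ℕ} {m : M} (hm : m ∈ nilp c M k) : grp c w • m ∈ nilp c M k := by
  induction k generalizing m with
  | zero =>
    have : m = 0 := hm
    rw [this, smul_zero]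
    exact zero_mem _
  | succ k ih =>
    rw [mem_nilp_succ] at hm ⊢
    intro v
    have h := grp_mul_dun c w (w.1.symm v)
    rw [LinearEquiv.apply_symm_apply] at h
    rw [← mul_smul, ← h, mul_smul]
    exact ih (hm _)

lemma mulOp_lin_nilp (x : Module.Dual ℂ 𝔥) {k : ℕ} {m : M} (hm : m ∈ nilp c M k) :
    mulOp c (lin x) • m ∈ nilp c M (k + 1) := by
  induction k generalizing m with
  | zero =>
    have : m = 0 := hm
    rw [this, smul_zero]
    exact zero_mem _
  | succ k ih =>
    have hm' := mem_nilp_succ.mp hm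
    have hscal : ∀ (a : ℂ), ∀ n ∈ nilp c M (k + 1),
        mulOp c (algebraMap ℂ _ a) • n ∈ nilp c M (k + 1) := fun a n hn => by
      rw [AlgHom.commutes, algebraMap_smul]
      exact Submodule.smul_mem _ _ hn
    rw [mem_nilp_succ]
    intro v
    rw [← mul_smul, dun_mul_mulOp, sub_smul, add_smul, Finset.sum_smul, mul_smul, dirDeriv_lin]
    refine sub_mem (add_mem (ih (hm' v)) (hscal _ _ hm)) (sum_mem fun r _ => ?_)
    obtain ⟨a, ha⟩ := r.divDiff_lin x
    rw [smul_assoc, mul_smul (mulOp c _), ha]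
    exact Submodule.smul_mem _ _ (hscal _ _ (grp_nilp _ hm))

lemma smul_nilp (a : Cher c) (m : M) (hm : ∃ k, m ∈ nilp c M k) :
    ∃ k, a • m ∈ nilp c M k := by
  have hadd : ∀ m n : M, (∃ k, m ∈ nilp c M k) → (∃ k, n ∈ nilp c M k) →
      ∃ k, m + n ∈ nilp c M k := by
    rintro m n ⟨k, hk⟩ ⟨l, hl⟩
    exact ⟨max k l, add_mem (nilp_mono (le_max_left _ _) hk) (nilp_mono (le_max_right _ _) hl)⟩
  induction a using cherednik_induction generalizing m with
  | hgrp w =>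
    obtain ⟨k, hk⟩ := hm
    exact ⟨k, grp_nilp w hk⟩
  | hmulOp f =>
    induction f using polyFun_induction generalizing m with
    | hlin x =>
      obtain ⟨k, hk⟩ := hm
      exact ⟨k + 1, mulOp_lin_nilp x hk⟩
    | hconst a =>
      obtain ⟨k, hk⟩ := hm
      refine ⟨k, ?_⟩
      rw [AlgHom.commutes, algebraMap_smul]
      exact Submodule.smul_mem _ _ hk
    | hadd f g hf hg =>
      rw [map_add, add_smul]
      exact hadd _ _ (hf m hm) (hg m hm)
    | hmul f g hf hg =>
      rw [map_mul, mul_smul]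
      exact hf _ (hg m hm)
  | hdun v =>
    obtain ⟨k, hk⟩ := hm
    exact ⟨k, mem_nilp_succ.mp (nilp_le_succ k hk) v⟩
  | hadd a b ha hb =>
    rw [add_smul]
    exact hadd _ _ (ha m hm) (hb m hm)
  | hmul a b ha hb =>
    rw [mul_smul]
    exact ha _ (hb m hm)

lemma pow_smul_nilp (v : 𝔥) {k : ℕ} {m : M} (hm : m ∈ nilp c M k) : (dun c v ^ k) • m = 0 := by
  induction k generalizing m with
  | zero => rw [pow_zero, one_smul]; exact hm
  | succ k ih => rw [pow_succ, mul_smul]; exact ih (mem_nilp_succ.mp hm v)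

end Nilpotency

lemma objO_std (E : Rep.{u} ℂ W) [E.ρ.IsIrreducible] :
    objO c (ModuleCat.of (Cher c) (Std c E)) := by
  constructor
  · have := finite_of_irreducible E
    exact inferInstanceAs (Module.Finite (Cher c) (Std c E))
  · intro v m
    change ∃ N : ℕ, (dun c v ^ N) • (m : Std c E) = 0
    have : ∃ k, m ∈ nilp c (Std c E) k := by
      refine std_induction c (p := fun m => ∃ k, m ∈ nilp c (Std c E) k) ?_ ⟨0, zero_mem _⟩ ?_ m
      · rintro s t ⟨k, hk⟩ ⟨l, hl⟩
        exact ⟨max k l,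
          add_mem (nilp_mono (le_max_left _ _) hk) (nilp_mono (le_max_right _ _) hl)⟩
      · intro a e
        refine smul_nilp a _ ⟨1, mem_nilp_succ.mpr fun v => ?_⟩
        rw [dun_stdMk]
        exact zero_mem _
    obtain ⟨k, hk⟩ := this
    exact ⟨k, pow_smul_nilp v hk⟩

/-- The standard module `Δ_c(E)`, as an object of `O_c`. -/
def stdObj (E : Rep.{u} ℂ W) [E.ρ.IsIrreducible] : CatO c :=
  ⟨ModuleCat.of (Cher c) (Std c E), objO_std c E⟩

end Standard

section Representations

variable {G : Type u} [Group G]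

/-- The `E`-isotypic part of a representation `T`: the sum of the images of all homomorphisms from
`E` to `T`. -/
def isotypicPart (E T : Rep.{u} ℂ G) : Submodule ℂ T :=
  ⨆ f : E.ρ.IntertwiningMap T.ρ, LinearMap.range f.toLinearMap

end Representations

section Unitary

variable {𝔥 : Type u} [AddCommGroup 𝔥] [Module ℂ 𝔥] {W : Subgroup (𝔥 ≃ₗ[ℂ] 𝔥)} [Finite W]

variable (W) in
/-- A positive definite `W`-invariant Hermitian form on `𝔥`, regarded as the conjugate linear map
`v ↦ (v, ·)` from `𝔥` to `𝔥*`. -/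
structure InvForm where
  /-- the conjugate linear map `v ↦ (v, ·)` -/
  toDual : 𝔥 →ₗ⋆[ℂ] Module.Dual ℂ 𝔥
  /-- the form is Hermitian -/
  symm : ∀ u v, toDual v u = starRingEnd ℂ (toDual u v)
  /-- the form is positive definite -/
  pos : ∀ v, v ≠ 0 → 0 < (toDual v v).re
  /-- the form is invariant -/
  inv : ∀ (w : W) (u v : 𝔥), toDual (w.1 u) (w.1 v) = toDual u v

variable {c : Param W}

/-- An `H_c`-module is unitary, with respect to a positive definite `W`-invariant Hermitian form on
`𝔥`, if it carries a positive definite Hermitian form which is `W`-invariant and contravariant: the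
adjoint of `D_v` is multiplication by the linear form `(v, ·)`. -/
def IsUnitary (B : InvForm W) (M : ModuleCat.{u} (Cher c)) : Prop :=
  ∃ Φ : M →ₗ⋆[ℂ] M →ₗ[ℂ] ℂ,
    (∀ m n, Φ n m = starRingEnd ℂ (Φ m n)) ∧
    (∀ m, m ≠ 0 → 0 < (Φ m m).re) ∧
    (∀ (w : W) (m n : M), Φ (grp c w • m) (grp c w • n) = Φ m n) ∧
    ∀ (v : 𝔥) (m n : M), Φ (dun c v • m) n = Φ m (mulOp c (lin (B.toDual v)) • n)

end Unitary

section Comparison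

variable {𝔥 : Type u} [AddCommGroup 𝔥] [Module ℂ 𝔥] [FiniteDimensional ℂ 𝔥]
  {W : Subgroup (𝔥 ≃ₗ[ℂ] 𝔥)} [Finite W] (c : Param W)

/-- The representation of `W` on the degree `d` subspace `M_d`. -/
def wtRep (M : ModuleCat.{u} (Cher c)) (d : ℂ) : Representation ℂ W (wt c M d) :=
  (wRep c M).subrepresentation (wt c M d) (wt_stable c M d)

/-- The representation of `W` on the degree `d` piece of `⨁_E Ext^i(Δ_c(E), L) ⊗ E`, in which the
summand of `E` is placed in degree `c_E`, the degree of the generating subspace `E` of `Δ_c(E)`. The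
group `W` acts on the second factor of each summand. -/
def extDeg {ι : Type*} (E : ι → Rep.{u} ℂ W) [∀ j, (E j).ρ.IsIrreducible] (L : CatO c) (i : ℕ)
    (d : ℂ) :
    Representation ℂ W
      (⨁ j : {j : ι // cFun c (E j) = d}, Abelian.Ext (stdObj c (E j)) L i ⊗[ℂ] E j) :=
  Representation.directSum fun j : {j : ι // cFun c (E j) = d} =>
    (Representation.trivial ℂ W (Abelian.Ext (stdObj c (E j)) L i)).tprod (E j).ρ

end Comparison

end Cherednik

end

noncomputable section

namespace Cherednik

section EulerRelations

variable {𝔥 : Type u} [AddCommGroup 𝔥] [Module ℂ 𝔥] {W : Subgroup (𝔥 ≃ₗ[ℂ] 𝔥)}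

lemma Refl.exists_dual_coroot (r : Refl W) :
    ∃ b : 𝔥, ∀ u, u - r.toEquiv.symm u = r.form u • b :=
  eq_smul_of_ker_le r.form_ne_zero (x := LinearMap.id - r.toEquiv.symm.toLinearMap) (by
    intro y hy
    rw [r.ker_form, mem_fixedSpace] at hy
    have : r.toEquiv.symm y = y := by rw [LinearEquiv.symm_apply_eq]; exact hy.symm
    simp [this])

/-- The vector `β_r` with `u - r⁻¹ u = α_r(u) β_r`. -/
def Refl.coroot (r : Refl W) : 𝔥 := r.exists_dual_coroot.choose

lemma Refl.sub_symm (r : Refl W) (u : 𝔥) : u - r.toEquiv.symm u = r.form u • r.coroot :=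
  r.exists_dual_coroot.choose_spec u

lemma Refl.divDiff_lin_eq (r : Refl W) (x : Module.Dual ℂ 𝔥) :
    r.divDiff (lin x) = algebraMap ℂ _ (x r.coroot) := by
  apply lin_mul_cancel r.form_ne_zero
  rw [r.form_mul_divDiff]
  refine poly_ext fun y => ?_
  have := congrArg x (r.sub_symm y)
  simpa using this

variable [FiniteDimensional ℂ 𝔥] [Finite W] (c : Param W)

/-- The Euler vector field on polynomial functions. -/
def eulerField : Module.End ℂ (Poly 𝔥) := (euler c).1

lemma eulerField_apply (f : Poly 𝔥) (y : 𝔥) : (eulerField c f).1 y = lineDeriv ℂ f.1 y y :=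
  euler_apply c f y

lemma eulerField_mul (f g : Poly 𝔥) :
    eulerField c (f * g) = eulerField c f * g + f * eulerField c g := by
  refine poly_ext fun y => ?_
  rw [eulerField_apply, lineDeriv_mul', poly_add_apply, poly_mul_apply, poly_mul_apply,
    eulerField_apply, eulerField_apply]

lemma eulerField_lin (x : Module.Dual ℂ 𝔥) : eulerField c (lin x) = lin x := by
  refine poly_ext fun y => ?_
  rw [eulerField_apply, lineDeriv_lin, lin_apply]

lemma eulerField_const (a : ℂ) : eulerField c (algebraMap ℂ _ a) = 0 := by
  refine poly_ext fun y => ?_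
  rw [eulerField_apply, lineDeriv_const']; rfl

lemma eulerField_dirDeriv (v : 𝔥) (f : Poly 𝔥) :
    dirDeriv v (eulerField c f) = eulerField c (dirDeriv v f) + dirDeriv v f := by
  induction f using polyFun_induction with
  | hlin x => rw [eulerField_lin, dirDeriv_lin, eulerField_const, zero_add]
  | hconst a => rw [eulerField_const, dirDeriv_const, map_zero, map_zero, add_zero]
  | hadd f g hf hg => simp only [map_add, hf, hg]; abel
  | hmul f g hf hg =>
    simp only [eulerField_mul, dirDeriv_mul, map_add, hf, hg]
    ring

lemma eulerField_polyAct (w : W) (f : Poly 𝔥) :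
    eulerField c (polyAct w.1 f) = polyAct w.1 (eulerField c f) :=
  (congrArg (fun a : Cher c => a.1 f) (grp_mul_euler c w)).symm

lemma eulerField_divDiff (r : Refl W) (f : Poly 𝔥) :
    r.divDiff (eulerField c f) = eulerField c (r.divDiff f) + r.divDiff f := by
  apply lin_mul_cancel r.form_ne_zero
  have h := eulerField_mul c (lin r.form) (r.divDiff f)
  rw [r.form_mul_divDiff, eulerField_lin, map_sub] at h
  have h2 := eulerField_polyAct c r.1 f
  change eulerField c (polyAct r.toEquiv f) = polyAct r.toEquiv _ at h2
  rw [r.form_mul_divDiff, ← h2, h]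
  ring

lemma dun_mul_euler (v : 𝔥) : dun c v * euler c = (euler c + 1) * dun c v := by
  refine cher_ext fun f => ?_
  change dunkl c v (eulerField c f) = eulerField c (dunkl c v f) + dunkl c v f
  simp only [dunkl_apply, map_sub, map_sum, map_smul, eulerField_dirDeriv, eulerField_divDiff,
    smul_add, Finset.sum_add_distrib]
  abel

lemma euler_mul_lin (x : Module.Dual ℂ 𝔥) :
    euler c * mulOp c (lin x) = mulOp c (lin x) * (euler c + 1) := by
  refine cher_ext fun f => ?_
  change eulerField c (lin x * f) = lin x * (eulerField c f + f)
  rw [eulerField_mul, eulerField_lin]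
  ring

lemma dun_mul_lin (v : 𝔥) (x : Module.Dual ℂ 𝔥) :
    dun c v * mulOp c (lin x) = mulOp c (lin x) * dun c v + algebraMap ℂ _ (x v) -
      ∑ r : Refl W, (c.val r * r.form v * x r.coroot) • grp c r.1 := by
  rw [dun_mul_mulOp, dirDeriv_lin, AlgHom.commutes]
  congr 1
  refine Finset.sum_congr rfl fun r _ => ?_
  rw [r.divDiff_lin_eq, AlgHom.commutes, ← Algebra.smul_def, smul_smul]

/-- The element `z_c = ∑ c_r (1 - r)` of `H_c`. -/
def zElt : Cher c := ∑ r : Refl W, c.val r • (1 - grp c r.1)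

lemma euler_eq : euler c = ∑ i, mulOp c (lin ((Module.finBasis ℂ 𝔥).coord i)) *
    dun c (Module.finBasis ℂ 𝔥 i) + zElt c := rfl

lemma isIntegral_zElt : IsIntegral ℂ (zElt c) := by
  have : Fintype W := Fintype.ofFinite W
  let A := MonoidAlgebra.lift ℂ (Cher c) W (grp c)
  have h : A (∑ r : Refl W, c.val r • (1 - MonoidAlgebra.of ℂ W r.1)) = zElt c := by
    simp [A, zElt]
  rw [← h]
  have : Module.Finite ℂ (MonoidAlgebra ℂ W) := inferInstance
  exact (IsIntegral.of_finite ℂ _).map A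

/-- A list of complex numbers `a` such that the product of the `z_c - a` is zero. -/
def zRoots : List ℂ := (minpoly ℂ (zElt c)).roots.toList

lemma prod_zRoots : ((zRoots c).map fun a => zElt c - algebraMap ℂ _ a).prod = 0 := by
  have h := minpoly.aeval ℂ (zElt c)
  have h2 := (IsAlgClosed.splits (minpoly ℂ (zElt c))).eq_prod_roots_of_monic
    (minpoly.monic (isIntegral_zElt c))
  have h3 : minpoly ℂ (zElt c) =
      ((zRoots c).map fun a => (Polynomial.X - Polynomial.C a : Polynomial ℂ)).prod := by
    conv_lhs => rw [h2]
    rw [← Multiset.prod_coe, ← Multiset.map_coe, zRoots, Multiset.coe_toList]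
  rw [h3, map_list_prod, List.map_map] at h
  rw [← h]
  congr 2
  ext a
  simp

/-- The lowest weights that may occur. -/
def zSpec : Finset ℂ := (zRoots c).toFinset

/-- The set of weights that may occur in a module on which the Dunkl operators act locally
nilpotently. -/
def wtSet : Set ℂ := {d | ∃ s ∈ zSpec c, ∃ k : ℕ, d = s + k}

end EulerRelations

section ProductOfShifts

variable {𝔥 : Type u} [AddCommGroup 𝔥] [Module ℂ 𝔥] [FiniteDimensional ℂ 𝔥]
  {W : Subgroup (𝔥 ≃ₗ[ℂ] 𝔥)} [Finite W] (c : Param W)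

/-- The product of the `eu - a`. -/
def eulerProd (l : List ℂ) : Cher c := (l.map fun a => euler c - algebraMap ℂ _ a).prod

lemma dun_mul_eulerProd (v : 𝔥) (l : List ℂ) :
    dun c v * eulerProd c (l.map (· + 1)) = eulerProd c l * dun c v := by
  induction l with
  | nil => simp [eulerProd]
  | cons a l ih =>
    have h : dun c v * (euler c - algebraMap ℂ _ (a + 1)) =
        (euler c - algebraMap ℂ _ a) * dun c v := by
      rw [mul_sub, dun_mul_euler, map_add, map_one, mul_add, mul_one,
        ← Algebra.commutes a (dun c v), sub_mul, add_mul, one_mul]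
      abel
    simp only [eulerProd, List.map_cons, List.prod_cons] at ih ⊢
    rw [← mul_assoc, h, mul_assoc, ih, mul_assoc]

/-- The weights that occur in the `k`-th step of the nilpotency filtration. -/
def nilpWeights : ℕ → List ℂ
  | 0 => []
  | k + 1 => zRoots c ++ (nilpWeights k).map (· + 1)

lemma nilpWeights_subset (k : ℕ) : ∀ a ∈ nilpWeights c k, a ∈ wtSet c := by
  induction k with
  | zero => simp [nilpWeights]
  | succ k ih =>
    intro a ha
    rw [nilpWeights, List.mem_append, List.mem_map] at ha
    rcases ha with ha | ⟨b, hb, rfl⟩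
    · exact ⟨a, by simpa [zSpec] using ha, 0, by simp⟩
    · obtain ⟨s, hs, k, rfl⟩ := ih b hb
      exact ⟨s, hs, k + 1, by push_cast; ring⟩

variable {c} {M : ModuleCat.{u} (Cher c)}

lemma euler_smul_of_singular {m : M} (hm : m ∈ nilp c M 1) : euler c • m = zElt c • m := by
  have : ∀ v : 𝔥, dun c v • m = 0 := fun v => mem_nilp_succ.mp hm v
  rw [euler_eq, add_smul, Finset.sum_smul]
  simp [mul_smul, this]

lemma zElt_singular {m : M} (hm : m ∈ nilp c M 1) : zElt c • m ∈ nilp c M 1 := by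
  rw [zElt, Finset.sum_smul]
  refine sum_mem fun r _ => ?_
  rw [smul_assoc, sub_smul, one_smul]
  exact Submodule.smul_mem _ _ (sub_mem hm (grp_nilp _ hm))

lemma eulerProd_singular (l : List ℂ) {m : M} (hm : m ∈ nilp c M 1) :
    eulerProd c l • m ∈ nilp c M 1 ∧
    eulerProd c l • m = (l.map fun a => zElt c - algebraMap ℂ _ a).prod • m := by
  induction l with
  | nil => simpa [eulerProd] using hm
  | cons a l ih =>
    simp only [eulerProd, List.map_cons, List.prod_cons] at ih ⊢
    rw [mul_smul, mul_smul, ← ih.2, sub_smul, sub_smul, euler_smul_of_singular ih.1]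
    refine ⟨sub_mem (zElt_singular ih.1) ?_, rfl⟩
    rw [algebraMap_smul]
    exact Submodule.smul_mem _ _ ih.1

lemma eulerProd_nilp (k : ℕ) : ∀ m ∈ nilp c M k, eulerProd c (nilpWeights c k) • m = 0 := by
  induction k with
  | zero =>
    intro m hm
    have : m = 0 := hm
    rw [this, smul_zero]
  | succ k ih =>
    intro m hm
    have h1 : eulerProd c ((nilpWeights c k).map (· + 1)) • m ∈ nilp c M 1 := by
      rw [mem_nilp_succ]
      intro v
      rw [← mul_smul, dun_mul_eulerProd, mul_smul, ih _ (mem_nilp_succ.mp hm v)]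
      exact zero_mem _
    have h2 := (eulerProd_singular (zRoots c) h1).2
    rw [prod_zRoots, zero_smul, ← mul_smul] at h2
    rw [← h2, nilpWeights, eulerProd, eulerProd, eulerProd, List.map_append, List.prod_append]

end ProductOfShifts

section GeneralizedEigenspaces

variable {V : Type*} [AddCommGroup V] [Module ℂ V] (f : Module.End ℂ V)

lemma sub_smul_surjOn_maxGenEigenspace {a b : ℂ} (hab : a ≠ b) {n : V}
    (hn : n ∈ f.maxGenEigenspace b) : ∃ m ∈ f.maxGenEigenspace b, f m - a • m = n := by
  rw [Module.End.mem_maxGenEigenspace] at hn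
  obtain ⟨k, hk⟩ := hn
  induction k generalizing n with
  | zero => exact ⟨0, zero_mem _, by simpa using hk.symm⟩
  | succ k ih =>
    rw [pow_succ, Module.End.mul_apply] at hk
    obtain ⟨m, hm, h⟩ := ih hk
    have hba : b - a ≠ 0 := sub_ne_zero.mpr hab.symm
    have hn : n ∈ f.maxGenEigenspace b := by
      rw [Module.End.mem_maxGenEigenspace]
      exact ⟨k + 1, by rw [pow_succ, Module.End.mul_apply, hk]⟩
    refine ⟨(b - a)⁻¹ • (n - m), Submodule.smul_mem _ _ (sub_mem hn hm), ?_⟩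
    have h' : f n - b • n = f m - a • m := by rw [h]; simp
    have h3 : f (n - m) - a • (n - m) = (b - a) • n := by
      rw [map_sub, sub_eq_iff_eq_add.mp h']
      module
    rw [map_smul, smul_comm a, ← smul_sub, h3, smul_smul, inv_mul_cancel₀ hba, one_smul]

lemma mem_iSup_maxGenEigenspace_of_prod (l : List ℂ) (m : V)
    (h : (l.map fun a => f - algebraMap ℂ (Module.End ℂ V) a).prod m = 0) :
    m ∈ ⨆ a ∈ l, f.maxGenEigenspace a := by
  classical
  suffices hs : ∀ (l : List ℂ) (s : Set ℂ), (∀ a ∈ l, a ∈ s) → ∀ m,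
      (l.map fun a => f - algebraMap ℂ (Module.End ℂ V) a).prod m = 0 →
      m ∈ ⨆ a ∈ s, f.maxGenEigenspace a from hs l {a | a ∈ l} (fun a ha => ha) m h
  intro l s
  induction l using List.reverseRecOn with
  | nil => intro _ m hm; simp only [List.map_nil, List.prod_nil, Module.End.one_apply] at hm
           rw [hm]; exact zero_mem _
  | append_singleton l a ih =>
    intro hs m hm
    rw [List.map_append, List.prod_append, List.map_singleton, List.prod_singleton,
      Module.End.mul_apply] at hm
    have h1 := ih (fun a ha => hs a (by simp [ha])) _ hm
    have has : a ∈ s := hs a (by simp)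
    have key : ∀ n ∈ ⨆ a ∈ s, f.maxGenEigenspace a,
        ∃ p ∈ ⨆ a ∈ s, f.maxGenEigenspace a, n - (f p - a • p) ∈ f.maxGenEigenspace a := by
      intro n hn
      induction hn using Submodule.iSup_induction' with
      | mem b x hx =>
        by_cases hb : b ∈ s
        · simp only [hb, iSup_pos] at hx
          by_cases hab : a = b
          · subst hab
            exact ⟨0, zero_mem _, by simpa using hx⟩
          · obtain ⟨p, hp, h⟩ := sub_smul_surjOn_maxGenEigenspace f hab hx
            refine ⟨p, Submodule.mem_iSup_of_mem b (Submodule.mem_iSup_of_mem hb hp), ?_⟩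
            rw [h, sub_self]
            exact zero_mem _
        · simp only [hb, not_false_eq_true, iSup_neg, Submodule.mem_bot] at hx
          exact ⟨0, zero_mem _, by simp [hx]⟩
      | zero => exact ⟨0, zero_mem _, by simp⟩
      | add x y _ _ hx hy =>
        obtain ⟨p, hp, h⟩ := hx
        obtain ⟨q, hq, h'⟩ := hy
        refine ⟨p + q, add_mem hp hq, ?_⟩
        convert add_mem h h' using 1
        simp only [map_add, smul_add]
        abel
    obtain ⟨p, hp, h⟩ := key _ h1
    have h2 : m - p ∈ f.maxGenEigenspace a := by
      rw [Module.End.mem_maxGenEigenspace] at h ⊢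
      obtain ⟨k, hk⟩ := h
      refine ⟨k + 1, ?_⟩
      rw [pow_succ, Module.End.mul_apply, ← hk]
      congr 1
      simp only [LinearMap.sub_apply, LinearMap.smul_apply, Module.End.one_apply, map_sub,
        Module.algebraMap_end_apply]
    have := add_mem (Submodule.mem_iSup_of_mem a (Submodule.mem_iSup_of_mem has h2)) hp
    rwa [sub_add_cancel] at this

end GeneralizedEigenspaces

section WeightDecomposition

variable {𝔥 : Type u} [AddCommGroup 𝔥] [Module ℂ 𝔥] [FiniteDimensional ℂ 𝔥]
  {W : Subgroup (𝔥 ≃ₗ[ℂ] 𝔥)} [Finite W] {c : Param W}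

/-- Every element is killed by all products of sufficiently many Dunkl operators. -/
def LocNilp (M : ModuleCat.{u} (Cher c)) : Prop := ∀ m : M, ∃ k, m ∈ nilp c M k

variable (M : ModuleCat.{u} (Cher c))

lemma nilp_le_iSup_wt (k : ℕ) : nilp c M k ≤ ⨆ a ∈ nilpWeights c k, wt c M a := by
  intro m hm
  refine mem_iSup_maxGenEigenspace_of_prod _ _ _ ?_
  have h := eulerProd_nilp k m hm
  have h2 : act c M (eulerProd c (nilpWeights c k)) m = 0 := h
  rw [eulerProd, map_list_prod, List.map_map] at h2
  rw [← h2]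
  congr 3
  ext a : 1
  simp only [Function.comp, map_sub, AlgHom.commutes]

variable {M}

lemma LocNilp.of_objO (hM : objO c M) : LocNilp M := by
  intro m
  let b := Module.finBasis ℂ 𝔥
  have key : ∀ (K : ℕ) (N : Fin (Module.finrank ℂ 𝔥) → ℕ), ∑ i, N i = K → ∀ m : M,
      (∀ i, dun c (b i) ^ N i • m = 0) → m ∈ nilp c M (K + 1) := by
    intro K
    induction K with
    | zero =>
      intro N hN m hm
      rw [mem_nilp_succ]
      intro v
      have h0 : ∀ i, dun c (b i) • m = 0 := fun i => by
        have h1 : N i = 0 := (Finset.sum_eq_zero_iff.mp hN) i (Finset.mem_univ i)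
        have := hm i
        rw [h1, pow_zero, one_smul] at this
        rw [this, smul_zero]
      have : dun c v = ∑ i, b.repr v i • dun c (b i) := by
        conv_lhs => rw [← b.sum_repr v]
        simp only [map_sum, map_smul]
      rw [this, Finset.sum_smul]
      refine sum_mem fun i _ => ?_
      rw [smul_assoc, h0, smul_zero]
      exact zero_mem _
    | succ K ih =>
      intro N hN m hm
      rw [mem_nilp_succ]
      intro v
      have h0 : ∀ i, dun c (b i) • m ∈ nilp c M (K + 1) := fun i => by
        rcases Nat.eq_zero_or_pos (N i) with h1 | h1
        · have := hm i
          rw [h1, pow_zero, one_smul] at this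
          rw [this, smul_zero]
          exact zero_mem _
        · refine ih (Function.update N i (N i - 1)) ?_ _ fun j => ?_
          · have h2 := Finset.sum_update_of_mem (Finset.mem_univ i) N (N i - 1)
            have h3 := Finset.add_sum_erase Finset.univ N (Finset.mem_univ i)
            rw [← Finset.sdiff_singleton_eq_erase] at h3
            omega
          · by_cases hj : j = i
            · subst hj
              rw [Function.update_self, ← mul_smul, ← pow_succ, Nat.sub_add_cancel h1]
              exact hm j
            · rw [Function.update_of_ne hj, ← mul_smul]
              have : Commute (dun c (b j) ^ N j) (dun c (b i)) :=
                Commute.pow_left (dun_comm c _ _) _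
              rw [this.eq, mul_smul, hm j, smul_zero]
      have : dun c v = ∑ i, b.repr v i • dun c (b i) := by
        conv_lhs => rw [← b.sum_repr v]
        simp only [map_sum, map_smul]
      rw [this, Finset.sum_smul]
      refine sum_mem fun i _ => ?_
      rw [smul_assoc]
      exact Submodule.smul_mem _ _ (h0 i)
  choose N hN using fun i => hM.2 (b i) m
  exact ⟨_, key _ N rfl m hN⟩

lemma LocNilp.iSup_wt (hM : LocNilp M) : ⨆ d, wt c M d = ⊤ := by
  rw [eq_top_iff]
  rintro m -
  obtain ⟨k, hk⟩ := hM m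
  exact iSup₂_le (fun a _ => le_iSup (wt c M) a) (nilp_le_iSup_wt M k hk)

variable (M) in
lemma iSupIndep_wt : iSupIndep (wt c M) := Module.End.independent_maxGenEigenspace _

lemma LocNilp.isInternal (hM : LocNilp M) : DirectSum.IsInternal (wt c M) :=
  (DirectSum.isInternal_submodule_iff_iSupIndep_and_iSup_eq_top _).mpr ⟨iSupIndep_wt M, hM.iSup_wt⟩

lemma LocNilp.wt_eq_bot (hM : LocNilp M) {d : ℂ} (hd : d ∉ wtSet c) : wt c M d = ⊥ := by
  have h1 : ⨆ a ≠ d, wt c M a = ⊤ := by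
    rw [eq_top_iff]
    rintro m -
    obtain ⟨k, hk⟩ := hM m
    refine (iSup₂_le fun a ha => ?_ : ⨆ a ∈ nilpWeights c k, wt c M a ≤ _)
      (nilp_le_iSup_wt M k hk)
    exact le_iSup₂ (f := fun a (_ : a ≠ d) => wt c M a) a
      fun h => hd (h ▸ nilpWeights_subset c k a ha)
  have h2 := iSupIndep_wt M d
  rw [h1] at h2
  simpa using h2

/-- The projection onto the degree `d` subspace. -/
def LocNilp.pr (hM : LocNilp M) (d : ℂ) : Module.End ℂ M :=
  (wt c M d).subtype ∘ₗ DirectSum.component ℂ ℂ (fun d => wt c M d) d ∘ₗ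
    (LinearEquiv.ofBijective (DirectSum.coeLinearMap (wt c M)) hM.isInternal).symm.toLinearMap

lemma LocNilp.pr_mem (hM : LocNilp M) (d : ℂ) (m : M) : hM.pr d m ∈ wt c M d :=
  Submodule.coe_mem _

lemma LocNilp.pr_symm (hM : LocNilp M) {d : ℂ} {m : M} (hm : m ∈ wt c M d) :
    (LinearEquiv.ofBijective (DirectSum.coeLinearMap (wt c M)) hM.isInternal).symm m =
      DirectSum.lof ℂ ℂ (fun d => wt c M d) d ⟨m, hm⟩ := by
  rw [LinearEquiv.symm_apply_eq]
  exact (DirectSum.coeLinearMap_lof (wt c M) d ⟨m, hm⟩).symm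

lemma LocNilp.pr_of_mem (hM : LocNilp M) {d : ℂ} {m : M} (hm : m ∈ wt c M d) :
    hM.pr d m = m := by
  simp only [LocNilp.pr, LinearMap.comp_apply, LinearEquiv.coe_coe, hM.pr_symm hm]
  rw [DirectSum.component.lof_self]
  rfl

lemma LocNilp.pr_of_mem_ne (hM : LocNilp M) {d e : ℂ} (h : e ≠ d) {m : M} (hm : m ∈ wt c M e) :
    hM.pr d m = 0 := by
  simp only [LocNilp.pr, LinearMap.comp_apply, LinearEquiv.coe_coe, hM.pr_symm hm]
  rw [DirectSum.component.of, dif_neg h.symm.symm]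
  rfl

lemma LocNilp.induction (hM : LocNilp M) {p : M → Prop} (h0 : p 0)
    (hadd : ∀ m n, p m → p n → p (m + n)) (hwt : ∀ d, ∀ m ∈ wt c M d, p m) (m : M) : p m := by
  have hm : m ∈ ⨆ d, wt c M d := by rw [hM.iSup_wt]; trivial
  induction hm using Submodule.iSup_induction' with
  | mem d x hx => exact hwt d x hx
  | zero => exact h0
  | add x y _ _ hx hy => exact hadd x y hx hy

lemma LocNilp.exists_sum_pr (hM : LocNilp M) (m : M) :
    ∃ s : Finset ℂ, (∀ d ∉ s, hM.pr d m = 0) ∧ ∀ t : Finset ℂ, s ⊆ t → ∑ d ∈ t, hM.pr d m = m := by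
  classical
  suffices h : ∃ s : Finset ℂ, (∀ d ∉ s, hM.pr d m = 0) ∧ ∑ d ∈ s, hM.pr d m = m by
    obtain ⟨s, h1, h2⟩ := h
    refine ⟨s, h1, fun t ht => ?_⟩
    rw [← Finset.sum_subset ht fun d _ hd => h1 d hd, h2]
  refine hM.induction (p := fun m => ∃ s : Finset ℂ, (∀ d ∉ s, hM.pr d m = 0) ∧
    ∑ d ∈ s, hM.pr d m = m) ⟨∅, by simp, by simp⟩ ?_ ?_ m
  · rintro m n ⟨s, h1, h2⟩ ⟨t, h3, h4⟩
    refine ⟨s ∪ t, fun d hd => ?_, ?_⟩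
    · rw [Finset.mem_union, not_or] at hd
      rw [map_add, h1 d hd.1, h3 d hd.2, add_zero]
    · simp only [map_add, Finset.sum_add_distrib]
      rw [← Finset.sum_subset Finset.subset_union_left fun d _ hd => h1 d hd,
        ← Finset.sum_subset Finset.subset_union_right fun d _ hd => h3 d hd, h2, h4]
  · intro d m hm
    exact ⟨{d}, fun e he => hM.pr_of_mem_ne (fun h => he (by simp [h])) hm, by
      simp [hM.pr_of_mem hm]⟩

lemma LocNilp.ext_pr (hM : LocNilp M) {m n : M} (h : ∀ d, hM.pr d m = hM.pr d n) : m = n := by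
  classical
  obtain ⟨s, _, h1⟩ := hM.exists_sum_pr m
  obtain ⟨t, _, h2⟩ := hM.exists_sum_pr n
  rw [← h1 (s ∪ t) Finset.subset_union_left, ← h2 (s ∪ t) Finset.subset_union_right]
  exact Finset.sum_congr rfl fun d _ => h d

lemma LocNilp.pr_eq_of_shift (hM : LocNilp M) {N : ModuleCat.{u} (Cher c)} (hN : LocNilp N)
    (T : M →ₗ[ℂ] N) (a : ℂ)
    (hT : ∀ d, ∀ m ∈ wt c M d, T m ∈ wt c N (d + a)) (d : ℂ) (m : M) :
    hN.pr (d + a) (T m) = T (hM.pr d m) := by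
  refine hM.induction (p := fun m => hN.pr (d + a) (T m) = T (hM.pr d m)) ?_ ?_ ?_ m
  · simp
  · intro m n h1 h2
    simp only [map_add, h1, h2]
  · intro e m hm
    by_cases h : e = d
    · subst h
      rw [hM.pr_of_mem hm, hN.pr_of_mem (hT _ _ hm)]
    · rw [hM.pr_of_mem_ne h hm, hN.pr_of_mem_ne (by simpa using h) (hT _ _ hm), map_zero]

lemma wt_shift {M : ModuleCat.{u} (Cher c)} {a : Cher c} {k : ℂ}
    (h : euler c * a = a * (euler c + algebraMap ℂ _ k)) {d : ℂ} {m : M} (hm : m ∈ wt c M d) :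
    a • m ∈ wt c M (d + k) := by
  rw [wt, Module.End.mem_maxGenEigenspace] at hm ⊢
  obtain ⟨n, hn⟩ := hm
  refine ⟨n, ?_⟩
  have key : ∀ (n : ℕ) (m : M), ((act c M (euler c) - (d + k) • 1) ^ n) (a • m) =
      a • (((act c M (euler c) - d • 1) ^ n) m) := by
    intro n
    induction n with
    | zero => intro m; simp
    | succ n ih =>
      intro m
      rw [pow_succ, pow_succ, Module.End.mul_apply, Module.End.mul_apply, ← ih]
      congr 1
      simp only [LinearMap.sub_apply, act_apply, LinearMap.smul_apply, Module.End.one_apply]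
      rw [← mul_smul, h, mul_smul, add_smul, algebraMap_smul, smul_sub, smul_add,
        smul_comm a k m, smul_comm a d m, add_smul]
      abel
  rw [key, hn, smul_zero]

lemma lin_wt (x : Module.Dual ℂ 𝔥) {d : ℂ} {m : M} (hm : m ∈ wt c M d) :
    mulOp c (lin x) • m ∈ wt c M (d + 1) :=
  wt_shift (by rw [euler_mul_lin, map_one]) hm

lemma dun_wt (v : 𝔥) {d : ℂ} {m : M} (hm : m ∈ wt c M d) :
    dun c v • m ∈ wt c M (d - 1) := by
  rw [sub_eq_add_neg]
  refine wt_shift ?_ hm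
  rw [map_neg, map_one, mul_add, dun_mul_euler, add_mul, one_mul, mul_neg, mul_one]
  abel

lemma grp_wt (w : W) {d : ℂ} {m : M} (hm : m ∈ wt c M d) : grp c w • m ∈ wt c M d :=
  wt_stable c M d w hm

lemma LocNilp.pr_map (hM : LocNilp M) {N : ModuleCat.{u} (Cher c)} (hN : LocNilp N)
    (f : M →ₗ[Cher c] N) (d : ℂ) (m : M) : hN.pr d (f m) = f (hM.pr d m) := by
  have := hM.pr_eq_of_shift hN (f.restrictScalars ℂ) 0 (fun d m hm => by
    rw [add_zero]; exact wt_map f d hm) d m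
  rwa [add_zero] at this

lemma LocNilp.lin_pr (hM : LocNilp M) (x : Module.Dual ℂ 𝔥) (d : ℂ) (m : M) :
    hM.pr (d + 1) (mulOp c (lin x) • m) = mulOp c (lin x) • hM.pr d m :=
  hM.pr_eq_of_shift hM (act c M (mulOp c (lin x))) 1 (fun _ _ hm => lin_wt x hm) d m

lemma LocNilp.dun_pr (hM : LocNilp M) (v : 𝔥) (d : ℂ) (m : M) :
    hM.pr (d - 1) (dun c v • m) = dun c v • hM.pr d m := by
  have := hM.pr_eq_of_shift hM (act c M (dun c v)) (-1) (fun d m hm => by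
    rw [← sub_eq_add_neg]; exact dun_wt v hm) d m
  rwa [← sub_eq_add_neg] at this

lemma LocNilp.wt_surjective (hM : LocNilp M) {N : ModuleCat.{u} (Cher c)} (hN : LocNilp N)
    {f : M →ₗ[Cher c] N} (hf : Function.Surjective f) {d : ℂ} {n : N} (hn : n ∈ wt c N d) :
    ∃ m ∈ wt c M d, f m = n := by
  obtain ⟨m, rfl⟩ := hf n
  exact ⟨hM.pr d m, hM.pr_mem d m, by rw [← hM.pr_map hN, hN.pr_of_mem hn]⟩

lemma nilp_map {N : ModuleCat.{u} (Cher c)} (f : M →ₗ[Cher c] N) {k : ℕ} {m : M}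
    (hm : m ∈ nilp c M k) : f m ∈ nilp c N k := by
  induction k generalizing m with
  | zero =>
    have : m = 0 := hm
    rw [this, map_zero]
    exact zero_mem _
  | succ k ih =>
    rw [mem_nilp_succ] at hm ⊢
    intro v
    rw [← map_smul]
    exact ih (hm v)

lemma nilp_of_injective {N : ModuleCat.{u} (Cher c)} {f : M →ₗ[Cher c] N}
    (hf : Function.Injective f) {k : ℕ} {m : M}
    (hm : f m ∈ nilp c N k) : m ∈ nilp c M k := by
  induction k generalizing m with
  | zero =>
    have : f m = 0 := hm
    rw [← map_zero f] at this
    rw [hf this]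
    exact zero_mem _
  | succ k ih =>
    rw [mem_nilp_succ] at hm ⊢
    intro v
    refine ih ?_
    rw [map_smul]
    exact hm v

lemma LocNilp.of_injective {N : ModuleCat.{u} (Cher c)} (hN : LocNilp N) {f : M →ₗ[Cher c] N}
    (hf : Function.Injective f) : LocNilp M := fun m => by
  obtain ⟨k, hk⟩ := hN (f m)
  exact ⟨k, nilp_of_injective hf hk⟩

lemma LocNilp.of_surjective (hM : LocNilp M) {N : ModuleCat.{u} (Cher c)} {f : M →ₗ[Cher c] N}
    (hf : Function.Surjective f) : LocNilp N := fun n => by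
  obtain ⟨m, rfl⟩ := hf n
  obtain ⟨k, hk⟩ := hM m
  exact ⟨k, nilp_map f hk⟩

/-- A nonzero locally nilpotent module has a nonzero singular vector of one of the finitely many
lowest weights. -/
lemma LocNilp.exists_singular (hM : LocNilp M) {m : M} (hm : m ≠ 0) :
    ∃ s ∈ zSpec c, ∃ n ∈ wt c M s, n ≠ 0 ∧ ∀ v : 𝔥, dun c v • n = 0 := by
  have h1 : ∃ n ∈ nilp c M 1, n ≠ 0 := by
    obtain ⟨k, hk⟩ := hM m
    induction k generalizing m with
    | zero => exact absurd hk hm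
    | succ k ih =>
      by_cases h : ∀ v : 𝔥, dun c v • m = 0
      · refine ⟨m, mem_nilp_succ.mpr fun v => ?_, hm⟩
        rw [h v]; exact zero_mem _
      · push Not at h
        obtain ⟨v, hv⟩ := h
        exact ih hv (mem_nilp_succ.mp hk v)
  obtain ⟨n, hn, hn0⟩ := h1
  have h2 : ∃ d, hM.pr d n ≠ 0 := by
    by_contra! h
    exact hn0 (hM.ext_pr fun d => by rw [h d, map_zero])
  obtain ⟨d, hd⟩ := h2
  refine ⟨d, ?_, hM.pr d n, hM.pr_mem d n, hd, fun v => ?_⟩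
  · by_contra hds
    have h3 : wt c M d ⊓ ⨆ a ≠ d, wt c M a = ⊥ := (iSupIndep_wt M d).eq_bot
    have h4 : n ∈ ⨆ a ≠ d, wt c M a := by
      refine (iSup₂_le fun a ha => ?_ : ⨆ a ∈ nilpWeights c 1, wt c M a ≤ _)
        (nilp_le_iSup_wt M 1 hn)
      refine le_iSup₂ (f := fun a (_ : a ≠ d) => wt c M a) a fun h => hds ?_
      simpa [nilpWeights, zSpec, ← h] using ha
    have h5 : ⨆ a ≠ d, wt c M a ≤ LinearMap.ker (hM.pr d) := iSup₂_le fun a ha x hx =>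
      hM.pr_of_mem_ne ha hx
    exact hd (h5 h4)
  · have : dun c v • n = 0 := mem_nilp_succ.mp hn v
    rw [← hM.dun_pr, this, map_zero]

/-- Far below any given degree, the weight spaces vanish. -/
lemma LocNilp.exists_wt_sub_eq_bot (d : ℂ) :
    ∃ n : ℕ, ∀ (M : ModuleCat.{u} (Cher c)), LocNilp M → ∀ k ≥ n, wt c M (d - k) = ⊥ := by
  have h : ∃ n : ℕ, ∀ k ≥ n, d - (k : ℂ) ∉ wtSet c := by
    have hr : ∃ n : ℕ, ∀ s ∈ zSpec c, d.re - s.re < n := by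
      obtain ⟨n, hn⟩ := exists_nat_gt (∑ s ∈ zSpec c, |d.re - s.re|)
      refine ⟨n, fun s hs => lt_of_le_of_lt ((le_abs_self _).trans ?_) hn⟩
      exact Finset.single_le_sum (f := fun s : ℂ => |d.re - s.re|) (fun _ _ => abs_nonneg _) hs
    obtain ⟨n, hn⟩ := hr
    refine ⟨n, fun k hk => ?_⟩
    rintro ⟨s, hs, j, hj⟩
    have h1 := congrArg Complex.re hj
    simp only [Complex.sub_re, Complex.natCast_re, Complex.add_re] at h1
    have h2 := hn s hs
    have h3 : (n : ℝ) ≤ k := by exact_mod_cast hk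
    have h4 : (0 : ℝ) ≤ j := Nat.cast_nonneg j
    linarith
  obtain ⟨n, hn⟩ := h
  exact ⟨n, fun M hM k hk => hM.wt_eq_bot (hn k hk)⟩

/-- Vectors of a given degree are killed by all products of sufficiently many Dunkl operators. -/
lemma exists_wt_le_nilp (c : Param W) (d : ℂ) :
    ∃ n : ℕ, ∀ (M : ModuleCat.{u} (Cher c)), LocNilp M → wt c M d ≤ nilp c M n := by
  obtain ⟨n, hn⟩ := LocNilp.exists_wt_sub_eq_bot (c := c) d
  refine ⟨n, fun M hM => ?_⟩
  have key : ∀ k ≤ n, wt c M (d - n + k) ≤ nilp c M k := by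
    intro k
    induction k with
    | zero =>
      intro _
      rw [Nat.cast_zero, add_zero, hn M hM n le_rfl]
      exact bot_le
    | succ k ih =>
      intro hk m hm
      rw [mem_nilp_succ]
      intro v
      refine ih (by omega) ?_
      have := dun_wt v hm
      convert this using 2
      push_cast; ring
  have := key n le_rfl
  rwa [sub_add_cancel] at this

end WeightDecomposition

section Finiteness

variable {𝔥 : Type u} [AddCommGroup 𝔥] [Module ℂ 𝔥] [FiniteDimensional ℂ 𝔥]
  {W : Subgroup (𝔥 ≃ₗ[ℂ] 𝔥)} [Finite W] {c : Param W} {M : ModuleCat.{u} (Cher c)}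

lemma dun_eq_sum {ι : Type*} [Fintype ι] (b : Module.Basis ι ℂ 𝔥) (v : 𝔥) :
    dun c v = ∑ i, b.repr v i • dun c (b i) := by
  conv_lhs => rw [← b.sum_repr v]
  simp only [map_sum, map_smul]

lemma lin_eq_sum {ι : Type*} [Fintype ι] (b : Module.Basis ι ℂ 𝔥) (x : Module.Dual ℂ 𝔥) :
    lin x = ∑ i, x (b i) • lin (b.coord i) := by
  refine poly_ext fun y => ?_
  rw [poly_sum_apply]
  conv_lhs => rw [lin_apply, ← b.sum_repr y, map_sum]
  exact Finset.sum_congr rfl fun i _ => by simp [mul_comm]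

lemma mulOp_sub_const_mem (f : Poly 𝔥) (m : M) : mulOp c f • m - f.1 0 • m ∈ hStar c M := by
  induction f using polyFun_induction generalizing m with
  | hlin x =>
    have : (lin x).1 0 = 0 := by simp
    rw [this, zero_smul, sub_zero]
    exact Submodule.subset_span ⟨x, m, rfl⟩
  | hconst a =>
    rw [AlgHom.commutes, algebraMap_smul, poly_const_apply, sub_self]
    exact zero_mem _
  | hadd f g hf hg =>
    have := add_mem (hf m) (hg m)
    rw [map_add, add_smul, poly_add_apply, add_smul]
    convert this using 1
    abel
  | hmul f g hf hg =>
    have := add_mem (hf (mulOp c g • m)) (Submodule.smul_mem _ (f.1 0) (hg m))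
    rw [map_mul, mul_smul, poly_mul_apply, mul_smul]
    convert this using 1
    rw [smul_sub]
    abel

lemma objO.exists_generating_subspace (hM : objO c M) :
    ∃ U : Submodule ℂ M, U.FG ∧ (∀ m : M, m ∈ Submodule.span ℂ {m | ∃ f, ∃ u ∈ U, mulOp c f • u = m}) := by
  have := hM.1
  obtain ⟨s, hs⟩ := Module.Finite.fg_top (R := Cher c) (M := M)
  obtain ⟨U, h1, h2, h3, h4⟩ := exists_fd_stable hM.2 (Submodule.span ℂ (s : Set M)) ⟨s, rfl⟩
  refine ⟨U, h2, fun m => ?_⟩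
  have hm : m ∈ Submodule.span (Cher c) (s : Set M) := by rw [hs]; trivial
  induction hm using Submodule.span_induction with
  | mem x hx =>
    exact Submodule.subset_span ⟨1, x, h1 (Submodule.subset_span hx), by simp⟩
  | zero => exact zero_mem _
  | add x y _ _ hx hy => exact add_mem hx hy
  | smul a x _ hx => exact poly_span_stable U h3 h4 a x hx

lemma objO.exists_complement_hStar (hM : objO c M) :
    ∃ U : Submodule ℂ M, U.FG ∧ U ⊔ hStar c M = ⊤ := by
  obtain ⟨U, hU, h⟩ := hM.exists_generating_subspace
  refine ⟨U, hU, ?_⟩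
  rw [eq_top_iff]
  rintro m -
  refine (Submodule.span_le.mpr ?_ : _ ≤ U ⊔ hStar c M) (h m)
  rintro _ ⟨f, u, hu, rfl⟩
  have := add_mem (Submodule.mem_sup_left (T := hStar c M) (U.smul_mem (f.1 0) hu))
    (Submodule.mem_sup_right (S := U) (mulOp_sub_const_mem f u))
  rwa [add_sub_cancel] at this

lemma objO.finite_coinv (hM : objO c M) : FiniteDimensional ℂ (M ⧸ hStar c M) := by
  obtain ⟨U, hU, h⟩ := hM.exists_complement_hStar
  refine ⟨?_⟩
  have h2 : U.map (hStar c M).mkQ = ⊤ := by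
    have := congrArg (Submodule.map (hStar c M).mkQ) h
    rw [Submodule.map_sup, Submodule.mkQ_map_self, sup_bot_eq, Submodule.map_top,
      Submodule.range_mkQ] at this
    exact this
  rw [← h2]
  exact hU.map _

lemma LocNilp.pr_hStar (hM : LocNilp M) {ι : Type*} [Fintype ι] (b : Module.Basis ι ℂ 𝔥) (d : ℂ)
    {m : M} (hm : m ∈ hStar c M) :
    hM.pr d m ∈ ⨆ i, (wt c M (d - 1)).map (act c M (mulOp c (lin (b.coord i)))) := by
  refine (Submodule.span_le.mpr ?_ : hStar c M ≤ Submodule.comap (hM.pr d)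
    (⨆ i, (wt c M (d - 1)).map (act c M (mulOp c (lin (b.coord i)))))) hm
  rintro _ ⟨x, n, rfl⟩
  have h := hM.lin_pr x (d - 1) n
  rw [sub_add_cancel] at h
  change hM.pr d (mulOp c (lin x) • n) ∈
    ⨆ i, (wt c M (d - 1)).map (act c M (mulOp c (lin (b.coord i))))
  rw [h, lin_eq_sum b x, map_sum, Finset.sum_smul]
  refine sum_mem fun i _ => ?_
  rw [map_smul, smul_assoc]
  exact Submodule.smul_mem _ _ (Submodule.mem_iSup_of_mem i ⟨_, hM.pr_mem _ _, rfl⟩)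

/-- The weight spaces of an object of `O_c` are finite dimensional. -/
lemma objO.finite_wt (hM : objO c M) (d : ℂ) : FiniteDimensional ℂ (wt c M d) := by
  have hL := LocNilp.of_objO hM
  obtain ⟨U, hU, h⟩ := hM.exists_complement_hStar
  have key : ∀ (k : ℕ) (d : ℂ), wt c M (d - k) = ⊥ → (wt c M d).FG := by
    intro k
    induction k with
    | zero =>
      intro d hd
      rw [Nat.cast_zero, sub_zero] at hd
      rw [hd]
      exact Submodule.fg_bot
    | succ k ih =>
      intro d hd
      have h1 := ih (d - 1) (by rw [← hd]; congr 1; push_cast; ring)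
      let b := Module.finBasis ℂ 𝔥
      have h2 : (U.map (hL.pr d) ⊔ ⨆ i, (wt c M (d - 1)).map
          (act c M (mulOp c (lin (b.coord i))))).FG :=
        (hU.map _).sup (Submodule.fg_iSup _ fun i => h1.map _)
      refine Submodule.FG.of_le h2 fun m hm => ?_
      have hm' : m ∈ U ⊔ hStar c M := by rw [h]; trivial
      obtain ⟨u, hu, n, hn, rfl⟩ := Submodule.mem_sup.mp hm'
      rw [← hL.pr_of_mem hm, map_add]
      exact add_mem (Submodule.mem_sup_left ⟨u, hu, rfl⟩)
        (Submodule.mem_sup_right (hL.pr_hStar b d hn))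
  obtain ⟨n, hn⟩ := LocNilp.exists_wt_sub_eq_bot (c := c) d
  exact Module.Finite.iff_fg.mpr (key n d (hn M hL n le_rfl))

/-- A locally nilpotent module whose lowest weight spaces are finite dimensional is noetherian. -/
lemma LocNilp.isNoetherian (hM : LocNilp M) (hfin : ∀ s ∈ zSpec c, FiniteDimensional ℂ (wt c M s)) :
    IsNoetherian (Cher c) M := by
  let φ : Submodule (Cher c) M → ℕ := fun N =>
    ∑ s ∈ zSpec c, Module.finrank ℂ ↥(wt c M s ⊓ N.restrictScalars ℂ)
  have hfin' : ∀ s ∈ zSpec c, ∀ N : Submodule (Cher c) M,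
      FiniteDimensional ℂ ↥(wt c M s ⊓ N.restrictScalars ℂ) := fun s hs N => by
    have := hfin s hs
    exact Submodule.finiteDimensional_inf_left _ _
  have hφ : StrictMono φ := by
    intro N N' hlt
    refine Finset.sum_lt_sum (fun s hs => ?_) ?_
    · have := hfin' s hs N'
      exact Submodule.finrank_mono (inf_le_inf_left _ hlt.le)
    · obtain ⟨m, hm', hm⟩ := SetLike.exists_of_lt hlt
      let A := ModuleCat.of (Cher c) N'
      let B := ModuleCat.of (Cher c) (N'.map N.mkQ)
      have hA : LocNilp A := hM.of_injective (f := N'.subtype) Subtype.val_injective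
      let g : A →ₗ[Cher c] B := N.mkQ.submoduleMap N'
      have hg : Function.Surjective g := N.mkQ.submoduleMap_surjective N'
      have hB : LocNilp B := hA.of_surjective hg
      have hne : g ⟨m, hm'⟩ ≠ 0 := by
        intro h0
        have h1 : N.mkQ m = 0 := congrArg Subtype.val h0
        rw [Submodule.mkQ_apply, Submodule.Quotient.mk_eq_zero] at h1
        exact hm h1
      obtain ⟨s, hs, n, hn, hn0, -⟩ := hB.exists_singular hne
      obtain ⟨p, hp, rfl⟩ := hA.wt_surjective hB hg hn
      refine ⟨s, hs, ?_⟩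
      have := hfin' s hs N'
      refine Submodule.finrank_lt_finrank_of_lt (lt_of_le_of_ne (inf_le_inf_left _ hlt.le) ?_)
      intro heq
      have h2 : p.1 ∈ wt c M s ⊓ N'.restrictScalars ℂ :=
        ⟨wt_map (M := A) (N := M) N'.subtype s hp, p.2⟩
      rw [← heq] at h2
      refine hn0 (Subtype.ext ?_)
      exact (Submodule.Quotient.mk_eq_zero _).mpr h2.2
  let B : ℕ := ∑ s ∈ zSpec c, Module.finrank ℂ (wt c M s)
  have hB : ∀ N, φ N ≤ B := fun N => Finset.sum_le_sum fun s hs => by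
    have := hfin s hs
    exact Submodule.finrank_mono inf_le_left
  have hanti : StrictAnti fun N => B - φ N := fun N N' h => by
    have h1 := hφ h
    have h2 := hB N'
    change B - φ N' < B - φ N
    omega
  rw [isNoetherian_iff']
  exact hanti.wellFoundedGT

lemma LocNilp.objO (hM : LocNilp M) (hfin : ∀ s ∈ zSpec c, FiniteDimensional ℂ (wt c M s)) :
    objO c M := by
  have := hM.isNoetherian hfin
  refine ⟨inferInstance, fun v m => ?_⟩
  obtain ⟨k, hk⟩ := hM m
  exact ⟨k, pow_smul_nilp v hk⟩

end Finiteness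

section VanishingOrder

variable {𝔥 : Type u} [AddCommGroup 𝔥] [Module ℂ 𝔥]

/-- The polynomial functions that vanish to order `k` at `q`. -/
def van (q : 𝔥) : ℕ → Submodule ℂ (Poly 𝔥)
  | 0 => ⊤
  | k + 1 =>
    { carrier := {g | g.1 q = 0 ∧ ∀ v, dirDeriv v g ∈ van q k}
      add_mem' := fun {f g} hf hg => ⟨by rw [poly_add_apply, hf.1, hg.1, add_zero], fun v => by
        rw [map_add]; exact add_mem (hf.2 v) (hg.2 v)⟩
      zero_mem' := ⟨rfl, fun v => by rw [map_zero]; exact zero_mem _⟩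
      smul_mem' := fun a g hg => ⟨by rw [poly_smul_apply, hg.1, mul_zero], fun v => by
        rw [map_smul]; exact Submodule.smul_mem _ _ (hg.2 v)⟩ }

lemma mem_van_zero {q : 𝔥} {g : Poly 𝔥} : g ∈ van q 0 := Submodule.mem_top

lemma van_succ_le (q : 𝔥) (k : ℕ) : van q (k + 1) ≤ van q k := by
  induction k with
  | zero => exact fun _ _ => mem_van_zero
  | succ k ih => exact fun g hg => ⟨hg.1, fun v => ih (hg.2 v)⟩

lemma van_mono (q : 𝔥) {k l : ℕ} (h : k ≤ l) : van q l ≤ van q k :=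
  antitone_nat_of_succ_le (van_succ_le q) h

lemma mul_mem_van {q : 𝔥} {k : ℕ} (f : Poly 𝔥) {g : Poly 𝔥} (hg : g ∈ van q k) :
    f * g ∈ van q k := by
  induction k generalizing f g with
  | zero => exact mem_van_zero
  | succ k ih =>
    refine ⟨by rw [poly_mul_apply, hg.1, mul_zero], fun v => ?_⟩
    rw [dirDeriv_mul]
    exact add_mem (ih _ (van_succ_le q k hg)) (ih _ (hg.2 v))

lemma mul_mem_van_succ {q : 𝔥} {k : ℕ} {f : Poly 𝔥} (hf : f.1 q = 0) {g : Poly 𝔥}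
    (hg : g ∈ van q k) : f * g ∈ van q (k + 1) := by
  induction k generalizing g with
  | zero => exact ⟨by rw [poly_mul_apply, hf, zero_mul], fun v => mem_van_zero⟩
  | succ k ih =>
    refine ⟨by rw [poly_mul_apply, hf, zero_mul], fun v => ?_⟩
    rw [dirDeriv_mul]
    exact add_mem (mul_mem_van _ hg) (ih (hg.2 v))

lemma pow_mem_van {q : 𝔥} {f : Poly 𝔥} (hf : f.1 q = 0) (k : ℕ) : f ^ k ∈ van q k := by
  induction k with
  | zero => exact mem_van_zero
  | succ k ih => rw [pow_succ']; exact mul_mem_van_succ hf ih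

lemma mem_van_of_mul {q : 𝔥} {k : ℕ} {f g : Poly 𝔥} (hf : f.1 q ≠ 0) (h : f * g ∈ van q k) :
    g ∈ van q k := by
  induction k generalizing g with
  | zero => exact mem_van_zero
  | succ k ih =>
    refine ⟨(mul_eq_zero.mp h.1).resolve_left hf, fun v => ih ?_⟩
    have h1 := h.2 v
    rw [dirDeriv_mul] at h1
    have h2 := mul_mem_van (dirDeriv v f) (ih (van_succ_le q k h))
    simpa using sub_mem h1 h2

lemma polyAct_mem_van (w : 𝔥 ≃ₗ[ℂ] 𝔥) {q : 𝔥} {k : ℕ} {g : Poly 𝔥} (hg : g ∈ van (w.symm q) k) :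
    polyAct w g ∈ van q k := by
  induction k generalizing g with
  | zero => exact mem_van_zero
  | succ k ih =>
    refine ⟨hg.1, fun v => ?_⟩
    have h := polyAct_dirDeriv w (w.symm v) g
    rw [LinearEquiv.apply_symm_apply] at h
    rw [← h]
    exact ih (hg.2 _)

variable {W : Subgroup (𝔥 ≃ₗ[ℂ] 𝔥)}

/-- The polynomial functions that vanish to order `k` at all points of an orbit. -/
def orbVan (W : Subgroup (𝔥 ≃ₗ[ℂ] 𝔥)) (p : 𝔥) (k : ℕ) : Submodule ℂ (Poly 𝔥) :=
  ⨅ w : W, van (w.1 p) k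

lemma mem_orbVan {p : 𝔥} {k : ℕ} {g : Poly 𝔥} :
    g ∈ orbVan W p k ↔ ∀ w : W, g ∈ van (w.1 p) k := by simp [orbVan]

lemma dirDeriv_orbVan {p : 𝔥} {k : ℕ} {g : Poly 𝔥} (hg : g ∈ orbVan W p (k + 1)) (v : 𝔥) :
    dirDeriv v g ∈ orbVan W p k :=
  mem_orbVan.mpr fun w => (mem_orbVan.mp hg w).2 v

lemma divDiff_orbVan {p : 𝔥} (hp : ∀ w : W, w.1 p = p → w = 1) (r : Refl W) {k : ℕ} {g : Poly 𝔥}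
    (hg : g ∈ orbVan W p k) : r.divDiff g ∈ orbVan W p k := by
  rw [mem_orbVan] at hg ⊢
  intro w
  refine mem_van_of_mul (f := lin r.form) ?_ ?_
  · intro h
    have h1 : w.1 p ∈ LinearMap.ker r.form := h
    rw [r.ker_form, mem_fixedSpace] at h1
    have h2 : w⁻¹ * r.1 * w = 1 := hp _ (by
      change w.1.symm (r.1.1 (w.1 p)) = p
      rw [LinearEquiv.symm_apply_eq]
      exact h1)
    have h3 : r.1 = 1 := by
      have := congrArg (fun x => w * x * w⁻¹) h2
      simpa [mul_assoc] using this
    apply r.fixedSpace_ne_top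
    rw [eq_top_iff]
    rintro y -
    rw [mem_fixedSpace, Refl.toEquiv, h3]
    rfl
  · rw [r.form_mul_divDiff]
    refine sub_mem (hg w) (polyAct_mem_van _ ?_)
    exact hg (r.1⁻¹ * w)

lemma orbVan_succ_le (p : 𝔥) (k : ℕ) : orbVan W p (k + 1) ≤ orbVan W p k := fun g hg => by
  rw [mem_orbVan] at hg ⊢
  exact fun w => van_succ_le _ _ (hg w)

variable [Finite W] (c : Param W)

lemma dunkl_sub_dirDeriv_orbVan {p : 𝔥} (hp : ∀ w : W, w.1 p = p → w = 1) {k : ℕ} {g : Poly 𝔥}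
    (hg : g ∈ orbVan W p k) (v : 𝔥) : dunkl c v g - dirDeriv v g ∈ orbVan W p k := by
  rw [dunkl_apply, sub_sub_cancel_left]
  exact neg_mem (sum_mem fun r _ => Submodule.smul_mem _ _ (divDiff_orbVan hp r hg))

lemma dunkl_orbVan {p : 𝔥} (hp : ∀ w : W, w.1 p = p → w = 1) {k : ℕ} {g : Poly 𝔥}
    (hg : g ∈ orbVan W p (k + 1)) (v : 𝔥) : dunkl c v g ∈ orbVan W p k := by
  have := add_mem (orbVan_succ_le p k (dunkl_sub_dirDeriv_orbVan c hp hg v)) (dirDeriv_orbVan hg v)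
  rwa [sub_add_cancel] at this

/-- The effect of a Dunkl operator on the leading term of a test function. -/
lemma dunkl_leading {p : 𝔥} (hp : ∀ w : W, w.1 p = p → w = 1) (n : ℕ) (w₀ : W)
    (l : Module.Dual ℂ 𝔥) (h : Poly 𝔥) (hh : ∀ w : W, w ≠ w₀ → h ∈ van (w.1 p) (n + 1)) {k : ℕ}
    (hk : k + 1 ≤ n) (v : 𝔥) {g : Poly 𝔥} {a : ℂ}
    (hg : g - a • ((lin l - algebraMap ℂ _ (l (w₀.1 p))) ^ (k + 1) * h) ∈ orbVan W p (k + 2)) :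
    dunkl c v g - (a * ((k + 1 : ℕ) * l v)) • ((lin l - algebraMap ℂ _ (l (w₀.1 p))) ^ k * h) ∈
      orbVan W p (k + 1) := by
  set L : Poly 𝔥 := lin l - algebraMap ℂ _ (l (w₀.1 p)) with hL
  have hL0 : L.1 (w₀.1 p) = 0 := by simp [hL]
  have hdL : dirDeriv v L = algebraMap ℂ _ (l v) := by
    rw [hL, map_sub, dirDeriv_lin, dirDeriv_const, sub_zero]
  have hmem : ∀ h' : Poly 𝔥, (∀ w : W, w ≠ w₀ → h' ∈ van (w.1 p) (k + 1)) →
      L ^ (k + 1) * h' ∈ orbVan W p (k + 1) := fun h' hh' => by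
    rw [mem_orbVan]
    intro w
    by_cases hw : w = w₀
    · rw [hw, mul_comm]
      exact mul_mem_van _ (pow_mem_van hL0 _)
    · exact mul_mem_van _ (hh' w hw)
  have h1 := dunkl_orbVan c hp hg v
  have h2 := dunkl_sub_dirDeriv_orbVan c hp
    (hmem h fun w hw => van_mono _ (by omega) (hh w hw)) v
  have h3 := hmem (dirDeriv v h) fun w hw => van_mono _ hk ((hh w hw).2 v)
  have h4 : ∀ k : ℕ, dirDeriv v (L ^ (k + 1)) = ((k + 1 : ℕ) * l v : ℂ) • L ^ k := by
    intro k
    induction k with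
    | zero => simp [hdL, Algebra.smul_def]
    | succ k ih =>
      rw [pow_succ, dirDeriv_mul, ih, hdL]
      simp only [Algebra.smul_def, map_mul, map_natCast]
      push_cast
      ring
  rw [dirDeriv_mul, h4] at h2
  rw [map_sub, map_smul] at h1
  have h5 := add_mem h1 (Submodule.smul_mem _ a (add_mem h2 h3))
  convert h5 using 1
  rw [mul_smul, smul_mul_assoc]
  module

end VanishingOrder

section PBW

variable {𝔥 : Type u} [AddCommGroup 𝔥] [Module ℂ 𝔥] {W : Subgroup (𝔥 ≃ₗ[ℂ] 𝔥)}

lemma exists_dual_ne {y z : 𝔥} (h : y ≠ z) : ∃ l : Module.Dual ℂ 𝔥, l y ≠ l z := by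
  by_contra! hcon
  refine h (sub_eq_zero.mp ((Module.forall_dual_apply_eq_zero_iff ℂ (y - z)).mp fun l => ?_))
  rw [map_sub, hcon l, sub_self]

/-- A polynomial function that vanishes at all points with trivial stabilizer is zero. -/
lemma poly_eq_zero_of_generic [Finite W] {f : Poly 𝔥}
    (hf : ∀ p : 𝔥, (∀ w : W, w.1 p = p → w = 1) → f.1 p = 0) : f = 0 := by
  classical
  have : Fintype W := Fintype.ofFinite W
  have hex : ∀ w : W, w ≠ 1 → ∃ l : Module.Dual ℂ 𝔥, l ≠ 0 ∧ ∀ p, w.1 p = p → l p = 0 := by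
    intro w hw
    have h1 : ∃ y, w.1 y ≠ y := by
      by_contra! h
      exact hw (Subtype.ext (LinearEquiv.ext h))
    obtain ⟨y, hy⟩ := h1
    obtain ⟨l, hl⟩ := exists_dual_ne hy
    refine ⟨l ∘ₗ w.1.toLinearMap - l, fun h0 => hl ?_, fun p hp => by simp [hp]⟩
    have := LinearMap.congr_fun h0 y
    simpa [sub_eq_zero] using this
  choose! l hl0 hl using hex
  have hcancel : ∀ (s : Finset W), (∀ w ∈ s, w ≠ 1) → ∀ g : Poly 𝔥,
      (∏ w ∈ s, lin (l w)) * g = 0 → g = 0 := by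
    intro s
    induction s using Finset.induction_on with
    | empty => intro _ g hg; simpa using hg
    | insert w s hw ih =>
      intro hs g hg
      rw [Finset.prod_insert hw, mul_assoc] at hg
      exact ih (fun w hw => hs w (Finset.mem_insert_of_mem hw)) g
        (lin_mul_eq_zero (hl0 w (hs w (Finset.mem_insert_self _ _))) hg)
  refine hcancel (Finset.univ.erase 1) (fun w hw => Finset.ne_of_mem_erase hw) f ?_
  refine poly_ext fun p => ?_
  rw [poly_mul_apply]
  change _ = (0 : ℂ)
  by_cases hp : ∀ w : W, w.1 p = p → w = 1
  · rw [hf p hp, mul_zero]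
  · push Not at hp
    obtain ⟨w, hw, hw1⟩ := hp
    rw [← Finset.mul_prod_erase _ _ (Finset.mem_erase.mpr ⟨hw1, Finset.mem_univ w⟩),
      poly_mul_apply, lin_apply, hl w hw1 p hw, zero_mul, zero_mul]

variable [FiniteDimensional ℂ 𝔥] [Finite W] (c : Param W)

/-- The subalgebra generated by the Dunkl operators. -/
def dunAlg : Subalgebra ℂ (Cher c) := Algebra.adjoin ℂ (Set.range (dun c))

instance dunAlgCommRing : CommRing (dunAlg c) :=
  { (inferInstance : Ring (dunAlg c)) with
    mul_comm := (Algebra.isMulCommutative_adjoin ℂ (s := Set.range (dun c)) (by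
      rintro _ ⟨u, rfl⟩ _ ⟨v, rfl⟩
      exact dun_comm c u v)).is_comm.comm }

variable {ι : Type} (b : Module.Basis ι ℂ 𝔥)

/-- Polynomials in the Dunkl operators of a basis. -/
def dunPoly : MvPolynomial ι ℂ →ₐ[ℂ] Cher c :=
  (dunAlg c).val.comp (MvPolynomial.aeval (S₁ := dunAlg c)
    fun i => ⟨dun c (b i), Algebra.subset_adjoin ⟨_, rfl⟩⟩)

@[simp] lemma dunPoly_X (i : ι) : dunPoly c b (MvPolynomial.X i) = dun c (b i) := by
  simp [dunPoly]

/-- The normal ordered monomial `w D^α`. -/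
def grpDun (k : W × (ι →₀ ℕ)) : Cher c := grp c k.1 * dunPoly c b (MvPolynomial.monomial k.2 1)

/-- The map sending a family of coefficients to the normal ordered sum `∑ f w D^α`. -/
def pbwMap : ((W × (ι →₀ ℕ)) →₀ Poly 𝔥) →ₗ[ℂ] Cher c :=
  Finsupp.lsum ℂ fun k => LinearMap.mulRight ℂ (grpDun c b k) ∘ₗ (mulOp c).toLinearMap

lemma pbwMap_single (k : W × (ι →₀ ℕ)) (f : Poly 𝔥) :
    pbwMap c b (Finsupp.single k f) = mulOp c f * grpDun c b k := by
  simp [pbwMap]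

lemma pbwMap_apply (a : (W × (ι →₀ ℕ)) →₀ Poly 𝔥) :
    pbwMap c b a = ∑ k ∈ a.support, mulOp c (a k) * grpDun c b k := by
  simp [pbwMap, Finsupp.lsum_apply, Finsupp.sum]

lemma dunPoly_leading {p : 𝔥} (hp : ∀ w : W, w.1 p = p → w = 1) (n : ℕ) (w₀ : W)
    (l : Module.Dual ℂ 𝔥) (h : Poly 𝔥) (hh : ∀ w : W, w ≠ w₀ → h ∈ van (w.1 p) (n + 1)) (j : ℕ)
    (hj : j ≤ n) (α : ι →₀ ℕ) (hα : α.degree = j) :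
    (dunPoly c b (MvPolynomial.monomial α 1)).1
        ((lin l - algebraMap ℂ _ (l (w₀.1 p))) ^ n * h) -
      ((n.descFactorial j : ℂ) * MvPolynomial.eval (fun i => l (b i)) (MvPolynomial.monomial α 1)) •
        ((lin l - algebraMap ℂ _ (l (w₀.1 p))) ^ (n - j) * h) ∈ orbVan W p (n - j + 1) := by
  induction j generalizing α with
  | zero =>
    have : α = 0 := (Finsupp.degree_eq_zero_iff α).mp hα
    subst this
    have h1 : dunPoly c b (MvPolynomial.monomial 0 1) = 1 := map_one _
    rw [h1]
    have h2 : (MvPolynomial.monomial 0 1 : MvPolynomial ι ℂ) = 1 := rfl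
    rw [h2, map_one, Nat.descFactorial_zero, Nat.cast_one, one_mul, one_smul, Nat.sub_zero]
    change _ - _ ∈ _
    have h3 : ∀ f : Poly 𝔥, (1 : Cher c).1 f = f := fun _ => rfl
    rw [h3, sub_self]
    exact zero_mem _
  | succ j ih =>
    have hex : ∃ i, α i ≠ 0 := by
      by_contra! h
      have : α = 0 := Finsupp.ext h
      rw [this, map_zero] at hα
      omega
    obtain ⟨i, hi⟩ := hex
    obtain ⟨β, rfl⟩ : ∃ β : ι →₀ ℕ, α = Finsupp.single i 1 + β :=
      ⟨α - Finsupp.single i 1, by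
        rw [add_tsub_cancel_of_le]
        rw [Finsupp.single_le_iff]; omega⟩
    have hβ : β.degree = j := by
      rw [map_add, Finsupp.degree_single] at hα
      omega
    have h1 := ih (by omega) β hβ
    have hnj : n - j = (n - (j + 1)) + 1 := by omega
    rw [hnj] at h1
    have h2 := dunkl_leading c hp n w₀ l h hh (by omega) (b i) h1
    have h3 : MvPolynomial.monomial (Finsupp.single i 1 + β) (1 : ℂ) =
        MvPolynomial.X i * MvPolynomial.monomial β 1 := by
      rw [MvPolynomial.X, MvPolynomial.monomial_mul, one_mul]
    have h4 : dunPoly c b (MvPolynomial.X i * MvPolynomial.monomial β 1) =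
        dun c (b i) * dunPoly c b (MvPolynomial.monomial β 1) := by rw [map_mul, dunPoly_X]
    have h5 : (n.descFactorial (j + 1) : ℂ) * MvPolynomial.eval (fun i => l (b i))
        (MvPolynomial.X i * MvPolynomial.monomial β 1) =
        n.descFactorial j * MvPolynomial.eval (fun i => l (b i)) (MvPolynomial.monomial β 1) *
          ((n - (j + 1) + 1 : ℕ) * l (b i)) := by
      rw [map_mul, MvPolynomial.eval_X, Nat.descFactorial_succ, hnj]
      push_cast
      ring
    rw [h3, h4, h5]
    exact h2

lemma pbw_leading_eq_zero [Fintype ι] (a : (W × (ι →₀ ℕ)) →₀ Poly 𝔥) (ha : pbwMap c b a = 0) (n : ℕ)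
    (hn : ∀ k, a k ≠ 0 → k.2.degree ≤ n) (k : W × (ι →₀ ℕ)) (hk : k.2.degree = n) : a k = 0 := by
  classical
  have : Fintype W := Fintype.ofFinite W
  refine poly_eq_zero_of_generic (W := W) fun p hp => ?_
  obtain ⟨w₁, α₁⟩ := k
  set w₀ : W := w₁⁻¹ with hw₀
  have hsep : ∀ w : W, w ≠ w₀ → ∃ l : Module.Dual ℂ 𝔥, l (w₀.1 p) ≠ l (w.1 p) := by
    intro w hw
    refine exists_dual_ne fun heq => hw ?_
    have : w₀⁻¹ * w = 1 := hp _ (by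
      change w₀.1.symm (w.1 p) = p
      rw [LinearEquiv.symm_apply_eq]; exact heq.symm)
    exact (inv_mul_eq_one.mp this).symm
  choose! l' hl' using hsep
  set h : Poly 𝔥 := ∏ w ∈ Finset.univ.erase w₀,
    (lin (l' w) - algebraMap ℂ _ (l' w (w.1 p))) ^ (n + 1) with hdef
  have hh : ∀ w : W, w ≠ w₀ → h ∈ van (w.1 p) (n + 1) := by
    intro w hw
    rw [hdef, ← Finset.mul_prod_erase _ _ (Finset.mem_erase.mpr ⟨hw, Finset.mem_univ w⟩), mul_comm]
    exact mul_mem_van _ (pow_mem_van (by simp) _)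
  have hprod : ∀ (s : Finset W) (g : W → Poly 𝔥), (∀ w ∈ s, (g w).1 (w₀.1 p) ≠ 0) →
      (∏ w ∈ s, g w).1 (w₀.1 p) ≠ 0 := by
    intro s g
    induction s using Finset.induction_on with
    | empty => intro _; exact one_ne_zero
    | insert w s hw ih =>
      intro hs
      rw [Finset.prod_insert hw, poly_mul_apply]
      exact mul_ne_zero (hs w (Finset.mem_insert_self _ _))
        (ih fun w hw => hs w (Finset.mem_insert_of_mem hw))
  have hpow : ∀ (g : Poly 𝔥) (q : 𝔥) (m : ℕ), (g ^ m).1 q = (g.1 q) ^ m := by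
    intro g q m
    induction m with
    | zero => simp; rfl
    | succ m ih => rw [pow_succ, poly_mul_apply, ih, pow_succ]
  have hh0 : h.1 (w₀.1 p) ≠ 0 := by
    refine hprod _ _ fun w hw => ?_
    rw [hpow]
    refine pow_ne_zero _ ?_
    rw [poly_sub_apply, lin_apply, poly_const_apply, sub_ne_zero]
    exact hl' w (Finset.ne_of_mem_erase hw)
  have hval : ∀ (l : Module.Dual ℂ 𝔥) (k : W × (ι →₀ ℕ)), k.2.degree ≤ n →
      ((grpDun c b k).1 ((lin l - algebraMap ℂ _ (l (w₀.1 p))) ^ n * h)).1 p =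
        if k.1 = w₁ ∧ k.2.degree = n then (n.factorial : ℂ) *
          MvPolynomial.eval (fun i => l (b i)) (MvPolynomial.monomial k.2 1) * h.1 (w₀.1 p)
        else 0 := by
    intro l k hk
    have h1 := dunPoly_leading c b hp n w₀ l h hh _ hk k.2 rfl
    have h2 := ((mem_orbVan.mp h1) k.1⁻¹).1
    rw [poly_sub_apply, sub_eq_zero] at h2
    refine Eq.trans (b := ((dunPoly c b (MvPolynomial.monomial k.2 1)).1
      ((lin l - algebraMap ℂ _ (l (w₀.1 p))) ^ n * h)).1 (k.1⁻¹.1 p)) rfl ?_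
    rw [h2, poly_smul_apply, poly_mul_apply, hpow]
    by_cases hw : k.1 = w₁
    · have hw' : k.1⁻¹ = w₀ := by rw [hw]
      rw [hw']
      by_cases hd : k.2.degree = n
      · rw [if_pos ⟨hw, hd⟩, hd, Nat.sub_self, pow_zero, Nat.descFactorial_self, one_mul]
      · have h3 : n - k.2.degree ≠ 0 := by omega
        rw [if_neg (fun h => hd h.2), poly_sub_apply, lin_apply, poly_const_apply, sub_self,
          zero_pow h3, zero_mul, mul_zero]
    · have hw' : k.1⁻¹ ≠ w₀ := fun h => hw (by rw [← inv_inj, h])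
      rw [if_neg (fun h => hw h.1), (hh _ hw').1, mul_zero, mul_zero]
  let P : MvPolynomial ι ℂ := ∑ k ∈ a.support.filter (fun k => k.1 = w₁ ∧ k.2.degree = n),
    MvPolynomial.monomial k.2 ((a k).1 p)
  have hP : P = 0 := by
    refine MvPolynomial.funext fun t => ?_
    let l : Module.Dual ℂ 𝔥 := b.constr ℂ t
    have hl : (fun i => l (b i)) = t := funext fun i => b.constr_basis ℂ t i
    have h1 : ((pbwMap c b a).1 ((lin l - algebraMap ℂ _ (l (w₀.1 p))) ^ n * h)).1 p = 0 := by
      rw [ha]; rfl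
    rw [pbwMap_apply, cher_sum_apply, poly_sum_apply] at h1
    have h2 : ∀ k ∈ a.support, ((mulOp c (a k) * grpDun c b k).1
        ((lin l - algebraMap ℂ _ (l (w₀.1 p))) ^ n * h)).1 p =
        if k.1 = w₁ ∧ k.2.degree = n then (n.factorial * h.1 (w₀.1 p)) *
          MvPolynomial.eval t (MvPolynomial.monomial k.2 ((a k).1 p)) else 0 := by
      intro k hk
      refine Eq.trans (b := (a k).1 p * ((grpDun c b k).1
        ((lin l - algebraMap ℂ _ (l (w₀.1 p))) ^ n * h)).1 p) rfl ?_
      rw [hval l k (hn k (Finsupp.mem_support_iff.mp hk)), hl]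
      split_ifs
      · rw [MvPolynomial.eval_monomial, MvPolynomial.eval_monomial]; ring
      · rw [mul_zero]
    replace h1 := (Finset.sum_congr (rfl : a.support = a.support) h2).symm.trans h1
    rw [← Finset.sum_filter, ← Finset.mul_sum, ← map_sum] at h1
    rw [map_zero]
    refine (mul_eq_zero.mp h1).resolve_left (mul_ne_zero ?_ hh0)
    exact_mod_cast Nat.factorial_ne_zero n
  have h1 := congrArg (MvPolynomial.coeff α₁) hP
  rw [MvPolynomial.coeff_sum, MvPolynomial.coeff_zero] at h1
  by_cases hmem : a (w₁, α₁) = 0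
  · rw [hmem]; rfl
  · rw [Finset.sum_eq_single (w₁, α₁)] at h1
    · simpa [MvPolynomial.coeff_monomial] using h1
    · rintro ⟨w, α⟩ hmem' hne
      rw [MvPolynomial.coeff_monomial, if_neg]
      intro hα
      have h3 : w = w₁ := (Finset.mem_filter.mp hmem').2.1
      exact hne (Prod.ext h3 hα)
    · intro hnot
      exact absurd (Finset.mem_filter.mpr ⟨Finsupp.mem_support_iff.mpr hmem, rfl, hk⟩) hnot

lemma pbwMap_injective [Fintype ι] : Function.Injective (pbwMap c b) := by
  rw [injective_iff_map_eq_zero]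
  intro a ha
  by_contra hne
  obtain ⟨k, hk, hmax⟩ := Finset.exists_max_image a.support (fun k => k.2.degree)
    (Finsupp.support_nonempty_iff.mpr hne)
  exact Finsupp.mem_support_iff.mp hk (pbw_leading_eq_zero c b a ha k.2.degree
    (fun k' hk' => hmax k' (Finsupp.mem_support_iff.mpr hk')) k rfl)

lemma pbwMap_surjective [Fintype ι] : Function.Surjective (pbwMap c b) := by
  have hgen : ∀ (f : Poly 𝔥) (w : W) (P : MvPolynomial ι ℂ),
      mulOp c f * (grp c w * dunPoly c b P) ∈ LinearMap.range (pbwMap c b) := by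
    intro f w P
    induction P using MvPolynomial.induction_on' with
    | monomial α z =>
      refine ⟨Finsupp.single (w, α) (z • f), ?_⟩
      have : (MvPolynomial.monomial α z : MvPolynomial ι ℂ) = z • MvPolynomial.monomial α 1 := by
        rw [MvPolynomial.smul_monomial, smul_eq_mul, mul_one]
      rw [pbwMap_single, this, map_smul, map_smul, mul_smul_comm, mul_smul_comm, smul_mul_assoc]
      rfl
    | add p q hp hq =>
      rw [map_add, mul_add, mul_add]
      exact add_mem hp hq
  have hred : ∀ a : Cher c, (∀ k f, a * (mulOp c f * grpDun c b k) ∈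
      LinearMap.range (pbwMap c b)) → ∀ t ∈ LinearMap.range (pbwMap c b),
      a * t ∈ LinearMap.range (pbwMap c b) := by
    rintro a ha _ ⟨t, rfl⟩
    rw [pbwMap_apply, Finset.mul_sum]
    exact sum_mem fun k _ => ha k _
  have key : ∀ a : Cher c, ∀ t ∈ LinearMap.range (pbwMap c b),
      a * t ∈ LinearMap.range (pbwMap c b) := by
    intro a
    induction a using cherednik_induction with
    | hgrp w =>
      refine hred _ fun k f => ?_
      rw [grpDun, ← mul_assoc, grp_mul_mulOp, mul_assoc, ← mul_assoc (grp c w), ← map_mul]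
      exact hgen _ _ _
    | hmulOp g =>
      refine hred _ fun k f => ?_
      rw [← mul_assoc, ← map_mul]
      exact hgen _ _ _
    | hdun v =>
      refine hred _ fun k f => ?_
      have h1 : ∀ v : 𝔥, dun c v = dunPoly c b (∑ i, b.repr v i • MvPolynomial.X i) := fun v => by
        rw [dun_eq_sum b v, map_sum]
        simp only [map_smul, dunPoly_X]
      have h2 : dun c v * grp c k.1 = grp c k.1 * dun c (k.1.1.symm v) := by
        rw [grp_mul_dun, LinearEquiv.apply_symm_apply]
      rw [← mul_assoc, dun_mul_mulOp, sub_mul, add_mul, Finset.sum_mul]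
      refine sub_mem (add_mem ?_ (hgen _ _ _)) (sum_mem fun r _ => ?_)
      · rw [grpDun, mul_assoc, ← mul_assoc (dun c v), h2, mul_assoc (grp c _), h1, ← map_mul]
        exact hgen _ _ _
      · rw [smul_mul_assoc, grpDun, mul_assoc, ← mul_assoc (grp c r.1), ← map_mul]
        exact Submodule.smul_mem _ _ (hgen _ _ _)
    | hadd x y hx hy =>
      intro t ht
      rw [add_mul]
      exact add_mem (hx t ht) (hy t ht)
    | hmul x y hx hy =>
      intro t ht
      rw [mul_assoc]
      exact hx _ (hy t ht)
  intro a
  have h1 : (1 : Cher c) ∈ LinearMap.range (pbwMap c b) := by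
    have := hgen 1 1 1
    simpa using this
  have := key a 1 h1
  rwa [mul_one] at this

/-- The Poincaré–Birkhoff–Witt theorem: every element of `H_c` is in a unique way a normal ordered
sum `∑ f w D^α`. -/
def pbwEquiv [Fintype ι] : ((W × (ι →₀ ℕ)) →₀ Poly 𝔥) ≃ₗ[ℂ] Cher c :=
  LinearEquiv.ofBijective (pbwMap c b) ⟨pbwMap_injective c b, pbwMap_surjective c b⟩

lemma pbwEquiv_single [Fintype ι] (k : W × (ι →₀ ℕ)) (f : Poly 𝔥) :
    pbwEquiv c b (Finsupp.single k f) = mulOp c f * grpDun c b k :=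
  pbwMap_single c b k f

end PBW

section Category

variable {𝔥 : Type u} [AddCommGroup 𝔥] [Module ℂ 𝔥] [FiniteDimensional ℂ 𝔥]
  {W : Subgroup (𝔥 ≃ₗ[ℂ] 𝔥)} [Finite W] {c : Param W}

instance : Limits.PreservesFiniteLimits (objO c).ι := by
  have : ∀ {X Y : CatO c} (f : X ⟶ Y), Limits.PreservesLimit (Limits.parallelPair f 0) (objO c).ι :=
    fun {X Y} f => (objO c).preservesKernels_ι (Y := Y) f
  exact Functor.preservesFiniteLimits_of_preservesKernels _

instance : Limits.PreservesFiniteColimits (objO c).ι := by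
  have : ∀ {X Y : CatO c} (f : X ⟶ Y),
      Limits.PreservesColimit (Limits.parallelPair f 0) (objO c).ι :=
    fun {X Y} f => (objO c).preservesCokernels_ι (Y := Y) f
  exact Functor.preservesFiniteColimits_of_preservesCokernels _

instance : (objO c).ι.PreservesHomology := Functor.preservesHomologyOfExact _

/-- The homomorphism of modules underlying a morphism of `O_c`. -/
abbrev homO {X Y : CatO c} (f : X ⟶ Y) : X.obj →ₗ[Cher c] Y.obj := f.hom.hom

lemma epi_catO_iff {X Y : CatO c} (f : X ⟶ Y) : Epi f ↔ Function.Surjective (homO f) := by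
  refine Iff.trans ?_ (ModuleCat.epi_iff_surjective f.hom)
  exact ((objO c).ι.epi_map_iff_epi f).symm

lemma mono_catO_iff {X Y : CatO c} (f : X ⟶ Y) : Mono f ↔ Function.Injective (homO f) := by
  refine Iff.trans ?_ (ModuleCat.mono_iff_injective f.hom)
  exact ((objO c).ι.mono_map_iff_mono f).symm

lemma exact_catO_iff (S : ShortComplex (CatO c)) :
    S.Exact ↔ ∀ x, homO S.g x = 0 → ∃ y, homO S.f y = x := by
  refine Iff.trans (S.exact_map_iff_of_faithful (objO c).ι).symm ?_
  exact ShortComplex.moduleCat_exact_iff _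

/-- The morphism of `O_c` given by a homomorphism of modules. -/
def ofHomO {X Y : CatO c} (f : X.obj →ₗ[Cher c] Y.obj) : X ⟶ Y := (objO c).homMk (ModuleCat.ofHom f)

@[simp] lemma homO_ofHomO {X Y : CatO c} (f : X.obj →ₗ[Cher c] Y.obj) : homO (ofHomO f) = f := rfl

lemma homO_ext {X Y : CatO c} {f g : X ⟶ Y} (h : ∀ x, homO f x = homO g x) : f = g :=
  InducedCategory.hom_ext (ModuleCat.hom_ext (LinearMap.ext h))

lemma CatO.locNilp (X : CatO c) : LocNilp X.obj := LocNilp.of_objO X.property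

end Category

section Projectives

variable {𝔥 : Type u} [AddCommGroup 𝔥] [Module ℂ 𝔥] [FiniteDimensional ℂ 𝔥]
  {W : Subgroup (𝔥 ≃ₗ[ℂ] 𝔥)} [Finite W] (c : Param W)

/-- The left ideal generated by the products of at least `n` Dunkl operators. -/
def dunIdeal (n : ℕ) : Submodule (Cher c) (Cher c) :=
  Submodule.span (Cher c) {a | ∃ α : Fin (Module.finrank ℂ 𝔥) →₀ ℕ, n ≤ α.degree ∧
    a = dunPoly c (Module.finBasis ℂ 𝔥) (MvPolynomial.monomial α 1)}

/-- The quotient of `H_c` by the left ideal generated by the products of `n` Dunkl operators. -/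
abbrev cyc (n : ℕ) : ModuleCat.{u} (Cher c) := ModuleCat.of (Cher c) (Cher c ⧸ dunIdeal c n)

/-- The canonical generator. -/
def cycGen (n : ℕ) : cyc c n := (dunIdeal c n).mkQ 1

variable {c}

lemma dunPoly_smul_nilp {ι : Type} (b : Module.Basis ι ℂ 𝔥) {M : ModuleCat.{u} (Cher c)}
    (α : ι →₀ ℕ) : ∀ (k : ℕ) (m : M), m ∈ nilp c M k →
      dunPoly c b (MvPolynomial.monomial α 1) • m ∈ nilp c M (k - α.degree) := by
  induction α using Finsupp.induction_linear with
  | zero =>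
    intro k m hm
    have : (MvPolynomial.monomial 0 1 : MvPolynomial ι ℂ) = 1 := rfl
    rw [this, map_one, one_smul]
    simpa using hm
  | add α β hα hβ =>
    intro k m hm
    have h1 : MvPolynomial.monomial (α + β) (1 : ℂ) =
        MvPolynomial.monomial α 1 * MvPolynomial.monomial β 1 := by
      rw [MvPolynomial.monomial_mul, one_mul]
    rw [h1, map_mul, mul_smul, map_add, add_comm, ← Nat.sub_sub]
    exact hα _ _ (hβ _ _ hm)
  | single i j =>
    induction j with
    | zero =>
      intro k m hm
      have : (MvPolynomial.monomial (Finsupp.single i 0) 1 : MvPolynomial ι ℂ) = 1 := by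
        rw [Finsupp.single_zero]; rfl
      rw [this, map_one, one_smul]
      simpa using hm
    | succ j ih =>
      intro k m hm
      have h1 : MvPolynomial.monomial (Finsupp.single i (j + 1)) (1 : ℂ) =
          MvPolynomial.X i * MvPolynomial.monomial (Finsupp.single i j) 1 := by
        rw [MvPolynomial.X, MvPolynomial.monomial_mul, one_mul, ← Finsupp.single_add, add_comm]
      have h2 := ih k m hm
      rw [Finsupp.degree_single] at h2 ⊢
      rw [h1, map_mul, dunPoly_X, mul_smul]
      rcases Nat.lt_or_ge j k with hjk | hjk
      · rw [show k - j = (k - (j + 1)) + 1 by omega] at h2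
        exact mem_nilp_succ.mp h2 _
      · rw [show k - j = 0 by omega] at h2
        have h3 : dunPoly c b (MvPolynomial.monomial (Finsupp.single i j) 1) • m = 0 := h2
        rw [h3, smul_zero]
        exact zero_mem _

lemma dunIdeal_smul {n : ℕ} {M : ModuleCat.{u} (Cher c)} {m : M} (hm : m ∈ nilp c M n)
    {a : Cher c} (ha : a ∈ dunIdeal c n) : a • m = 0 := by
  have h : dunIdeal c n ≤ LinearMap.ker (LinearMap.toSpanSingleton (Cher c) M m) := by
    refine Submodule.span_le.mpr ?_
    rintro _ ⟨α, hα, rfl⟩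
    have := dunPoly_smul_nilp (Module.finBasis ℂ 𝔥) α n m hm
    rw [Nat.sub_eq_zero_of_le hα] at this
    exact this
  exact h ha

lemma mem_nilp_of_dunPoly {ι : Type} [Fintype ι] (b : Module.Basis ι ℂ 𝔥)
    {M : ModuleCat.{u} (Cher c)} : ∀ (n : ℕ) (m : M), (∀ α : ι →₀ ℕ, n ≤ α.degree →
      dunPoly c b (MvPolynomial.monomial α 1) • m = 0) → m ∈ nilp c M n := by
  intro n
  induction n with
  | zero =>
    intro m hm
    have h := hm 0 (Nat.zero_le _)
    have : (MvPolynomial.monomial 0 1 : MvPolynomial ι ℂ) = 1 := rfl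
    rw [this, map_one, one_smul] at h
    exact h
  | succ n ih =>
    intro m hm
    have key : ∀ i, dun c (b i) • m ∈ nilp c M n := by
      refine fun i => ih _ fun α hα => ?_
      have h1 : MvPolynomial.monomial (α + Finsupp.single i 1) (1 : ℂ) =
          MvPolynomial.monomial α 1 * MvPolynomial.X i := by
        rw [MvPolynomial.X, MvPolynomial.monomial_mul, one_mul]
      have h2 := hm (α + Finsupp.single i 1) (by rw [map_add, Finsupp.degree_single]; omega)
      rwa [h1, map_mul, dunPoly_X, mul_smul] at h2
    rw [mem_nilp_succ]
    intro v
    rw [dun_eq_sum b v, Finset.sum_smul]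
    refine sum_mem fun i _ => ?_
    rw [smul_assoc]
    exact Submodule.smul_mem _ _ (key i)

variable (c)

lemma cycGen_mem (n : ℕ) : cycGen c n ∈ nilp c (cyc c n) n := by
  refine mem_nilp_of_dunPoly (Module.finBasis ℂ 𝔥) n _ fun α hα => ?_
  rw [cycGen, ← map_smul, smul_eq_mul, mul_one, Submodule.mkQ_apply,
    Submodule.Quotient.mk_eq_zero]
  exact Submodule.subset_span ⟨α, hα, rfl⟩

variable {c}

/-- The homomorphism out of the cyclic module that is determined by the image of the generator. -/
def cycLift {n : ℕ} {M : ModuleCat.{u} (Cher c)} (m : M) (hm : m ∈ nilp c M n) :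
    cyc c n →ₗ[Cher c] M :=
  (dunIdeal c n).liftQ (LinearMap.toSpanSingleton (Cher c) M m) fun _ ha => dunIdeal_smul hm ha

lemma cycLift_gen {n : ℕ} {M : ModuleCat.{u} (Cher c)} (m : M) (hm : m ∈ nilp c M n) :
    cycLift m hm (cycGen c n) = m :=
  ((dunIdeal c n).liftQ_apply _ _).trans (one_smul _ m)

lemma cyc_hom_ext {n : ℕ} {M : ModuleCat.{u} (Cher c)} {f g : cyc c n →ₗ[Cher c] M}
    (h : f (cycGen c n) = g (cycGen c n)) : f = g := by
  refine Submodule.linearMap_qext _ (LinearMap.ext_ring ?_)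
  exact h

variable (c)

lemma objO_cyc (n : ℕ) : objO c (cyc c n) := by
  refine ⟨inferInstanceAs (Module.Finite (Cher c) (Cher c ⧸ dunIdeal c n)), fun v m => ?_⟩
  have h : ∃ k, m ∈ nilp c (cyc c n) k := by
    obtain ⟨a, rfl⟩ := (dunIdeal c n).mkQ_surjective m
    have : (dunIdeal c n).mkQ a = a • cycGen c n := by
      rw [cycGen, ← map_smul, smul_eq_mul, mul_one]
    rw [this]
    exact smul_nilp a _ ⟨n, cycGen_mem c n⟩
  obtain ⟨k, hk⟩ := h
  exact ⟨k, pow_smul_nilp v hk⟩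

/-- An order of nilpotency of the weight spaces of weight `d`. -/
def nilpOrd (d : ℂ) : ℕ := (exists_wt_le_nilp c d).choose

lemma wt_le_nilp (d : ℂ) {M : ModuleCat.{u} (Cher c)} (hM : LocNilp M) :
    wt c M d ≤ nilp c M (nilpOrd c d) :=
  (exists_wt_le_nilp c d).choose_spec M hM

lemma locNilp_cyc (n : ℕ) : LocNilp (cyc c n) := LocNilp.of_objO (objO_cyc c n)

/-- The component of weight `d` of the generator. -/
def projElt (d : ℂ) : cyc c (nilpOrd c d) := (locNilp_cyc c _).pr d (cycGen c _)

lemma projElt_mem (d : ℂ) : projElt c d ∈ wt c (cyc c (nilpOrd c d)) d := LocNilp.pr_mem _ _ _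

/-- The idempotent endomorphism whose image represents the functor `M ↦ M_d`. -/
def projIdem (d : ℂ) : cyc c (nilpOrd c d) →ₗ[Cher c] cyc c (nilpOrd c d) :=
  cycLift (projElt c d) (wt_le_nilp c d (locNilp_cyc c _) (projElt_mem c d))

lemma projIdem_gen (d : ℂ) : projIdem c d (cycGen c _) = projElt c d := cycLift_gen _ _

lemma projIdem_projElt (d : ℂ) : projIdem c d (projElt c d) = projElt c d := by
  conv_lhs => rw [projElt]
  rw [← LocNilp.pr_map (locNilp_cyc c _) (locNilp_cyc c _), projIdem_gen]
  exact LocNilp.pr_of_mem _ (projElt_mem c d)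

/-- The module representing the functor `M ↦ M_d`. -/
abbrev projMod (d : ℂ) : ModuleCat.{u} (Cher c) :=
  ModuleCat.of (Cher c) (LinearMap.range (projIdem c d))

lemma objO_projMod (d : ℂ) : objO c (projMod c d) := by
  have h := objO_cyc c (nilpOrd c d)
  have := ((ModuleCat.mono_iff_injective (ModuleCat.ofHom (X := projMod c d)
    (LinearMap.range (projIdem c d)).subtype)).mpr (Submodule.injective_subtype _))
  exact (objO c).prop_of_mono (ModuleCat.ofHom (X := projMod c d)
    (LinearMap.range (projIdem c d)).subtype) h

/-- The universal vector of weight `d`. -/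
def projGen (d : ℂ) : projMod c d := ⟨projElt c d, cycGen c _, projIdem_gen c d⟩

lemma projGen_mem (d : ℂ) : projGen c d ∈ wt c (projMod c d) d := by
  have h := wt_map (M := cyc c (nilpOrd c d)) (N := projMod c d)
    (projIdem c d).rangeRestrict d (projElt_mem c d)
  have h2 : (projIdem c d).rangeRestrict (projElt c d) = projGen c d :=
    Subtype.ext (projIdem_projElt c d)
  rwa [h2] at h

variable {c}

/-- The homomorphism out of `P_d` that is determined by the image of the universal vector. -/
def projLift {d : ℂ} {M : ModuleCat.{u} (Cher c)} (hM : LocNilp M) (m : M) (hm : m ∈ wt c M d) :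
    projMod c d →ₗ[Cher c] M :=
  cycLift m (wt_le_nilp c d hM hm) ∘ₗ (LinearMap.range (projIdem c d)).subtype

lemma projLift_gen {d : ℂ} {M : ModuleCat.{u} (Cher c)} (hM : LocNilp M) (m : M)
    (hm : m ∈ wt c M d) : projLift hM m hm (projGen c d) = m := by
  change cycLift m (wt_le_nilp c d hM hm) (projElt c d) = m
  rw [projElt, ← LocNilp.pr_map (locNilp_cyc c _) hM, cycLift_gen]
  exact LocNilp.pr_of_mem _ hm

lemma proj_hom_ext {d : ℂ} {M : ModuleCat.{u} (Cher c)} {f g : projMod c d →ₗ[Cher c] M}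
    (h : f (projGen c d) = g (projGen c d)) : f = g := by
  have h1 : f ∘ₗ (projIdem c d).rangeRestrict = g ∘ₗ (projIdem c d).rangeRestrict := by
    refine cyc_hom_ext (M := M) ?_
    have : (projIdem c d).rangeRestrict (cycGen c _) = projGen c d := Subtype.ext (projIdem_gen c d)
    rw [LinearMap.comp_apply, LinearMap.comp_apply, this, h]
  refine LinearMap.ext fun x => ?_
  obtain ⟨y, hy⟩ := (projIdem c d).surjective_rangeRestrict x
  rw [← hy]
  exact LinearMap.congr_fun h1 y

/-- The direct sum of the modules `P_d` for a finite family of weights. -/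
abbrev projSum {k : ℕ} (d : Fin k → ℂ) : ModuleCat.{u} (Cher c) :=
  ModuleCat.of (Cher c) (∀ j, projMod c (d j))

lemma objO_projSum {k : ℕ} (d : Fin k → ℂ) : objO c (projSum (c := c) d) := by
  have hfin := fun j => (objO_projMod c (d j)).1
  refine ⟨inferInstanceAs (Module.Finite (Cher c) (∀ j, projMod c (d j))), fun v m => ?_⟩
  choose N hN using fun j => (objO_projMod c (d j)).2 v (m j)
  refine ⟨Finset.univ.sup N, funext fun j => ?_⟩
  obtain ⟨k, hk⟩ := Nat.exists_eq_add_of_le (Finset.le_sup (f := N) (Finset.mem_univ j))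
  change (dun c v ^ Finset.univ.sup N) • m j = 0
  rw [hk, add_comm, pow_add, mul_smul, hN, smul_zero]

/-- The direct sum of the modules `P_d` for a finite family of weights, as an object of `O_c`. -/
def projObj {k : ℕ} (d : Fin k → ℂ) : CatO c := ⟨projSum d, objO_projSum d⟩

/-- The homomorphism out of a direct sum of modules `P_d` given by a family of weight vectors. -/
def projSumLift {k : ℕ} {d : Fin k → ℂ} {M : ModuleCat.{u} (Cher c)} (hM : LocNilp M) (m : Fin k → M)
    (hm : ∀ j, m j ∈ wt c M (d j)) : projSum (c := c) d →ₗ[Cher c] M :=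
  LinearMap.lsum (Cher c) (fun j => projMod c (d j)) ℕ fun j => projLift hM (m j) (hm j)

lemma projSumLift_single {k : ℕ} {d : Fin k → ℂ} {M : ModuleCat.{u} (Cher c)} (hM : LocNilp M)
    (m : Fin k → M) (hm : ∀ j, m j ∈ wt c M (d j)) (j : Fin k) :
    projSumLift hM m hm (Pi.single j (projGen c (d j)) : ∀ j, projMod c (d j)) = m j := by
  rw [projSumLift, LinearMap.lsum_piSingle, projLift_gen]

lemma projSum_hom_ext {k : ℕ} {d : Fin k → ℂ} {M : ModuleCat.{u} (Cher c)}
    {f g : projSum (c := c) d →ₗ[Cher c] M}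
    (h : ∀ j, f (Pi.single j (projGen c (d j)) : ∀ j, projMod c (d j)) =
      g (Pi.single j (projGen c (d j)) : ∀ j, projMod c (d j))) : f = g :=
  LinearMap.pi_ext' fun j => proj_hom_ext (M := M) (h j)

instance projective_projObj {k : ℕ} (d : Fin k → ℂ) : Projective (projObj (c := c) d) where
  factors {E X} f e he := by
    have hs := (epi_catO_iff e).mp he
    have hwt : ∀ j, ∃ m ∈ wt c E.obj (d j), homO e m =
        homO f (Pi.single j (projGen c (d j)) : ∀ j, projMod c (d j)) := by
      intro j
      refine E.locNilp.wt_surjective X.locNilp hs ?_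
      refine wt_map (M := projSum d) (homO f) (d j) ?_
      exact wt_map (M := projMod c (d j)) (N := projSum d)
        (LinearMap.single (Cher c) (fun j => projMod c (d j)) j) (d j) (projGen_mem c (d j))
    choose m hm hme using hwt
    refine ⟨ofHomO (X := projObj d) (projSumLift E.locNilp m hm), homO_ext fun x => ?_⟩
    have : homO e ∘ₗ projSumLift E.locNilp m hm = homO f := by
      refine projSum_hom_ext (M := X.obj) fun j => ?_
      rw [LinearMap.comp_apply, projSumLift_single, hme]
      rfl
    exact LinearMap.congr_fun this x

lemma exists_epi_projObj (X : CatO c) :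
    ∃ (k : ℕ) (d : Fin k → ℂ) (f : projObj (c := c) d ⟶ X), Epi f := by
  have hfin := X.property.1
  obtain ⟨S, hS⟩ := Module.Finite.fg_top (R := Cher c) (M := X.obj)
  obtain ⟨T, hT, hT'⟩ : ∃ T : Finset X.obj, (∀ n ∈ T, ∃ d, n ∈ wt c X.obj d) ∧
      Submodule.span (Cher c) (T : Set X.obj) = ⊤ := by
    classical
    choose D hD using fun m => X.locNilp.exists_sum_pr m
    refine ⟨S.biUnion fun s => (D s).image fun d => X.locNilp.pr d s, ?_, ?_⟩
    · intro n hn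
      obtain ⟨s, hs, hn⟩ := Finset.mem_biUnion.mp hn
      obtain ⟨d, hd, rfl⟩ := Finset.mem_image.mp hn
      exact ⟨d, X.locNilp.pr_mem _ _⟩
    · rw [eq_top_iff, ← hS, Submodule.span_le]
      intro s hs
      rw [SetLike.mem_coe, ← (hD s).2 (D s) subset_rfl]
      refine sum_mem fun d hd => Submodule.subset_span ?_
      exact Finset.mem_biUnion.mpr ⟨s, hs, Finset.mem_image.mpr ⟨d, hd, rfl⟩⟩
  let e := T.equivFin
  choose d hd using fun j => hT (e.symm j).1 (e.symm j).2
  refine ⟨T.card, d, ofHomO (X := projObj d) (projSumLift X.locNilp (fun j => (e.symm j).1) hd),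
    (epi_catO_iff _).mpr ?_⟩
  change Function.Surjective (projSumLift X.locNilp (fun j => (e.symm j).1) hd)
  rw [← LinearMap.range_eq_top, eq_top_iff, ← hT', Submodule.span_le]
  intro n hn
  refine ⟨(Pi.single (e ⟨n, hn⟩) (projGen c (d (e ⟨n, hn⟩))) : ∀ j, projMod c (d j)), ?_⟩
  rw [projSumLift_single, Equiv.symm_apply_apply]

instance enoughProjectives_catO : EnoughProjectives (CatO c) where
  presentation X := by
    obtain ⟨k, d, f, hf⟩ := exists_epi_projObj X
    exact ⟨{ p := projObj d, f := f }⟩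

end Projectives

section Exterior

variable {𝔥 : Type u} [AddCommGroup 𝔥] [Module ℂ 𝔥]

instance : Semiring (ExteriorAlgebra ℂ (Module.Dual ℂ 𝔥)) := inferInstance

instance : AddCommMonoid (ExteriorAlgebra ℂ (Module.Dual ℂ 𝔥)) := inferInstance

instance : AddCommGroup (ExteriorAlgebra ℂ (Module.Dual ℂ 𝔥)) := inferInstance

instance : Module ℂ (ExteriorAlgebra ℂ (Module.Dual ℂ 𝔥)) := inferInstance

instance : AddCommMonoid (Poly 𝔥) := inferInstance

instance {V : Type*} [AddCommGroup V] [Module ℂ V] :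
    AddCommMonoid (V ⊗[ℂ] ExteriorAlgebra ℂ (Module.Dual ℂ 𝔥)) := inferInstance

instance {V : Type*} [AddCommGroup V] [Module ℂ V] :
    AddCommGroup (V ⊗[ℂ] ExteriorAlgebra ℂ (Module.Dual ℂ 𝔥)) := inferInstance

/-- Left multiplication by a linear form on the exterior algebra. -/
def wedge : Module.Dual ℂ 𝔥 →ₗ[ℂ] Module.End ℂ (ExteriorAlgebra ℂ (Module.Dual ℂ 𝔥)) :=
  LinearMap.mul ℂ _ ∘ₗ ExteriorAlgebra.ι ℂ

@[simp] lemma wedge_apply (x : Module.Dual ℂ 𝔥) (ω : ExteriorAlgebra ℂ (Module.Dual ℂ 𝔥)) :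
    wedge x ω = ExteriorAlgebra.ι ℂ x * ω := rfl

lemma wedge_mem (x : Module.Dual ℂ 𝔥) {i : ℕ} {ω : ExteriorAlgebra ℂ (Module.Dual ℂ 𝔥)}
    (hω : ω ∈ ⋀[ℂ]^i (Module.Dual ℂ 𝔥)) : wedge x ω ∈ ⋀[ℂ]^(i + 1) (Module.Dual ℂ 𝔥) := by
  change _ ∈ LinearMap.range (ExteriorAlgebra.ι ℂ) ^ (i + 1)
  rw [pow_succ']
  exact Submodule.mul_mem_mul ⟨x, rfl⟩ hω

lemma exteriorPower_induction {i : ℕ} {p : ExteriorAlgebra ℂ (Module.Dual ℂ 𝔥) → Prop}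
    (hadd : ∀ a b, p a → p b → p (a + b))
    (hmul : ∀ x, ∀ ω ∈ ⋀[ℂ]^i (Module.Dual ℂ 𝔥), p (ExteriorAlgebra.ι ℂ x * ω))
    {ω : ExteriorAlgebra ℂ (Module.Dual ℂ 𝔥)} (hω : ω ∈ ⋀[ℂ]^(i + 1) (Module.Dual ℂ 𝔥)) : p ω := by
  change ω ∈ LinearMap.range (ExteriorAlgebra.ι ℂ) ^ (i + 1) at hω
  rw [pow_succ'] at hω
  refine Submodule.mul_induction_on hω ?_ hadd
  rintro _ ⟨x, rfl⟩ ω hω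
  exact hmul x ω hω

lemma contr_mem_zero (y : 𝔥) {ω : ExteriorAlgebra ℂ (Module.Dual ℂ 𝔥)}
    (hω : ω ∈ ⋀[ℂ]^0 (Module.Dual ℂ 𝔥)) : contr y ω = 0 := by
  change ω ∈ LinearMap.range (ExteriorAlgebra.ι ℂ) ^ 0 at hω
  rw [pow_zero] at hω
  obtain ⟨a, rfl⟩ := Submodule.mem_one.mp hω
  exact contr_algebraMap y a

lemma contr_mem (y : 𝔥) {i : ℕ} {ω : ExteriorAlgebra ℂ (Module.Dual ℂ 𝔥)}
    (hω : ω ∈ ⋀[ℂ]^(i + 1) (Module.Dual ℂ 𝔥)) : contr y ω ∈ ⋀[ℂ]^i (Module.Dual ℂ 𝔥) := by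
  induction i generalizing ω with
  | zero =>
    refine exteriorPower_induction (p := fun ω => contr y ω ∈ ⋀[ℂ]^0 (Module.Dual ℂ 𝔥))
      (fun a b ha hb => by rw [map_add]; exact add_mem ha hb) (fun x ω hω => ?_) hω
    rw [contr_ι_mul, contr_mem_zero y hω, mul_zero, sub_zero]
    exact Submodule.smul_mem _ _ hω
  | succ i ih =>
    refine exteriorPower_induction (p := fun ω => contr y ω ∈ ⋀[ℂ]^(i + 1) (Module.Dual ℂ 𝔥))
      (fun a b ha hb => by rw [map_add]; exact add_mem ha hb) (fun x ω hω => ?_) hω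
    rw [contr_ι_mul]
    exact sub_mem (Submodule.smul_mem _ _ hω) (wedge_mem x (ih hω))

lemma wedge_wedge (x z : Module.Dual ℂ 𝔥) (ω : ExteriorAlgebra ℂ (Module.Dual ℂ 𝔥)) :
    ExteriorAlgebra.ι ℂ x * (ExteriorAlgebra.ι ℂ z * ω) =
      -(ExteriorAlgebra.ι ℂ z * (ExteriorAlgebra.ι ℂ x * ω)) := by
  have h := ExteriorAlgebra.ι_add_mul_swap (R := ℂ) x z
  rw [← mul_assoc, ← mul_assoc, eq_neg_iff_add_eq_zero, ← add_mul, h, zero_mul]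

variable [FiniteDimensional ℂ 𝔥]

/-- The operator `∑ x_i ∧ y_i` on the exterior algebra, for dual bases `y_i` and `x_i`. -/
def degOp : Module.End ℂ (ExteriorAlgebra ℂ (Module.Dual ℂ 𝔥)) :=
  ∑ i, wedge ((Module.finBasis ℂ 𝔥).coord i) * contr (Module.finBasis ℂ 𝔥 i)

lemma degOp_apply (ω : ExteriorAlgebra ℂ (Module.Dual ℂ 𝔥)) :
    degOp ω = ∑ i, ExteriorAlgebra.ι ℂ ((Module.finBasis ℂ 𝔥).coord i) *
      contr (Module.finBasis ℂ 𝔥 i) ω := by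
  simp [degOp, LinearMap.sum_apply]

lemma dual_eq_sum {ι : Type*} [Fintype ι] (b : Module.Basis ι ℂ 𝔥) (x : Module.Dual ℂ 𝔥) :
    x = ∑ i, x (b i) • b.coord i := by
  refine b.ext fun k => ?_
  classical
  simp

lemma degOp_of_mem {i : ℕ} {ω : ExteriorAlgebra ℂ (Module.Dual ℂ 𝔥)}
    (hω : ω ∈ ⋀[ℂ]^i (Module.Dual ℂ 𝔥)) : degOp ω = (i : ℂ) • ω := by
  induction i generalizing ω with
  | zero =>
    rw [degOp_apply, Nat.cast_zero, zero_smul]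
    exact Finset.sum_eq_zero fun i _ => by rw [contr_mem_zero _ hω, mul_zero]
  | succ i ih =>
    refine exteriorPower_induction (p := fun ω => degOp ω = ((i + 1 : ℕ) : ℂ) • ω)
      (fun a b ha hb => by rw [map_add, ha, hb, smul_add]) (fun x ω hω => ?_) hω
    have h1 := ih hω
    rw [degOp_apply] at h1 ⊢
    simp only [contr_ι_mul, mul_sub, wedge_wedge _ x, sub_neg_eq_add, Finset.sum_add_distrib,
      ← Finset.mul_sum, h1, mul_smul_comm]
    have h2 : ∑ j, x (Module.finBasis ℂ 𝔥 j) •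
        (ExteriorAlgebra.ι ℂ ((Module.finBasis ℂ 𝔥).coord j) * ω) = ExteriorAlgebra.ι ℂ x * ω := by
      conv_rhs => rw [dual_eq_sum (Module.finBasis ℂ 𝔥) x]
      simp only [map_sum, map_smul, Finset.sum_mul, smul_mul_assoc]
    rw [h2]
    push_cast
    rw [add_smul, one_smul, add_comm]

variable {W : Subgroup (𝔥 ≃ₗ[ℂ] 𝔥)} [Finite W]

lemma extRep_refl (r : Refl W) (ω : ExteriorAlgebra ℂ (Module.Dual ℂ 𝔥)) :
    extRep W r.1 ω = ω - ExteriorAlgebra.ι ℂ r.form * contr r.coroot ω := by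
  induction ω using CliffordAlgebra.left_induction with
  | algebraMap a =>
    have h : extRep W r.1 (algebraMap ℂ _ a) = algebraMap ℂ _ a :=
      (ExteriorAlgebra.map (dualRep W r.1)).commutes a
    erw [contr_algebraMap, h, mul_zero, sub_zero]
  | add a b ha hb => rw [map_add, map_add, ha, hb, mul_add]; abel
  | ι_mul ω x ih =>
    change extRep W r.1 (ExteriorAlgebra.ι ℂ x * ω) = ExteriorAlgebra.ι ℂ x * ω -
      ExteriorAlgebra.ι ℂ r.form * contr r.coroot (ExteriorAlgebra.ι ℂ x * ω)
    have h1 : extRep W r.1 (ExteriorAlgebra.ι ℂ x * ω) =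
        ExteriorAlgebra.ι ℂ (dualRep W r.1 x) * extRep W r.1 ω := by
      have h1 := map_mul (ExteriorAlgebra.map (dualRep W r.1)) (ExteriorAlgebra.ι ℂ x) ω
      rw [ExteriorAlgebra.map_apply_ι] at h1
      exact h1
    have h2 : dualRep W r.1 x = x - x r.coroot • r.form := by
      refine LinearMap.ext fun u => ?_
      have h3 := congrArg x (r.sub_symm u)
      rw [map_sub, map_smul, smul_eq_mul] at h3
      change x (r.toEquiv.symm u) = x u - x r.coroot * r.form u
      rw [mul_comm, ← h3]
      ring
    have h4 : ExteriorAlgebra.ι ℂ r.form * (ExteriorAlgebra.ι ℂ r.form * contr r.coroot ω) = 0 := by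
      rw [← mul_assoc, ExteriorAlgebra.ι_sq_zero, zero_mul]
    rw [h1, h2, ih, contr_ι_mul, map_sub, map_smul, sub_mul, mul_sub, mul_sub, mul_sub, smul_mul_assoc,
      smul_mul_assoc, h4, smul_zero, sub_zero, wedge_wedge x, mul_smul_comm]
    abel

end Exterior

section GenericKoszul

variable {𝔥 : Type u} [AddCommGroup 𝔥] [Module ℂ 𝔥] [FiniteDimensional ℂ 𝔥]
  {V : Type*} [AddCommGroup V] [Module ℂ V] {V' : Type*} [AddCommGroup V'] [Module ℂ V']

/-- The Koszul differential of a vector space with an action of the linear forms. -/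
def kosD (A : Module.Dual ℂ 𝔥 →ₗ[ℂ] Module.End ℂ V) :
    Module.End ℂ (V ⊗[ℂ] ExteriorAlgebra ℂ (Module.Dual ℂ 𝔥)) :=
  ∑ i, TensorProduct.map (A ((Module.finBasis ℂ 𝔥).coord i)) (contr (Module.finBasis ℂ 𝔥 i))

/-- The opposite differential given by an action of the vectors. -/
def kosDelta (B : 𝔥 →ₗ[ℂ] Module.End ℂ V) :
    Module.End ℂ (V ⊗[ℂ] ExteriorAlgebra ℂ (Module.Dual ℂ 𝔥)) :=
  ∑ i, TensorProduct.map (B (Module.finBasis ℂ 𝔥 i)) (wedge ((Module.finBasis ℂ 𝔥).coord i))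

lemma kosD_tmul (A : Module.Dual ℂ 𝔥 →ₗ[ℂ] Module.End ℂ V) (v : V)
    (ω : ExteriorAlgebra ℂ (Module.Dual ℂ 𝔥)) : kosD A (v ⊗ₜ ω) =
      ∑ i, (A ((Module.finBasis ℂ 𝔥).coord i) v) ⊗ₜ[ℂ] contr (Module.finBasis ℂ 𝔥 i) ω := by
  simp [kosD, LinearMap.sum_apply]

lemma kosDelta_tmul (B : 𝔥 →ₗ[ℂ] Module.End ℂ V) (v : V)
    (ω : ExteriorAlgebra ℂ (Module.Dual ℂ 𝔥)) : kosDelta B (v ⊗ₜ ω) =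
      ∑ i, (B (Module.finBasis ℂ 𝔥 i) v) ⊗ₜ[ℂ]
        (ExteriorAlgebra.ι ℂ ((Module.finBasis ℂ 𝔥).coord i) * ω) := by
  simp [kosDelta, LinearMap.sum_apply]

lemma kosD_kosDelta (A : Module.Dual ℂ 𝔥 →ₗ[ℂ] Module.End ℂ V) (B : 𝔥 →ₗ[ℂ] Module.End ℂ V) (v : V)
    (ω : ExteriorAlgebra ℂ (Module.Dual ℂ 𝔥)) :
    kosD A (kosDelta B (v ⊗ₜ ω)) + kosDelta B (kosD A (v ⊗ₜ ω)) =
      (∑ i, A ((Module.finBasis ℂ 𝔥).coord i) (B (Module.finBasis ℂ 𝔥 i) v)) ⊗ₜ ω +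
      ∑ i, ∑ j, (B (Module.finBasis ℂ 𝔥 j) (A ((Module.finBasis ℂ 𝔥).coord i) v) -
        A ((Module.finBasis ℂ 𝔥).coord i) (B (Module.finBasis ℂ 𝔥 j) v)) ⊗ₜ[ℂ]
          (ExteriorAlgebra.ι ℂ ((Module.finBasis ℂ 𝔥).coord j) *
            contr (Module.finBasis ℂ 𝔥 i) ω) := by
  have h1 : ∀ j, kosD A ((B (Module.finBasis ℂ 𝔥 j) v) ⊗ₜ[ℂ]
      (ExteriorAlgebra.ι ℂ ((Module.finBasis ℂ 𝔥).coord j) * ω)) =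
      A ((Module.finBasis ℂ 𝔥).coord j) (B (Module.finBasis ℂ 𝔥 j) v) ⊗ₜ ω -
      ∑ i, A ((Module.finBasis ℂ 𝔥).coord i) (B (Module.finBasis ℂ 𝔥 j) v) ⊗ₜ[ℂ]
        (ExteriorAlgebra.ι ℂ ((Module.finBasis ℂ 𝔥).coord j) *
            contr (Module.finBasis ℂ 𝔥 i) ω) := by
    intro j
    rw [kosD_tmul]
    simp only [contr_ι_mul, TensorProduct.tmul_sub, Finset.sum_sub_distrib]
    congr 1
    rw [Finset.sum_eq_single j]
    · simp
    · intro i _ hij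
      simp [hij]
    · intro h; exact absurd (Finset.mem_univ j) h
  rw [kosDelta_tmul, kosD_tmul, map_sum, map_sum]
  simp only [h1, kosDelta_tmul, TensorProduct.sub_tmul, Finset.sum_sub_distrib,
    TensorProduct.sum_tmul]
  rw [Finset.sum_comm (f := fun i j => A ((Module.finBasis ℂ 𝔥).coord i)
    (B (Module.finBasis ℂ 𝔥 j) v) ⊗ₜ[ℂ] (ExteriorAlgebra.ι ℂ ((Module.finBasis ℂ 𝔥).coord j) *
            contr (Module.finBasis ℂ 𝔥 i) ω))]
  abel

variable (V 𝔥) in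
/-- The part `V ⊗ Λ^i 𝔥*` of `V ⊗ Λ 𝔥*`. -/
def lamPart (i : ℕ) : Submodule ℂ (V ⊗[ℂ] ExteriorAlgebra ℂ (Module.Dual ℂ 𝔥)) :=
  Submodule.span ℂ {t | ∃ v : V, ∃ ω ∈ ⋀[ℂ]^i (Module.Dual ℂ 𝔥), t = v ⊗ₜ ω}

lemma tmul_mem_lamPart {i : ℕ} (v : V) {ω : ExteriorAlgebra ℂ (Module.Dual ℂ 𝔥)}
    (hω : ω ∈ ⋀[ℂ]^i (Module.Dual ℂ 𝔥)) : v ⊗ₜ ω ∈ lamPart 𝔥 V i :=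
  Submodule.subset_span ⟨v, ω, hω, rfl⟩

lemma lamPart_map {i : ℕ} {U : Submodule ℂ (V' ⊗[ℂ] ExteriorAlgebra ℂ (Module.Dual ℂ 𝔥))}
    (f : V ⊗[ℂ] ExteriorAlgebra ℂ (Module.Dual ℂ 𝔥) →ₗ[ℂ]
      V' ⊗[ℂ] ExteriorAlgebra ℂ (Module.Dual ℂ 𝔥))
    (hf : ∀ v : V, ∀ ω ∈ ⋀[ℂ]^i (Module.Dual ℂ 𝔥), f (v ⊗ₜ ω) ∈ U)
    {t : V ⊗[ℂ] ExteriorAlgebra ℂ (Module.Dual ℂ 𝔥)} (ht : t ∈ lamPart 𝔥 V i) : f t ∈ U := by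
  have : lamPart 𝔥 V i ≤ U.comap f := by
    refine Submodule.span_le.mpr ?_
    rintro _ ⟨v, ω, hω, rfl⟩
    exact hf v ω hω
  exact this ht

lemma kosD_mem (A : Module.Dual ℂ 𝔥 →ₗ[ℂ] Module.End ℂ V) {i : ℕ}
    {t : V ⊗[ℂ] ExteriorAlgebra ℂ (Module.Dual ℂ 𝔥)} (ht : t ∈ lamPart 𝔥 V (i + 1)) :
    kosD A t ∈ lamPart 𝔥 V i := by
  refine lamPart_map (kosD A) (fun v ω hω => ?_) ht
  rw [kosD_tmul]
  exact sum_mem fun j _ => tmul_mem_lamPart _ (contr_mem _ hω)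

lemma kosDelta_mem (B : 𝔥 →ₗ[ℂ] Module.End ℂ V) {i : ℕ}
    {t : V ⊗[ℂ] ExteriorAlgebra ℂ (Module.Dual ℂ 𝔥)} (ht : t ∈ lamPart 𝔥 V i) :
    kosDelta B t ∈ lamPart 𝔥 V (i + 1) := by
  refine lamPart_map (kosDelta B) (fun v ω hω => ?_) ht
  rw [kosDelta_tmul]
  exact sum_mem fun j _ => tmul_mem_lamPart _ (wedge_mem _ hω)

lemma rTensor_mem_lamPart (f : V →ₗ[ℂ] V') {i : ℕ}
    {t : V ⊗[ℂ] ExteriorAlgebra ℂ (Module.Dual ℂ 𝔥)} (ht : t ∈ lamPart 𝔥 V i) :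
    f.rTensor _ t ∈ lamPart 𝔥 V' i :=
  lamPart_map (f.rTensor _) (fun v _ hω => tmul_mem_lamPart (f v) hω) ht

lemma kosD_rTensor {A : Module.Dual ℂ 𝔥 →ₗ[ℂ] Module.End ℂ V}
    {A' : Module.Dual ℂ 𝔥 →ₗ[ℂ] Module.End ℂ V'} {f : V →ₗ[ℂ] V'}
    (hf : ∀ x v, f (A x v) = A' x (f v)) (t : V ⊗[ℂ] ExteriorAlgebra ℂ (Module.Dual ℂ 𝔥)) :
    kosD A' (f.rTensor _ t) = f.rTensor _ (kosD A t) := by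
  induction t using TensorProduct.induction_on with
  | zero => simp only [map_zero]
  | add a b ha hb => simp only [map_add, ha, hb]
  | tmul v ω =>
    rw [LinearMap.rTensor_tmul, kosD_tmul, kosD_tmul, map_sum]
    simp only [LinearMap.rTensor_tmul, hf]

/-- Exactness of the Koszul complex in positive degrees. -/
def Acyc (A : Module.Dual ℂ 𝔥 →ₗ[ℂ] Module.End ℂ V) : Prop :=
  ∀ i, ∀ t ∈ lamPart 𝔥 V (i + 1), kosD A t = 0 → ∃ s ∈ lamPart 𝔥 V (i + 2), kosD A s = t

/-- A locally finite retract criterion for exactness of the Koszul complex. -/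
lemma Acyc.of_sum {A : Module.Dual ℂ 𝔥 →ₗ[ℂ] Module.End ℂ V} {κ : Type*}
    {F : κ → Type*} [∀ k, AddCommGroup (F k)] [∀ k, Module ℂ (F k)]
    {A' : ∀ k, Module.Dual ℂ 𝔥 →ₗ[ℂ] Module.End ℂ (F k)} (hA : ∀ k, Acyc (A' k))
    (p : ∀ k, V →ₗ[ℂ] F k) (q : ∀ k, F k →ₗ[ℂ] V) (hp : ∀ k x v, p k (A x v) = A' k x (p k v))
    (hq : ∀ k x v, q k (A' k x v) = A x (q k v))
    (hs : ∀ v, ∃ S : Finset κ, ∀ T, S ⊆ T → ∑ k ∈ T, q k (p k v) = v) : Acyc A := by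
  classical
  intro i t ht h0
  have hs' : ∀ t : V ⊗[ℂ] ExteriorAlgebra ℂ (Module.Dual ℂ 𝔥), ∃ S : Finset κ, ∀ T, S ⊆ T →
      ∑ k ∈ T, (q k).rTensor _ ((p k).rTensor _ t) = t := by
    intro t
    induction t using TensorProduct.induction_on with
    | zero => exact ⟨∅, fun T _ => by simp only [map_zero, Finset.sum_const_zero]⟩
    | add a b ha hb =>
      obtain ⟨S, hS⟩ := ha
      obtain ⟨S', hS'⟩ := hb
      refine ⟨S ∪ S', fun T hT => ?_⟩
      simp only [map_add, Finset.sum_add_distrib]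
      rw [hS T (Finset.union_subset_left hT), hS' T (Finset.union_subset_right hT)]
    | tmul v ω =>
      obtain ⟨S, hS⟩ := hs v
      refine ⟨S, fun T hT => ?_⟩
      simp only [LinearMap.rTensor_tmul]
      rw [← TensorProduct.sum_tmul, hS T hT]
  obtain ⟨S, hS⟩ := hs' t
  have h1 : ∀ k, ∃ s ∈ lamPart 𝔥 (F k) (i + 2), kosD (A' k) s = (p k).rTensor _ t := fun k =>
    hA k i _ (rTensor_mem_lamPart _ ht) (by rw [kosD_rTensor (hp k), h0, map_zero])
  choose s hs1 hs2 using h1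
  refine ⟨∑ k ∈ S, (q k).rTensor _ (s k), sum_mem fun k _ => rTensor_mem_lamPart _ (hs1 k), ?_⟩
  rw [map_sum, ← hS S subset_rfl]
  exact Finset.sum_congr rfl fun k _ => by rw [kosD_rTensor (hq k), hs2]

lemma Acyc.of_retract {A : Module.Dual ℂ 𝔥 →ₗ[ℂ] Module.End ℂ V}
    {A' : Module.Dual ℂ 𝔥 →ₗ[ℂ] Module.End ℂ V'} (hA : Acyc A')
    (p : V →ₗ[ℂ] V') (q : V' →ₗ[ℂ] V) (hp : ∀ x v, p (A x v) = A' x (p v))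
    (hq : ∀ x v, q (A' x v) = A x (q v)) (hs : ∀ v, q (p v) = v) : Acyc A := by
  intro i t ht h0
  obtain ⟨s, hs1, hs2⟩ := hA i _ (rTensor_mem_lamPart p ht) (by rw [kosD_rTensor hp, h0, map_zero])
  refine ⟨q.rTensor _ s, rTensor_mem_lamPart _ hs1, ?_⟩
  rw [kosD_rTensor hq, hs2, ← LinearMap.comp_apply, ← LinearMap.rTensor_comp]
  have : q ∘ₗ p = LinearMap.id := LinearMap.ext hs
  rw [this, LinearMap.rTensor_id, LinearMap.id_apply]

end GenericKoszul

section PolyKoszul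

variable (𝔥 : Type u) [AddCommGroup 𝔥] [Module ℂ 𝔥]

/-- Multiplication by linear forms on polynomial functions. -/
def polyLin : Module.Dual ℂ 𝔥 →ₗ[ℂ] Module.End ℂ (Poly 𝔥) where
  toFun x := LinearMap.mulLeft ℂ (lin x)
  map_add' x y := LinearMap.ext fun f => add_mul (lin x) (lin y) f
  map_smul' a x := LinearMap.ext fun f => smul_mul_assoc a (lin x) f

/-- Directional derivatives of polynomial functions. -/
def polyDer : 𝔥 →ₗ[ℂ] Module.End ℂ (Poly 𝔥) where
  toFun := dirDeriv
  map_add' u v := LinearMap.ext fun f => dirDeriv_add_dir u v f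
  map_smul' a v := LinearMap.ext fun f => dirDeriv_smul_dir a v f

variable [FiniteDimensional ℂ 𝔥]

/-- The Euler vector field. -/
def polyEuler : Module.End ℂ (Poly 𝔥) :=
  ∑ i, polyLin 𝔥 ((Module.finBasis ℂ 𝔥).coord i) * polyDer 𝔥 (Module.finBasis ℂ 𝔥 i)

variable {𝔥}

lemma polyEuler_apply (f : Poly 𝔥) : polyEuler 𝔥 f =
    ∑ i, lin ((Module.finBasis ℂ 𝔥).coord i) * dirDeriv (Module.finBasis ℂ 𝔥 i) f := by
  rw [polyEuler, LinearMap.sum_apply]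
  rfl

lemma polyEuler_mul (f g : Poly 𝔥) :
    polyEuler 𝔥 (f * g) = polyEuler 𝔥 f * g + f * polyEuler 𝔥 g := by
  simp only [polyEuler_apply, dirDeriv_mul, mul_add, Finset.sum_add_distrib, Finset.sum_mul,
    Finset.mul_sum]
  congr 1
  · exact Finset.sum_congr rfl fun i _ => by ring
  · exact Finset.sum_congr rfl fun i _ => by ring

lemma polyEuler_lin (x : Module.Dual ℂ 𝔥) : polyEuler 𝔥 (lin x) = lin x := by
  rw [polyEuler_apply]
  refine poly_ext fun y => ?_
  rw [poly_sum_apply]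
  have h := LinearMap.congr_fun (dual_eq_sum (Module.finBasis ℂ 𝔥) x) y
  rw [LinearMap.sum_apply] at h
  rw [lin_apply, h]
  refine Finset.sum_congr rfl fun i _ => ?_
  rw [poly_mul_apply, lin_apply, dirDeriv_lin, poly_const_apply, LinearMap.smul_apply, smul_eq_mul,
    mul_comm]

lemma polyEuler_const (a : ℂ) : polyEuler 𝔥 (algebraMap ℂ _ a) = 0 := by
  rw [polyEuler_apply]
  exact Finset.sum_eq_zero fun i _ => by rw [dirDeriv_const, mul_zero]

lemma mem_span_polyEuler (f : Poly 𝔥) :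
    f ∈ Submodule.span ℂ {g | ∃ k : ℕ, polyEuler 𝔥 g = (k : ℂ) • g} := by
  induction f using polyFun_induction with
  | hlin x => exact Submodule.subset_span ⟨1, by rw [polyEuler_lin, Nat.cast_one, one_smul]⟩
  | hconst a => exact Submodule.subset_span ⟨0, by rw [polyEuler_const, Nat.cast_zero, zero_smul]⟩
  | hadd f g hf hg => exact add_mem hf hg
  | hmul f g hf hg =>
    have h := Submodule.mul_mem_mul hf hg
    rw [Submodule.span_mul_span] at h
    refine Submodule.span_mono ?_ h
    rintro _ ⟨a, ⟨k, hk⟩, b, ⟨l, hl⟩, rfl⟩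
    refine ⟨k + l, ?_⟩
    change polyEuler 𝔥 (a * b) = _ • (a * b)
    rw [polyEuler_mul, hk, hl, smul_mul_assoc, mul_smul_comm, ← add_smul, Nat.cast_add]

variable (𝔥)

/-- The Laplacian of the Koszul complex of the polynomial functions. -/
def polyLap : Module.End ℂ (Poly 𝔥 ⊗[ℂ] ExteriorAlgebra ℂ (Module.Dual ℂ 𝔥)) :=
  TensorProduct.map (polyEuler 𝔥) LinearMap.id + TensorProduct.map LinearMap.id degOp

variable {𝔥}

lemma kosD_polyDer (t : Poly 𝔥 ⊗[ℂ] ExteriorAlgebra ℂ (Module.Dual ℂ 𝔥)) :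
    kosD (polyLin 𝔥) (kosDelta (polyDer 𝔥) t) + kosDelta (polyDer 𝔥) (kosD (polyLin 𝔥) t) =
      polyLap 𝔥 t := by
  induction t using TensorProduct.induction_on with
  | zero => simp only [map_zero, add_zero]
  | add a b ha hb => rw [map_add, map_add, map_add, map_add, map_add, ← ha, ← hb]; abel
  | tmul f ω =>
    rw [kosD_kosDelta]
    have h1 : ∀ i j, polyDer 𝔥 (Module.finBasis ℂ 𝔥 j)
        (polyLin 𝔥 ((Module.finBasis ℂ 𝔥).coord i) f) -
        polyLin 𝔥 ((Module.finBasis ℂ 𝔥).coord i) (polyDer 𝔥 (Module.finBasis ℂ 𝔥 j) f) =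
        (if i = j then (1 : ℂ) else 0) • f := by
      intro i j
      change dirDeriv _ (lin _ * f) - lin _ * dirDeriv _ f = _
      rw [dirDeriv_mul, dirDeriv_lin, add_sub_cancel_right, ← Algebra.smul_def]
      congr 1
      simp [Finsupp.single_apply, eq_comm]
    simp only [h1]
    rw [polyLap, LinearMap.add_apply, TensorProduct.map_tmul, TensorProduct.map_tmul,
      LinearMap.id_apply, LinearMap.id_apply, degOp_apply, TensorProduct.tmul_sum]
    congr 1
    · congr 1
      rw [polyEuler_apply]
      rfl
    · refine Finset.sum_congr rfl fun i _ => ?_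
      rw [Finset.sum_eq_single i]
      · rw [if_pos rfl, one_smul]
      · intro j _ hj
        rw [if_neg (Ne.symm hj), zero_smul, TensorProduct.zero_tmul]
      · intro h; exact absurd (Finset.mem_univ i) h

lemma kosD_kosD_poly (t : Poly 𝔥 ⊗[ℂ] ExteriorAlgebra ℂ (Module.Dual ℂ 𝔥)) :
    kosD (polyLin 𝔥) (kosD (polyLin 𝔥) t) = 0 := by
  induction t using TensorProduct.induction_on with
  | zero => simp only [map_zero]
  | add a b ha hb => simp only [map_add, ha, hb, add_zero]
  | tmul m ω =>
    have hanti : ∀ (y z : 𝔥), contr y (contr z ω) = -contr z (contr y ω) := fun y z =>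
      CliffordAlgebra.contractLeft_comm _ _ _
    have key : kosD (polyLin 𝔥) (kosD (polyLin 𝔥) (m ⊗ₜ ω)) =
        -kosD (polyLin 𝔥) (kosD (polyLin 𝔥) (m ⊗ₜ ω)) := by
      simp only [kosD_tmul, map_sum]
      conv_lhs => rw [Finset.sum_comm]
      simp only [← Finset.sum_neg_distrib]
      refine Finset.sum_congr rfl fun i _ => Finset.sum_congr rfl fun j _ => ?_
      rw [hanti, TensorProduct.tmul_neg]
      congr 2
      exact mul_left_comm _ _ _
    have h2 : (2 : ℂ) • kosD (polyLin 𝔥) (kosD (polyLin 𝔥) (m ⊗ₜ ω)) = 0 := by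
      rw [two_smul]
      nth_rewrite 1 [key]
      exact neg_add_cancel _
    exact (smul_eq_zero.mp h2).resolve_left two_ne_zero

lemma exists_annihilator {i : ℕ} {t : Poly 𝔥 ⊗[ℂ] ExteriorAlgebra ℂ (Module.Dual ℂ 𝔥)}
    (ht : t ∈ lamPart 𝔥 (Poly 𝔥) (i + 1)) : ∃ p : Polynomial ℂ, p.coeff 0 ≠ 0 ∧
      Polynomial.aeval (polyLap 𝔥) p t = 0 := by
  let S : Submodule ℂ (Poly 𝔥 ⊗[ℂ] ExteriorAlgebra ℂ (Module.Dual ℂ 𝔥)) :=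
    { carrier := {t | ∃ p : Polynomial ℂ, p.coeff 0 ≠ 0 ∧ Polynomial.aeval (polyLap 𝔥) p t = 0}
      zero_mem' := ⟨1, by simp, by simp⟩
      add_mem' := by
        rintro s t ⟨p, hp, hs⟩ ⟨q, hq, ht⟩
        refine ⟨p * q, by rw [Polynomial.mul_coeff_zero]; exact mul_ne_zero hp hq, ?_⟩
        rw [map_add, map_mul, Module.End.mul_apply, Module.End.mul_apply, ht, map_zero, add_zero,
          ← Module.End.mul_apply, ← map_mul, mul_comm, map_mul, Module.End.mul_apply, hs, map_zero]
      smul_mem' := by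
        rintro a t ⟨p, hp, ht⟩
        exact ⟨p, hp, by rw [map_smul, ht, smul_zero]⟩ }
  suffices h : lamPart 𝔥 (Poly 𝔥) (i + 1) ≤ S from h ht
  refine Submodule.span_le.mpr ?_
  rintro _ ⟨f, ω, hω, rfl⟩
  have h2 : Submodule.span ℂ {g | ∃ k : ℕ, polyEuler 𝔥 g = (k : ℂ) • g} ≤
      S.comap ((TensorProduct.mk ℂ _ _).flip ω) := by
    refine Submodule.span_le.mpr ?_
    rintro g ⟨k, hk⟩
    refine ⟨Polynomial.X + Polynomial.C (-(k + (i + 1) : ℂ)), ?_, ?_⟩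
    · have : (k + (i + 1) : ℂ) ≠ 0 := by exact_mod_cast Nat.succ_ne_zero (k + i)
      rw [Polynomial.coeff_add, Polynomial.coeff_X_zero, Polynomial.coeff_C_zero, zero_add]
      exact neg_ne_zero.mpr this
    · have h3 : polyLap 𝔥 (g ⊗ₜ ω) = (k + (i + 1) : ℂ) • (g ⊗ₜ ω) := by
        rw [polyLap, LinearMap.add_apply, TensorProduct.map_tmul, TensorProduct.map_tmul,
          LinearMap.id_apply, LinearMap.id_apply, hk, degOp_of_mem hω, TensorProduct.tmul_smul,
          ← TensorProduct.smul_tmul', ← add_smul]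
        push_cast
        rfl
      rw [map_add, Polynomial.aeval_X, Polynomial.aeval_C, LinearMap.add_apply]
      change polyLap 𝔥 (g ⊗ₜ ω) + algebraMap ℂ (Module.End ℂ _) _ (g ⊗ₜ ω) = 0
      rw [h3, Module.algebraMap_end_apply, neg_smul, add_neg_cancel]
  exact h2 (mem_span_polyEuler f)

lemma acyc_poly : Acyc (polyLin 𝔥) := by
  intro i t ht h0
  have hcomm : ∀ s, kosD (polyLin 𝔥) (polyLap 𝔥 s) = polyLap 𝔥 (kosD (polyLin 𝔥) s) := by
    intro s
    rw [← kosD_polyDer, ← kosD_polyDer, map_add, kosD_kosD_poly, kosD_kosD_poly, map_zero, zero_add,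
      add_zero]
  have hp : ∀ (q : Polynomial ℂ), Polynomial.aeval (polyLap 𝔥) q t ∈ lamPart 𝔥 (Poly 𝔥) (i + 1) ∧
      kosD (polyLin 𝔥) (Polynomial.aeval (polyLap 𝔥) q t) = 0 := by
    have hX : ∀ s, (s ∈ lamPart 𝔥 (Poly 𝔥) (i + 1) ∧ kosD (polyLin 𝔥) s = 0) →
        (polyLap 𝔥 s ∈ lamPart 𝔥 (Poly 𝔥) (i + 1) ∧ kosD (polyLin 𝔥) (polyLap 𝔥 s) = 0) := by
      rintro s ⟨h1, h2⟩
      refine ⟨?_, by rw [hcomm, h2, map_zero]⟩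
      rw [← kosD_polyDer, h2, map_zero, add_zero]
      exact kosD_mem _ (kosDelta_mem _ h1)
    intro q
    induction q using Polynomial.induction_on with
    | C a =>
      rw [Polynomial.aeval_C, Module.algebraMap_end_apply]
      exact ⟨Submodule.smul_mem _ _ ht, by rw [map_smul, h0, smul_zero]⟩
    | add p q hp hq =>
      rw [map_add, LinearMap.add_apply]
      exact ⟨add_mem hp.1 hq.1, by rw [map_add, hp.2, hq.2, add_zero]⟩
    | monomial n a ih =>
      have : Polynomial.C a * Polynomial.X ^ (n + 1) =
          Polynomial.X * (Polynomial.C a * Polynomial.X ^ n) := by ring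
      rw [this, map_mul, Polynomial.aeval_X, Module.End.mul_apply]
      exact hX _ ih
  obtain ⟨p, hp0, hpt⟩ := exists_annihilator ht
  have h1 : Polynomial.aeval (polyLap 𝔥) (p.divX * Polynomial.X + Polynomial.C (p.coeff 0)) t = 0 := by
    rw [Polynomial.divX_mul_X_add, hpt]
  obtain ⟨h2, h3⟩ := hp p.divX
  rw [map_add, mul_comm, map_mul, Polynomial.aeval_X, Polynomial.aeval_C, LinearMap.add_apply,
    Module.End.mul_apply, Module.algebraMap_end_apply, ← kosD_polyDer, h3, map_zero, add_zero] at h1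
  refine ⟨(-(p.coeff 0)⁻¹) • kosDelta (polyDer 𝔥) (Polynomial.aeval (polyLap 𝔥) p.divX t),
    Submodule.smul_mem _ _ (kosDelta_mem _ h2), ?_⟩
  rw [map_smul, eq_neg_of_add_eq_zero_left h1, smul_neg, neg_smul, neg_neg, smul_smul,
    inv_mul_cancel₀ hp0, one_smul]

/-- Componentwise multiplication by linear forms on finitely supported families. -/
def finsuppLin (K : Type*) : Module.Dual ℂ 𝔥 →ₗ[ℂ] Module.End ℂ (K →₀ Poly 𝔥) where
  toFun x := Finsupp.mapRange.linearMap (polyLin 𝔥 x)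
  map_add' x y := by ext; simp
  map_smul' a x := by ext; simp

lemma acyc_finsupp (K : Type*) : Acyc (finsuppLin (𝔥 := 𝔥) K) := by
  classical
  refine Acyc.of_sum (κ := K) (fun _ => acyc_poly (𝔥 := 𝔥)) (fun k => Finsupp.lapply k)
    (fun k => Finsupp.lsingle k) (fun k x v => rfl) (fun k x v => ?_) (fun v => ?_)
  · simp [finsuppLin]
  · refine ⟨v.support, fun T hT => ?_⟩
    simp only [Finsupp.lapply_apply, Finsupp.lsingle_apply]
    rw [← Finset.sum_subset hT fun k _ hk => by simp [Finsupp.notMem_support_iff.mp hk]]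
    exact v.sum_single

end PolyKoszul

section CherKoszul

variable {𝔥 : Type u} [AddCommGroup 𝔥] [Module ℂ 𝔥] [FiniteDimensional ℂ 𝔥]
  {W : Subgroup (𝔥 ≃ₗ[ℂ] 𝔥)} [Finite W] (c : Param W) (M : ModuleCat.{u} (Cher c))

/-- The action of linear forms on a module. -/
def linAct : Module.Dual ℂ 𝔥 →ₗ[ℂ] Module.End ℂ M where
  toFun x := act c M (mulOp c (lin x))
  map_add' x y := by rw [lin_add, map_add, map_add]
  map_smul' a x := by rw [lin_smul, map_smul, map_smul, RingHom.id_apply]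

/-- The action of Dunkl operators on a module. -/
def dunAct : 𝔥 →ₗ[ℂ] Module.End ℂ M := (act c M).toLinearMap ∘ₗ dun c

lemma koszulD_eq : koszulD c M = kosD (linAct c M) := rfl

/-- The operator `∑ D_{y_i} ⊗ x_i` on `M ⊗ Λ 𝔥*`. -/
abbrev koszulDelta : Module.End ℂ (Koszul c M) := kosDelta (dunAct c M)

/-- The grading operator on the Koszul complex. -/
def koszulEuler : Module.End ℂ (Koszul c M) :=
  TensorProduct.map (act c M (euler c)) LinearMap.id + TensorProduct.map LinearMap.id degOp

variable {c M}

lemma koszulEuler_tmul (m : M) (ω : ExteriorAlgebra ℂ (Module.Dual ℂ 𝔥)) :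
    koszulEuler c M (m ⊗ₜ ω) = (euler c • m) ⊗ₜ ω + m ⊗ₜ degOp ω := by
  simp [koszulEuler]

lemma zAct_koszulRep_tmul (m : M) (ω : ExteriorAlgebra ℂ (Module.Dual ℂ 𝔥)) :
    zAct c (koszulRep c M) (m ⊗ₜ ω) =
      ∑ r : Refl W, c.val r • (m ⊗ₜ ω - (grp c r.1 • m) ⊗ₜ extRep W r.1 ω) := by
  rw [zAct, LinearMap.sum_apply]
  rfl

/-- The Laplacian of the Koszul complex. -/
lemma koszulD_koszulDelta (t : Koszul c M) :
    koszulD c M (koszulDelta c M t) + koszulDelta c M (koszulD c M t) =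
      koszulEuler c M t - zAct c (koszulRep c M) t := by
  induction t using TensorProduct.induction_on with
  | zero => simp only [map_zero, add_zero, sub_zero]
  | add a b ha hb =>
    simp only [map_add]
    rw [add_add_add_comm, ha, hb]
    abel
  | tmul m ω =>
    have h1 : ∀ i j, dunAct c M (Module.finBasis ℂ 𝔥 j)
        (linAct c M ((Module.finBasis ℂ 𝔥).coord i) m) -
        linAct c M ((Module.finBasis ℂ 𝔥).coord i) (dunAct c M (Module.finBasis ℂ 𝔥 j) m) =
        (if i = j then (1 : ℂ) else 0) • m - ∑ r : Refl W,
          (c.val r * r.form (Module.finBasis ℂ 𝔥 j) * (Module.finBasis ℂ 𝔥).coord i r.coroot) •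
            grp c r.1 • m := by
      intro i j
      change dun c _ • mulOp c (lin _) • m - mulOp c (lin _) • dun c _ • m = _
      rw [← mul_smul, dun_mul_lin, sub_smul, add_smul, mul_smul, add_sub_assoc, add_sub_cancel_left,
        algebraMap_smul, Finset.sum_smul]
      congr 1
      · congr 1
        simp [Finsupp.single_apply, eq_comm]
      · exact Finset.sum_congr rfl fun r _ => smul_assoc _ _ _
    rw [koszulD_eq, kosD_kosDelta, koszulEuler_tmul, zAct_koszulRep_tmul]
    simp only [h1, TensorProduct.sub_tmul, Finset.sum_sub_distrib]
    have h2 : ∑ i, ∑ j, ((if i = j then (1 : ℂ) else 0) • m) ⊗ₜ[ℂ]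
        (ExteriorAlgebra.ι ℂ ((Module.finBasis ℂ 𝔥).coord j) *
            contr (Module.finBasis ℂ 𝔥 i) ω) = m ⊗ₜ degOp ω := by
      rw [degOp_apply, TensorProduct.tmul_sum]
      refine Finset.sum_congr rfl fun i _ => ?_
      rw [Finset.sum_eq_single i]
      · rw [if_pos rfl, one_smul]
      · intro j _ hj
        rw [if_neg (Ne.symm hj), zero_smul, TensorProduct.zero_tmul]
      · intro h; exact absurd (Finset.mem_univ i) h
    have h3 : ∑ i, ∑ j, (∑ r : Refl W, (c.val r * r.form (Module.finBasis ℂ 𝔥 j) *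
        (Module.finBasis ℂ 𝔥).coord i r.coroot) • grp c r.1 • m) ⊗ₜ[ℂ]
        (ExteriorAlgebra.ι ℂ ((Module.finBasis ℂ 𝔥).coord j) *
            contr (Module.finBasis ℂ 𝔥 i) ω) =
        ∑ r : Refl W, c.val r • ((grp c r.1 • m) ⊗ₜ[ℂ]
          (ExteriorAlgebra.ι ℂ r.form * contr r.coroot ω)) := by
      have h4 : ∀ r : Refl W, ExteriorAlgebra.ι ℂ r.form * contr r.coroot ω =
          ∑ i, ∑ j, (r.form (Module.finBasis ℂ 𝔥 j) * (Module.finBasis ℂ 𝔥).coord i r.coroot) •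
            (ExteriorAlgebra.ι ℂ ((Module.finBasis ℂ 𝔥).coord j) *
              contr (Module.finBasis ℂ 𝔥 i) ω) := by
        intro r
        have h5 : contr r.coroot ω = ∑ i, (Module.finBasis ℂ 𝔥).coord i r.coroot •
            contr (Module.finBasis ℂ 𝔥 i) ω := by
          conv_lhs => rw [← (Module.finBasis ℂ 𝔥).sum_repr r.coroot]
          simp only [map_sum, map_smul, LinearMap.sum_apply, LinearMap.smul_apply]
          rfl
        conv_lhs => rw [h5, dual_eq_sum (Module.finBasis ℂ 𝔥) r.form]
        simp only [map_sum, map_smul, Finset.mul_sum, Finset.sum_mul, mul_smul_comm,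
          smul_mul_assoc, Finset.smul_sum, smul_smul]
        refine Finset.sum_congr rfl fun i _ => Finset.sum_congr rfl fun j _ => ?_
        rw [mul_comm]
      simp only [h4, TensorProduct.sum_tmul, TensorProduct.tmul_sum, Finset.smul_sum]
      rw [Finset.sum_comm]
      simp only [Finset.sum_comm (s := (Finset.univ : Finset (Fin (Module.finrank ℂ 𝔥))))
        (t := (Finset.univ : Finset (Refl W)))]
      refine Finset.sum_congr rfl fun r _ => ?_
      rw [Finset.sum_comm]
      refine Finset.sum_congr rfl fun i _ => Finset.sum_congr rfl fun j _ => ?_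
      rw [TensorProduct.tmul_smul, smul_smul, ← TensorProduct.smul_tmul', mul_assoc]
    rw [h2, h3]
    have h6 : (∑ i, linAct c M ((Module.finBasis ℂ 𝔥).coord i)
        (dunAct c M (Module.finBasis ℂ 𝔥 i) m)) = euler c • m -
        ∑ r : Refl W, c.val r • (m - grp c r.1 • m) := by
      rw [euler_eq, add_smul, zElt, Finset.sum_smul, Finset.sum_smul, eq_sub_iff_add_eq]
      congr 1
      · exact Finset.sum_congr rfl fun i _ => (mul_smul _ _ _).symm
      · refine Finset.sum_congr rfl fun r _ => ?_
        rw [smul_assoc, sub_smul, one_smul]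
    rw [h6, TensorProduct.sub_tmul, TensorProduct.sum_tmul]
    have h7 : ∀ r : Refl W, (c.val r • (m - grp c r.1 • m)) ⊗ₜ[ℂ] ω = c.val r • (m ⊗ₜ ω) -
        c.val r • ((grp c r.1 • m) ⊗ₜ ω) := fun r => by
      rw [← TensorProduct.smul_tmul', TensorProduct.sub_tmul, smul_sub]
    have h8 : ∀ r : Refl W, c.val r • (m ⊗ₜ ω - (grp c r.1 • m) ⊗ₜ[ℂ] extRep W r.1 ω) =
        c.val r • (m ⊗ₜ ω) - c.val r • ((grp c r.1 • m) ⊗ₜ ω) + c.val r • ((grp c r.1 • m) ⊗ₜ[ℂ]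
          (ExteriorAlgebra.ι ℂ r.form * contr r.coroot ω)) := fun r => by
      rw [extRep_refl, TensorProduct.tmul_sub, smul_sub, smul_sub]
      abel
    simp only [h7, h8, Finset.sum_add_distrib]
    abel

lemma koszulPiece_eq (i : ℕ) (d : ℂ) : koszulPiece c M i d =
    Submodule.span ℂ {t | ∃ m ∈ wt c M (d - i), ∃ ω ∈ ⋀[ℂ]^i (Module.Dual ℂ 𝔥), t = m ⊗ₜ ω} := by
  refine le_antisymm ?_ (Submodule.span_le.mpr ?_)
  · rintro _ ⟨t, rfl⟩
    induction t using TensorProduct.induction_on with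
    | zero => rw [map_zero]; exact zero_mem _
    | add a b ha hb => rw [map_add]; exact add_mem ha hb
    | tmul m ω => exact Submodule.subset_span ⟨m.1, m.2, ω.1, ω.2, rfl⟩
  · rintro _ ⟨m, hm, ω, hω, rfl⟩
    exact ⟨⟨m, hm⟩ ⊗ₜ ⟨ω, hω⟩, rfl⟩

lemma koszulPiece_map {V : Type*} [AddCommGroup V] [Module ℂ V] {i : ℕ} {d : ℂ} {U : Submodule ℂ V}
    (f : Koszul c M →ₗ[ℂ] V)
    (hf : ∀ m ∈ wt c M (d - i), ∀ ω ∈ ⋀[ℂ]^i (Module.Dual ℂ 𝔥), f (m ⊗ₜ ω) ∈ U)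
    {t : Koszul c M} (ht : t ∈ koszulPiece c M i d) : f t ∈ U := by
  rw [koszulPiece_eq] at ht
  have : Submodule.span ℂ {t | ∃ m ∈ wt c M (d - i), ∃ ω ∈ ⋀[ℂ]^i (Module.Dual ℂ 𝔥),
      t = m ⊗ₜ ω} ≤ U.comap f := by
    refine Submodule.span_le.mpr ?_
    rintro _ ⟨m, hm, ω, hω, rfl⟩
    exact hf m hm ω hω
  exact this ht

lemma tmul_mem_koszulPiece {i : ℕ} {d : ℂ} {m : M} (hm : m ∈ wt c M (d - i))
    {ω : ExteriorAlgebra ℂ (Module.Dual ℂ 𝔥)} (hω : ω ∈ ⋀[ℂ]^i (Module.Dual ℂ 𝔥)) :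
    m ⊗ₜ ω ∈ koszulPiece c M i d := by
  rw [koszulPiece_eq]
  exact Submodule.subset_span ⟨m, hm, ω, hω, rfl⟩

lemma koszulD_mem {i : ℕ} {d : ℂ} {t : Koszul c M} (ht : t ∈ koszulPiece c M (i + 1) d) :
    koszulD c M t ∈ koszulPiece c M i d := by
  refine koszulPiece_map _ (fun m hm ω hω => ?_) ht
  rw [koszulD_tmul]
  refine sum_mem fun j _ => tmul_mem_koszulPiece ?_ (contr_mem _ hω)
  have h := lin_wt ((Module.finBasis ℂ 𝔥).coord j) hm
  convert h using 2
  push_cast; ring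

lemma koszulD_piece_zero {d : ℂ} {t : Koszul c M} (ht : t ∈ koszulPiece c M 0 d) :
    koszulD c M t = 0 := by
  refine koszulPiece_map (U := ⊥) (koszulD c M) (fun m hm ω hω => ?_) ht
  rw [koszulD_tmul]
  exact Finset.sum_eq_zero fun j _ => by rw [contr_mem_zero _ hω, TensorProduct.tmul_zero]

lemma koszulDelta_mem {i : ℕ} {d : ℂ} {t : Koszul c M} (ht : t ∈ koszulPiece c M i d) :
    koszulDelta c M t ∈ koszulPiece c M (i + 1) d := by
  refine koszulPiece_map _ (fun m hm ω hω => ?_) ht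
  rw [kosDelta_tmul]
  refine sum_mem fun j _ => tmul_mem_koszulPiece ?_ (wedge_mem _ hω)
  have h := dun_wt (Module.finBasis ℂ 𝔥 j) hm
  change dun c (Module.finBasis ℂ 𝔥 j) • m ∈ _
  convert h using 2
  push_cast; ring

/-- The grading operator has generalized eigenvalue `d` on the part of degree `d`. -/
lemma koszulPiece_le (i : ℕ) (d : ℂ) :
    koszulPiece c M i d ≤ (koszulEuler c M).maxGenEigenspace d := by
  intro t ht
  refine koszulPiece_map LinearMap.id (fun m hm ω hω => ?_) ht
  rw [LinearMap.id_apply, Module.End.mem_maxGenEigenspace]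
  rw [wt, Module.End.mem_maxGenEigenspace] at hm
  obtain ⟨k, hk⟩ := hm
  refine ⟨k, ?_⟩
  have key : ∀ (k : ℕ) (m : M), ((koszulEuler c M - d • 1) ^ k) (m ⊗ₜ ω) =
      ((act c M (euler c) - (d - i) • 1) ^ k) m ⊗ₜ ω := by
    intro k
    induction k with
    | zero => intro m; rfl
    | succ k ih =>
      intro m
      rw [pow_succ, pow_succ, Module.End.mul_apply, Module.End.mul_apply, ← ih]
      congr 1
      rw [LinearMap.sub_apply, koszulEuler_tmul, degOp_of_mem hω]
      simp only [LinearMap.sub_apply, LinearMap.smul_apply, Module.End.one_apply, act_apply,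
        TensorProduct.sub_tmul, TensorProduct.tmul_smul, TensorProduct.smul_tmul', sub_smul]
      abel
  rw [key, hk, TensorProduct.zero_tmul]

lemma koszulCycles_le (i : ℕ) (d : ℂ) : koszulCycles c M i d ≤ koszulPiece c M i d := inf_le_left

lemma koszulBoundaries_le (i : ℕ) (d : ℂ) : koszulBoundaries c M i d ≤ koszulCycles c M i d := by
  rintro _ ⟨t, ht, rfl⟩
  exact ⟨koszulD_mem ht, koszulD_koszulD c M t⟩

variable (c M) in
/-- The class of a cycle in `Tor`. -/
def torMk (i : ℕ) (d : ℂ) : koszulCycles c M i d →ₗ[ℂ] torDeg c M i d :=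
  ((koszulBoundaries c M i d).comap (koszulCycles c M i d).subtype).mkQ

lemma torMk_surjective (i : ℕ) (d : ℂ) : Function.Surjective (torMk c M i d) :=
  Submodule.mkQ_surjective _

lemma torMk_eq_zero {i : ℕ} {d : ℂ} {t : koszulCycles c M i d} :
    torMk c M i d t = 0 ↔ t.1 ∈ koszulBoundaries c M i d :=
  Submodule.Quotient.mk_eq_zero _

lemma torMk_rep (i : ℕ) (d : ℂ) (w : W) (t : koszulCycles c M i d) :
    (torDeg c M i d).ρ w (torMk c M i d t) = torMk c M i d (cyclesRep c M i d w t) := rfl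

lemma zAct_torMk {i : ℕ} {d : ℂ} (t : koszulCycles c M i d) :
    zAct c (torDeg c M i d).ρ (torMk c M i d t) = torMk c M i d (zAct c (cyclesRep c M i d) t) := by
  rw [zAct, zAct, LinearMap.sum_apply, LinearMap.sum_apply, map_sum]
  rfl

lemma zAct_cyclesRep_coe {i : ℕ} {d : ℂ} (t : koszulCycles c M i d) :
    (zAct c (cyclesRep c M i d) t).1 = zAct c (koszulRep c M) t.1 := by
  rw [zAct, zAct, LinearMap.sum_apply, LinearMap.sum_apply, AddSubmonoidClass.coe_finsetSum]
  rfl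

lemma koszulEuler_cycles {i : ℕ} {d : ℂ} (t : koszulCycles c M i d) :
    koszulEuler c M t.1 = zAct c (koszulRep c M) t.1 + koszulD c M (koszulDelta c M t.1) := by
  have h := koszulD_koszulDelta t.1
  rw [LinearMap.mem_ker.mp t.2.2, map_zero, add_zero] at h
  rw [h]
  abel

/-- On `Tor`, the grading is given by the action of `z_c`. -/
lemma torDeg_le_maxGenEigenspace (i : ℕ) (d : ℂ) (q : torDeg c M i d) :
    q ∈ (zAct c (torDeg c M i d).ρ).maxGenEigenspace d := by
  obtain ⟨t, rfl⟩ := torMk_surjective i d q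
  obtain ⟨k, hk⟩ := (Module.End.mem_maxGenEigenspace _ _ _).mp (koszulPiece_le i d t.2.1)
  rw [Module.End.mem_maxGenEigenspace]
  refine ⟨k, ?_⟩
  have key : ∀ (k : ℕ) (t : koszulCycles c M i d), ∃ s : koszulCycles c M i d,
      s.1 = ((koszulEuler c M - d • 1) ^ k) t.1 ∧
      torMk c M i d s = ((zAct c (torDeg c M i d).ρ - d • 1) ^ k) (torMk c M i d t) := by
    intro k
    induction k with
    | zero => intro t; exact ⟨t, rfl, rfl⟩
    | succ k ih =>
      intro t
      let b : koszulCycles c M i d := ⟨koszulD c M (koszulDelta c M t.1),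
        koszulBoundaries_le i d ⟨_, koszulDelta_mem t.2.1, rfl⟩⟩
      have hb : torMk c M i d b = 0 := torMk_eq_zero.mpr ⟨_, koszulDelta_mem t.2.1, rfl⟩
      obtain ⟨s, h1, h2⟩ := ih (zAct c (cyclesRep c M i d) t + b - d • t)
      refine ⟨s, ?_, ?_⟩
      · rw [h1, pow_succ, Module.End.mul_apply]
        congr 1
        rw [LinearMap.sub_apply, koszulEuler_cycles, LinearMap.smul_apply, Module.End.one_apply,
          ← zAct_cyclesRep_coe]
        rfl
      · rw [h2, pow_succ, Module.End.mul_apply]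
        congr 1
        rw [map_sub, map_add, hb, add_zero, map_smul, LinearMap.sub_apply, zAct_torMk,
          LinearMap.smul_apply, Module.End.one_apply]
  obtain ⟨s, h1, h2⟩ := key k t
  rw [← h2, torMk_eq_zero, h1, hk]
  exact zero_mem _

/-- Equivariant purity. -/
lemma torDeg_hom_eq_zero (E : Rep.{u} ℂ W) [E.ρ.IsIrreducible] {i : ℕ} {d : ℂ} (hd : d ≠ cFun c E)
    (f : E.ρ.IntertwiningMap (torDeg c M i d).ρ) : f = 0 := by
  ext e
  change f e = 0
  obtain ⟨k, hk⟩ := (Module.End.mem_maxGenEigenspace _ _ _).mp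
    (torDeg_le_maxGenEigenspace i d (f e))
  have hz : ∀ e, zAct c (torDeg c M i d).ρ (f e) = cFun c E • f e := by
    intro e
    have h1 : f (zAct c E.ρ e) = zAct c (torDeg c M i d).ρ (f e) := by
      change f.toLinearMap _ = zAct c (torDeg c M i d).ρ (f.toLinearMap e)
      rw [zAct, zAct, LinearMap.sum_apply, LinearMap.sum_apply, map_sum]
      refine Finset.sum_congr rfl fun r _ => ?_
      rw [LinearMap.smul_apply, LinearMap.smul_apply, map_smul, LinearMap.sub_apply,
        LinearMap.sub_apply, map_sub]
      congr 2
      exact LinearMap.congr_fun (f.isIntertwining' r.1) e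
    rw [← h1, cFun_spec]
    exact f.toLinearMap.map_smul _ _
  have hp : ∀ k : ℕ, ((zAct c (torDeg c M i d).ρ - d • 1) ^ k) (f e) =
      (cFun c E - d) ^ k • f e := by
    intro k
    induction k with
    | zero => rw [pow_zero, pow_zero, one_smul]; rfl
    | succ k ih =>
      rw [pow_succ', Module.End.mul_apply, ih, map_smul, LinearMap.sub_apply, hz,
        LinearMap.smul_apply, Module.End.one_apply, ← sub_smul, smul_smul, pow_succ]
  rw [hp] at hk
  exact (smul_eq_zero.mp hk).resolve_left (pow_ne_zero _ (sub_ne_zero.mpr (Ne.symm hd)))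

lemma eq_cFun_of_isotypicPart (E : Rep.{u} ℂ W) [E.ρ.IsIrreducible] {i : ℕ} {d : ℂ}
    (h : isotypicPart E (torDeg c M i d) ≠ ⊥) : d = cFun c E := by
  by_contra hd
  refine h ?_
  rw [isotypicPart, iSup_eq_bot]
  intro f
  rw [torDeg_hom_eq_zero E hd f]
  exact LinearMap.range_zero

lemma koszulPiece_le_lamPart (i : ℕ) (d : ℂ) : koszulPiece c M i d ≤ lamPart 𝔥 M i := by
  intro t ht
  exact koszulPiece_map LinearMap.id (fun m _ ω hω => tmul_mem_lamPart m hω) ht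

/-- The projection of the Koszul complex to a weight space of the module. -/
def LocNilp.koszulPr (hM : LocNilp M) (d : ℂ) : Module.End ℂ (Koszul c M) := (hM.pr d).rTensor _

lemma LocNilp.koszulPr_mem (hM : LocNilp M) {i : ℕ} (d : ℂ) {t : Koszul c M}
    (ht : t ∈ lamPart 𝔥 M i) : hM.koszulPr (d - i) t ∈ koszulPiece c M i d :=
  lamPart_map (hM.koszulPr (d - i))
    (fun m _ hω => tmul_mem_koszulPiece (hM.pr_mem _ m) hω) ht

lemma LocNilp.koszulPr_of_mem (hM : LocNilp M) {i : ℕ} {d : ℂ} {t : Koszul c M}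
    (ht : t ∈ koszulPiece c M i d) : hM.koszulPr (d - i) t = t := by
  refine sub_eq_zero.mp (koszulPiece_map (U := ⊥) (hM.koszulPr (d - i) - LinearMap.id)
    (fun m hm ω _ => ?_) ht)
  rw [Submodule.mem_bot, LinearMap.sub_apply, LocNilp.koszulPr, LinearMap.rTensor_tmul,
    hM.pr_of_mem hm, LinearMap.id_apply, sub_self]

lemma LocNilp.koszulD_koszulPr (hM : LocNilp M) (d : ℂ) (t : Koszul c M) :
    koszulD c M (hM.koszulPr d t) = hM.koszulPr (d + 1) (koszulD c M t) := by
  induction t using TensorProduct.induction_on with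
  | zero => simp only [map_zero]
  | add a b ha hb => simp only [map_add, ha, hb]
  | tmul m ω =>
    rw [LocNilp.koszulPr, LocNilp.koszulPr, LinearMap.rTensor_tmul, koszulD_tmul, koszulD_tmul,
      map_sum]
    simp only [LinearMap.rTensor_tmul, hM.lin_pr]

/-- Exactness of the Koszul complex implies the vanishing of `Tor` in positive degrees. -/
lemma torDeg_subsingleton (hM : LocNilp M) (hA : Acyc (linAct c M)) (i : ℕ) (d : ℂ) :
    Subsingleton (torDeg c M (i + 1) d) := by
  refine ⟨fun q q' => ?_⟩
  suffices h : ∀ q : torDeg c M (i + 1) d, q = 0 by rw [h q, h q']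
  intro q
  obtain ⟨t, rfl⟩ := torMk_surjective (i + 1) d q
  rw [torMk_eq_zero]
  obtain ⟨s, hs1, hs2⟩ := hA i t.1 (koszulPiece_le_lamPart _ _ t.2.1) (LinearMap.mem_ker.mp t.2.2)
  refine ⟨_, hM.koszulPr_mem (i := i + 2) d hs1, ?_⟩
  rw [hM.koszulD_koszulPr, koszulD_eq, hs2]
  have := hM.koszulPr_of_mem t.2.1
  convert this using 3
  push_cast; ring

end CherKoszul

section Acyclic

variable {𝔥 : Type u} [AddCommGroup 𝔥] [Module ℂ 𝔥] [FiniteDimensional ℂ 𝔥]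
  {W : Subgroup (𝔥 ≃ₗ[ℂ] 𝔥)} [Finite W] {c : Param W}

lemma Acyc.of_retract_module {M N : ModuleCat.{u} (Cher c)} (hN : Acyc (linAct c N))
    (p : M →ₗ[Cher c] N) (q : N →ₗ[Cher c] M) (h : ∀ m, q (p m) = m) : Acyc (linAct c M) :=
  Acyc.of_retract hN (p.restrictScalars ℂ) (q.restrictScalars ℂ)
    (fun x m => p.map_smul (mulOp c (lin x)) m) (fun x n => q.map_smul (mulOp c (lin x)) n) h

/-- Truncation of normal ordered expressions to degree less than `n` in the Dunkl operators. -/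
def pbwTrunc (K : Type*) (n : ℕ) : ((K × (Fin (Module.finrank ℂ 𝔥) →₀ ℕ)) →₀ Poly 𝔥) →ₗ[ℂ]
    ((K × (Fin (Module.finrank ℂ 𝔥) →₀ ℕ)) →₀ Poly 𝔥) :=
  Finsupp.lsum ℂ fun k => if k.2.degree < n then Finsupp.lsingle k else 0

lemma pbwTrunc_single {K : Type*} (n : ℕ) (k : K × (Fin (Module.finrank ℂ 𝔥) →₀ ℕ)) (f : Poly 𝔥) :
    pbwTrunc K n (Finsupp.single k f) = if k.2.degree < n then Finsupp.single k f else 0 := by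
  rw [pbwTrunc, Finsupp.lsum_single]
  split_ifs <;> rfl

lemma dunIdeal_eq (n : ℕ) {a : Cher c} (ha : a ∈ dunIdeal c n) :
    pbwTrunc W n ((pbwEquiv c (Module.finBasis ℂ 𝔥)).symm a) = 0 := by
  let b := Module.finBasis ℂ 𝔥
  have key : ∀ (a : Cher c) (α : Fin (Module.finrank ℂ 𝔥) →₀ ℕ), n ≤ α.degree →
      pbwTrunc W n ((pbwEquiv c b).symm (a * dunPoly c b (MvPolynomial.monomial α 1))) = 0 := by
    intro a α hα
    obtain ⟨t, rfl⟩ := (pbwEquiv c b).surjective a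
    induction t using Finsupp.induction_linear with
    | zero => simp only [map_zero, zero_mul]
    | add s t hs ht => rw [map_add, add_mul, map_add, map_add, hs, ht, add_zero]
    | single k f =>
      have h1 : MvPolynomial.monomial (k.2 + α) (1 : ℂ) =
          MvPolynomial.monomial k.2 1 * MvPolynomial.monomial α 1 := by
        rw [MvPolynomial.monomial_mul, one_mul]
      have h2 : pbwEquiv c b (Finsupp.single k f) * dunPoly c b (MvPolynomial.monomial α 1) =
          pbwEquiv c b (Finsupp.single (k.1, k.2 + α) f) := by
        rw [pbwEquiv_single, pbwEquiv_single, grpDun, grpDun, h1, map_mul, mul_assoc, mul_assoc]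
      rw [h2, LinearEquiv.symm_apply_apply, pbwTrunc_single, if_neg]
      rw [map_add]
      omega
  induction ha using Submodule.span_induction with
  | mem a ha =>
    obtain ⟨α, hα, rfl⟩ := ha
    have := key 1 α hα
    rwa [one_mul] at this
  | zero => rw [map_zero, map_zero]
  | add x y _ _ hx hy => rw [map_add, map_add, hx, hy, add_zero]
  | smul a x hx ih =>
    clear ih
    induction hx using Submodule.span_induction generalizing a with
    | mem x hx =>
      obtain ⟨α, hα, rfl⟩ := hx
      exact key a α hα
    | zero => rw [smul_zero, map_zero, map_zero]
    | add x y _ _ hx hy => rw [smul_add, map_add, map_add, hx, hy, add_zero]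
    | smul b x _ ih => rw [← mul_smul]; exact ih _

lemma finsuppLin_single {K : Type*} (x : Module.Dual ℂ 𝔥) (k : K) (f : Poly 𝔥) :
    finsuppLin K x (Finsupp.single k f) = Finsupp.single k (lin x * f) :=
  Finsupp.mapRange_single (hf := map_zero (polyLin 𝔥 x))

lemma pbwEquiv_symm_lin (x : Module.Dual ℂ 𝔥) (a : Cher c) :
    (pbwEquiv c (Module.finBasis ℂ 𝔥)).symm (mulOp c (lin x) * a) =
      finsuppLin _ x ((pbwEquiv c (Module.finBasis ℂ 𝔥)).symm a) := by
  rw [LinearEquiv.symm_apply_eq]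
  obtain ⟨t, rfl⟩ := (pbwEquiv c (Module.finBasis ℂ 𝔥)).surjective a
  rw [LinearEquiv.symm_apply_apply]
  induction t using Finsupp.induction_linear with
  | zero => simp only [map_zero, mul_zero]
  | add s t hs ht => rw [map_add, mul_add, map_add, map_add, hs, ht]
  | single k f =>
    rw [finsuppLin_single, pbwEquiv_single, pbwEquiv_single, map_mul, mul_assoc]

/-- As a module over `ℂ[𝔥]`, the cyclic module is a retract of a free module. -/
lemma exists_cyc_retract (n : ℕ) :
    ∃ (p : cyc c n →ₗ[ℂ] ((W × (Fin (Module.finrank ℂ 𝔥) →₀ ℕ)) →₀ Poly 𝔥))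
      (q : ((W × (Fin (Module.finrank ℂ 𝔥) →₀ ℕ)) →₀ Poly 𝔥) →ₗ[ℂ] cyc c n),
      (∀ x t, p (linAct c (cyc c n) x t) = finsuppLin _ x (p t)) ∧
      (∀ x t, q (finsuppLin _ x t) = linAct c (cyc c n) x (q t)) ∧ ∀ t, q (p t) = t := by
  let b := Module.finBasis ℂ 𝔥
  have htrunc : ∀ (x : Module.Dual ℂ 𝔥) t,
      pbwTrunc W n (finsuppLin _ x t) = finsuppLin _ x (pbwTrunc W n t) := by
    intro x t
    induction t using Finsupp.induction_linear with
    | zero => simp only [map_zero]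
    | add s t hs ht => simp only [map_add, hs, ht]
    | single k f =>
      rw [finsuppLin_single, pbwTrunc_single, pbwTrunc_single]
      split_ifs
      · rw [finsuppLin_single]
      · rw [map_zero]
  let J : Submodule ℂ (Cher c) := (dunIdeal c n).restrictScalars ℂ
  let p : cyc c n →ₗ[ℂ] ((W × (Fin (Module.finrank ℂ 𝔥) →₀ ℕ)) →₀ Poly 𝔥) :=
    { toFun := Quotient.lift (fun a => pbwTrunc W n ((pbwEquiv c b).symm a)) (by
        intro a a' h
        have h1 : a - a' ∈ dunIdeal c n := (Submodule.quotientRel_def _).mp h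
        have h2 := dunIdeal_eq n h1
        rw [map_sub, map_sub, sub_eq_zero] at h2
        exact h2)
      map_add' := by
        rintro ⟨a⟩ ⟨a'⟩
        exact (congrArg _ (map_add _ a a')).trans (map_add _ _ _)
      map_smul' := by
        rintro z ⟨a⟩
        have h : z • (dunIdeal c n).mkQ a = (dunIdeal c n).mkQ (z • a) := by
          rw [← algebraMap_smul (Cher c) z (a : Cher c), map_smul]
          rfl
        exact (congrArg _ (map_smul _ z a)).trans (map_smul _ _ _) }
  let q : ((W × (Fin (Module.finrank ℂ 𝔥) →₀ ℕ)) →₀ Poly 𝔥) →ₗ[ℂ] cyc c n :=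
    { toFun := fun t => (dunIdeal c n).mkQ (pbwEquiv c b t)
      map_add' := fun s t => by rw [map_add, map_add]
      map_smul' := fun z t => by
        rw [map_smul, ← algebraMap_smul (Cher c) z (pbwEquiv c b t), map_smul]
        rfl }
  refine ⟨p, q, ?_, ?_, ?_⟩
  · rintro x ⟨a⟩
    change pbwTrunc W n ((pbwEquiv c b).symm (mulOp c (lin x) * a)) =
      finsuppLin _ x (pbwTrunc W n ((pbwEquiv c b).symm a))
    rw [pbwEquiv_symm_lin, htrunc]
  · intro x t
    change (dunIdeal c n).mkQ _ = mulOp c (lin x) • (dunIdeal c n).mkQ _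
    rw [← map_smul, smul_eq_mul]
    congr 1
    rw [← LinearEquiv.eq_symm_apply, pbwEquiv_symm_lin, LinearEquiv.symm_apply_apply]
  · rintro ⟨a⟩
    change (dunIdeal c n).mkQ (pbwEquiv c b (pbwTrunc W n ((pbwEquiv c b).symm a))) =
      (dunIdeal c n).mkQ a
    obtain ⟨t, rfl⟩ := (pbwEquiv c b).surjective a
    rw [LinearEquiv.symm_apply_apply]
    induction t using Finsupp.induction_linear with
    | zero => simp only [map_zero]
    | add s t hs ht => simp only [map_add, hs, ht]
    | single k f =>
      rw [pbwTrunc_single]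
      split_ifs with hk
      · rfl
      · rw [map_zero, map_zero, eq_comm, Submodule.mkQ_apply, Submodule.Quotient.mk_eq_zero,
          pbwEquiv_single, grpDun, ← mul_assoc]
        exact Submodule.smul_mem _ _ (Submodule.subset_span ⟨k.2, not_lt.mp hk, rfl⟩)

lemma acyc_cyc (n : ℕ) : Acyc (linAct c (cyc c n)) := by
  obtain ⟨p, q, h1, h2, h3⟩ := exists_cyc_retract (c := c) n
  exact Acyc.of_retract (acyc_finsupp (𝔥 := 𝔥) (W × (Fin (Module.finrank ℂ 𝔥) →₀ ℕ))) p q h1 h2 h3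

lemma projIdem_comp_projIdem (d : ℂ) : projIdem c d ∘ₗ projIdem c d = projIdem c d := by
  refine cyc_hom_ext (M := cyc c (nilpOrd c d)) ?_
  rw [LinearMap.comp_apply, projIdem_gen, projIdem_projElt]

lemma acyc_projMod (d : ℂ) : Acyc (linAct c (projMod c d)) := by
  refine Acyc.of_retract_module (acyc_cyc (nilpOrd c d)) (LinearMap.range (projIdem c d)).subtype
    (projIdem c d).rangeRestrict ?_
  rintro ⟨_, y, rfl⟩
  exact Subtype.ext (LinearMap.congr_fun (projIdem_comp_projIdem d) y)

lemma acyc_projSum {k : ℕ} (d : Fin k → ℂ) : Acyc (linAct c (projSum (c := c) d)) := by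
  refine Acyc.of_sum (κ := Fin k) (F := fun j => projMod c (d j)) (fun j => acyc_projMod (d j))
    (fun j => (LinearMap.proj (R := Cher c) (φ := fun j => projMod c (d j)) j).restrictScalars ℂ)
    (fun j => (LinearMap.single (Cher c) (fun j => projMod c (d j)) j).restrictScalars ℂ)
    (fun j x v => rfl)
    (fun j x v => (LinearMap.single (Cher c) (fun j => projMod c (d j)) j).map_smul
      (mulOp c (lin x)) v) fun v => ⟨Finset.univ, fun T hT => ?_⟩
  rw [Finset.univ_subset_iff.mp hT]
  exact Finset.univ_sum_single v

lemma acyc_of_projective (P : CatO c) [Projective P] : Acyc (linAct c P.obj) := by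
  obtain ⟨k, d, f, hf⟩ := exists_epi_projObj P
  refine Acyc.of_retract_module (acyc_projSum d) (homO (Projective.factorThru (𝟙 P) f)) (homO f) ?_
  intro m
  have := Projective.factorThru_comp (𝟙 P) f
  exact congrArg (fun g => homO g m) this

end Acyclic

section FiniteGroups

variable {G : Type u} [Group G] [Finite G]
  {V V' V'' : Type u} [AddCommGroup V] [Module ℂ V] [AddCommGroup V'] [Module ℂ V']
  [AddCommGroup V''] [Module ℂ V'']
  {ρ : Representation ℂ G V} {σ : Representation ℂ G V'} {τ : Representation ℂ G V''}

variable (ρ σ) in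
/-- The average over the group of a linear map between representations. -/
def avg (l : V →ₗ[ℂ] V') : ρ.IntertwiningMap σ := by
  letI := Fintype.ofFinite G
  exact
  { toLinearMap := (Fintype.card G : ℂ)⁻¹ • ∑ g : G, σ g ∘ₗ l ∘ₗ ρ g⁻¹
    isIntertwining' := fun h => by
      ext v
      simp only [LinearMap.comp_apply, LinearMap.smul_apply, LinearMap.sum_apply, map_smul, map_sum]
      congr 1
      refine Fintype.sum_equiv (Equiv.mulLeft h⁻¹) _ _ fun g => ?_
      change σ g (l (ρ g⁻¹ (ρ h v))) = σ h (σ (h⁻¹ * g) (l (ρ (h⁻¹ * g)⁻¹ v)))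
      rw [← Module.End.mul_apply, ← Module.End.mul_apply (f := σ h), ← map_mul, ← map_mul]
      congr 2
      · group
      · congr 2; group }

lemma avg_apply [Fintype G] (l : V →ₗ[ℂ] V') (v : V) :
    avg ρ σ l v = (Fintype.card G : ℂ)⁻¹ • ∑ g : G, σ g (l (ρ g⁻¹ v)) := by
  obtain rfl : ‹Fintype G› = Fintype.ofFinite G := Subsingleton.elim _ _
  let _ := Fintype.ofFinite G
  change ((Fintype.card G : ℂ)⁻¹ • ∑ g : G, σ g ∘ₗ l ∘ₗ ρ g⁻¹) v = _
  rw [LinearMap.smul_apply, LinearMap.sum_apply]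
  rfl

lemma rep_apply_inv (g : G) (v : V) : ρ g (ρ g⁻¹ v) = v := by
  rw [← Module.End.mul_apply, ← map_mul, mul_inv_cancel, map_one, Module.End.one_apply]

lemma comp_avg (π : σ.IntertwiningMap τ) (h : ρ.IntertwiningMap τ) (l : V →ₗ[ℂ] V')
    (hl : ∀ v, π (l v) = h v) (v : V) : π (avg ρ σ l v) = h v := by
  have := Fintype.ofFinite G
  have h0 : (Fintype.card G : ℂ) ≠ 0 := by exact_mod_cast Fintype.card_ne_zero
  have h1 : ∀ g : G, π (σ g (l (ρ g⁻¹ v))) = h v := fun g => by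
    rw [π.isIntertwining, hl, ← h.isIntertwining, rep_apply_inv]
  rw [avg_apply, map_smul, map_sum]
  simp only [h1, Finset.sum_const, Finset.card_univ]
  rw [← Nat.cast_smul_eq_nsmul ℂ, smul_smul, inv_mul_cancel₀ h0, one_smul]

lemma avg_comp (π : ρ.IntertwiningMap σ) (h : ρ.IntertwiningMap τ) (l : V' →ₗ[ℂ] V'')
    (hl : ∀ v, l (π v) = h v) (v : V) : avg σ τ l (π v) = h v := by
  have := Fintype.ofFinite G
  have h0 : (Fintype.card G : ℂ) ≠ 0 := by exact_mod_cast Fintype.card_ne_zero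
  have h1 : ∀ g : G, τ g (l (σ g⁻¹ (π v))) = h v := fun g => by
    rw [← π.isIntertwining, hl, h.isIntertwining, rep_apply_inv]
  rw [avg_apply]
  simp only [h1, Finset.sum_const, Finset.card_univ]
  rw [← Nat.cast_smul_eq_nsmul ℂ, smul_smul, inv_mul_cancel₀ h0, one_smul]

lemma exists_lift {π : σ.IntertwiningMap τ} (hπ : Function.Surjective π)
    (h : ρ.IntertwiningMap τ) : ∃ k : ρ.IntertwiningMap σ, ∀ v, π (k v) = h v := by
  obtain ⟨l, hl⟩ := π.toLinearMap.exists_rightInverse_of_surjective (LinearMap.range_eq_top.mpr hπ)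
  exact ⟨avg ρ σ (l ∘ₗ h.toLinearMap), comp_avg π h _ fun v => LinearMap.congr_fun hl (h v)⟩

lemma exists_retract {π : ρ.IntertwiningMap σ} (hπ : Function.Injective π) :
    ∃ k : σ.IntertwiningMap ρ, ∀ v, k (π v) = v := by
  obtain ⟨l, hl⟩ := π.toLinearMap.exists_leftInverse_of_injective (LinearMap.ker_eq_bot.mpr hπ)
  exact ⟨avg σ ρ l, avg_comp π (.id ρ) _ fun v => LinearMap.congr_fun hl v⟩

variable (ρ σ) in
/-- The dimension of the space of homomorphisms between two representations. -/
def mult : ℕ := Module.finrank ℂ (ρ.IntertwiningMap σ)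

lemma mult_congr (e : σ.Equiv τ) : mult ρ σ = mult ρ τ :=
  LinearEquiv.finrank_eq
    { toFun := fun f => e.toIntertwiningMap.comp f
      invFun := fun f => e.symm.toIntertwiningMap.comp f
      map_add' := fun f g => by ext v; exact map_add e (f v) (g v)
      map_smul' := fun a f => by ext v; exact map_smul e a (f v)
      left_inv := fun f => by ext v; exact e.toLinearEquiv.symm_apply_apply (f v)
      right_inv := fun f => by ext v; exact e.toLinearEquiv.apply_symm_apply (f v) }

lemma mult_eq_zero_of_subsingleton [Subsingleton V'] : mult ρ σ = 0 := by
  have : Subsingleton (ρ.IntertwiningMap σ) :=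
    ⟨fun f g => by ext v; exact Subsingleton.elim (f v) (g v)⟩
  exact Module.finrank_zero_of_subsingleton

/-- The multiplicity is additive in short exact sequences. -/
lemma mult_exact {U : Type u} [AddCommGroup U] [Module ℂ U] [FiniteDimensional ℂ U]
    (θ : Representation ℂ G U) [FiniteDimensional ℂ V']
    (f : ρ.IntertwiningMap σ) (g : σ.IntertwiningMap τ) (hf : Function.Injective f)
    (hg : Function.Surjective g) (hfg : ∀ v, g v = 0 ↔ ∃ w, f w = v) :
    mult θ σ = mult θ ρ + mult θ τ := by
  let F : θ.IntertwiningMap ρ →ₗ[ℂ] θ.IntertwiningMap σ :=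
    { toFun := fun h => f.comp h
      map_add' := fun h k => by ext v; exact map_add f (h v) (k v)
      map_smul' := fun a h => by ext v; exact map_smul f a (h v) }
  let K : θ.IntertwiningMap σ →ₗ[ℂ] θ.IntertwiningMap τ :=
    { toFun := fun h => g.comp h
      map_add' := fun h k => by ext v; exact map_add g (h v) (k v)
      map_smul' := fun a h => by ext v; exact map_smul g a (h v) }
  have hF : Function.Injective F := fun h k hhk => by
    ext v
    exact hf (congrArg (fun h : θ.IntertwiningMap σ => h v) hhk)
  have hK : Function.Surjective K := fun h => by
    obtain ⟨k, hk⟩ := exists_lift hg h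
    exact ⟨k, by ext v; exact hk v⟩
  have hrange : LinearMap.ker K = LinearMap.range F := by
    ext h
    constructor
    · intro hh
      have h1 : ∀ v, ∃ w, f w = h v := fun v =>
        (hfg _).mp (congrArg (fun h : θ.IntertwiningMap τ => h v) hh)
      obtain ⟨r, hr⟩ := exists_retract hf
      refine ⟨r.comp h, ?_⟩
      ext v
      obtain ⟨w, hw⟩ := h1 v
      change f (r (h v)) = h v
      rw [← hw, hr]
    · rintro ⟨k, rfl⟩
      change K (F k) = 0
      ext v
      exact (hfg _).mpr ⟨k v, rfl⟩
  have h1 := LinearMap.finrank_range_add_finrank_ker K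
  rw [LinearMap.range_eq_top.mpr hK, finrank_top, hrange, LinearMap.finrank_range_of_inj hF] at h1
  unfold mult
  omega

lemma exists_irreducible_sub [FiniteDimensional ℂ V] [Nontrivial V] (ρ : Representation ℂ G V) :
    ∃ (E : Rep.{u} ℂ G) (_ : E.ρ.IsIrreducible) (f : E.ρ.IntertwiningMap ρ),
      Function.Injective f := by
  have hne : ∃ n, ∃ S : Subrepresentation ρ, S.toSubmodule ≠ ⊥ ∧
      Module.finrank ℂ S.toSubmodule = n := ⟨_, ⊤, top_ne_bot, rfl⟩
  classical
  obtain ⟨S, hS, hn⟩ := Nat.find_spec hne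
  have hmin : ∀ T : Subrepresentation ρ, T.toSubmodule ≤ S.toSubmodule → T.toSubmodule ≠ ⊥ →
      T.toSubmodule = S.toSubmodule := by
    intro T hTS hT
    refine Submodule.eq_of_le_of_finrank_le hTS ?_
    rw [hn]
    exact Nat.find_min' hne ⟨T, hT, rfl⟩
  refine ⟨Rep.of S.toRepresentation, ?_, ⟨S.toSubmodule.subtype, fun g => rfl⟩,
    Subtype.val_injective⟩
  have hnt : Nontrivial (Subrepresentation S.toRepresentation) := by
    refine ⟨⊥, ⊤, fun h => hS ?_⟩
    have h1 : (⊥ : Submodule ℂ S.toSubmodule) = ⊤ := congrArg Subrepresentation.toSubmodule h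
    exact Submodule.subsingleton_iff_eq_bot.mp
      ((Submodule.subsingleton_iff ℂ).mp (subsingleton_of_bot_eq_top h1))
  refine { eq_bot_or_eq_top := fun T => ?_ }
  let T' : Subrepresentation ρ := ⟨T.toSubmodule.map S.toSubmodule.subtype, by
    rintro g _ ⟨t, ht, rfl⟩
    exact ⟨_, T.apply_mem_toSubmodule g ht, rfl⟩⟩
  by_cases hT : T'.toSubmodule = ⊥
  · left
    refine Subrepresentation.toSubmodule_injective ?_
    refine (Submodule.eq_bot_iff _).mpr fun x hx => ?_
    have h1 : x.1 ∈ T'.toSubmodule := ⟨x, hx, rfl⟩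
    rw [hT] at h1
    exact Subtype.ext h1
  · right
    refine Subrepresentation.toSubmodule_injective ?_
    have h1 := hmin T' (Submodule.map_subtype_le _ _) hT
    refine eq_top_iff.mpr ?_
    rintro x -
    have h2 : x.1 ∈ T'.toSubmodule := by rw [h1]; exact x.2
    obtain ⟨t, ht, htx⟩ := h2
    have : t = x := Subtype.ext htx
    rwa [← this]

/-- Finite dimensional representations with the same multiplicities are equivalent. -/
lemma equiv_of_mult_aux (n : ℕ) : ∀ {V V' : Type u} [AddCommGroup V] [Module ℂ V] [AddCommGroup V']
    [Module ℂ V'] [FiniteDimensional ℂ V] [FiniteDimensional ℂ V']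
    (ρ : Representation ℂ G V) (σ : Representation ℂ G V'), Module.finrank ℂ V = n →
    (∀ (E : Rep.{u} ℂ G) [E.ρ.IsIrreducible] [FiniteDimensional ℂ E], mult E.ρ ρ = mult E.ρ σ) → Nonempty (ρ.Equiv σ) := by
  induction n using Nat.strong_induction_on with
  | _ n ih =>
  intro V V' _ _ _ _ _ _ ρ σ hn hm
  rcases subsingleton_or_nontrivial V with hV | hV
  · have hV' : Subsingleton V' := by
      by_contra hcon
      rw [not_subsingleton_iff_nontrivial] at hcon
      obtain ⟨E, hE, f, hf⟩ := exists_irreducible_sub σ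
      have : FiniteDimensional ℂ E := FiniteDimensional.of_injective f.toLinearMap hf
      have h1 : mult E.ρ σ = 0 := by rw [← hm E]; exact mult_eq_zero_of_subsingleton
      have h2 : Subsingleton (E.ρ.IntertwiningMap σ) := Module.finrank_zero_iff.mp h1
      have h3 : f = 0 := Subsingleton.elim _ _
      have h4 : (⊥ : Subrepresentation E.ρ) = ⊤ := by
        ext e
        have : e = 0 := hf (by rw [h3]; rfl)
        rw [this]
        exact ⟨fun _ => zero_mem _, fun _ => zero_mem _⟩
      exact bot_ne_top h4
    exact ⟨Representation.Equiv.mk (LinearEquiv.ofSubsingleton _ _)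
      fun g => LinearMap.ext fun v => Subsingleton.elim _ _⟩
  · obtain ⟨E, hE, f, hf⟩ := exists_irreducible_sub ρ
    have hfin : FiniteDimensional ℂ E := FiniteDimensional.of_injective f.toLinearMap hf
    have hnt : Nontrivial E := by
      by_contra hcon
      rw [not_nontrivial_iff_subsingleton] at hcon
      have h4 : (⊥ : Subrepresentation E.ρ) = ⊤ := by
        ext e
        have : e = 0 := Subsingleton.elim _ _
        rw [this]
        exact ⟨fun _ => zero_mem _, fun _ => zero_mem _⟩
      exact bot_ne_top h4
    have hpos : mult E.ρ σ ≠ 0 := by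
      rw [← hm E]
      intro h1
      have h2 : Subsingleton (E.ρ.IntertwiningMap ρ) := Module.finrank_zero_iff.mp h1
      have h3 : f = 0 := Subsingleton.elim _ _
      obtain ⟨e, he⟩ := exists_ne (0 : E)
      exact he (hf (by rw [h3]; rfl))
    obtain ⟨f', hf'⟩ : ∃ f' : E.ρ.IntertwiningMap σ, f' ≠ 0 := by
      by_contra! hcon
      have : Subsingleton (E.ρ.IntertwiningMap σ) := ⟨fun a b => by rw [hcon a, hcon b]⟩
      exact hpos Module.finrank_zero_of_subsingleton
    have hf'i : Function.Injective f' :=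
      (Representation.IsIrreducible.injective_or_eq_zero f').resolve_right hf'
    obtain ⟨r, hr⟩ := exists_retract hf
    obtain ⟨r', hr'⟩ := exists_retract hf'i
    let K : Subrepresentation ρ := r.ker
    let K' : Subrepresentation σ := r'.ker
    have hsplit : ∀ {U : Type u} [AddCommGroup U] [Module ℂ U] [FiniteDimensional ℂ U]
        (θ : Representation ℂ G U) (f : E.ρ.IntertwiningMap θ) (r : θ.IntertwiningMap E.ρ),
        (∀ v, r (f v) = v) → ∀ (X : Rep.{u} ℂ G) [X.ρ.IsIrreducible] [FiniteDimensional ℂ X], mult X.ρ θ =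
          mult X.ρ r.ker.toRepresentation + mult X.ρ E.ρ := by
      intro U _ _ _ θ f r hr X hX hXf
      refine mult_exact X.ρ ⟨r.ker.toSubmodule.subtype, fun g => rfl⟩ r Subtype.val_injective
        (fun e => ⟨f e, hr e⟩) fun v => ⟨fun hv => ⟨⟨v, hv⟩, rfl⟩, ?_⟩
      rintro ⟨w, rfl⟩
      exact w.2
    have hlt : Module.finrank ℂ K.toSubmodule < n := by
      rw [← hn]
      refine Submodule.finrank_lt fun htop => ?_
      obtain ⟨e, he⟩ := exists_ne (0 : E)
      have : f e ∈ K.toSubmodule := by rw [htop]; trivial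
      have h2 : r (f e) = 0 := this
      rw [hr] at h2
      exact he h2
    obtain ⟨φ⟩ := ih _ hlt K.toRepresentation K'.toRepresentation rfl fun X hX hXf => by
      have h1 : mult X.ρ ρ = mult X.ρ K.toRepresentation + mult X.ρ E.ρ := hsplit ρ f r hr X
      have h2 : mult X.ρ σ = mult X.ρ K'.toRepresentation + mult X.ρ E.ρ := hsplit σ f' r' hr' X
      have h3 := hm X
      omega
    have hdec : ∀ v, v - f (r v) ∈ K.toSubmodule := fun v => by
      change r (v - f (r v)) = 0
      rw [map_sub, hr, sub_self]
    let Φ : V →ₗ[ℂ] V' := f'.toLinearMap ∘ₗ r.toLinearMap + K'.toSubmodule.subtype ∘ₗ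
      φ.toIntertwiningMap.toLinearMap ∘ₗ
        (LinearMap.id - f.toLinearMap ∘ₗ r.toLinearMap).codRestrict K.toSubmodule hdec
    have hΦ : ∀ v, Φ v = f' (r v) + (φ ⟨v - f (r v), hdec v⟩ : K'.toSubmodule).1 := fun v => rfl
    have hr'φ : ∀ k, r' (φ k : K'.toSubmodule).1 = 0 := fun k => (φ k).2
    have hΦr : ∀ v, r' (Φ v) = r v := fun v => by
      rw [hΦ, map_add, hr', hr'φ, add_zero]
    have hinj : Function.Injective Φ := by
      rw [injective_iff_map_eq_zero]
      intro v hv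
      have h1 : r v = 0 := by rw [← hΦr, hv, map_zero]
      have h2 := hΦ v
      have h0 : f' (r v) = 0 := by rw [h1, map_zero]
      rw [hv, h0, zero_add] at h2
      have h3 : φ ⟨v - f (r v), hdec v⟩ = 0 := Subtype.ext h2.symm
      have h4 : (⟨v - f (r v), hdec v⟩ : K.toSubmodule) = 0 :=
        φ.toLinearEquiv.map_eq_zero_iff.mp h3
      have h5 : v - f (r v) = 0 := congrArg Subtype.val h4
      rwa [h1, map_zero, sub_zero] at h5
    have hsurj : Function.Surjective Φ := by
      intro w
      have hw : r' (w - f' (r' w)) = 0 := by rw [map_sub, hr', sub_self]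
      obtain ⟨k, hk⟩ := φ.toLinearEquiv.surjective ⟨w - f' (r' w), hw⟩
      have hrk : r k.1 = 0 := k.2
      have h1 : r (f (r' w) + k.1) = r' w := by rw [map_add, hr, hrk, add_zero]
      refine ⟨f (r' w) + k.1, ?_⟩
      rw [hΦ]
      have h2 : (⟨f (r' w) + k.1 - f (r (f (r' w) + k.1)), hdec _⟩ : K.toSubmodule) = k := by
        refine Subtype.ext ?_
        change f (r' w) + k.1 - f (r (f (r' w) + k.1)) = k.1
        rw [h1, add_sub_cancel_left]
      have h3 : (φ k : K'.toSubmodule).1 = w - f' (r' w) := congrArg Subtype.val hk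
      rw [h2, h1, h3, add_sub_cancel]
    refine ⟨Representation.Equiv.mk (LinearEquiv.ofBijective Φ ⟨hinj, hsurj⟩) fun g => ?_⟩
    refine LinearMap.ext fun v => ?_
    change Φ (ρ g v) = σ g (Φ v)
    have h0 : f' (r (ρ g v)) = σ g (f' (r v)) := by rw [r.isIntertwining, f'.isIntertwining]
    rw [hΦ, hΦ, map_add, h0]
    have h1 : (⟨ρ g v - f (r (ρ g v)), hdec _⟩ : K.toSubmodule) =
        K.toRepresentation g ⟨v - f (r v), hdec v⟩ := by
      refine Subtype.ext ?_
      change ρ g v - f (r (ρ g v)) = ρ g (v - f (r v))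
      rw [map_sub, r.isIntertwining, f.isIntertwining]
    have h2 := φ.toIntertwiningMap.isIntertwining _ _ g (⟨v - f (r v), hdec v⟩ : K.toSubmodule)
    have h3 : (φ (K.toRepresentation g ⟨v - f (r v), hdec v⟩) : K'.toSubmodule).1 =
        σ g (φ ⟨v - f (r v), hdec v⟩ : K'.toSubmodule).1 := congrArg Subtype.val h2
    rw [← h3, h1]

/-- Finite dimensional representations with the same multiplicities are equivalent. -/
lemma equiv_of_mult [FiniteDimensional ℂ V] [FiniteDimensional ℂ V']
    (ρ : Representation ℂ G V) (σ : Representation ℂ G V')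
    (h : ∀ (E : Rep.{u} ℂ G) [E.ρ.IsIrreducible] [FiniteDimensional ℂ E], mult E.ρ ρ = mult E.ρ σ) :
    Nonempty (ρ.Equiv σ) :=
  equiv_of_mult_aux _ ρ σ rfl h

end FiniteGroups

section Multiplicity

variable {G : Type u} [Group G] [Finite G]
  {V₁ V₂ V₃ V₄ V₅ : Type u} [AddCommGroup V₁] [Module ℂ V₁] [AddCommGroup V₂] [Module ℂ V₂]
  [AddCommGroup V₃] [Module ℂ V₃] [AddCommGroup V₄] [Module ℂ V₄] [AddCommGroup V₅] [Module ℂ V₅]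
  {ρ₁ : Representation ℂ G V₁} {ρ₂ : Representation ℂ G V₂} {ρ₃ : Representation ℂ G V₃}
  {ρ₄ : Representation ℂ G V₄} {ρ₅ : Representation ℂ G V₅}

lemma exists_lift_of_forall (π : ρ₂.IntertwiningMap ρ₃) (h : ρ₁.IntertwiningMap ρ₃)
    (hh : ∀ v, ∃ w, π w = h v) : ∃ k : ρ₁.IntertwiningMap ρ₂, ∀ v, π (k v) = h v := by
  obtain ⟨l, hl⟩ := π.toLinearMap.rangeRestrict.exists_rightInverse_of_surjective
    (LinearMap.range_rangeRestrict _)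
  let h' : V₁ →ₗ[ℂ] LinearMap.range π.toLinearMap := h.toLinearMap.codRestrict _ hh
  refine ⟨avg ρ₁ ρ₂ (l ∘ₗ h'), comp_avg π h _ fun v => ?_⟩
  exact congrArg Subtype.val (LinearMap.congr_fun hl (h' v))

/-- Composition with a homomorphism of representations. -/
def homMap (ρ₁ : Representation ℂ G V₁) (f : ρ₂.IntertwiningMap ρ₃) :
    ρ₁.IntertwiningMap ρ₂ →ₗ[ℂ] ρ₁.IntertwiningMap ρ₃ where
  toFun h := f.comp h
  map_add' h k := by ext v; exact map_add f (h v) (k v)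
  map_smul' a h := by ext v; exact map_smul f a (h v)

lemma homMap_eq_zero (f : ρ₂.IntertwiningMap ρ₃) (h : ρ₁.IntertwiningMap ρ₂) :
    homMap ρ₁ f h = 0 ↔ ∀ v, f (h v) = 0 :=
  ⟨fun hh v => congrArg (fun k : ρ₁.IntertwiningMap ρ₃ => k v) hh, fun hh => by ext v; exact hh v⟩

lemma homMap_surjective (ρ₁ : Representation ℂ G V₁) {f : ρ₂.IntertwiningMap ρ₃}
    (hf : Function.Surjective f) : Function.Surjective (homMap ρ₁ f) := fun h => by
  obtain ⟨k, hk⟩ := exists_lift_of_forall f h fun v => hf _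
  exact ⟨k, by ext v; exact hk v⟩

lemma ker_homMap (ρ₁ : Representation ℂ G V₁) {f : ρ₂.IntertwiningMap ρ₃} {g : ρ₃.IntertwiningMap ρ₄}
    (hfg : ∀ v, g v = 0 ↔ ∃ w, f w = v) :
    LinearMap.ker (homMap ρ₁ g) = LinearMap.range (homMap ρ₁ f) := by
  ext h
  rw [LinearMap.mem_ker, homMap_eq_zero]
  constructor
  · intro hh
    obtain ⟨k, hk⟩ := exists_lift_of_forall f h fun v => (hfg _).mp (hh v)
    exact ⟨k, by ext v; exact hk v⟩
  · rintro ⟨k, rfl⟩ v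
    exact (hfg _).mpr ⟨k v, rfl⟩

/-- Multiplicities of a connecting homomorphism, presented as a correspondence, whose target is the
kernel of a homomorphism. -/
lemma mult_eq_finrank_ker [FiniteDimensional ℂ V₂] (θ : Rep.{u} ℂ G) [FiniteDimensional ℂ θ]
    (p : ρ₂.IntertwiningMap ρ₁) (q : ρ₂.IntertwiningMap ρ₃) (f : ρ₃.IntertwiningMap ρ₄)
    (hp : Function.Surjective p) (hpq : ∀ v, p v = 0 ↔ q v = 0)
    (hqf : ∀ v, f v = 0 ↔ ∃ w, q w = v) :
    mult θ.ρ ρ₁ = Module.finrank ℂ (LinearMap.ker (homMap θ.ρ f)) := by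
  have h1 := LinearMap.finrank_range_add_finrank_ker (homMap θ.ρ p)
  have h2 := LinearMap.finrank_range_add_finrank_ker (homMap θ.ρ q)
  have h3 : LinearMap.ker (homMap θ.ρ p) = LinearMap.ker (homMap θ.ρ q) := by
    ext h
    simp only [LinearMap.mem_ker, homMap_eq_zero, hpq]
  rw [LinearMap.range_eq_top.mpr (homMap_surjective θ.ρ hp), finrank_top, h3] at h1
  rw [ker_homMap θ.ρ hqf]
  unfold mult
  omega

/-- Multiplicities in a four term exact sequence. -/
lemma mult_four [FiniteDimensional ℂ V₂] [FiniteDimensional ℂ V₃] [FiniteDimensional ℂ V₄]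
    (θ : Rep.{u} ℂ G) [FiniteDimensional ℂ θ]
    (p : ρ₂.IntertwiningMap ρ₁) (q : ρ₂.IntertwiningMap ρ₃) (f : ρ₃.IntertwiningMap ρ₄)
    (g : ρ₄.IntertwiningMap ρ₅)
    (hp : Function.Surjective p) (hpq : ∀ v, p v = 0 ↔ q v = 0)
    (hqf : ∀ v, f v = 0 ↔ ∃ w, q w = v) (hfg : ∀ v, g v = 0 ↔ ∃ w, f w = v)
    (hg : Function.Surjective g) :
    mult θ.ρ ρ₁ + mult θ.ρ ρ₄ = mult θ.ρ ρ₃ + mult θ.ρ ρ₅ := by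
  have h1 := mult_eq_finrank_ker θ p q f hp hpq hqf
  have h2 := LinearMap.finrank_range_add_finrank_ker (homMap θ.ρ f)
  have h3 := LinearMap.finrank_range_add_finrank_ker (homMap θ.ρ g)
  rw [LinearMap.range_eq_top.mpr (homMap_surjective θ.ρ hg), finrank_top, ker_homMap θ.ρ hfg] at h3
  unfold mult at *
  omega

lemma mult_eq_of_ker_eq [FiniteDimensional ℂ V₂] (θ : Rep.{u} ℂ G) [FiniteDimensional ℂ θ]
    (p : ρ₂.IntertwiningMap ρ₁) (q : ρ₂.IntertwiningMap ρ₃)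
    (hp : Function.Surjective p) (hpq : ∀ v, p v = 0 ↔ q v = 0) (hq : Function.Surjective q) :
    mult θ.ρ ρ₁ = mult θ.ρ ρ₃ := by
  have h1 := LinearMap.finrank_range_add_finrank_ker (homMap θ.ρ p)
  have h2 := LinearMap.finrank_range_add_finrank_ker (homMap θ.ρ q)
  have h3 : LinearMap.ker (homMap θ.ρ p) = LinearMap.ker (homMap θ.ρ q) := by
    ext h
    simp only [LinearMap.mem_ker, homMap_eq_zero, hpq]
  rw [LinearMap.range_eq_top.mpr (homMap_surjective θ.ρ hp), finrank_top, h3] at h1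
  rw [LinearMap.range_eq_top.mpr (homMap_surjective θ.ρ hq), finrank_top] at h2
  unfold mult
  omega

end Multiplicity

section KoszulMaps

variable {𝔥 : Type u} [AddCommGroup 𝔥] [Module ℂ 𝔥] [FiniteDimensional ℂ 𝔥]
  {W : Subgroup (𝔥 ≃ₗ[ℂ] 𝔥)} [Finite W] {c : Param W}
  {M N : ModuleCat.{u} (Cher c)}

lemma exists_lamProj (i : ℕ) : ∃ π : Module.End ℂ (ExteriorAlgebra ℂ (Module.Dual ℂ 𝔥)),
    (∀ ω, π ω ∈ ⋀[ℂ]^i (Module.Dual ℂ 𝔥)) ∧ ∀ ω ∈ ⋀[ℂ]^i (Module.Dual ℂ 𝔥), π ω = ω := by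
  obtain ⟨l, hl⟩ := (⋀[ℂ]^i (Module.Dual ℂ 𝔥)).subtype.exists_leftInverse_of_injective
    (Submodule.ker_subtype _)
  exact ⟨(⋀[ℂ]^i (Module.Dual ℂ 𝔥)).subtype ∘ₗ l, fun ω => (l ω).2,
    fun ω hω => congrArg Subtype.val (LinearMap.congr_fun hl ⟨ω, hω⟩)⟩

/-- A projection of the exterior algebra onto its part of degree `i`. -/
def lamProj (𝔥 : Type u) [AddCommGroup 𝔥] [Module ℂ 𝔥] [FiniteDimensional ℂ 𝔥] (i : ℕ) :
    Module.End ℂ (ExteriorAlgebra ℂ (Module.Dual ℂ 𝔥)) := (exists_lamProj (𝔥 := 𝔥) i).choose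

/-- A projection of the Koszul complex onto its piece of homological degree `i` and internal
degree `d`. -/
def LocNilp.piecePr (hM : LocNilp M) (i : ℕ) (d : ℂ) : Module.End ℂ (Koszul c M) :=
  TensorProduct.map (hM.pr (d - i)) (lamProj 𝔥 i)

lemma LocNilp.piecePr_mem (hM : LocNilp M) (i : ℕ) (d : ℂ) (t : Koszul c M) :
    hM.piecePr i d t ∈ koszulPiece c M i d := by
  induction t using TensorProduct.induction_on with
  | zero => rw [map_zero]; exact zero_mem _
  | add a b ha hb => rw [map_add]; exact add_mem ha hb
  | tmul m ω =>
    exact tmul_mem_koszulPiece (hM.pr_mem _ m) ((exists_lamProj (𝔥 := 𝔥) i).choose_spec.1 ω)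

lemma LocNilp.piecePr_of_mem (hM : LocNilp M) {i : ℕ} {d : ℂ} {t : Koszul c M}
    (ht : t ∈ koszulPiece c M i d) : hM.piecePr i d t = t := by
  refine sub_eq_zero.mp (koszulPiece_map (U := ⊥) (hM.piecePr i d - LinearMap.id)
    (fun m hm ω hω => ?_) ht)
  have h : lamProj 𝔥 i ω = ω := (exists_lamProj (𝔥 := 𝔥) i).choose_spec.2 ω hω
  rw [Submodule.mem_bot, LinearMap.sub_apply, LocNilp.piecePr, TensorProduct.map_tmul,
    hM.pr_of_mem hm, h, LinearMap.id_apply, sub_self]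

/-- The map of Koszul complexes induced by a homomorphism. -/
def kosMap (f : M →ₗ[Cher c] N) : Koszul c M →ₗ[ℂ] Koszul c N := (f.restrictScalars ℂ).rTensor _

lemma kosMap_koszulD (f : M →ₗ[Cher c] N) (t : Koszul c M) :
    koszulD c N (kosMap f t) = kosMap f (koszulD c M t) :=
  kosD_rTensor (A := linAct c M) (A' := linAct c N) (fun _ m => f.map_smul _ m) t

lemma kosMap_koszulRep (f : M →ₗ[Cher c] N) (w : W) (t : Koszul c M) :
    koszulRep c N w (kosMap f t) = kosMap f (koszulRep c M w t) := by
  induction t using TensorProduct.induction_on with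
  | zero => simp only [map_zero]
  | add a b ha hb => simp only [map_add, ha, hb]
  | tmul m ω =>
    change (grp c w • f m) ⊗ₜ[ℂ] extRep W w ω = f (grp c w • m) ⊗ₜ[ℂ] extRep W w ω
    rw [map_smul]

lemma kosMap_mem (f : M →ₗ[Cher c] N) {i : ℕ} {d : ℂ} {t : Koszul c M}
    (ht : t ∈ koszulPiece c M i d) : kosMap f t ∈ koszulPiece c N i d :=
  koszulPiece_map (kosMap f) (fun _ hm _ hω => tmul_mem_koszulPiece (wt_map f _ hm) hω) ht

lemma kosMap_piecePr (hM : LocNilp M) (hN : LocNilp N) (f : M →ₗ[Cher c] N) (i : ℕ) (d : ℂ)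
    (t : Koszul c M) : hN.piecePr i d (kosMap f t) = kosMap f (hM.piecePr i d t) := by
  induction t using TensorProduct.induction_on with
  | zero => simp only [map_zero]
  | add a b ha hb => simp only [map_add, ha, hb]
  | tmul m ω =>
    change hN.pr (d - i) (f m) ⊗ₜ[ℂ] lamProj 𝔥 i ω = f (hM.pr (d - i) m) ⊗ₜ[ℂ] lamProj 𝔥 i ω
    rw [hM.pr_map hN]

lemma kosMap_injective {f : M →ₗ[Cher c] N} (hf : Function.Injective f) :
    Function.Injective (kosMap f) := Module.Flat.rTensor_preserves_injective_linearMap _ hf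

lemma exists_kosMap_eq {f : M →ₗ[Cher c] N} (hM : LocNilp M) (hN : LocNilp N)
    (hf : Function.Surjective f) {i : ℕ} {d : ℂ} {t : Koszul c N} (ht : t ∈ koszulPiece c N i d) :
    ∃ s ∈ koszulPiece c M i d, kosMap f s = t := by
  obtain ⟨s, rfl⟩ := LinearMap.rTensor_surjective (ExteriorAlgebra ℂ (Module.Dual ℂ 𝔥))
    (g := f.restrictScalars ℂ) hf t
  refine ⟨hM.piecePr i d s, hM.piecePr_mem i d s, ?_⟩
  rw [← kosMap_piecePr hM hN]
  exact hN.piecePr_of_mem ht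

lemma exists_kosMap_eq_of_zero {L : ModuleCat.{u} (Cher c)} {f : L →ₗ[Cher c] M}
    {g : M →ₗ[Cher c] N} (hL : LocNilp L) (hM : LocNilp M)
    (hfg : Function.Exact f g) (hg : Function.Surjective g) {i : ℕ} {d : ℂ} {t : Koszul c M}
    (ht : t ∈ koszulPiece c M i d) (h0 : kosMap g t = 0) :
    ∃ s ∈ koszulPiece c L i d, kosMap f s = t := by
  have hex := rTensor_exact (ExteriorAlgebra ℂ (Module.Dual ℂ 𝔥)) (f := f.restrictScalars ℂ)
    (g := g.restrictScalars ℂ) hfg hg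
  obtain ⟨s, rfl⟩ := (hex t).mp h0
  refine ⟨hL.piecePr i d s, hL.piecePr_mem i d s, ?_⟩
  rw [← kosMap_piecePr hL hM]
  exact hM.piecePr_of_mem ht

lemma kosMap_mem_cycles (f : M →ₗ[Cher c] N) {i : ℕ} {d : ℂ} {t : Koszul c M}
    (ht : t ∈ koszulCycles c M i d) : kosMap f t ∈ koszulCycles c N i d :=
  ⟨kosMap_mem f ht.1, LinearMap.mem_ker.mpr (by
    rw [kosMap_koszulD, LinearMap.mem_ker.mp ht.2, map_zero])⟩

/-- The map on `Tor` induced by a homomorphism. -/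
def torMap (f : M →ₗ[Cher c] N) (i : ℕ) (d : ℂ) :
    (torDeg c M i d).ρ.IntertwiningMap (torDeg c N i d).ρ where
  toLinearMap := Submodule.mapQ _ _ ((kosMap f).restrict (p := koszulCycles c M i d)
    (q := koszulCycles c N i d) fun t ht => kosMap_mem_cycles f ht) (by
    rintro ⟨t, ht⟩ ⟨s, hs, hst⟩
    exact ⟨kosMap f s, kosMap_mem f hs, by rw [kosMap_koszulD, hst]; rfl⟩)
  isIntertwining' w := by
    refine LinearMap.ext fun q => ?_
    obtain ⟨t, rfl⟩ := torMk_surjective i d q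
    refine congrArg (torMk c N i d) (Subtype.ext ?_)
    exact (kosMap_koszulRep f w t.1).symm

lemma torMap_torMk (f : M →ₗ[Cher c] N) {i : ℕ} {d : ℂ} (t : koszulCycles c M i d)
    (ht : kosMap f t.1 ∈ koszulCycles c N i d) :
    torMap f i d (torMk c M i d t) = torMk c N i d ⟨kosMap f t.1, ht⟩ := rfl

lemma finite_koszulPiece (hM : objO c M) (i : ℕ) (d : ℂ) : FiniteDimensional ℂ (koszulPiece c M i d) := by
  have := hM.finite_wt (d - i)
  have : FiniteDimensional ℂ (⋀[ℂ]^i (Module.Dual ℂ 𝔥)) := inferInstance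
  exact Module.Finite.range _

lemma finite_torDeg (hM : objO c M) (i : ℕ) (d : ℂ) : FiniteDimensional ℂ (torDeg c M i d) := by
  have := finite_koszulPiece hM i d
  have : FiniteDimensional ℂ (koszulCycles c M i d) :=
    Submodule.finiteDimensional_of_le (koszulCycles_le i d)
  exact Module.Finite.of_surjective _ (torMk_surjective i d)

end KoszulMaps

section Recursion

variable {𝔥 : Type u} [AddCommGroup 𝔥] [Module ℂ 𝔥] [FiniteDimensional ℂ 𝔥]
  {W : Subgroup (𝔥 ≃ₗ[ℂ] 𝔥)} [Finite W] {c : Param W}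
  {L M N : ModuleCat.{u} (Cher c)}

/-- Pairs of composable homomorphisms forming a short exact sequence in category `O_c`. -/
structure IsSES (f : L →ₗ[Cher c] M) (g : M →ₗ[Cher c] N) : Prop where
  inj : Function.Injective f
  exact : Function.Exact f g
  surj : Function.Surjective g
  left : objO c L
  mid : objO c M
  right : objO c N

variable {f : L →ₗ[Cher c] M} {g : M →ₗ[Cher c] N}

/-- The correspondence defining the connecting homomorphism. -/
def connSub (g : M →ₗ[Cher c] N) (i : ℕ) (d : ℂ) : Submodule ℂ (Koszul c M) :=
  koszulPiece c M (i + 1) d ⊓ LinearMap.ker (kosMap g ∘ₗ koszulD c M)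

lemma mem_connSub {i : ℕ} {d : ℂ} {t : Koszul c M} :
    t ∈ connSub g i d ↔ t ∈ koszulPiece c M (i + 1) d ∧ kosMap g (koszulD c M t) = 0 := Iff.rfl

lemma connSub_stable (g : M →ₗ[Cher c] N) (i : ℕ) (d : ℂ) (w : W) :
    connSub g i d ≤ (connSub g i d).comap (koszulRep c M w) := by
  intro t ht
  rw [mem_connSub] at ht
  rw [Submodule.mem_comap, mem_connSub]
  refine ⟨koszulPiece_stable c M _ d w ht.1, ?_⟩
  rw [← koszulRep_koszulD, ← kosMap_koszulRep, ht.2, map_zero]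

/-- The action of `W` on the correspondence defining the connecting homomorphism. -/
def connRep (g : M →ₗ[Cher c] N) (i : ℕ) (d : ℂ) : Representation ℂ W (connSub g i d) :=
  (koszulRep c M).subrepresentation _ (connSub_stable g i d)

lemma kosMap_comp_eq_zero (h : IsSES f g) (t : Koszul c L) : kosMap g (kosMap f t) = 0 := by
  induction t using TensorProduct.induction_on with
  | zero => simp only [map_zero]
  | add a b ha hb => simp only [map_add, ha, hb, add_zero]
  | tmul m ω =>
    change g (f m) ⊗ₜ[ℂ] ω = 0
    rw [h.exact.apply_apply_eq_zero, TensorProduct.zero_tmul]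

lemma exists_kosMap_retract (h : IsSES f g) : ∃ r : Koszul c M →ₗ[ℂ] Koszul c L,
    ∀ t, r (kosMap f t) = t := by
  obtain ⟨r, hr⟩ := (kosMap f).exists_leftInverse_of_injective
    (LinearMap.ker_eq_bot.mpr (kosMap_injective h.inj))
  exact ⟨r, LinearMap.congr_fun hr⟩

lemma exists_connSub_preimage (h : IsSES f g) {i : ℕ} {d : ℂ} {t : Koszul c M}
    (ht : t ∈ connSub g i d) : ∃ s ∈ koszulCycles c L i d, kosMap f s = koszulD c M t := by
  rw [mem_connSub] at ht
  obtain ⟨s, hs, hst⟩ := exists_kosMap_eq_of_zero (LocNilp.of_objO h.left) (LocNilp.of_objO h.mid)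
    h.exact h.surj (koszulD_mem ht.1) ht.2
  refine ⟨s, ⟨hs, LinearMap.mem_ker.mpr (kosMap_injective h.inj ?_)⟩, hst⟩
  rw [← kosMap_koszulD, hst, koszulD_koszulD, map_zero]

/-- The projection of the correspondence to the homology of the quotient. -/
def connRight (g : M →ₗ[Cher c] N) (i : ℕ) (d : ℂ) :
    (connRep g i d).IntertwiningMap (torDeg c N (i + 1) d).ρ where
  toLinearMap := torMk c N (i + 1) d ∘ₗ (kosMap g).restrict (p := connSub g i d)
    (q := koszulCycles c N (i + 1) d) fun t ht => ⟨kosMap_mem g ht.1, LinearMap.mem_ker.mpr (by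
      rw [kosMap_koszulD]; exact ht.2)⟩
  isIntertwining' w := by
    refine LinearMap.ext fun t => ?_
    exact congrArg (torMk c N (i + 1) d) (Subtype.ext (kosMap_koszulRep g w t.1).symm)

lemma exists_connLeft (h : IsSES f g) (i : ℕ) (d : ℂ) :
    ∃ q : (connRep g i d).IntertwiningMap (torDeg c L i d).ρ,
      ∀ (t : connSub g i d) (s : koszulCycles c L i d), kosMap f s.1 = koszulD c M t.1 →
        q t = torMk c L i d s := by
  obtain ⟨r, hr⟩ := exists_kosMap_retract h
  have hmem : ∀ t ∈ connSub g i d, (r ∘ₗ koszulD c M) t ∈ koszulCycles c L i d := fun t ht => by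
    obtain ⟨s, hs, hst⟩ := exists_connSub_preimage h ht
    rw [LinearMap.comp_apply, ← hst, hr]
    exact hs
  have hval : ∀ (t : connSub g i d) (s : koszulCycles c L i d), kosMap f s.1 = koszulD c M t.1 →
      (r ∘ₗ koszulD c M).restrict hmem t = s := fun t s hst => Subtype.ext (by
    change r (koszulD c M t.1) = s.1
    rw [← hst, hr])
  refine ⟨⟨torMk c L i d ∘ₗ (r ∘ₗ koszulD c M).restrict hmem, fun w => ?_⟩, fun t s hst =>
    congrArg (torMk c L i d) (hval t s hst)⟩
  refine LinearMap.ext fun t => ?_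
  obtain ⟨s, hs, hst⟩ := exists_connSub_preimage h t.2
  rw [LinearMap.comp_apply, LinearMap.comp_apply, LinearMap.comp_apply, LinearMap.comp_apply,
    hval t ⟨s, hs⟩ hst, hval (connRep g i d w t) (cyclesRep c L i d w ⟨s, hs⟩)]
  · rfl
  · change kosMap f (koszulRep c L w s) = koszulD c M (koszulRep c M w t.1)
    rw [← kosMap_koszulRep, hst, koszulRep_koszulD]

lemma connRight_surjective (h : IsSES f g) (i : ℕ) (d : ℂ) :
    Function.Surjective (connRight g i d) := by
  intro q
  obtain ⟨t, rfl⟩ := torMk_surjective (i + 1) d q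
  obtain ⟨s, hs, hst⟩ := exists_kosMap_eq (LocNilp.of_objO h.mid) (LocNilp.of_objO h.right) h.surj
    t.2.1
  refine ⟨⟨s, mem_connSub.mpr ⟨hs, ?_⟩⟩, congrArg (torMk c N (i + 1) d) (Subtype.ext hst)⟩
  rw [← kosMap_koszulD, hst]
  exact t.2.2

lemma connRight_eq_zero {i : ℕ} {d : ℂ} (t : connSub g i d) :
    connRight g i d t = 0 ↔ kosMap g t.1 ∈ koszulBoundaries c N (i + 1) d := torMk_eq_zero

lemma conn_ker (h : IsSES f g) {i : ℕ} {d : ℂ} (hM : Subsingleton (torDeg c M (i + 1) d))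
    {q : (connRep g i d).IntertwiningMap (torDeg c L i d).ρ}
    (hq : ∀ (t : connSub g i d) (s : koszulCycles c L i d), kosMap f s.1 = koszulD c M t.1 →
        q t = torMk c L i d s) (t : connSub g i d) : connRight g i d t = 0 ↔ q t = 0 := by
  have hLn := LocNilp.of_objO h.left
  have hMn := LocNilp.of_objO h.mid
  have hNn := LocNilp.of_objO h.right
  obtain ⟨s, hs, hst⟩ := exists_connSub_preimage h t.2
  rw [hq t ⟨s, hs⟩ hst, torMk_eq_zero, connRight_eq_zero]
  constructor
  · rintro ⟨y, hy, hyt⟩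
    obtain ⟨x, hx, rfl⟩ := exists_kosMap_eq hMn hNn h.surj hy
    obtain ⟨a, ha, hat⟩ := exists_kosMap_eq_of_zero hLn hMn h.exact h.surj
      (sub_mem t.2.1 (koszulD_mem hx)) (by rw [map_sub, ← kosMap_koszulD, hyt, sub_self])
    refine ⟨a, ha, kosMap_injective h.inj ?_⟩
    rw [← kosMap_koszulD, hat, map_sub, koszulD_koszulD, sub_zero, ← hst]
  · rintro ⟨a, ha, has⟩
    have has' : koszulD c L a = s := has
    have hcyc : t.1 - kosMap f a ∈ koszulCycles c M (i + 1) d := by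
      refine ⟨sub_mem t.2.1 (kosMap_mem f ha), LinearMap.mem_ker.mpr ?_⟩
      rw [map_sub, kosMap_koszulD, has', hst, sub_self]
    have h0 : torMk c M (i + 1) d ⟨_, hcyc⟩ = 0 := Subsingleton.elim _ _
    rw [torMk_eq_zero] at h0
    obtain ⟨x, hx, hxt⟩ := h0
    refine ⟨kosMap g x, kosMap_mem g hx, ?_⟩
    rw [kosMap_koszulD, hxt]
    change kosMap g (t.1 - kosMap f a) = _
    rw [map_sub, kosMap_comp_eq_zero h, sub_zero]

lemma conn_exact (h : IsSES f g) {i : ℕ} {d : ℂ}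
    {q : (connRep g i d).IntertwiningMap (torDeg c L i d).ρ}
    (hq : ∀ (t : connSub g i d) (s : koszulCycles c L i d), kosMap f s.1 = koszulD c M t.1 →
        q t = torMk c L i d s) (v : torDeg c L i d) :
    torMap f i d v = 0 ↔ ∃ t, q t = v := by
  obtain ⟨s, rfl⟩ := torMk_surjective i d v
  rw [torMap_torMk f s (kosMap_mem_cycles f s.2), torMk_eq_zero]
  constructor
  · rintro ⟨t, ht, hts⟩
    refine ⟨⟨t, mem_connSub.mpr ⟨ht, ?_⟩⟩, hq _ _ hts.symm⟩
    rw [hts]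
    exact kosMap_comp_eq_zero h _
  · rintro ⟨t, ht⟩
    obtain ⟨s', hs', hst'⟩ := exists_connSub_preimage h t.2
    rw [hq t ⟨s', hs'⟩ hst', ← sub_eq_zero, ← map_sub, torMk_eq_zero] at ht
    obtain ⟨x, hx, hxs⟩ := ht
    have hxs' : koszulD c L x = s' - s.1 := hxs
    refine ⟨t.1 - kosMap f x, sub_mem t.2.1 (kosMap_mem f hx), ?_⟩
    rw [map_sub, kosMap_koszulD, hxs', map_sub, hst', sub_sub_cancel]

lemma torMap_exact (h : IsSES f g) {i : ℕ} {d : ℂ} (v : torDeg c M i d) :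
    torMap g i d v = 0 ↔ ∃ u, torMap f i d u = v := by
  have hLn := LocNilp.of_objO h.left
  have hMn := LocNilp.of_objO h.mid
  have hNn := LocNilp.of_objO h.right
  constructor
  · obtain ⟨s, rfl⟩ := torMk_surjective i d v
    rw [torMap_torMk g s (kosMap_mem_cycles g s.2), torMk_eq_zero]
    rintro ⟨y, hy, hys⟩
    have hys' : koszulD c N y = kosMap g s.1 := hys
    obtain ⟨x, hx, rfl⟩ := exists_kosMap_eq hMn hNn h.surj hy
    obtain ⟨a, ha, has⟩ := exists_kosMap_eq_of_zero hLn hMn h.exact h.surj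
      (sub_mem s.2.1 (koszulD_mem hx)) (by rw [map_sub, ← kosMap_koszulD, hys', sub_self])
    have hac : a ∈ koszulCycles c L i d := by
      refine ⟨ha, LinearMap.mem_ker.mpr (kosMap_injective h.inj ?_)⟩
      rw [← kosMap_koszulD, has, map_sub, koszulD_koszulD, LinearMap.mem_ker.mp s.2.2, sub_zero,
        map_zero]
    refine ⟨torMk c L i d ⟨a, hac⟩, ?_⟩
    rw [torMap_torMk f ⟨a, hac⟩ (kosMap_mem_cycles f hac), ← sub_eq_zero, ← map_sub, torMk_eq_zero]
    refine ⟨-x, neg_mem hx, ?_⟩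
    change koszulD c M (-x) = kosMap f a - s.1
    rw [has, map_neg]
    abel
  · rintro ⟨u, rfl⟩
    obtain ⟨s, rfl⟩ := torMk_surjective i d u
    rw [torMap_torMk f s (kosMap_mem_cycles f s.2),
      torMap_torMk g _ (kosMap_mem_cycles g (kosMap_mem_cycles f s.2)), torMk_eq_zero]
    change kosMap g (kosMap f s.1) ∈ _
    rw [kosMap_comp_eq_zero h]
    exact zero_mem _

lemma torMap_zero_surjective (h : IsSES f g) (d : ℂ) : Function.Surjective (torMap g 0 d) := by
  intro v
  obtain ⟨t, rfl⟩ := torMk_surjective 0 d v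
  obtain ⟨s, hs, hst⟩ := exists_kosMap_eq (LocNilp.of_objO h.mid) (LocNilp.of_objO h.right) h.surj
    t.2.1
  have hsc : s ∈ koszulCycles c M 0 d := ⟨hs, koszulD_piece_zero hs⟩
  refine ⟨torMk c M 0 d ⟨s, hsc⟩, ?_⟩
  rw [torMap_torMk g ⟨s, hsc⟩ (kosMap_mem_cycles g hsc)]
  exact congrArg _ (Subtype.ext hst)

variable (θ : Rep.{u} ℂ W) [FiniteDimensional ℂ θ]

lemma finite_connSub (h : IsSES f g) (i : ℕ) (d : ℂ) : FiniteDimensional ℂ (connSub g i d) := by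
  have := finite_koszulPiece h.mid (i + 1) d
  exact Submodule.finiteDimensional_of_le inf_le_left

/-- Dimension shifting for the multiplicities in `Tor`. -/
lemma mult_torDeg_succ (h : IsSES f g) (i : ℕ) (d : ℂ) (h1 : Subsingleton (torDeg c M (i + 1) d))
    (h0 : Subsingleton (torDeg c M i d)) :
    mult θ.ρ (torDeg c N (i + 1) d).ρ = mult θ.ρ (torDeg c L i d).ρ := by
  have := finite_connSub h i d
  obtain ⟨q, hq⟩ := exists_connLeft h i d
  refine mult_eq_of_ker_eq θ (connRight g i d) q (connRight_surjective h i d) (conn_ker h h1 hq) ?_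
  intro v
  exact (conn_exact h hq v).mp (Subsingleton.elim _ _)

lemma mult_torDeg_zero (h : IsSES f g) (d : ℂ) (h1 : Subsingleton (torDeg c M 1 d)) :
    mult θ.ρ (torDeg c N 1 d).ρ + mult θ.ρ (torDeg c M 0 d).ρ =
      mult θ.ρ (torDeg c L 0 d).ρ + mult θ.ρ (torDeg c N 0 d).ρ := by
  have := finite_connSub h 0 d
  have := finite_torDeg h.left 0 d
  have := finite_torDeg h.mid 0 d
  obtain ⟨q, hq⟩ := exists_connLeft h 0 d
  exact mult_four θ (connRight g 0 d) q (torMap f 0 d) (torMap g 0 d) (connRight_surjective h 0 d)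
    (conn_ker h h1 hq) (conn_exact h hq) (torMap_exact h) (torMap_zero_surjective h d)

variable (M)

lemma exists_hStar_eq_koszulD (hM : LocNilp M) {d : ℂ} {m : M} (hm : m ∈ wt c M d)
    (hS : m ∈ hStar c M) : ∃ t ∈ koszulPiece c M 1 d, koszulD c M t = m ⊗ₜ 1 := by
  have h1 := hM.pr_hStar (Module.finBasis ℂ 𝔥) d hS
  rw [hM.pr_of_mem hm] at h1
  suffices h : (⨆ i, (wt c M (d - 1)).map (act c M (mulOp c (lin ((Module.finBasis ℂ 𝔥).coord i))))) ≤
      ((koszulPiece c M 1 d).map (koszulD c M)).comap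
        ((TensorProduct.mk ℂ M (ExteriorAlgebra ℂ (Module.Dual ℂ 𝔥))).flip 1) by
    exact h h1
  refine iSup_le fun i => ?_
  rintro _ ⟨n, hn, rfl⟩
  refine ⟨n ⊗ₜ ExteriorAlgebra.ι ℂ ((Module.finBasis ℂ 𝔥).coord i), tmul_mem_koszulPiece ?_ ?_, ?_⟩
  · rwa [Nat.cast_one]
  · have := wedge_mem (𝔥 := 𝔥) ((Module.finBasis ℂ 𝔥).coord i) (i := 0) (ω := 1)
      (by change (1 : ExteriorAlgebra ℂ (Module.Dual ℂ 𝔥)) ∈ _ ^ 0; rw [pow_zero]; exact Submodule.one_le.mp le_rfl)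
    rwa [wedge_apply, mul_one] at this
  · have hc : ∀ j, contr (Module.finBasis ℂ 𝔥 j) (ExteriorAlgebra.ι ℂ ((Module.finBasis ℂ 𝔥).coord i)) =
        if j = i then 1 else 0 := fun j => by
      have h := contr_ι_mul (Module.finBasis ℂ 𝔥 j) ((Module.finBasis ℂ 𝔥).coord i) 1
      have h' := contr_algebraMap (Module.finBasis ℂ 𝔥 j) 1
      rw [map_one] at h'
      rw [mul_one, h', mul_zero, sub_zero] at h
      rw [h, Module.Basis.coord_apply, Module.Basis.repr_self, Finsupp.single_apply]
      split_ifs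
      · rw [one_smul]
      · rw [zero_smul]
    rw [koszulD_tmul, Finset.sum_eq_single i]
    · rw [hc, if_pos rfl]; rfl
    · intro j _ hj
      rw [hc, if_neg hj, TensorProduct.tmul_zero]
    · intro h; exact absurd (Finset.mem_univ i) h

lemma mem_hStar_of_koszulD {t : Koszul c M} {m : M} (h : koszulD c M t = m ⊗ₜ 1) : m ∈ hStar c M := by
  let ε : Koszul c M →ₗ[ℂ] M := (TensorProduct.rid ℂ M).toLinearMap ∘ₗ
    (ExteriorAlgebra.algebraMapInv (R := ℂ) (M := Module.Dual ℂ 𝔥)).toLinearMap.lTensor M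
  have hε : ∀ (m : M) ω, ε (m ⊗ₜ ω) = ExteriorAlgebra.algebraMapInv ω • m := fun m ω => rfl
  have h1 : ∀ t, ε (koszulD c M t) ∈ hStar c M := by
    intro t
    induction t using TensorProduct.induction_on with
    | zero => simp only [map_zero]; exact zero_mem _
    | add a b ha hb => simp only [map_add]; exact add_mem ha hb
    | tmul m ω =>
      rw [koszulD_tmul, map_sum]
      refine sum_mem fun i _ => ?_
      rw [hε]
      exact Submodule.smul_mem _ _ (Submodule.subset_span ⟨_, _, rfl⟩)
  have h2 := h1 t
  rwa [h, hε, map_one, one_smul] at h2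

/-- `Tor_0` and the coinvariants have the same multiplicities. -/
lemma mult_torDeg_coinvWt (hM : objO c M) (d : ℂ) : mult θ.ρ (torDeg c M 0 d).ρ =
    mult θ.ρ ((coinvRep c M).subrepresentation (coinvWt c M d) (coinvWt_stable c M d)) := by
  have hL := LocNilp.of_objO hM
  have := hM.finite_wt d
  have h1 : (1 : ExteriorAlgebra ℂ (Module.Dual ℂ 𝔥)) ∈ ⋀[ℂ]^0 (Module.Dual ℂ 𝔥) := by
    change _ ∈ _ ^ 0
    rw [pow_zero]
    exact Submodule.one_le.mp le_rfl
  have hmem : ∀ m ∈ wt c M d, (TensorProduct.mk ℂ M (ExteriorAlgebra ℂ (Module.Dual ℂ 𝔥))).flip 1 m ∈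
      koszulCycles c M 0 d := fun m hm => by
    have h2 : m ⊗ₜ[ℂ] (1 : ExteriorAlgebra ℂ (Module.Dual ℂ 𝔥)) ∈ koszulPiece c M 0 d :=
      tmul_mem_koszulPiece (by rwa [Nat.cast_zero, sub_zero]) h1
    exact ⟨h2, koszulD_piece_zero h2⟩
  let p : (wtRep c M d).IntertwiningMap (torDeg c M 0 d).ρ :=
    { toLinearMap := torMk c M 0 d ∘ₗ
        ((TensorProduct.mk ℂ M (ExteriorAlgebra ℂ (Module.Dual ℂ 𝔥))).flip 1).restrict hmem
      isIntertwining' := fun w => by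
        refine LinearMap.ext fun m => congrArg (torMk c M 0 d) (Subtype.ext ?_)
        change (grp c w • m.1) ⊗ₜ[ℂ] (1 : ExteriorAlgebra ℂ (Module.Dual ℂ 𝔥)) =
          (grp c w • m.1) ⊗ₜ[ℂ] extRep W w 1
        rw [show extRep W w 1 = 1 from map_one (ExteriorAlgebra.map (dualRep W w))] }
  let q : (wtRep c M d).IntertwiningMap
      ((coinvRep c M).subrepresentation (coinvWt c M d) (coinvWt_stable c M d)) :=
    { toLinearMap := (hStar c M).mkQ.restrict fun m hm => ⟨m, hm, rfl⟩
      isIntertwining' := fun w => rfl }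
  refine mult_eq_of_ker_eq θ p q ?_ ?_ ?_
  · intro v
    obtain ⟨t, rfl⟩ := torMk_surjective 0 d v
    have ht := t.2.1
    have : t.1 ∈ (wt c M d).map ((TensorProduct.mk ℂ M (ExteriorAlgebra ℂ (Module.Dual ℂ 𝔥))).flip 1) := by
      refine koszulPiece_map LinearMap.id (fun m hm ω hω => ?_) ht
      rw [Nat.cast_zero, sub_zero] at hm
      change ω ∈ _ ^ 0 at hω
      rw [pow_zero] at hω
      obtain ⟨a, rfl⟩ := Submodule.mem_one.mp hω
      refine ⟨a • m, Submodule.smul_mem _ _ hm, ?_⟩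
      change (a • m) ⊗ₜ[ℂ] (1 : ExteriorAlgebra ℂ (Module.Dual ℂ 𝔥)) = m ⊗ₜ algebraMap ℂ _ a
      rw [TensorProduct.smul_tmul, Algebra.algebraMap_eq_smul_one]
    obtain ⟨m, hm, hmt⟩ := this
    exact ⟨⟨m, hm⟩, congrArg (torMk c M 0 d) (Subtype.ext hmt)⟩
  · intro m
    have hp : p m = 0 ↔ m.1 ⊗ₜ[ℂ] (1 : ExteriorAlgebra ℂ (Module.Dual ℂ 𝔥)) ∈
        koszulBoundaries c M 0 d := torMk_eq_zero
    have hq : q m = 0 ↔ m.1 ∈ hStar c M :=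
      Subtype.ext_iff.trans (Submodule.Quotient.mk_eq_zero _)
    rw [hp, hq]
    constructor
    · rintro ⟨t, -, ht⟩
      exact mem_hStar_of_koszulD M ht
    · intro h
      obtain ⟨t, ht, htm⟩ := exists_hStar_eq_koszulD M hL m.2 h
      exact ⟨t, ht, htm⟩
  · rintro ⟨_, m, hm, rfl⟩
    exact ⟨⟨m, hm⟩, rfl⟩

end Recursion

section DimensionShifting

open Limits

variable {C : Type*} [Category* C] [Abelian C] {A : Type*} [Category* A] [Abelian A]

/-- A numerical function which is additive in short exact sequences whose middle term is finite. -/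
structure IsAdditiveFun (fin : A → Prop) (μ : A → ℕ) : Prop where
  of_mono : ∀ {X Y : A} (f : X ⟶ Y) [Mono f], fin Y → fin X
  of_epi : ∀ {X Y : A} (f : X ⟶ Y) [Epi f], fin X → fin Y
  iso : ∀ {X Y : A}, (X ≅ Y) → μ X = μ Y
  add : ∀ (S : ShortComplex A), S.ShortExact → fin S.X₂ → μ S.X₂ = μ S.X₁ + μ S.X₃

variable {fin : A → Prop} {μ : A → ℕ}

lemma exact_iff_of_epi_comp {X' X Y Z : A} (e : X' ⟶ X) [Epi e] {f : X ⟶ Y} {g : Y ⟶ Z}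
    {f' : X' ⟶ Y} (hf : e ≫ f = f') (w : f ≫ g = 0) (w' : f' ≫ g = 0) :
    (ShortComplex.mk f' g w').Exact ↔ (ShortComplex.mk f g w).Exact := by
  let φ : ShortComplex.mk f' g w' ⟶ ShortComplex.mk f g w :=
    { τ₁ := e, τ₂ := 𝟙 _, τ₃ := 𝟙 _
      comm₁₂ := hf.trans (Category.comp_id f').symm
      comm₂₃ := (Category.id_comp g).trans (Category.comp_id g).symm }
  have : Epi φ.τ₁ := inferInstanceAs (Epi e)
  have : IsIso φ.τ₂ := inferInstanceAs (IsIso (𝟙 _))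
  have : Mono φ.τ₃ := inferInstanceAs (Mono (𝟙 _))
  exact ShortComplex.exact_iff_of_epi_of_isIso_of_mono φ

lemma exact_iff_of_comp_mono {X Y Z Z' : A} (m : Z ⟶ Z') [Mono m] {f : X ⟶ Y} {g : Y ⟶ Z}
    {g' : Y ⟶ Z'} (hg : g ≫ m = g') (w : f ≫ g = 0) (w' : f ≫ g' = 0) :
    (ShortComplex.mk f g w).Exact ↔ (ShortComplex.mk f g' w').Exact := by
  let φ : ShortComplex.mk f g w ⟶ ShortComplex.mk f g' w' :=
    { τ₁ := 𝟙 _, τ₂ := 𝟙 _, τ₃ := m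
      comm₁₂ := (Category.id_comp f).trans (Category.comp_id f).symm
      comm₂₃ := (Category.id_comp g').trans hg.symm }
  have : Epi φ.τ₁ := inferInstanceAs (Epi (𝟙 _))
  have : IsIso φ.τ₂ := inferInstanceAs (IsIso (𝟙 _))
  have : Mono φ.τ₃ := inferInstanceAs (Mono m)
  exact ShortComplex.exact_iff_of_epi_of_isIso_of_mono φ

lemma shortExact_cokernelDesc (S : ShortComplex A) (hS : S.Exact) {N : A} (p : S.X₃ ⟶ N) (he : Epi p)
    (w : S.g ≫ p = 0) (hp : (ShortComplex.mk S.g p w).Exact) :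
    (ShortComplex.mk (cokernel.desc S.f S.g S.zero) p (by
      rw [← cancel_epi (cokernel.π S.f)]; simpa using w)).ShortExact where
  exact := (exact_iff_of_epi_comp (cokernel.π S.f) (cokernel.π_desc _ _ _) _ w).mp hp
  mono_f := hS.mono_cokernelDesc
  epi_g := he

lemma shortExact_kernelLift (S : ShortComplex A) (hS : S.Exact) {N : A} (p : N ⟶ S.X₁) (he : Mono p)
    (w : p ≫ S.f = 0) (hp : (ShortComplex.mk p S.f w).Exact) :
    (ShortComplex.mk p (kernel.lift S.g S.f S.zero) (by
      rw [← cancel_mono (kernel.ι S.g)]; simpa using w)).ShortExact where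
  exact := (exact_iff_of_comp_mono (kernel.ι S.g) (kernel.lift_ι _ _ _) _ w).mpr hp
  mono_f := he
  epi_g := hS.epi_kernelLift

lemma shortExact_kernel {X Y : A} (f : X ⟶ Y) [Epi f] :
    (ShortComplex.mk (kernel.ι f) f (kernel.condition f)).ShortExact where
  exact := ShortComplex.kernelSequence_exact f
  mono_f := inferInstanceAs (Mono (kernel.ι f))
  epi_g := inferInstanceAs (Epi f)

lemma shortExact_cokernel {X Y : A} (f : X ⟶ Y) [Mono f] :
    (ShortComplex.mk f (cokernel.π f) (cokernel.condition f)).ShortExact where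
  exact := ShortComplex.cokernelSequence_exact f
  mono_f := inferInstanceAs (Mono f)
  epi_g := inferInstanceAs (Epi (cokernel.π f))

lemma IsAdditiveFun.kernel_add (hμ : IsAdditiveFun fin μ) (S : ShortComplex A) (hS : S.Exact)
    [Epi S.g] (h1 : fin S.X₁) (h2 : fin S.X₂) :
    μ (kernel S.f) + μ S.X₂ = μ S.X₁ + μ S.X₃ := by
  have e1 : μ S.X₁ = μ (kernel S.f) + μ (kernel S.g) :=
    hμ.add _ (shortExact_kernelLift S hS (kernel.ι S.f) inferInstance (kernel.condition _)
      (ShortComplex.kernelSequence_exact S.f)) h1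
  have e2 : μ S.X₂ = μ (kernel S.g) + μ S.X₃ := hμ.add _ (shortExact_kernel S.g) h2
  omega

lemma IsAdditiveFun.cokernel_add (hμ : IsAdditiveFun fin μ) (S : ShortComplex A) (hS : S.Exact)
    [Mono S.f] (h2 : fin S.X₂) (h3 : fin S.X₃) :
    μ (cokernel S.g) + μ S.X₂ = μ S.X₁ + μ S.X₃ := by
  have e1 : μ S.X₃ = μ (cokernel S.f) + μ (cokernel S.g) :=
    hμ.add _ (shortExact_cokernelDesc S hS (cokernel.π S.g) inferInstance (cokernel.condition _)
      (ShortComplex.cokernelSequence_exact S.g)) h3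
  have e2 : μ S.X₂ = μ S.X₁ + μ (cokernel S.f) := hμ.add _ (shortExact_cokernel S.f) h2
  omega

lemma IsAdditiveFun.homology_right (hμ : IsAdditiveFun fin μ) (S : ShortComplex A) {N : A}
    (p : S.X₃ ⟶ N) (he : Epi p) (w : S.g ≫ p = 0) (hp : (ShortComplex.mk S.g p w).Exact)
    (h1 : fin (cokernel S.f)) (h3 : fin S.X₃) :
    fin S.homology ∧ μ S.homology + μ S.X₃ = μ (cokernel S.f) + μ N := by
  have hw : S.fromOpcycles ≫ p = 0 := by
    rw [← cancel_epi S.pOpcycles, ShortComplex.p_fromOpcycles_assoc, w, comp_zero]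
  have hT : (ShortComplex.mk S.fromOpcycles p hw).Exact :=
    (exact_iff_of_epi_comp S.pOpcycles S.p_fromOpcycles hw w).mp hp
  have hfo : fin S.opcycles := hμ.of_mono S.opcyclesIsoCokernel.hom h1
  have : Epi (ShortComplex.mk S.fromOpcycles p hw).g := he
  have h4 : μ (kernel S.fromOpcycles) + μ S.X₃ = μ S.opcycles + μ N :=
    hμ.kernel_add _ hT hfo h3
  have e2 : S.homology ≅ kernel S.fromOpcycles :=
    IsLimit.conePointUniqueUpToIso S.homologyIsKernel (limit.isLimit _)
  refine ⟨hμ.of_mono S.homologyι hfo, ?_⟩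
  rw [hμ.iso e2, ← hμ.iso S.opcyclesIsoCokernel]
  exact h4

lemma IsAdditiveFun.homology_left (hμ : IsAdditiveFun fin μ) (S : ShortComplex A) {N : A}
    (p : N ⟶ S.X₁) (he : Mono p) (w : p ≫ S.f = 0) (hp : (ShortComplex.mk p S.f w).Exact)
    (h1 : fin (kernel S.g)) (h3 : fin S.X₁) :
    fin S.homology ∧ μ S.homology + μ S.X₁ = μ N + μ (kernel S.g) := by
  have hw : p ≫ S.toCycles = 0 := by
    rw [← cancel_mono S.iCycles, Category.assoc, ShortComplex.toCycles_i, w, zero_comp]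
  have hT : (ShortComplex.mk p S.toCycles hw).Exact :=
    (exact_iff_of_comp_mono S.iCycles S.toCycles_i hw w).mpr hp
  have hfo : fin S.cycles := hμ.of_mono S.cyclesIsoKernel.hom h1
  have : Mono (ShortComplex.mk p S.toCycles hw).f := he
  have h4 : μ (cokernel S.toCycles) + μ S.X₁ = μ N + μ S.cycles :=
    hμ.cokernel_add _ hT h3 hfo
  have e2 : S.homology ≅ cokernel S.toCycles :=
    IsColimit.coconePointUniqueUpToIso S.homologyIsCokernel (colimit.isColimit _)
  refine ⟨hμ.of_epi S.homologyπ hfo, ?_⟩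
  rw [hμ.iso e2, ← hμ.iso S.cyclesIsoKernel]
  exact h4

/-- Families of numerical functions which behave like the dimensions of left derived functors. -/
structure ProjShift (T : ℕ → C → ℕ) : Prop where
  succ : ∀ (S : ShortComplex C), S.ShortExact → Projective S.X₂ →
    ∀ i, T (i + 2) S.X₃ = T (i + 1) S.X₁
  zero : ∀ (S : ShortComplex C), S.ShortExact → Projective S.X₂ →
    T 1 S.X₃ + T 0 S.X₂ = T 0 S.X₁ + T 0 S.X₃

/-- Families of numerical functions which behave like the dimensions of right derived functors. -/
structure InjShift (T : ℕ → C → ℕ) : Prop where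
  succ : ∀ (S : ShortComplex C), S.ShortExact → Injective S.X₂ →
    ∀ i, T (i + 2) S.X₁ = T (i + 1) S.X₃
  zero : ∀ (S : ShortComplex C), S.ShortExact → Injective S.X₂ →
    T 1 S.X₁ + T 0 S.X₂ = T 0 S.X₁ + T 0 S.X₃

lemma ProjShift.unique [EnoughProjectives C] {T T' : ℕ → C → ℕ} (hT : ProjShift T)
    (hT' : ProjShift T') (h0 : ∀ X, T 0 X = T' 0 X) (i : ℕ) (X : C) : T i X = T' i X := by
  have hS := fun X : C => shortExact_kernel (Projective.π X)
  have hP : ∀ X : C, Projective (Projective.over X) := inferInstance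
  induction i generalizing X with
  | zero => exact h0 X
  | succ i ih =>
    rcases i with _ | i
    · have h1 := hT.zero _ (hS X) (hP X)
      have h2 := hT'.zero _ (hS X) (hP X)
      rw [h0, h0, h0] at h1
      exact Nat.add_right_cancel (h1.trans h2.symm)
    · exact (hT.succ _ (hS X) (hP X) i).trans ((ih _).trans (hT'.succ _ (hS X) (hP X) i).symm)

lemma InjShift.unique [EnoughInjectives C] {T T' : ℕ → C → ℕ} (hT : InjShift T)
    (hT' : InjShift T') (h0 : ∀ X, T 0 X = T' 0 X) (i : ℕ) (X : C) : T i X = T' i X := by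
  have hS := fun X : C => shortExact_cokernel (Injective.ι X)
  have hP : ∀ X : C, Injective (Injective.under X) := inferInstance
  induction i generalizing X with
  | zero => exact h0 X
  | succ i ih =>
    rcases i with _ | i
    · have h1 := hT.zero _ (hS X) (hP X)
      have h2 := hT'.zero _ (hS X) (hP X)
      rw [h0, h0, h0] at h1
      exact Nat.add_right_cancel (h1.trans h2.symm)
    · exact (hT.succ _ (hS X) (hP X) i).trans ((ih _).trans (hT'.succ _ (hS X) (hP X) i).symm)

variable (F : C ⥤ A) [F.Additive]

lemma homology_of_rightExact [PreservesFiniteColimits F] (hμ : IsAdditiveFun fin μ)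
    (hfin : ∀ X, fin (F.obj X)) (S : ShortComplex C) {N : C} (p : S.X₃ ⟶ N) (he : Epi p)
    (w : S.g ≫ p = 0) (hp : (ShortComplex.mk S.g p w).Exact) :
    fin (S.map F).homology ∧ μ (S.map F).homology + μ (F.obj S.X₃) =
      μ (F.obj (cokernel S.f)) + μ (F.obj N) := by
  have hF := ((Functor.preservesFiniteColimits_tfae F).out 3 1).mp ‹_›
  obtain ⟨h1, h2⟩ := hF (ShortComplex.mk S.g p w) ⟨hp, he⟩
  have e1 : cokernel (S.map F).f ≅ F.obj (cokernel S.f) := (PreservesCokernel.iso F S.f).symm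
  rw [← hμ.iso e1]
  exact hμ.homology_right (S.map F) (N := F.obj N) (F.map p) h2 _ h1 (hμ.of_mono e1.hom (hfin _)) (hfin _)

lemma homology_of_leftExact [PreservesFiniteLimits F] (hμ : IsAdditiveFun fin μ)
    (hfin : ∀ X, fin (F.obj X)) (S : ShortComplex C) {N : C} (p : N ⟶ S.X₁) (he : Mono p)
    (w : p ≫ S.f = 0) (hp : (ShortComplex.mk p S.f w).Exact) :
    fin (S.map F).homology ∧ μ (S.map F).homology + μ (F.obj S.X₁) =
      μ (F.obj N) + μ (F.obj (kernel S.g)) := by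
  have hF := ((Functor.preservesFiniteLimits_tfae F).out 3 1).mp ‹_›
  obtain ⟨h1, h2⟩ := hF (ShortComplex.mk p S.f w) ⟨hp, he⟩
  have e1 : kernel (S.map F).g ≅ F.obj (kernel S.g) := (PreservesKernel.iso F S.g).symm
  rw [← hμ.iso e1]
  exact hμ.homology_left (S.map F) (N := F.obj N) (F.map p) h2 _ h1 (hμ.of_mono e1.hom (hfin _)) (hfin _)

/-- Left derived functors are computed, numerically, by dimension shifting. -/
theorem leftDerived_numeric [EnoughProjectives C] [PreservesFiniteColimits F]
    (hμ : IsAdditiveFun fin μ) (hfin : ∀ X, fin (F.obj X)) {T : ℕ → C → ℕ} (hT : ProjShift T)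
    (hT0 : ∀ X, T 0 X = μ (F.obj X)) (i : ℕ) (M : C) :
    fin ((F.leftDerived i).obj M) ∧ μ ((F.leftDerived i).obj M) = T i M := by
  rcases i with _ | i
  · have e : (F.leftDerived 0).obj M ≅ F.obj M := F.leftDerivedZeroIsoSelf.app M
    exact ⟨hμ.of_mono e.hom (hfin _), by rw [hμ.iso e, hT0]⟩
  let P := projectiveResolution M
  let K := P.complex
  have key : ∀ (j k : ℕ) (N : C) (p : K.X k ⟶ N) (_ : Epi p) (w : K.d (k + 1) k ≫ p = 0),
      (ShortComplex.mk _ _ w).Exact →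
      fin ((K.sc' (k + j + 2) (k + j + 1) (k + j)).map F).homology ∧
        μ ((K.sc' (k + j + 2) (k + j + 1) (k + j)).map F).homology = T (j + 1) N := by
    intro j
    induction j with
    | zero =>
      intro k N p he w hp
      obtain ⟨h1, h2⟩ := homology_of_rightExact F hμ hfin (K.sc' (k + 2) (k + 1) k) p he w hp
      refine ⟨h1, ?_⟩
      have h3 := hT.zero _ (shortExact_cokernelDesc (K.sc' (k + 2) (k + 1) k)
        (P.exact_succ k) p he w hp) (P.projective k)
      rw [← hT0, ← hT0, ← hT0] at h2
      exact Nat.add_right_cancel (h2.trans h3.symm)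
    | succ j ih =>
      intro k N p he w hp
      have h3 := hT.succ _ (shortExact_cokernelDesc (K.sc' (k + 2) (k + 1) k)
        (P.exact_succ k) p he w hp) (P.projective k) j
      have h4 := ih (k + 1) (cokernel (K.d (k + 2) (k + 1))) (cokernel.π _) inferInstance
        (cokernel.condition _) (ShortComplex.cokernelSequence_exact _)
      rw [show k + 1 + j = k + (j + 1) by ring] at h4
      exact ⟨h4.1, h4.2.trans h3.symm⟩
  have h := key i 0 M (P.π.f 0) (inferInstanceAs (Epi (P.π.f 0))) P.complex_d_comp_π_f_zero P.exact₀
  rw [zero_add] at h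
  have e : (F.leftDerived (i + 1)).obj M ≅ ((K.sc' (i + 2) (i + 1) i).map F).homology :=
    P.isoLeftDerivedObj F (i + 1) ≪≫ ShortComplex.homologyMapIso
      (((F.mapHomologicalComplex _).obj K).isoSc' (i + 2) (i + 1) i (by simp) (by simp))
  exact ⟨hμ.of_mono e.hom h.1, (hμ.iso e).trans h.2⟩

/-- Right derived functors are computed, numerically, by dimension shifting. -/
theorem rightDerived_numeric [EnoughInjectives C] [PreservesFiniteLimits F]
    (hμ : IsAdditiveFun fin μ) (hfin : ∀ X, fin (F.obj X)) {T : ℕ → C → ℕ} (hT : InjShift T)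
    (hT0 : ∀ X, T 0 X = μ (F.obj X)) (i : ℕ) (M : C) :
    fin ((F.rightDerived i).obj M) ∧ μ ((F.rightDerived i).obj M) = T i M := by
  rcases i with _ | i
  · have e : (F.rightDerived 0).obj M ≅ F.obj M := F.rightDerivedZeroIsoSelf.app M
    exact ⟨hμ.of_mono e.hom (hfin _), by rw [hμ.iso e, hT0]⟩
  let P := injectiveResolution M
  let K := P.cocomplex
  have key : ∀ (j k : ℕ) (N : C) (p : N ⟶ K.X k) (_ : Mono p) (w : p ≫ K.d k (k + 1) = 0),
      (ShortComplex.mk _ _ w).Exact →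
      fin ((K.sc' (k + j) (k + j + 1) (k + j + 2)).map F).homology ∧
        μ ((K.sc' (k + j) (k + j + 1) (k + j + 2)).map F).homology = T (j + 1) N := by
    intro j
    induction j with
    | zero =>
      intro k N p he w hp
      obtain ⟨h1, h2⟩ := homology_of_leftExact F hμ hfin (K.sc' k (k + 1) (k + 2)) p he w hp
      refine ⟨h1, ?_⟩
      have h3 := hT.zero _ (shortExact_kernelLift (K.sc' k (k + 1) (k + 2))
        (P.exact_succ k) p he w hp) (P.injective k)
      rw [← hT0, ← hT0, ← hT0] at h2
      exact Nat.add_right_cancel (h2.trans h3.symm)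
    | succ j ih =>
      intro k N p he w hp
      have h3 := hT.succ _ (shortExact_kernelLift (K.sc' k (k + 1) (k + 2))
        (P.exact_succ k) p he w hp) (P.injective k) j
      have h4 := ih (k + 1) (kernel (K.d (k + 1) (k + 2))) (kernel.ι _) inferInstance
        (kernel.condition _) (ShortComplex.kernelSequence_exact _)
      rw [show k + 1 + j = k + (j + 1) by ring] at h4
      exact ⟨h4.1, h4.2.trans h3.symm⟩
  have hex : (ShortComplex.mk _ _ P.ι_f_zero_comp_complex_d).Exact :=
    ShortComplex.exact_of_f_is_kernel _ P.isLimitKernelFork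
  have h := key i 0 M (P.ι.f 0) (inferInstanceAs (Mono (P.ι.f 0))) P.ι_f_zero_comp_complex_d hex
  rw [zero_add] at h
  have e : (F.rightDerived (i + 1)).obj M ≅ ((K.sc' i (i + 1) (i + 2)).map F).homology :=
    P.isoRightDerivedObj F (i + 1) ≪≫ ShortComplex.homologyMapIso
      (((F.mapHomologicalComplex _).obj K).isoSc' i (i + 1) (i + 2) (by simp) (by simp))
  exact ⟨hμ.of_mono e.hom h.1, (hμ.iso e).trans h.2⟩

end DimensionShifting

section GradedRepresentations

open Limits

variable {G : Type u} [Group G] [Finite G]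

lemma exact_rep_iff (S : ShortComplex (Rep.{u} ℂ G)) :
    S.Exact ↔ ∀ x, S.g.hom x = 0 → ∃ y, S.f.hom y = x := by
  refine Iff.trans (S.exact_map_iff_of_faithful (forget₂ (Rep.{u} ℂ G) (ModuleCat.{u} ℂ))).symm ?_
  exact ShortComplex.moduleCat_exact_iff _

/-- Additivity of multiplicities. -/
lemma mult_shortExact (θ : Rep.{u} ℂ G) [FiniteDimensional ℂ θ] (S : ShortComplex (Rep.{u} ℂ G))
    (hS : S.ShortExact) (h2 : FiniteDimensional ℂ S.X₂) :
    mult θ.ρ S.X₂.ρ = mult θ.ρ S.X₁.ρ + mult θ.ρ S.X₃.ρ := by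
  have hm := hS.mono_f
  have he := hS.epi_g
  refine mult_exact θ.ρ S.f.hom S.g.hom ((Rep.mono_iff_injective _).mp hm)
    ((Rep.epi_iff_surjective _).mp he) fun v => ⟨(exact_rep_iff S).mp hS.exact v, ?_⟩
  rintro ⟨w, rfl⟩
  exact congrArg (fun f : S.X₁ ⟶ S.X₃ => f.hom w) S.zero

variable {ι : Type*}

lemma exact_graded_iff (S : ShortComplex (Discrete ι ⥤ Rep.{u} ℂ G)) :
    S.Exact ↔ ∀ d : ι, ∀ x, (S.g.app ⟨d⟩).hom x = 0 → ∃ y, (S.f.app ⟨d⟩).hom y = x := by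
  have h1 : S.Exact ↔ ∀ d : ι, (S.map ((evaluation _ _).obj ⟨d⟩)).Exact := by
    constructor
    · intro h d
      exact h.map _
    · intro h
      rw [ShortComplex.exact_iff_isZero_homology, Functor.isZero_iff]
      rintro ⟨d⟩
      exact ((S.map ((evaluation _ _).obj ⟨d⟩)).exact_iff_isZero_homology.mp (h d)).of_iso
        (S.mapHomologyIso ((evaluation _ _).obj ⟨d⟩)).symm
  rw [h1]
  exact forall_congr' fun d => exact_rep_iff _

lemma epi_graded_iff {X Y : Discrete ι ⥤ Rep.{u} ℂ G} (f : X ⟶ Y) :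
    Epi f ↔ ∀ d : ι, Function.Surjective (f.app ⟨d⟩).hom := by
  rw [NatTrans.epi_iff_epi_app]
  exact ⟨fun h d => (Rep.epi_iff_surjective _).mp (h ⟨d⟩),
    fun h ⟨d⟩ => (Rep.epi_iff_surjective _).mpr (h d)⟩

lemma mono_graded_iff {X Y : Discrete ι ⥤ Rep.{u} ℂ G} (f : X ⟶ Y) :
    Mono f ↔ ∀ d : ι, Function.Injective (f.app ⟨d⟩).hom := by
  rw [NatTrans.mono_iff_mono_app]
  exact ⟨fun h d => (Rep.mono_iff_injective _).mp (h ⟨d⟩),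
    fun h ⟨d⟩ => (Rep.mono_iff_injective _).mpr (h d)⟩

lemma isAdditiveFun_mult (θ : Rep.{u} ℂ G) [FiniteDimensional ℂ θ] (d : ι) :
    IsAdditiveFun (A := Discrete ι ⥤ Rep.{u} ℂ G)
      (fun V => ∀ e, FiniteDimensional ℂ (V.obj ⟨e⟩)) fun V => mult θ.ρ (V.obj ⟨d⟩).ρ where
  of_mono {X Y} f hf h e := by
    have := h e
    exact FiniteDimensional.of_injective (f.app ⟨e⟩).hom.toLinearMap ((mono_graded_iff f).mp hf e)
  of_epi {X Y} f hf h e := by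
    have := h e
    exact Module.Finite.of_surjective (f.app ⟨e⟩).hom.toLinearMap ((epi_graded_iff f).mp hf e)
  iso e := mult_congr (Representation.equivOfIso (e.app ⟨d⟩))
  add S hS h2 := mult_shortExact θ (S.map ((evaluation _ _).obj ⟨d⟩))
    (hS.map_of_exact ((evaluation _ _).obj ⟨d⟩)) (h2 d)

/-- Graded representations are determined by the multiplicities of the irreducible
representations in their pieces. -/
lemma nonempty_iso_of_mult {X Y : Discrete ι ⥤ Rep.{u} ℂ G}
    (hX : ∀ d, FiniteDimensional ℂ (X.obj ⟨d⟩)) (hY : ∀ d, FiniteDimensional ℂ (Y.obj ⟨d⟩))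
    (h : ∀ d, ∀ (E : Rep.{u} ℂ G) [E.ρ.IsIrreducible] [FiniteDimensional ℂ E],
      mult E.ρ (X.obj ⟨d⟩).ρ = mult E.ρ (Y.obj ⟨d⟩).ρ) : Nonempty (X ≅ Y) := by
  have hd : ∀ d : ι, Nonempty ((X.obj ⟨d⟩).ρ.Equiv (Y.obj ⟨d⟩).ρ) := fun d => by
    have := hX d
    have := hY d
    exact equiv_of_mult _ _ (h d)
  exact ⟨Discrete.natIso fun ⟨d⟩ => Rep.mkIso (hd d).some⟩

end GradedRepresentations

section Homology

open Limits

variable {𝔥 : Type u} [AddCommGroup 𝔥] [Module ℂ 𝔥] [FiniteDimensional ℂ 𝔥]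
  {W : Subgroup (𝔥 ≃ₗ[ℂ] 𝔥)} [Finite W] {c : Param W}

lemma IsSES.of_shortExact {S : ShortComplex (CatO c)} (hS : S.ShortExact) :
    IsSES (homO S.f) (homO S.g) where
  inj := (mono_catO_iff _).mp hS.mono_f
  exact x := ⟨(exact_catO_iff S).mp hS.exact x, by
    rintro ⟨y, rfl⟩
    exact congrArg (fun f : S.X₁ ⟶ S.X₃ => homO f y) S.zero⟩
  surj := (epi_catO_iff _).mp hS.epi_g
  left := S.X₁.property
  mid := S.X₂.property
  right := S.X₃.property

lemma projShift_torDeg (θ : Rep.{u} ℂ W) [FiniteDimensional ℂ θ] (d : ℂ) :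
    ProjShift fun i (X : CatO c) => mult θ.ρ (torDeg c X.obj i d).ρ where
  succ S hS hP i := by
    have hA := acyc_of_projective S.X₂
    exact mult_torDeg_succ θ (.of_shortExact hS) (i + 1) d
      (torDeg_subsingleton S.X₂.locNilp hA _ d) (torDeg_subsingleton S.X₂.locNilp hA _ d)
  zero S hS hP := mult_torDeg_zero θ (.of_shortExact hS) d
      (torDeg_subsingleton S.X₂.locNilp (acyc_of_projective S.X₂) 0 d)

lemma LocNilp.pr_mem_hStar {M : ModuleCat.{u} (Cher c)} (hM : LocNilp M) (d : ℂ) {m : M}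
    (hm : m ∈ hStar c M) : hM.pr d m ∈ hStar c M := by
  suffices h : ⨆ i, (wt c M (d - 1)).map (act c M (mulOp c (lin ((Module.finBasis ℂ 𝔥).coord i)))) ≤
      hStar c M from h (hM.pr_hStar (Module.finBasis ℂ 𝔥) d hm)
  refine iSup_le fun i => ?_
  rintro _ ⟨n, -, rfl⟩
  exact Submodule.subset_span ⟨_, n, rfl⟩

lemma coinvMap_surjective {M N : ModuleCat.{u} (Cher c)} {f : M →ₗ[Cher c] N}
    (hM : LocNilp M) (hN : LocNilp N)
    (hf : Function.Surjective f) {d : ℂ} {n : N ⧸ hStar c N} (hn : n ∈ coinvWt c N d) :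
    ∃ m ∈ coinvWt c M d, coinvMap f m = n := by
  obtain ⟨n, hn, rfl⟩ := hn
  obtain ⟨m, hm, rfl⟩ := hM.wt_surjective hN hf hn
  exact ⟨_, ⟨m, hm, rfl⟩, rfl⟩

lemma exists_hStar_of_surjective {M N : ModuleCat.{u} (Cher c)} {f : M →ₗ[Cher c] N}
    (hf : Function.Surjective f) {n : N} (hn : n ∈ hStar c N) : ∃ m ∈ hStar c M, f m = n := by
  induction hn using Submodule.span_induction with
  | mem n hn =>
    obtain ⟨x, n, rfl⟩ := hn
    obtain ⟨m, rfl⟩ := hf n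
    exact ⟨_, Submodule.subset_span ⟨x, m, rfl⟩, map_smul f _ _⟩
  | zero => exact ⟨0, zero_mem _, map_zero f⟩
  | add a b _ _ ha hb =>
    obtain ⟨a, ha, rfl⟩ := ha
    obtain ⟨b, hb, rfl⟩ := hb
    exact ⟨_, add_mem ha hb, map_add f a b⟩
  | smul s a _ ha =>
    obtain ⟨a, ha, rfl⟩ := ha
    exact ⟨_, Submodule.smul_mem _ s ha, (f.restrictScalars ℂ).map_smul s a⟩

instance : PreservesFiniteColimits (homologyZero c) := by
  refine ((Functor.preservesFiniteColimits_tfae (homologyZero c)).out 0 3).mp fun S hS => ?_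
  have h := IsSES.of_shortExact hS
  refine ⟨(exact_graded_iff _).mpr fun d => ?_, (epi_graded_iff _).mpr fun d => ?_⟩
  · rintro ⟨_, m, hm, rfl⟩ hx
    have hx' : homO S.g m ∈ hStar c S.X₃.obj :=
      (Submodule.Quotient.mk_eq_zero _).mp (congrArg Subtype.val hx)
    obtain ⟨n, hn, hnm⟩ := exists_hStar_of_surjective h.surj hx'
    obtain ⟨l, hl⟩ := (h.exact (m - n)).mp (by rw [map_sub, hnm, sub_self])
    have hl' : homO S.f (S.X₁.locNilp.pr d l) = m - S.X₂.locNilp.pr d n := by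
      rw [← LocNilp.pr_map S.X₁.locNilp S.X₂.locNilp, hl, map_sub, S.X₂.locNilp.pr_of_mem hm]
    refine ⟨⟨_, _, S.X₁.locNilp.pr_mem d l, rfl⟩, Subtype.ext ?_⟩
    change (hStar c S.X₂.obj).mkQ (homO S.f _) = _
    rw [hl', map_sub, sub_eq_self, Submodule.mkQ_apply, Submodule.Quotient.mk_eq_zero]
    exact S.X₂.locNilp.pr_mem_hStar d hn
  · rintro ⟨x, hx⟩
    obtain ⟨m, hm, hmx⟩ := coinvMap_surjective S.X₂.locNilp S.X₃.locNilp h.surj hx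
    exact ⟨⟨m, hm⟩, Subtype.ext hmx⟩

lemma finite_homologyZero (X : CatO c) (d : ℂ) :
    FiniteDimensional ℂ (((homologyZero c).obj X).obj ⟨d⟩) := by
  have := objO.finite_wt X.property d
  have : FiniteDimensional ℂ (coinvWt c X.obj d) := Module.Finite.map _ _
  exact this

lemma mult_homologyZero (E : Rep.{u} ℂ W) [FiniteDimensional ℂ E] (X : CatO c) (d : ℂ) :
    mult E.ρ (torDeg c X.obj 0 d).ρ = mult E.ρ (((homologyZero c).obj X).obj ⟨d⟩).ρ :=
  mult_torDeg_coinvWt X.obj E X.property d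

lemma mult_leftDerived_homologyZero (E : Rep.{u} ℂ W) [FiniteDimensional ℂ E] (M : CatO c) (i : ℕ)
    (d : ℂ) :
    (fun V : GrRep W => ∀ e, FiniteDimensional ℂ (V.obj ⟨e⟩))
      (((homologyZero c).leftDerived i).obj M) ∧
    (fun V : GrRep W => mult E.ρ (V.obj ⟨d⟩).ρ) (((homologyZero c).leftDerived i).obj M) =
      mult E.ρ (torDeg c M.obj i d).ρ :=
  leftDerived_numeric (homologyZero c) (isAdditiveFun_mult E d) finite_homologyZero
    (projShift_torDeg E d) (fun X => mult_homologyZero E X d) i M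

lemma hStarHomology_eq (i : ℕ) : hStarHomology c i = (homologyZero c).leftDerived i := rfl

lemma mult_hStarHomology (E : Rep.{u} ℂ W) [FiniteDimensional ℂ E] (M : CatO c) (i : ℕ) (d : ℂ) :
    mult E.ρ (((hStarHomology c i).obj M).obj ⟨d⟩).ρ = mult E.ρ (torDeg c M.obj i d).ρ := by
  rw [hStarHomology_eq]
  exact (mult_leftDerived_homologyZero E M i d).2

lemma finite_hStarHomology (M : CatO c) (i : ℕ) (d : ℂ) :
    FiniteDimensional ℂ (((hStarHomology c i).obj M).obj ⟨d⟩) := by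
  have : FiniteDimensional ℂ (Rep.of (Representation.trivial ℂ W PUnit.{u + 1})) :=
    inferInstanceAs (FiniteDimensional ℂ PUnit.{u + 1})
  rw [hStarHomology_eq]
  exact (mult_leftDerived_homologyZero (Rep.of (Representation.trivial ℂ W PUnit.{u + 1})) M i 0).1 d

/-- `𝔥*`-homology is the homology of the Koszul complex. -/
theorem nonempty_hStarHomology_iso (M : CatO c) (i : ℕ) :
    Nonempty ((hStarHomology c i).obj M ≅ torGr c M.obj i) :=
  nonempty_iso_of_mult (finite_hStarHomology M i) (fun d => finite_torDeg M.property i d)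
    fun d E _ _ => mult_hStarHomology E M i d

end Homology

section Lifting

variable {A : Type*} [Ring A] [Algebra ℂ A]

/-- The algebra homomorphism from a polynomial ring given by commuting elements of an algebra. -/
def commLift {ι : Type*} (a : ι → A) (h : ∀ i j, a i * a j = a j * a i) : MvPolynomial ι ℂ →ₐ[ℂ] A :=
  letI : CommRing (Algebra.adjoin ℂ (Set.range a)) :=
    { (inferInstance : Ring (Algebra.adjoin ℂ (Set.range a))) with
      mul_comm := (Algebra.isMulCommutative_adjoin ℂ (s := Set.range a) (by
        rintro _ ⟨u, rfl⟩ _ ⟨v, rfl⟩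
        exact h u v)).is_comm.comm }
  (Algebra.adjoin ℂ (Set.range a)).val.comp
    (MvPolynomial.aeval (S₁ := Algebra.adjoin ℂ (Set.range a))
      fun i => ⟨a i, Algebra.subset_adjoin ⟨_, rfl⟩⟩)

lemma commLift_X {ι : Type*} (a : ι → A) (h : ∀ i j, a i * a j = a j * a i) (i : ι) :
    commLift a h (MvPolynomial.X i) = a i := by
  simp [commLift]

variable {𝔥 : Type u} [AddCommGroup 𝔥] [Module ℂ 𝔥] [FiniteDimensional ℂ 𝔥]

lemma aeval_lin_apply {ι : Type*} (b : Module.Basis ι ℂ 𝔥) (P : MvPolynomial ι ℂ) (y : 𝔥) :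
    (MvPolynomial.aeval (R := ℂ) (fun i => lin (b.coord i)) P).1 y = MvPolynomial.eval (b.repr y) P := by
  induction P using MvPolynomial.induction_on with
  | C a => simp
  | add p q hp hq => rw [map_add, map_add, poly_add_apply, hp, hq]
  | mul_X p i hp => rw [map_mul, map_mul, poly_mul_apply, hp]; simp

lemma dual_apply_eq_sum {ι : Type*} [Fintype ι] (b : Module.Basis ι ℂ 𝔥) (x : Module.Dual ℂ 𝔥) (y : 𝔥) :
    x y = ∑ i, x (b i) * b.repr y i := by
  conv_lhs => rw [← b.sum_repr y]
  simp only [map_sum, map_smul, smul_eq_mul, mul_comm]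

lemma lin_eq_sum_coord {ι : Type*} [Fintype ι] (b : Module.Basis ι ℂ 𝔥) (x : Module.Dual ℂ 𝔥) :
    lin x = ∑ i, x (b i) • lin (b.coord i) := by
  refine poly_ext fun y => ?_
  rw [poly_sum_apply]
  exact dual_apply_eq_sum b x y

/-- Polynomial functions are polynomials in the coordinates. -/
lemma aeval_lin_bijective {ι : Type*} [Finite ι] (b : Module.Basis ι ℂ 𝔥) :
    Function.Bijective (MvPolynomial.aeval (R := ℂ) fun i => lin (b.coord i)) := by
  have := Fintype.ofFinite ι
  constructor
  · rw [injective_iff_map_eq_zero]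
    intro P hP
    refine MvPolynomial.funext fun t => ?_
    have h := aeval_lin_apply b P (b.equivFun.symm t)
    rw [hP] at h
    have ht : (b.repr (b.equivFun.symm t) : ι → ℂ) = t := b.equivFun.apply_symm_apply t
    rw [ht] at h
    rw [map_zero, ← h]
    rfl
  · intro f
    change f ∈ (MvPolynomial.aeval (R := ℂ) fun i => lin (b.coord i)).range
    induction f using polyFun_induction with
    | hlin x =>
      rw [lin_eq_sum_coord b]
      exact sum_mem fun i _ => Subalgebra.smul_mem _
        ((AlgHom.mem_range _).mpr ⟨MvPolynomial.X i, by simp⟩) _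
    | hconst a => exact algebraMap_mem _ a
    | hadd f g hf hg => exact add_mem hf hg
    | hmul f g hf hg => exact mul_mem hf hg

/-- The algebra homomorphism from `ℂ[𝔥]` given by a linear map with commuting values on `𝔥*`. -/
def polyLift (x : Module.Dual ℂ 𝔥 →ₗ[ℂ] A) (h : ∀ k l, x k * x l = x l * x k) : Poly 𝔥 →ₐ[ℂ] A :=
  (commLift (fun i => x ((Module.finBasis ℂ 𝔥).coord i)) fun _ _ => h _ _).comp
    (AlgEquiv.ofBijective _ (aeval_lin_bijective (Module.finBasis ℂ 𝔥))).symm.toAlgHom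

lemma polyLift_lin (x : Module.Dual ℂ 𝔥 →ₗ[ℂ] A) (h : ∀ k l, x k * x l = x l * x k)
    (l : Module.Dual ℂ 𝔥) : polyLift x h (lin l) = x l := by
  let b := Module.finBasis ℂ 𝔥
  let e := AlgEquiv.ofBijective _ (aeval_lin_bijective b)
  have h1 : ∀ i, e.symm (lin (b.coord i)) = MvPolynomial.X i := fun i => by
    rw [AlgEquiv.symm_apply_eq]
    exact (MvPolynomial.aeval_X (R := ℂ) (fun i => lin (b.coord i)) i).symm
  have h2 : x l = ∑ i, l (b i) • x (b.coord i) := by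
    have h3 : l = ∑ i, l (b i) • b.coord i := LinearMap.ext fun y => by
      rw [LinearMap.sum_apply]; exact dual_apply_eq_sum b l y
    have h4 := congrArg x h3
    rw [map_sum] at h4
    simpa only [map_smul] using h4
  rw [h2, lin_eq_sum_coord b l, map_sum]
  refine Finset.sum_congr rfl fun i _ => ?_
  rw [map_smul]
  exact congrArg (l (b i) • ·) ((congrArg (commLift (fun i => x (b.coord i))
    fun _ _ => h _ _) (h1 i)).trans (commLift_X _ _ i))

variable {W : Subgroup (𝔥 ≃ₗ[ℂ] 𝔥)} [Finite W] (c : Param W)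

variable (A) in
/-- Elements of an algebra that satisfy the defining relations of the Cherednik algebra. -/
structure CherGen where
  /-- the images of the group elements -/
  g : W →* A
  /-- the images of the linear forms -/
  x : Module.Dual ℂ 𝔥 →ₗ[ℂ] A
  /-- the images of the Dunkl operators -/
  y : 𝔥 →ₗ[ℂ] A
  x_comm : ∀ k l, x k * x l = x l * x k
  y_comm : ∀ u v, y u * y v = y v * y u
  g_x : ∀ (w : W) l, g w * x l = x (l ∘ₗ w.1.symm.toLinearMap) * g w
  g_y : ∀ (w : W) v, g w * y v = y (w.1 v) * g w
  y_x : ∀ v l, y v * x l = x l * y v + algebraMap ℂ A (l v) -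
    ∑ r : Refl W, (c.val r * r.form v * l r.coroot) • g r.1

namespace CherGen

variable {c} (D : CherGen A c)

/-- The action of polynomial functions. -/
def px : Poly 𝔥 →ₐ[ℂ] A := polyLift D.x D.x_comm

/-- The action of polynomials in the Dunkl operators. -/
def py : MvPolynomial (Fin (Module.finrank ℂ 𝔥)) ℂ →ₐ[ℂ] A :=
  commLift (fun i => D.y (Module.finBasis ℂ 𝔥 i)) fun _ _ => D.y_comm _ _

lemma px_lin (l : Module.Dual ℂ 𝔥) : D.px (lin l) = D.x l := polyLift_lin _ _ l

lemma g_px (w : W) (f : Poly 𝔥) : D.g w * D.px f = D.px (polyAct w.1 f) * D.g w := by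
  induction f using polyFun_induction with
  | hlin l => rw [px_lin, polyAct_lin, px_lin, D.g_x]
  | hconst a => rw [AlgHom.commutes, AlgHom.commutes, AlgHom.commutes, Algebra.commutes]
  | hadd f g hf hg => rw [map_add, map_add, map_add, mul_add, add_mul, hf, hg]
  | hmul f g hf hg => rw [map_mul, map_mul, map_mul, ← mul_assoc, hf, mul_assoc, hg, mul_assoc]

lemma y_px (v : 𝔥) (f : Poly 𝔥) : D.y v * D.px f = D.px f * D.y v + D.px (dirDeriv v f) -
    ∑ r : Refl W, (c.val r * r.form v) • (D.px (r.divDiff f) * D.g r.1) := by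
  induction f using polyFun_induction with
  | hlin l =>
    rw [px_lin, D.y_x, dirDeriv_lin, AlgHom.commutes]
    congr 1
    refine Finset.sum_congr rfl fun r _ => ?_
    rw [r.divDiff_lin_eq, AlgHom.commutes, ← Algebra.smul_def, smul_smul]
  | hconst a =>
    rw [AlgHom.commutes, dirDeriv_const, map_zero, add_zero, Algebra.commutes]
    simp [Refl.divDiff_const]
  | hadd f g hf hg =>
    simp only [map_add, mul_add, add_mul, hf, hg, smul_add, Finset.sum_add_distrib]
    abel
  | hmul f g hf hg =>
    have h1 : ∀ r : Refl W, D.px (r.divDiff (f * g)) * D.g r.1 =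
        D.px f * (D.px (r.divDiff g) * D.g r.1) + D.px (r.divDiff f) * D.g r.1 * D.px g := fun r => by
      rw [r.divDiff_mul, map_add, map_mul, map_mul, add_mul, mul_assoc, mul_assoc, mul_assoc, D.g_px]
      rfl
    simp only [h1, dirDeriv_mul, map_mul, map_add, smul_add, Finset.sum_add_distrib]
    rw [← mul_assoc, hf, sub_mul, add_mul, mul_assoc _ _ (D.px g), hg, mul_sub, mul_add, Finset.mul_sum,
      Finset.sum_mul]
    simp only [mul_smul_comm, smul_mul_assoc, mul_assoc]
    abel

/-- The linear map underlying the lift. -/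
def liftLin : Cher c →ₗ[ℂ] A :=
  (Finsupp.lsum ℂ fun k : W × (Fin (Module.finrank ℂ 𝔥) →₀ ℕ) =>
    LinearMap.mulRight ℂ (D.g k.1 * D.py (MvPolynomial.monomial k.2 1)) ∘ₗ D.px.toLinearMap) ∘ₗ
    (pbwEquiv c (Module.finBasis ℂ 𝔥)).symm.toLinearMap

lemma liftLin_apply (f : Poly 𝔥) (w : W) (P : MvPolynomial (Fin (Module.finrank ℂ 𝔥)) ℂ) :
    D.liftLin (mulOp c f * (grp c w * dunPoly c (Module.finBasis ℂ 𝔥) P)) =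
      D.px f * (D.g w * D.py P) := by
  induction P using MvPolynomial.induction_on' with
  | monomial α z =>
    have h1 : (MvPolynomial.monomial α z : MvPolynomial (Fin (Module.finrank ℂ 𝔥)) ℂ) =
        z • MvPolynomial.monomial α 1 := by
      rw [MvPolynomial.smul_monomial, smul_eq_mul, mul_one]
    have h2 : D.liftLin (mulOp c f *
        (grp c w * dunPoly c (Module.finBasis ℂ 𝔥) (MvPolynomial.monomial α 1))) =
        D.px f * (D.g w * D.py (MvPolynomial.monomial α 1)) := by
      have h3 := pbwEquiv_single c (Module.finBasis ℂ 𝔥) (w, α) f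
      rw [grpDun] at h3
      rw [← h3, liftLin, LinearMap.comp_apply, LinearEquiv.coe_coe, LinearEquiv.symm_apply_apply]
      simp [mul_assoc]
    rw [h1]
    simp only [map_smul, mul_smul_comm, h2]
  | add p q hp hq => simp only [map_add, mul_add, hp, hq]

lemma pbw_induction {p : Cher c → Prop} (hadd : ∀ a b, p a → p b → p (a + b)) (hzero : p 0)
    (hmk : ∀ f w P, p (mulOp c f * (grp c w * dunPoly c (Module.finBasis ℂ 𝔥) P))) (a : Cher c) :
    p a := by
  obtain ⟨a, rfl⟩ := (pbwEquiv c (Module.finBasis ℂ 𝔥)).surjective a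
  induction a using Finsupp.induction_linear with
  | zero => rw [map_zero]; exact hzero
  | add a b ha hb => rw [map_add]; exact hadd _ _ ha hb
  | single k f => rw [pbwEquiv_single]; exact hmk _ _ _

lemma liftLin_mulOp_mul (f : Poly 𝔥) (a : Cher c) :
    D.liftLin (mulOp c f * a) = D.px f * D.liftLin a := by
  induction a using pbw_induction with
  | hadd a b ha hb => simp only [mul_add, map_add, ha, hb]
  | hzero => simp
  | hmk g w P => rw [← mul_assoc, ← map_mul, liftLin_apply, liftLin_apply, map_mul, mul_assoc]

lemma liftLin_grp_mul (w : W) (a : Cher c) :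
    D.liftLin (grp c w * a) = D.g w * D.liftLin a := by
  induction a using pbw_induction with
  | hadd a b ha hb => simp only [mul_add, map_add, ha, hb]
  | hzero => simp
  | hmk g w' P =>
    rw [← mul_assoc, grp_mul_mulOp, mul_assoc, ← mul_assoc (grp c w), ← map_mul, liftLin_apply,
      liftLin_apply, ← mul_assoc (D.g w), g_px, map_mul]
    simp only [mul_assoc]

lemma liftLin_dun_mul (v : 𝔥) (a : Cher c) :
    D.liftLin (dun c v * a) = D.y v * D.liftLin a := by
  induction a using pbw_induction with
  | hadd a b ha hb => simp only [mul_add, map_add, ha, hb]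
  | hzero => simp
  | hmk f w P =>
    obtain ⟨Q, hQ, hQ'⟩ : ∃ Q : MvPolynomial (Fin (Module.finrank ℂ 𝔥)) ℂ,
        dun c (w.1.symm v) = dunPoly c (Module.finBasis ℂ 𝔥) Q ∧ D.y (w.1.symm v) = D.py Q := by
      refine ⟨∑ i, (Module.finBasis ℂ 𝔥).repr (w.1.symm v) i • MvPolynomial.X i, ?_, ?_⟩
      · simp only [map_sum, map_smul, dunPoly_X]
        conv_lhs => rw [← (Module.finBasis ℂ 𝔥).sum_repr (w.1.symm v)]
        simp only [map_sum, map_smul]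
      · simp only [map_sum, map_smul, py, commLift_X]
        conv_lhs => rw [← (Module.finBasis ℂ 𝔥).sum_repr (w.1.symm v)]
        simp only [map_sum, map_smul]
    have h1 := grp_mul_dun c w (w.1.symm v)
    rw [LinearEquiv.apply_symm_apply] at h1
    have h1' := D.g_y w (w.1.symm v)
    rw [LinearEquiv.apply_symm_apply] at h1'
    have h2 : dun c v * (grp c w * dunPoly c (Module.finBasis ℂ 𝔥) P) =
        grp c w * dunPoly c (Module.finBasis ℂ 𝔥) (Q * P) := by
      rw [← mul_assoc, ← h1, mul_assoc, hQ, ← map_mul]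
    have h2' : D.y v * (D.g w * D.py P) = D.g w * D.py (Q * P) := by
      rw [← mul_assoc, ← h1', mul_assoc, hQ', ← map_mul]
    have h3 : ∀ r : Refl W, mulOp c (r.divDiff f) * grp c r.1 *
        (grp c w * dunPoly c (Module.finBasis ℂ 𝔥) P) =
        mulOp c (r.divDiff f) * (grp c (r.1 * w) * dunPoly c (Module.finBasis ℂ 𝔥) P) := fun r => by
      rw [map_mul]; simp only [mul_assoc]
    have h4 : dun c v * (mulOp c f * (grp c w * dunPoly c (Module.finBasis ℂ 𝔥) P)) =
        mulOp c f * (grp c w * dunPoly c (Module.finBasis ℂ 𝔥) (Q * P)) +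
        mulOp c (dirDeriv v f) * (grp c w * dunPoly c (Module.finBasis ℂ 𝔥) P) -
        ∑ r : Refl W, (c.val r * r.form v) •
          (mulOp c (r.divDiff f) * (grp c (r.1 * w) * dunPoly c (Module.finBasis ℂ 𝔥) P)) := by
      rw [← mul_assoc, dun_mul_mulOp, sub_mul, add_mul, mul_assoc _ (dun c v), h2, Finset.sum_mul]
      exact congrArg _ (Finset.sum_congr rfl fun r _ => by rw [smul_mul_assoc, h3])
    have h4' : D.y v * (D.px f * (D.g w * D.py P)) = D.px f * (D.g w * D.py (Q * P)) +
        D.px (dirDeriv v f) * (D.g w * D.py P) -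
        ∑ r : Refl W, (c.val r * r.form v) • (D.px (r.divDiff f) * (D.g (r.1 * w) * D.py P)) := by
      rw [← mul_assoc, D.y_px, sub_mul, add_mul, mul_assoc _ (D.y v), h2', Finset.sum_mul]
      exact congrArg _ (Finset.sum_congr rfl fun r _ => by
        rw [smul_mul_assoc, map_mul]; simp only [mul_assoc])
    rw [h4, liftLin_apply, h4', map_sub, map_add, map_sum]
    simp only [map_smul, liftLin_apply]

lemma liftLin_one : D.liftLin 1 = 1 := by
  have := D.liftLin_apply 1 1 1
  simpa using this

/-- The Cherednik algebra is presented by its defining relations. -/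
def lift : Cher c →ₐ[ℂ] A :=
  AlgHom.ofLinearMap D.liftLin D.liftLin_one fun a b => by
    induction a using cherednik_induction generalizing b with
    | hgrp w => rw [liftLin_grp_mul, ← mul_one (grp c w), liftLin_grp_mul, liftLin_one, mul_one]
    | hmulOp f => rw [liftLin_mulOp_mul, ← mul_one (mulOp c f), liftLin_mulOp_mul, liftLin_one, mul_one]
    | hdun v => rw [liftLin_dun_mul, ← mul_one (dun c v), liftLin_dun_mul, liftLin_one, mul_one]
    | hadd a a' ha ha' => rw [add_mul, map_add, map_add, add_mul, ha, ha']
    | hmul a a' ha ha' => rw [mul_assoc, ha, ha', ha, mul_assoc]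

lemma lift_grp (w : W) : D.lift (grp c w) = D.g w := by
  have := D.liftLin_grp_mul w 1
  rwa [mul_one, liftLin_one, mul_one] at this

lemma lift_lin (l : Module.Dual ℂ 𝔥) : D.lift (mulOp c (lin l)) = D.x l := by
  have := D.liftLin_mulOp_mul (lin l) 1
  rwa [mul_one, liftLin_one, mul_one, px_lin] at this

lemma lift_dun (v : 𝔥) : D.lift (dun c v) = D.y v := by
  have := D.liftLin_dun_mul v 1
  rwa [mul_one, liftLin_one, mul_one] at this

end CherGen

end Lifting

section Hermitian

variable {G : Type u} [Group G] [Finite G]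
variable {V : Type u} [AddCommGroup V] [Module ℂ V] [FiniteDimensional ℂ V]

/-- Every finite dimensional representation of a finite group carries an invariant positive
definite Hermitian form. -/
lemma exists_invariant_form (ρ : Representation ℂ G V) : ∃ Φ : V →ₗ⋆[ℂ] V →ₗ[ℂ] ℂ,
    (∀ u v, Φ v u = starRingEnd ℂ (Φ u v)) ∧ (∀ v, v ≠ 0 → 0 < (Φ v v).re) ∧
    ∀ g u v, Φ (ρ g u) (ρ g v) = Φ u v := by
  have := Fintype.ofFinite G
  let b := Module.finBasis ℂ V
  let Φ : V →ₗ⋆[ℂ] V →ₗ[ℂ] ℂ := LinearMap.mk₂'ₛₗ (starRingEnd ℂ) (RingHom.id ℂ)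
    (fun u v => ∑ g : G, ∑ i, starRingEnd ℂ (b.repr (ρ g u) i) * b.repr (ρ g v) i)
    (fun u u' v => by simp [add_mul, Finset.sum_add_distrib])
    (fun a u v => by simp [mul_assoc, Finset.mul_sum])
    (fun u v v' => by simp [mul_add, Finset.sum_add_distrib])
    (fun a u v => by simp [mul_left_comm, Finset.mul_sum])
  have hΦ : ∀ u v, Φ u v = ∑ g : G, ∑ i, starRingEnd ℂ (b.repr (ρ g u) i) * b.repr (ρ g v) i :=
    fun _ _ => rfl
  refine ⟨Φ, fun u v => ?_, fun v hv => ?_, fun g u v => ?_⟩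
  · simp only [hΦ, map_sum, map_mul, Complex.conj_conj]
    simp only [mul_comm]
  · have h1 : (Φ v v).re = ∑ g : G, ∑ i, Complex.normSq (b.repr (ρ g v) i) := by
      simp only [hΦ, Complex.re_sum, ← Complex.normSq_eq_conj_mul_self, Complex.ofReal_re]
    rw [h1]
    refine Finset.sum_pos' (fun g _ => Finset.sum_nonneg fun i _ => Complex.normSq_nonneg _)
      ⟨1, Finset.mem_univ _, ?_⟩
    obtain ⟨i, hi⟩ : ∃ i, b.repr v i ≠ 0 := by
      by_contra! h
      exact hv (b.repr.map_eq_zero_iff.mp (Finsupp.ext h))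
    refine Finset.sum_pos' (fun i _ => Complex.normSq_nonneg _) ⟨i, Finset.mem_univ _, ?_⟩
    rw [map_one]
    exact Complex.normSq_pos.mpr hi
  · simp only [hΦ, ← Module.End.mul_apply, ← map_mul]
    exact Fintype.sum_equiv (Equiv.mulRight g) _ _ fun h => rfl

/-- A conjugate linear injection between spaces of the same finite dimension is surjective. -/
lemma conjLinear_surjective {U : Type*} [AddCommGroup U] [Module ℂ U] [FiniteDimensional ℂ U]
    (f : V →ₗ⋆[ℂ] U) (hf : Function.Injective f)
    (h : Module.finrank ℂ U ≤ Module.finrank ℂ V) : Function.Surjective f := by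
  let g : V →ₗ[ℝ] U :=
    { toFun := f
      map_add' := map_add f
      map_smul' := fun r v => by
        change f ((r : ℂ) • v) = (r : ℂ) • f v
        rw [f.map_smulₛₗ, Complex.conj_ofReal] }
  have : FiniteDimensional ℝ V := FiniteDimensional.complexToReal V
  have : FiniteDimensional ℝ U := FiniteDimensional.complexToReal U
  have h1 : Module.finrank ℝ V = Module.finrank ℝ U := by
    refine le_antisymm (LinearMap.finrank_le_finrank_of_injective (f := g) hf) ?_
    rw [finrank_real_of_complex, finrank_real_of_complex]
    omega
  exact (LinearMap.injective_iff_surjective_of_finrank_eq_finrank (f := g) h1).mp hf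

/-- Finite dimensional representations in nondegenerate invariant sesquilinear duality are
isomorphic. -/
lemma equiv_of_pairing {U : Type u} [AddCommGroup U] [Module ℂ U] [FiniteDimensional ℂ U]
    (σ : Representation ℂ G U) (ρ : Representation ℂ G V) (Ψ : U →ₗ⋆[ℂ] V →ₗ[ℂ] ℂ)
    (hinv : ∀ g u v, Ψ (σ g u) (ρ g v) = Ψ u v) (hl : ∀ u, (∀ v, Ψ u v = 0) → u = 0)
    (hr : ∀ v, (∀ u, Ψ u v = 0) → v = 0) : Nonempty (σ.Equiv ρ) := by
  obtain ⟨Φ, hsymm, hpos, hΦ⟩ := exists_invariant_form ρ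
  have hΦinj : Function.Injective Φ := by
    rw [injective_iff_map_eq_zero]
    intro v hv
    by_contra hne
    have := hpos v hne
    rw [hv] at this
    simp at this
  have hΦsurj : Function.Surjective Φ :=
    conjLinear_surjective Φ hΦinj (Subspace.dual_finrank_eq).le
  choose s hs using hΦsurj
  have hsΨ : ∀ u v, Φ (s (Ψ u)) v = Ψ u v := fun u v => by rw [hs]
  let f : U →ₗ[ℂ] V :=
    { toFun := fun u => s (Ψ u)
      map_add' := fun u u' => hΦinj (by rw [hs, map_add, map_add, hs, hs])
      map_smul' := fun a u => hΦinj (by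
        rw [hs, RingHom.id_apply, Φ.map_smulₛₗ, hs, Ψ.map_smulₛₗ]) }
  have hfinj : Function.Injective f := by
    rw [injective_iff_map_eq_zero]
    intro u hu
    refine hl u fun v => ?_
    rw [← hsΨ]
    change Φ (f u) v = 0
    rw [hu, map_zero, LinearMap.zero_apply]
  have hfsurj : Function.Surjective f := by
    have h1 : Function.Injective (Ψ.flip) := by
      rw [injective_iff_map_eq_zero]
      intro v hv
      exact hr v fun u => LinearMap.congr_fun hv u
    rw [← LinearMap.range_eq_top]
    by_contra hne
    obtain ⟨φ, hφ, hφ'⟩ := Submodule.exists_le_ker_of_lt_top _ (lt_top_iff_ne_top.mpr hne)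
    refine hφ (LinearMap.ext fun v => ?_)
    have h2 : s φ = 0 := hr _ fun u => by
      have h3 : φ (f u) = 0 := hφ' ⟨u, rfl⟩
      rw [← hsΨ, hsymm]
      change starRingEnd ℂ (Φ (s φ) (f u)) = 0
      rw [hs, h3, map_zero]
    have h4 := hs φ
    rw [h2, map_zero] at h4
    rw [← h4]
  have hint : ∀ g, f ∘ₗ σ g = ρ g ∘ₗ f := fun g => by
    refine LinearMap.ext fun u => hΦinj (LinearMap.ext fun v => ?_)
    have h1 : Φ (ρ g (f u)) v = Ψ u (ρ g⁻¹ v) := by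
      have h2 := hΦ g (f u) (ρ g⁻¹ v)
      rw [← Module.End.mul_apply, ← map_mul, mul_inv_cancel, map_one, Module.End.one_apply] at h2
      exact h2.trans (hsΨ u _)
    have h3 := hinv g u (ρ g⁻¹ v)
    rw [← Module.End.mul_apply (ρ g), ← map_mul, mul_inv_cancel, map_one, Module.End.one_apply] at h3
    exact (hsΨ (σ g u) v).trans (h3.trans h1.symm)
  exact ⟨.mk (LinearEquiv.ofBijective f ⟨hfinj, hfsurj⟩) hint⟩

end Hermitian

section InvariantForms

variable {𝔥 : Type u} [AddCommGroup 𝔥] [Module ℂ 𝔥] [FiniteDimensional ℂ 𝔥]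
  {W : Subgroup (𝔥 ≃ₗ[ℂ] 𝔥)}

lemma nonempty_invForm [Finite W] : Nonempty (InvForm W) := by
  obtain ⟨Φ, h1, h2, h3⟩ := exists_invariant_form (hRep W)
  exact ⟨⟨Φ, h1, h2, h3⟩⟩

namespace InvForm

variable (B : InvForm W)

lemma toDual_injective : Function.Injective B.toDual := by
  rw [injective_iff_map_eq_zero]
  intro v hv
  by_contra hne
  have := B.pos v hne
  rw [hv] at this
  simp at this

/-- The conjugate linear isomorphism `𝔥 ≃ 𝔥*`. -/
def equiv : 𝔥 ≃ₛₗ[starRingEnd ℂ] Module.Dual ℂ 𝔥 :=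
  LinearEquiv.ofBijective B.toDual ⟨B.toDual_injective,
    conjLinear_surjective _ B.toDual_injective (Subspace.dual_finrank_eq).le⟩

lemma equiv_apply (v : 𝔥) : B.equiv v = B.toDual v := rfl

lemma toDual_equiv_symm (x : Module.Dual ℂ 𝔥) : B.toDual (B.equiv.symm x) = x :=
  B.equiv.apply_symm_apply x

lemma equiv_symm_toDual (v : 𝔥) : B.equiv.symm (B.toDual v) = v := B.equiv.symm_apply_apply v

lemma toDual_apply_symm (w : W) (u v : 𝔥) : B.toDual (w.1 u) v = B.toDual u (w.1.symm v) := by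
  have := B.inv w u (w.1.symm v)
  rwa [LinearEquiv.apply_symm_apply] at this

lemma toDual_map (w : W) (v : 𝔥) : B.toDual (w.1 v) = B.toDual v ∘ₗ w.1.symm.toLinearMap :=
  LinearMap.ext fun u => B.toDual_apply_symm w v u

lemma equiv_symm_comp (w : W) (x : Module.Dual ℂ 𝔥) :
    B.equiv.symm (x ∘ₗ w.1.symm.toLinearMap) = w.1 (B.equiv.symm x) := by
  rw [LinearEquiv.symm_apply_eq, equiv_apply, toDual_map, toDual_equiv_symm]

end InvForm

end InvariantForms

section Pairings

variable {𝔥 : Type u} [AddCommGroup 𝔥] [Module ℂ 𝔥]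
  {W : Subgroup (𝔥 ≃ₗ[ℂ] 𝔥)}

/-- The inverse of a reflection. -/
def Refl.inv (r : Refl W) : Refl W :=
  ⟨r.1⁻¹, by
    have h : fixedSpace ((r.1⁻¹ : W) : 𝔥 ≃ₗ[ℂ] 𝔥) = fixedSpace (r.1 : 𝔥 ≃ₗ[ℂ] 𝔥) := by
      ext y
      rw [mem_fixedSpace, mem_fixedSpace]
      change (r.1 : 𝔥 ≃ₗ[ℂ] 𝔥).symm y = y ↔ _
      rw [LinearEquiv.symm_apply_eq]
      exact eq_comm
    rw [h]
    exact r.2⟩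

lemma Refl.inv_inv (r : Refl W) : r.inv.inv = r := Subtype.ext (_root_.inv_inv r.1)

lemma Refl.inv_conj (w : W) (r : Refl W) : (r.conj w).inv = r.inv.conj w := Subtype.ext (by
  change (w * r.1 * w⁻¹)⁻¹ = w * r.1⁻¹ * w⁻¹
  group)

/-- The involution `r ↦ r⁻¹` of the set of reflections. -/
def Refl.invEquiv : Refl W ≃ Refl W := ⟨Refl.inv, Refl.inv, Refl.inv_inv, Refl.inv_inv⟩

/-- Parameters with `c'_{r⁻¹} = conj c_r`. -/
def IsDual (c c' : Param W) : Prop := ∀ r : Refl W, c'.val r.inv = starRingEnd ℂ (c.val r)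

lemma IsDual.symm {c c' : Param W} (h : IsDual c c') : IsDual c' c := fun r => by
  have := h r.inv
  rw [r.inv_inv] at this
  rw [this, Complex.conj_conj]

/-- The parameter `r ↦ conj c_{r⁻¹}`. -/
def Param.star (c : Param W) : Param W where
  val r := starRingEnd ℂ (c.val r.inv)
  val_conj w r := by rw [Refl.inv_conj, c.val_conj]

lemma isDual_star (c : Param W) : IsDual c c.star := fun r => by
  change starRingEnd ℂ (c.val r.inv.inv) = _
  rw [r.inv_inv]

lemma Param.IsReal.isDual {c : Param W} (h : c.IsReal) : IsDual c c := fun r => h r r.inv rfl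

variable [FiniteDimensional ℂ 𝔥] [Finite W] {c c' : Param W}

/-- A contravariant sesquilinear pairing of a module over `H_{c'}` with a module over `H_c`. -/
structure CPair (B : InvForm W) (P : ModuleCat.{u} (Cher c')) (A : ModuleCat.{u} (Cher c)) where
  /-- the sesquilinear form -/
  form : P →ₗ⋆[ℂ] A →ₗ[ℂ] ℂ
  grp_grp : ∀ (w : W) p a, form (grp c' w • p) (grp c w • a) = form p a
  dun_left : ∀ (v : 𝔥) p a, form (dun c' v • p) a = form p (mulOp c (lin (B.toDual v)) • a)
  lin_left : ∀ (v : 𝔥) p a, form (mulOp c' (lin (B.toDual v)) • p) a = form p (dun c v • a)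

/-- On a generalized eigenspace, subtracting another number from an operator is surjective. -/
lemma exists_sub_pow_of_maxGenEigenspace {V : Type*} [AddCommGroup V] [Module ℂ V]
    (T : Module.End ℂ V) {a b : ℂ} (hab : a ≠ b) {v : V} (hv : v ∈ T.maxGenEigenspace a) (k : ℕ) :
    ∃ u, ((T - b • 1) ^ k) u = v := by
  rw [Module.End.mem_maxGenEigenspace] at hv
  obtain ⟨m, hm⟩ := hv
  have hc : IsCoprime ((Polynomial.X - Polynomial.C b) ^ k) ((Polynomial.X - Polynomial.C a) ^ m) :=
    (Polynomial.isCoprime_X_sub_C_of_isUnit_sub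
      (sub_ne_zero.mpr hab.symm).isUnit).pow
  obtain ⟨p, q, hpq⟩ := hc
  have hX : ∀ z : ℂ, Polynomial.aeval T (Polynomial.X - Polynomial.C z) = T - z • 1 := fun z => by
    rw [map_sub, Polynomial.aeval_X, Polynomial.aeval_C, Algebra.algebraMap_eq_smul_one]
  have h1 := congrArg (fun r => Polynomial.aeval T r v) hpq
  refine ⟨Polynomial.aeval T p v, ?_⟩
  rw [mul_comm p] at h1
  simp only [map_add, map_mul, map_pow, map_one, hX, LinearMap.add_apply, Module.End.mul_apply, hm,
    map_zero, add_zero, Module.End.one_apply] at h1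
  exact h1

namespace CPair

variable {B : InvForm W} {P : ModuleCat.{u} (Cher c')} {A : ModuleCat.{u} (Cher c)}
  (Ψ : CPair B P A)

lemma form_smul_left (z : ℂ) (p : P) (a : A) : Ψ.form (z • p) a = starRingEnd ℂ z * Ψ.form p a := by
  rw [Ψ.form.map_smulₛₗ]; rfl

lemma grp_left (w : W) (p : P) (a : A) : Ψ.form (grp c' w • p) a = Ψ.form p (grp c w⁻¹ • a) := by
  have h := Ψ.grp_grp w p (grp c w⁻¹ • a)
  rwa [← mul_smul, ← map_mul, mul_inv_cancel, map_one, one_smul] at h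

lemma lin_left' (x : Module.Dual ℂ 𝔥) (p : P) (a : A) :
    Ψ.form (mulOp c' (lin x) • p) a = Ψ.form p (dun c (B.equiv.symm x) • a) := by
  rw [← Ψ.lin_left, B.toDual_equiv_symm]

/-- The pairing with the roles of the modules exchanged. -/
def flip : CPair B A P where
  form := LinearMap.mk₂'ₛₗ (starRingEnd ℂ) (RingHom.id ℂ) (fun a p => starRingEnd ℂ (Ψ.form p a))
    (fun a a' p => by rw [map_add, map_add])
    (fun z a p => by rw [map_smul, smul_eq_mul, map_mul]; rfl)
    (fun a p p' => by rw [map_add, LinearMap.add_apply, map_add])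
    (fun z a p => by rw [form_smul_left, map_mul, Complex.conj_conj]; rfl)
  grp_grp w a p := congrArg (starRingEnd ℂ) (Ψ.grp_grp w p a)
  dun_left v a p := congrArg (starRingEnd ℂ) (Ψ.lin_left v p a).symm
  lin_left v a p := congrArg (starRingEnd ℂ) (Ψ.dun_left v p a).symm

@[simp] lemma flip_apply (a : A) (p : P) : Ψ.flip.form a p = starRingEnd ℂ (Ψ.form p a) := rfl

/-- The pullback of a pairing along a homomorphism. -/
def comp {Q : ModuleCat.{u} (Cher c')} (f : Q →ₗ[Cher c'] P) : CPair B Q A where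
  form := LinearMap.comp Ψ.form (f.restrictScalars ℂ)
  grp_grp w p a := by
    change Ψ.form (f _) _ = Ψ.form (f _) _
    rw [map_smul f, Ψ.grp_grp]
  dun_left v p a := by
    change Ψ.form (f _) _ = Ψ.form (f _) _
    rw [map_smul f, Ψ.dun_left]
  lin_left v p a := by
    change Ψ.form (f _) _ = Ψ.form (f _) _
    rw [map_smul f, Ψ.lin_left]

@[simp] lemma comp_apply {Q : ModuleCat.{u} (Cher c')} (f : Q →ₗ[Cher c'] P) (q : Q) (a : A) :
    (Ψ.comp f).form q a = Ψ.form (f q) a := rfl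

lemma zElt_left (h : IsDual c c') (p : P) (a : A) :
    Ψ.form (zElt c' • p) a = Ψ.form p (zElt c • a) := by
  simp only [zElt, Finset.sum_smul, map_sum, LinearMap.sum_apply]
  refine (Fintype.sum_equiv Refl.invEquiv _ _ fun r => ?_).symm
  change Ψ.form p ((c.val r • (1 - grp c r.1)) • a) =
    Ψ.form ((c'.val r.inv • (1 - grp c' r.inv.1)) • p) a
  rw [h, smul_assoc, smul_assoc, form_smul_left, Complex.conj_conj, map_smul, smul_eq_mul,
    sub_smul, sub_smul, map_sub, map_sub, LinearMap.sub_apply, one_smul, one_smul, grp_left]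
  congr 4

lemma sum_lin_dun (B : InvForm W) : ∑ i, mulOp c (lin (B.toDual (Module.finBasis ℂ 𝔥 i))) *
      dun c (B.equiv.symm ((Module.finBasis ℂ 𝔥).coord i)) =
    ∑ i, mulOp c (lin ((Module.finBasis ℂ 𝔥).coord i)) * dun c (Module.finBasis ℂ 𝔥 i) := by
  let b := Module.finBasis ℂ 𝔥
  let u := fun i => B.equiv.symm (b.coord i)
  have h1 : ∀ v, dun c v = ∑ j, b.repr v j • dun c (b j) := fun v => by
    conv_lhs => rw [← b.sum_repr v]
    simp only [map_sum, map_smul]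
  have h2 : ∀ x, mulOp c (lin x) = ∑ k, x (b k) • mulOp c (lin (b.coord k)) := fun x => by
    rw [lin_eq_sum_coord b x, map_sum]
    simp only [map_smul]
  have hu : ∀ i, B.toDual (u i) = b.coord i := fun i => B.toDual_equiv_symm _
  have h3 : ∀ k j, ∑ i, B.toDual (b i) (b k) * b.repr (u i) j = b.coord j (b k) := fun k j => by
    have h4 : ∀ i, B.toDual (b i) (b k) * b.repr (u i) j =
        starRingEnd ℂ (B.toDual (b k) (b i) * b.repr (u j) i) := fun i => by
      rw [map_mul, ← B.symm]
      congr 1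
      change b.coord j (u i) = starRingEnd ℂ (b.coord i (u j))
      rw [← hu, ← hu, ← B.symm]
    simp only [h4]
    rw [← map_sum, ← dual_apply_eq_sum b, ← B.symm, hu]
  have h5 : ∀ i, mulOp c (lin (B.toDual (b i))) * dun c (u i) =
      ∑ k, ∑ j, (B.toDual (b i) (b k) * b.repr (u i) j) • (mulOp c (lin (b.coord k)) * dun c (b j)) :=
    fun i => by
      rw [h1 (u i), h2 (B.toDual (b i)), Finset.sum_mul]
      refine Finset.sum_congr rfl fun k _ => ?_
      rw [Finset.mul_sum]
      refine Finset.sum_congr rfl fun j _ => ?_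
      rw [smul_mul_smul_comm]
  change ∑ i, mulOp c (lin (B.toDual (b i))) * dun c (u i) = _
  simp only [h5]
  rw [Finset.sum_comm]
  refine Finset.sum_congr rfl fun k _ => ?_
  rw [Finset.sum_comm]
  simp only [← Finset.sum_smul, h3]
  rw [Finset.sum_eq_single k]
  · simp [b]
  · intro j _ hj
    simp [hj.symm]
  · simp

lemma euler_left (h : IsDual c c') (p : P) (a : A) :
    Ψ.form (euler c' • p) a = Ψ.form p (euler c • a) := by
  rw [euler_eq, euler_eq, add_smul, add_smul, map_add, map_add, LinearMap.add_apply,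
    Ψ.zElt_left h]
  congr 1
  rw [← sum_lin_dun (c := c) B, Finset.sum_smul, Finset.sum_smul, map_sum, map_sum,
    LinearMap.sum_apply]
  refine Finset.sum_congr rfl fun i _ => ?_
  rw [mul_smul, mul_smul, Ψ.lin_left', Ψ.dun_left]

lemma euler_pow_left (h : IsDual c c') (d : ℂ) (k : ℕ) (p : P) (a : A) :
    Ψ.form (((act c' P (euler c') - d • 1) ^ k) p) a =
      Ψ.form p (((act c A (euler c) - starRingEnd ℂ d • 1) ^ k) a) := by
  induction k generalizing p a with
  | zero => rfl
  | succ k ih =>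
    rw [pow_succ, pow_succ', Module.End.mul_apply, Module.End.mul_apply, ih]
    simp only [LinearMap.sub_apply, act_apply, LinearMap.smul_apply, Module.End.one_apply, map_sub,
      Ψ.euler_left h, map_smul, form_smul_left, smul_eq_mul]

/-- Weight spaces are orthogonal unless their weights are conjugate. -/
lemma form_eq_zero (h : IsDual c c') {d e : ℂ} (hde : starRingEnd ℂ d ≠ e) {p : P} {a : A}
    (hp : p ∈ wt c' P d) (ha : a ∈ wt c A e) : Ψ.form p a = 0 := by
  rw [wt, Module.End.mem_maxGenEigenspace] at hp
  obtain ⟨k, hk⟩ := hp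
  obtain ⟨a', rfl⟩ := exists_sub_pow_of_maxGenEigenspace _ hde.symm ha k
  rw [← Ψ.euler_pow_left h, hk, map_zero, LinearMap.zero_apply]

end CPair

end Pairings

section DualModule

variable {𝔥 : Type u} [AddCommGroup 𝔥] [Module ℂ 𝔥] [FiniteDimensional ℂ 𝔥]
  {W : Subgroup (𝔥 ≃ₗ[ℂ] 𝔥)} [Finite W] {c c' : Param W}

/-- The conjugate linear functionals on a module. -/
abbrev ConjFun (A : ModuleCat.{u} (Cher c)) : Type u := A →ₗ⋆[ℂ] ℂ

/-- Precomposition of conjugate linear functionals with the action of an element. -/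
def preAct (A : ModuleCat.{u} (Cher c)) (a : Cher c) : Module.End ℂ (ConjFun A) where
  toFun φ := φ.comp (act c A a)
  map_add' _ _ := rfl
  map_smul' _ _ := rfl

lemma preAct_apply (A : ModuleCat.{u} (Cher c)) (a : Cher c) (φ : ConjFun A) (m : A) :
    preAct A a φ m = φ (a • m) := rfl

lemma preAct_mul (A : ModuleCat.{u} (Cher c)) (a b : Cher c) :
    preAct A (a * b) = preAct A b * preAct A a := by
  refine LinearMap.ext fun φ => LinearMap.ext fun m => ?_
  exact congrArg φ (mul_smul a b m)

variable (h : IsDual c c') (B : InvForm W) (A : ModuleCat.{u} (Cher c))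

/-- The contragredient action on conjugate linear functionals. -/
def dualGen : CherGen (Module.End ℂ (ConjFun A)) c' where
  g :=
    { toFun := fun w => preAct A (grp c w⁻¹)
      map_one' := by
        refine LinearMap.ext fun φ => LinearMap.ext fun m => ?_
        rw [preAct_apply, inv_one, map_one, one_smul]; rfl
      map_mul' := fun w w' => by rw [mul_inv_rev, map_mul, preAct_mul] }
  x :=
    { toFun := fun l => preAct A (dun c (B.equiv.symm l))
      map_add' := fun k l => by
        refine LinearMap.ext fun φ => LinearMap.ext fun m => ?_
        simp only [preAct_apply, map_add, add_smul, LinearMap.add_apply]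
      map_smul' := fun z l => by
        refine LinearMap.ext fun φ => LinearMap.ext fun m => ?_
        simp only [preAct_apply, LinearEquiv.map_smulₛₗ, map_smul, smul_assoc, LinearMap.map_smulₛₗ,
          LinearMap.smul_apply]
        simp }
  y :=
    { toFun := fun v => preAct A (mulOp c (lin (B.toDual v)))
      map_add' := fun k l => by
        refine LinearMap.ext fun φ => LinearMap.ext fun m => ?_
        have h1 : lin (B.toDual k + B.toDual l) = lin (B.toDual k) + lin (B.toDual l) := rfl
        simp only [preAct_apply, map_add, add_smul, LinearMap.add_apply, h1]
      map_smul' := fun z l => by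
        refine LinearMap.ext fun φ => LinearMap.ext fun m => ?_
        have h1 : lin (starRingEnd ℂ z • B.toDual l) = starRingEnd ℂ z • lin (B.toDual l) := rfl
        simp only [preAct_apply, LinearMap.map_smulₛₗ, h1, map_smul, smul_assoc,
          LinearMap.smul_apply]
        simp }
  x_comm k l := by
    change preAct A _ * preAct A _ = preAct A _ * preAct A _
    rw [← preAct_mul, ← preAct_mul, dun_comm]
  y_comm u v := by
    change preAct A _ * preAct A _ = preAct A _ * preAct A _
    rw [← preAct_mul, ← preAct_mul, ← map_mul, ← map_mul, mul_comm]
  g_x w l := by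
    change preAct A _ * preAct A _ = preAct A _ * preAct A _
    rw [← preAct_mul, ← preAct_mul, B.equiv_symm_comp, grp_mul_dun]
    congr 3
    exact (w.1.symm_apply_apply _).symm
  g_y w v := by
    change preAct A _ * preAct A _ = preAct A _ * preAct A _
    rw [← preAct_mul, ← preAct_mul, B.toDual_map, grp_mul_mulOp, polyAct_lin]
    congr 4
    refine LinearMap.ext fun u => ?_
    change _ = B.toDual v (w.1.symm (w.1 u))
    rw [LinearEquiv.symm_apply_apply]
  y_x v l := by
    change preAct A _ * preAct A _ = preAct A _ * preAct A _ + _ - _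
    rw [← preAct_mul, ← preAct_mul, dun_mul_lin]
    refine LinearMap.ext fun φ => LinearMap.ext fun m => ?_
    simp only [preAct_apply, LinearMap.sub_apply, LinearMap.add_apply, sub_smul, add_smul, map_sub,
      map_add, Finset.sum_smul, map_sum, LinearMap.sum_apply, smul_assoc, LinearMap.map_smulₛₗ,
      algebraMap_smul, Module.algebraMap_end_apply, LinearMap.smul_apply]
    congr 1
    · congr 2
      rw [← B.symm, B.toDual_equiv_symm]
    · refine Fintype.sum_equiv Refl.invEquiv _ _ fun r => ?_
      change starRingEnd ℂ _ • φ (grp c r.1 • m) = _ • φ (grp c (r.inv.1)⁻¹ • m)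
      have h1 : (r.inv.1)⁻¹ = r.1 := inv_inv _
      rw [h1]
      congr 1
      have h2 := congrArg (B.toDual v) (r.sub_symm (B.equiv.symm l))
      have h3 := congrArg l (r.inv.sub_symm v)
      rw [map_smul, smul_eq_mul] at h2 h3
      change _ = c'.val r.inv * r.inv.form v * l r.inv.coroot
      rw [h, mul_assoc, mul_assoc, map_mul, ← h2, ← h3, map_sub, map_sub, map_sub, ← B.symm, ← B.symm,
        B.toDual_equiv_symm]
      congr 2
      have h4 := B.toDual_apply_symm r.inv.1 (B.equiv.symm l) v
      rw [B.toDual_equiv_symm] at h4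
      exact h4

/-- The module of conjugate linear functionals. -/
def ConjDual (_ : IsDual c c') (_ : InvForm W) (A : ModuleCat.{u} (Cher c)) : Type u := ConjFun A

instance : AddCommGroup (ConjDual h B A) := inferInstanceAs (AddCommGroup (ConjFun A))

instance : Module (Cher c') (ConjDual h B A) :=
  Module.compHom (ConjFun A) (dualGen h B A).lift.toRingHom

variable {A} in
/-- The functional underlying an element of the dual. -/
def ConjDual.toFun (φ : ConjDual h B A) : ConjFun A := φ

lemma conjDual_smul (a : Cher c') (φ : ConjDual h B A) :
    ConjDual.toFun h B (a • φ) = (dualGen h B A).lift a (ConjDual.toFun h B φ) := rfl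

variable {A} in
/-- The functionals that vanish on all weight spaces with weights outside a set. -/
def SupportedOn (S : Set ℂ) (φ : ConjFun A) : Prop := ∀ d ∉ S, ∀ m ∈ wt c A d, φ m = 0

/-- The conjugate linear functionals that vanish on all but finitely many weight spaces. -/
def dualSub : Submodule (Cher c') (ConjDual h B A) where
  carrier := {φ | ∃ S : Finset ℂ, SupportedOn (S : Set ℂ) (ConjDual.toFun h B φ)}
  zero_mem' := ⟨∅, fun _ _ _ _ => rfl⟩
  add_mem' := by
    classical
    rintro φ ψ ⟨S, hS⟩ ⟨T, hT⟩
    refine ⟨S ∪ T, fun d hd m hm => ?_⟩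
    rw [Finset.coe_union, Set.mem_union, not_or] at hd
    change ConjDual.toFun h B φ m + ConjDual.toFun h B ψ m = 0
    rw [hS d hd.1 m hm, hT d hd.2 m hm, add_zero]
  smul_mem' := by
    classical
    intro a φ hφ
    induction a using cherednik_induction generalizing φ with
    | hgrp w =>
      obtain ⟨S, hS⟩ := hφ
      refine ⟨S, fun d hd m hm => ?_⟩
      rw [conjDual_smul, CherGen.lift_grp]
      exact hS d hd _ (grp_wt _ hm)
    | hmulOp f =>
      induction f using polyFun_induction generalizing φ with
      | hlin x =>
        obtain ⟨S, hS⟩ := hφ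
        refine ⟨S.image (· + 1), fun d hd m hm => ?_⟩
        rw [conjDual_smul, CherGen.lift_lin]
        refine hS (d - 1) (fun h => hd ?_) _ (dun_wt _ hm)
        rw [Finset.coe_image]
        exact ⟨_, h, sub_add_cancel d 1⟩
      | hconst z =>
        obtain ⟨S, hS⟩ := hφ
        refine ⟨S, fun d hd m hm => ?_⟩
        rw [conjDual_smul, AlgHom.commutes, AlgHom.commutes, Module.algebraMap_end_apply,
          LinearMap.smul_apply, hS d hd m hm, smul_zero]
      | hadd f g hf hg =>
        obtain ⟨S, hS⟩ := hf hφ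
        obtain ⟨T, hT⟩ := hg hφ
        refine ⟨S ∪ T, fun d hd m hm => ?_⟩
        rw [Finset.coe_union, Set.mem_union, not_or] at hd
        rw [map_add, add_smul]
        change ConjDual.toFun h B (mulOp c' f • φ) m + ConjDual.toFun h B (mulOp c' g • φ) m = 0
        rw [hS d hd.1 m hm, hT d hd.2 m hm, add_zero]
      | hmul f g hf hg =>
        rw [map_mul, mul_smul]
        exact hf (hg hφ)
    | hdun v =>
      obtain ⟨S, hS⟩ := hφ
      refine ⟨S.image (· - 1), fun d hd m hm => ?_⟩
      rw [conjDual_smul, CherGen.lift_dun]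
      refine hS (d + 1) (fun h => hd ?_) _ (lin_wt _ hm)
      rw [Finset.coe_image]
      exact ⟨_, h, add_sub_cancel_right d 1⟩
    | hadd a b ha hb =>
      obtain ⟨S, hS⟩ := ha hφ
      obtain ⟨T, hT⟩ := hb hφ
      refine ⟨S ∪ T, fun d hd m hm => ?_⟩
      rw [Finset.coe_union, Set.mem_union, not_or] at hd
      rw [add_smul]
      change ConjDual.toFun h B (a • φ) m + ConjDual.toFun h B (b • φ) m = 0
      rw [hS d hd.1 m hm, hT d hd.2 m hm, add_zero]
    | hmul a b ha hb =>
      rw [mul_smul]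
      exact ha (hb hφ)

/-- The contravariant dual of a module. -/
def dualMod : ModuleCat.{u} (Cher c') := ModuleCat.of (Cher c') (dualSub h B A)

variable {A} in
/-- The functional underlying an element of the dual. -/
def dualMod.toFun (φ : dualMod h B A) : ConjFun A :=
  ConjDual.toFun h B (Subtype.val (p := (· ∈ dualSub h B A)) φ)

variable {A h B}

lemma dualMod_supported (φ : dualMod h B A) :
    ∃ S : Finset ℂ, SupportedOn (S : Set ℂ) (dualMod.toFun h B φ) :=
  Subtype.prop (p := (· ∈ dualSub h B A)) φ

lemma dualMod_smul (a : Cher c') (φ : dualMod h B A) :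
    dualMod.toFun h B (a • φ) = (dualGen h B A).lift a (dualMod.toFun h B φ) := rfl

lemma dualMod_add (φ ψ : dualMod h B A) :
    dualMod.toFun h B (φ + ψ) = dualMod.toFun h B φ + dualMod.toFun h B ψ := rfl

lemma dualMod_csmul (z : ℂ) (φ : dualMod h B A) :
    dualMod.toFun h B (z • φ) = z • dualMod.toFun h B φ := by
  refine Eq.trans (b := dualMod.toFun h B (algebraMap ℂ (Cher c') z • φ)) ?_ ?_
  · rw [algebraMap_smul]
  · rw [dualMod_smul, AlgHom.commutes, Module.algebraMap_end_apply]

variable (h B A) in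
/-- The canonical pairing of a module with its dual. -/
def dualPair : CPair B (dualMod h B A) A where
  form := LinearMap.mk₂'ₛₗ (starRingEnd ℂ) (RingHom.id ℂ)
    (fun φ a => starRingEnd ℂ (dualMod.toFun h B φ a))
    (fun φ ψ a => by rw [dualMod_add, LinearMap.add_apply, map_add])
    (fun z φ a => by rw [dualMod_csmul, LinearMap.smul_apply, smul_eq_mul, map_mul]; rfl)
    (fun φ a b => by rw [map_add, map_add])
    (fun z φ a => by rw [LinearMap.map_smulₛₗ, smul_eq_mul, map_mul, Complex.conj_conj]; rfl)
  grp_grp w φ a := by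
    change starRingEnd ℂ (dualMod.toFun h B (grp c' w • φ) (grp c w • a)) = _
    rw [dualMod_smul, CherGen.lift_grp]
    change starRingEnd ℂ (dualMod.toFun h B φ (grp c w⁻¹ • grp c w • a)) = _
    rw [← mul_smul, ← map_mul, inv_mul_cancel, map_one, one_smul]
    rfl
  dun_left v φ a := by
    change starRingEnd ℂ (dualMod.toFun h B (dun c' v • φ) a) = _
    rw [dualMod_smul, CherGen.lift_dun]
    rfl
  lin_left v φ a := by
    change starRingEnd ℂ (dualMod.toFun h B (mulOp c' (lin (B.toDual v)) • φ) a) = _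
    rw [dualMod_smul, CherGen.lift_lin]
    change starRingEnd ℂ (dualMod.toFun h B φ (dun c (B.equiv.symm (B.toDual v)) • a)) = _
    rw [B.equiv_symm_toDual]
    rfl

lemma dualPair_apply (φ : dualMod h B A) (a : A) :
    (dualPair h B A).form φ a = starRingEnd ℂ (dualMod.toFun h B φ a) := rfl

lemma dualMod_ext {φ ψ : dualMod h B A}
    (H : ∀ a, (dualPair h B A).form φ a = (dualPair h B A).form ψ a) : φ = ψ :=
  Subtype.ext (LinearMap.ext fun a => (starRingEnd ℂ).injective (H a))

end DualModule

section DualModule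

variable {𝔥 : Type u} [AddCommGroup 𝔥] [Module ℂ 𝔥] [FiniteDimensional ℂ 𝔥]
  {W : Subgroup (𝔥 ≃ₗ[ℂ] 𝔥)} [Finite W] {c c' : Param W} {h : IsDual c c'} {B : InvForm W}
  {A : ModuleCat.{u} (Cher c)}

lemma dualMod_mem_nilp (hA : LocNilp A) (k : ℕ) (S : Set ℂ) (φ : dualMod h B A)
    (hφ : SupportedOn S (dualMod.toFun h B φ)) (hS : ∀ d : ℂ, d + k ∈ S → wt c A d = ⊥) :
    φ ∈ nilp c' (dualMod h B A) k := by
  induction k generalizing S φ with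
  | zero =>
    have h0 : φ = 0 := dualMod_ext fun a => by
      rw [map_zero, LinearMap.zero_apply, dualPair_apply]
      refine hA.induction (p := fun a => starRingEnd ℂ (dualMod.toFun h B φ a) = 0) ?_ ?_ ?_ a
      · rw [map_zero, map_zero]
      · intro m n hm hn
        rw [map_add, map_add, hm, hn, add_zero]
      · intro d m hm
        by_cases hd : d ∈ S
        · have := hS d (by simpa using hd)
          rw [this, Submodule.mem_bot] at hm
          rw [hm, map_zero, map_zero]
        · rw [hφ d hd m hm, map_zero]
    rw [h0]
    exact zero_mem _
  | succ k ih =>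
    rw [mem_nilp_succ]
    intro v
    refine ih {d | d + 1 ∈ S} (dun c' v • φ) (fun d hd m hm => ?_) fun d hd => hS d ?_
    · rw [dualMod_smul, CherGen.lift_dun]
      exact hφ (d + 1) hd _ (lin_wt _ hm)
    · rw [Nat.cast_succ, ← add_assoc]
      exact hd

lemma dualMod_locNilp (hA : LocNilp A) : LocNilp (dualMod h B A) := by
  intro φ
  obtain ⟨S, hS⟩ := dualMod_supported φ
  choose n hn using fun d : ℂ => LocNilp.exists_wt_sub_eq_bot (c := c) d
  refine ⟨S.sup n, dualMod_mem_nilp hA _ S φ hS fun d hd => ?_⟩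
  have := hn (d + (S.sup n : ℕ)) A hA (S.sup n) (Finset.le_sup (f := n) hd)
  rwa [add_sub_cancel_right] at this

variable (h) in
lemma dualMod_eq_zero_of_wt (hA : LocNilp A) {d : ℂ} {φ : dualMod h B A}
    (hφ : φ ∈ wt c' (dualMod h B A) (starRingEnd ℂ d))
    (H : ∀ a ∈ wt c A d, (dualPair h B A).form φ a = 0) : φ = 0 := by
  refine dualMod_ext fun a => ?_
  rw [map_zero, LinearMap.zero_apply]
  refine hA.induction (p := fun a => (dualPair h B A).form φ a = 0) (map_zero _)
    (fun m n hm hn => by rw [map_add, hm, hn, add_zero]) (fun e m hm => ?_) a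
  by_cases hde : d = e
  · exact H m (hde ▸ hm)
  · exact (dualPair h B A).form_eq_zero h (by rwa [Complex.conj_conj]) hφ hm

/-- The restriction of the elements of a weight space of the dual to a basis of the dual weight
space. -/
lemma dualMod_finite_wt (hA : LocNilp A) {d : ℂ} (hd : FiniteDimensional ℂ (wt c A d)) :
    FiniteDimensional ℂ (wt c' (dualMod h B A) (starRingEnd ℂ d)) ∧
      Module.finrank ℂ (wt c' (dualMod h B A) (starRingEnd ℂ d)) ≤ Module.finrank ℂ (wt c A d) := by
  let b := Module.finBasis ℂ (wt c A d)
  let F : wt c' (dualMod h B A) (starRingEnd ℂ d) →ₗ[ℂ] (Fin (Module.finrank ℂ (wt c A d)) → ℂ) :=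
    { toFun := fun φ i => dualMod.toFun h B φ.1 (b i)
      map_add' := fun φ ψ => rfl
      map_smul' := fun z φ => funext fun i =>
        LinearMap.congr_fun (dualMod_csmul z φ.1) (b i) }
  have hF : Function.Injective F := by
    rw [injective_iff_map_eq_zero]
    intro φ hφ
    refine Subtype.ext (dualMod_eq_zero_of_wt h hA φ.2 fun a ha => ?_)
    have h1 : (dualPair h B A).form φ.1 ∘ₗ (wt c A d).subtype = 0 := b.ext fun i => by
      change starRingEnd ℂ (dualMod.toFun h B φ.1 (b i)) = 0
      have := congrFun hφ i
      change dualMod.toFun h B φ.1 (b i) = 0 at this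
      rw [this, map_zero]
    exact LinearMap.congr_fun h1 ⟨a, ha⟩
  refine ⟨FiniteDimensional.of_injective F hF, ?_⟩
  have := LinearMap.finrank_le_finrank_of_injective hF
  rwa [Module.finrank_fin_fun] at this

variable (h B) in
lemma objO_dualMod (hA : objO c A) : objO c' (dualMod h B A) := by
  have hL := LocNilp.of_objO hA
  refine (dualMod_locNilp hL).objO fun s _ => ?_
  have := (dualMod_finite_wt (h := h) (B := B) hL (hA.finite_wt (starRingEnd ℂ s))).1
  rwa [Complex.conj_conj] at this

/-- Functionals on a weight space extend to elements of the dual. -/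
lemma exists_dualMod (hA : LocNilp A) (d : ℂ) (ξ : A →ₗ[ℂ] ℂ) :
    ∃ φ ∈ wt c' (dualMod h B A) (starRingEnd ℂ d), ∀ a ∈ wt c A d,
      (dualPair h B A).form φ a = ξ a := by
  let φ₀ : ConjFun A :=
    { toFun := fun a => starRingEnd ℂ (ξ (hA.pr d a))
      map_add' := fun a b => by rw [map_add, map_add, map_add]
      map_smul' := fun z a => by rw [map_smul, map_smul, smul_eq_mul, map_mul]; rfl }
  have hφ₀ : φ₀ ∈ dualSub h B A := ⟨{d}, fun e he m hm => by
    change starRingEnd ℂ (ξ (hA.pr d m)) = 0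
    rw [hA.pr_of_mem_ne (by simpa using he) hm, map_zero, map_zero]⟩
  let φ : dualMod h B A := Subtype.mk (p := (· ∈ dualSub h B A)) φ₀ hφ₀
  have hφ : ∀ a, (dualPair h B A).form φ a = ξ (hA.pr d a) := fun a => Complex.conj_conj _
  have hD := dualMod_locNilp (h := h) (B := B) hA
  refine ⟨hD.pr (starRingEnd ℂ d) φ, hD.pr_mem _ _, fun a ha => ?_⟩
  rw [← hA.pr_of_mem ha, ← hφ]
  obtain ⟨S, -, hS⟩ := hD.exists_sum_pr φ
  classical
  have h1 := hS (insert (starRingEnd ℂ d) S) (Finset.subset_insert _ _)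
  conv_rhs => rw [← h1]
  rw [map_sum (dualPair h B A).form, LinearMap.sum_apply, hA.pr_of_mem ha]
  rw [Finset.sum_eq_single (starRingEnd ℂ d)]
  · intro e _ he
    refine (dualPair h B A).form_eq_zero h (fun hde => he ?_) (hD.pr_mem e φ) ha
    rw [← hde, Complex.conj_conj]
  · exact fun hn => absurd (Finset.mem_insert_self _ _) hn

lemma exists_dualMod_ne_zero (hA : LocNilp A) {a : A} (ha : a ≠ 0) :
    ∃ φ, (dualPair h B A).form φ a ≠ 0 := by
  obtain ⟨d, hd⟩ : ∃ d, hA.pr d a ≠ 0 := by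
    by_contra! H
    exact ha (hA.ext_pr fun d => by rw [H, map_zero])
  obtain ⟨ξ, hξ⟩ : ∃ ξ : A →ₗ[ℂ] ℂ, ξ (hA.pr d a) ≠ 0 := by
    by_contra! H
    exact hd ((Module.forall_dual_apply_eq_zero_iff ℂ _).mp H)
  obtain ⟨φ, hφ, hφξ⟩ := exists_dualMod (h := h) (B := B) hA d ξ
  refine ⟨φ, fun h0 => hξ ?_⟩
  rw [← hφξ _ (hA.pr_mem d a), ← h0]
  obtain ⟨S, -, hS⟩ := hA.exists_sum_pr a
  classical
  have h1 := hS (insert d S) (Finset.subset_insert _ _)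
  conv_rhs => rw [← h1]
  rw [map_sum ((dualPair h B A).form φ)]
  rw [Finset.sum_eq_single d]
  · intro e _ he
    exact (dualPair h B A).form_eq_zero h (by rw [Complex.conj_conj]; exact he.symm) hφ (hA.pr_mem e a)
  · exact fun hn => absurd (Finset.mem_insert_self _ _) hn

namespace CPair

variable {P : ModuleCat.{u} (Cher c')} (Ψ : CPair B P A)

lemma supportedOn (h : IsDual c c') (hP : LocNilp P) (p : P) :
    ∃ S : Finset ℂ, ∀ d ∉ S, ∀ a ∈ wt c A d, Ψ.form p a = 0 := by
  classical
  obtain ⟨S, -, hS⟩ := hP.exists_sum_pr p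
  refine ⟨S.image (starRingEnd ℂ), fun d hd a ha => ?_⟩
  rw [← hS S subset_rfl, map_sum, LinearMap.sum_apply]
  refine Finset.sum_eq_zero fun e he => Ψ.form_eq_zero h (fun hde => hd ?_) (hP.pr_mem e p) ha
  exact Finset.mem_image.mpr ⟨e, he, hde⟩

/-- The conjugate linear functional given by an element. -/
def conjFun (p : P) : ConjFun A where
  toFun a := starRingEnd ℂ (Ψ.form p a)
  map_add' a b := by rw [map_add, map_add]
  map_smul' z a := by rw [map_smul, smul_eq_mul, map_mul]; rfl

/-- The homomorphism to the dual given by a contravariant pairing. -/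
def toDual (h : IsDual c c') (hP : LocNilp P) : P →ₗ[Cher c'] dualMod h B A where
  toFun p := Subtype.mk (p := (· ∈ dualSub h B A)) (Ψ.conjFun p) (by
    obtain ⟨S, hS⟩ := Ψ.supportedOn h hP p
    exact ⟨S, fun d hd m hm => (congrArg (starRingEnd ℂ) (hS d hd m hm)).trans (map_zero _)⟩)
  map_add' p q := Subtype.ext (LinearMap.ext fun a => by
    change starRingEnd ℂ (Ψ.form (p + q) a) = starRingEnd ℂ (Ψ.form p a) + starRingEnd ℂ (Ψ.form q a)
    rw [map_add, LinearMap.add_apply, map_add])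
  map_smul' x p := by
    refine Subtype.ext ?_
    change Ψ.conjFun (x • p) = (dualGen h B A).lift x (Ψ.conjFun p)
    induction x using cherednik_induction generalizing p with
    | hgrp w =>
      rw [CherGen.lift_grp]
      exact LinearMap.ext fun a => congrArg (starRingEnd ℂ) (Ψ.grp_left w p a)
    | hmulOp f =>
      induction f using polyFun_induction generalizing p with
      | hlin l =>
        rw [CherGen.lift_lin]
        exact LinearMap.ext fun a => congrArg (starRingEnd ℂ) (Ψ.lin_left' l p a)
      | hconst z =>
        rw [AlgHom.commutes, AlgHom.commutes, algebraMap_smul, Module.algebraMap_end_apply]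
        refine LinearMap.ext fun a => ?_
        change starRingEnd ℂ (Ψ.form (z • p) a) = z * starRingEnd ℂ (Ψ.form p a)
        rw [form_smul_left, map_mul, Complex.conj_conj]
      | hadd f g hf hg =>
        rw [map_add, map_add, add_smul, LinearMap.add_apply, ← hf, ← hg]
        refine LinearMap.ext fun a => ?_
        change starRingEnd ℂ (Ψ.form (_ + _) a) = starRingEnd ℂ _ + starRingEnd ℂ _
        rw [map_add, LinearMap.add_apply, map_add]
      | hmul f g hf hg =>
        rw [map_mul, map_mul, mul_smul, hf, hg]
        rfl
    | hdun v =>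
      rw [CherGen.lift_dun]
      exact LinearMap.ext fun a => congrArg (starRingEnd ℂ) (Ψ.dun_left v p a)
    | hadd x y hx hy =>
      rw [map_add, add_smul, LinearMap.add_apply, ← hx, ← hy]
      refine LinearMap.ext fun a => ?_
      change starRingEnd ℂ (Ψ.form (_ + _) a) = starRingEnd ℂ _ + starRingEnd ℂ _
      rw [map_add, LinearMap.add_apply, map_add]
    | hmul x y hx hy =>
      rw [map_mul, mul_smul, hx, hy]
      rfl

lemma toDual_form (h : IsDual c c') (hP : LocNilp P) (p : P) (a : A) :
    (dualPair h B A).form (Ψ.toDual h hP p) a = Ψ.form p a := Complex.conj_conj _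

lemma toDual_injective (h : IsDual c c') (hP : LocNilp P)
    (H : ∀ p, (∀ a, Ψ.form p a = 0) → p = 0) : Function.Injective (Ψ.toDual h hP) := by
  rw [injective_iff_map_eq_zero]
  intro p hp
  refine H p fun a => ?_
  rw [← Ψ.toDual_form h hP, hp, map_zero, LinearMap.zero_apply]

end CPair

/-- The canonical homomorphism to the double dual. -/
def evDual (h : IsDual c c') (B : InvForm W) (hA : LocNilp A) :
    A →ₗ[Cher c] dualMod h.symm B (dualMod h B A) :=
  (dualPair h B A).flip.toDual h.symm hA

lemma evDual_form (hA : LocNilp A) (a : A) (φ : dualMod h B A) :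
    (dualPair h.symm B (dualMod h B A)).form (evDual h B hA a) φ =
      starRingEnd ℂ ((dualPair h B A).form φ a) :=
  CPair.toDual_form _ _ _ _ _

lemma evDual_injective (hA : LocNilp A) : Function.Injective (evDual h B hA) := by
  refine CPair.toDual_injective _ _ _ fun a ha => ?_
  by_contra hne
  obtain ⟨φ, hφ⟩ := exists_dualMod_ne_zero (h := h) (B := B) hA hne
  exact hφ ((starRingEnd ℂ).injective ((ha φ).trans (map_zero _).symm))

lemma evDual_surjective (hA : objO c A) :
    Function.Surjective (evDual h B (LocNilp.of_objO hA)) := by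
  have hL := LocNilp.of_objO hA
  have hD := dualMod_locNilp (h := h) (B := B) hL
  have hDD := dualMod_locNilp (h := h.symm) (B := B) hD
  intro ψ
  refine hDD.induction (p := fun ψ => ∃ a, evDual h B hL a = ψ) ⟨0, map_zero _⟩ ?_ ?_ ψ
  · rintro _ _ ⟨a, rfl⟩ ⟨b, rfl⟩
    exact ⟨a + b, map_add _ _ _⟩
  · intro d ψ hψ
    have h0 := hA.finite_wt d
    obtain ⟨h1, h2⟩ := dualMod_finite_wt (h := h) (B := B) hL h0
    obtain ⟨h3, h4⟩ := dualMod_finite_wt (h := h.symm) (B := B) hD h1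
    rw [Complex.conj_conj] at h3 h4
    let F : wt c A d →ₗ[ℂ] wt c (dualMod h.symm B (dualMod h B A)) d :=
      ((evDual h B hL).restrictScalars ℂ).restrict fun m hm => wt_map (evDual h B hL) d hm
    have hF : Function.Injective F := fun x y hxy =>
      Subtype.ext (evDual_injective hL (congrArg Subtype.val hxy))
    have hF2 := (LinearMap.injective_iff_surjective_of_finrank_eq_finrank
      (le_antisymm (LinearMap.finrank_le_finrank_of_injective hF) (h4.trans h2))).mp hF
    obtain ⟨a, ha⟩ := hF2 ⟨ψ, hψ⟩
    exact ⟨a.1, congrArg Subtype.val ha⟩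

/-- The dual of a homomorphism. -/
def dualMap (h : IsDual c c') (B : InvForm W) {A' : ModuleCat.{u} (Cher c)} (hA' : LocNilp A')
    (f : A →ₗ[Cher c] A') : dualMod h B A' →ₗ[Cher c'] dualMod h B A :=
  ((dualPair h B A').flip.comp f).flip.toDual h (dualMod_locNilp hA')

lemma dualMap_form {A' : ModuleCat.{u} (Cher c)} (hA' : LocNilp A')
    (f : A →ₗ[Cher c] A') (φ : dualMod h B A') (a : A) :
    (dualPair h B A).form (dualMap h B hA' f φ) a = (dualPair h B A').form φ (f a) := by
  rw [dualMap, CPair.toDual_form, CPair.flip_apply, CPair.comp_apply, CPair.flip_apply,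
    Complex.conj_conj]

end DualModule

section DualMod

variable {𝔥 : Type u} [AddCommGroup 𝔥] [Module ℂ 𝔥] [FiniteDimensional ℂ 𝔥]
  {W : Subgroup (𝔥 ≃ₗ[ℂ] 𝔥)} [Finite W] {c c' : Param W} {h : IsDual c c'} {B : InvForm W}
  {L M N : ModuleCat.{u} (Cher c)}

lemma exists_dualMod_of_support (S : Finset ℂ) (ξ : M →ₗ[ℂ] ℂ)
    (hξ : ∀ d ∉ S, ∀ a ∈ wt c M d, ξ a = 0) :
    ∃ φ : dualMod h B M, ∀ a, (dualPair h B M).form φ a = ξ a := by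
  let φ₀ : ConjFun M :=
    { toFun := fun a => starRingEnd ℂ (ξ a)
      map_add' := fun a b => by rw [map_add, map_add]
      map_smul' := fun z a => by rw [map_smul, smul_eq_mul, map_mul]; rfl }
  have hφ₀ : φ₀ ∈ dualSub h B M := ⟨S, fun d hd m hm =>
    (congrArg (starRingEnd ℂ) (hξ d hd m hm)).trans (map_zero _)⟩
  exact ⟨Subtype.mk (p := (· ∈ dualSub h B M)) φ₀ hφ₀, fun a => Complex.conj_conj _⟩

lemma dualMap_injective (hN : LocNilp N) {g : M →ₗ[Cher c] N} (hg : Function.Surjective g) :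
    Function.Injective (dualMap h B hN g) := by
  rw [injective_iff_map_eq_zero]
  intro φ hφ
  refine dualMod_ext fun n => ?_
  obtain ⟨m, rfl⟩ := hg n
  rw [← dualMap_form hN, hφ, map_zero, map_zero, LinearMap.zero_apply, LinearMap.zero_apply]

lemma dualMap_surjective (hL : LocNilp L) (hM : LocNilp M) {f : L →ₗ[Cher c] M}
    (hf : Function.Injective f) : Function.Surjective (dualMap h B hM f) := by
  intro φ
  refine (dualMod_locNilp hL).induction (p := fun φ => ∃ ψ, dualMap h B hM f ψ = φ)
    ⟨0, map_zero _⟩ ?_ ?_ φ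
  · rintro _ _ ⟨a, rfl⟩ ⟨b, rfl⟩
    exact ⟨a + b, map_add _ _ _⟩
  · intro e φ hφ
    obtain ⟨d, rfl⟩ : ∃ d, starRingEnd ℂ d = e := ⟨_, Complex.conj_conj e⟩
    obtain ⟨r, hr⟩ := (f.restrictScalars ℂ).exists_leftInverse_of_injective
      (LinearMap.ker_eq_bot.mpr hf)
    obtain ⟨ψ, hψ, hψr⟩ := exists_dualMod (h := h) (B := B) hM d ((dualPair h B L).form φ ∘ₗ r)
    refine ⟨ψ, sub_eq_zero.mp (dualMod_eq_zero_of_wt h hL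
      (sub_mem (wt_map (dualMap h B hM f) _ hψ) hφ) fun a ha => ?_)⟩
    rw [map_sub, LinearMap.sub_apply, dualMap_form, hψr _ (wt_map f d ha), sub_eq_zero]
    exact congrArg ((dualPair h B L).form φ) (LinearMap.congr_fun hr a)

lemma dualMap_exact (hM : LocNilp M) (hN : LocNilp N) {f : L →ₗ[Cher c] M} {g : M →ₗ[Cher c] N}
    (hg : Function.Surjective g) (hfg : Function.Exact f g) :
    Function.Exact (dualMap h B hN g) (dualMap h B hM f) := by
  intro φ
  constructor
  · intro hφ
    obtain ⟨s, hs⟩ := (g.restrictScalars ℂ).exists_rightInverse_of_surjective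
      (LinearMap.range_eq_top.mpr hg)
    have hker : ∀ m, g m = 0 → (dualPair h B M).form φ m = 0 := fun m hm => by
      obtain ⟨l, rfl⟩ := (hfg m).mp hm
      rw [← dualMap_form hM, hφ, map_zero, LinearMap.zero_apply]
    have hsg : ∀ m, (dualPair h B M).form φ (s (g m)) = (dualPair h B M).form φ m := fun m => by
      rw [← sub_eq_zero, ← map_sub]
      refine hker _ ?_
      rw [map_sub, sub_eq_zero]
      exact LinearMap.congr_fun hs (g m)
    obtain ⟨S, hS⟩ := (dualPair h B M).supportedOn h (dualMod_locNilp hM) φ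
    obtain ⟨ψ, hψ⟩ := exists_dualMod_of_support (h := h) (B := B) S
      ((dualPair h B M).form φ ∘ₗ s) fun d hd n hn => by
        obtain ⟨m, hm, rfl⟩ := hM.wt_surjective hN hg hn
        exact (hsg m).trans (hS d hd m hm)
    refine ⟨ψ, dualMod_ext fun m => ?_⟩
    rw [dualMap_form, hψ]
    exact hsg m
  · rintro ⟨ψ, rfl⟩
    refine dualMod_ext fun l => ?_
    rw [dualMap_form, dualMap_form, hfg.apply_apply_eq_zero, map_zero, map_zero, LinearMap.zero_apply]

lemma IsSES.dual (h : IsDual c c') (B : InvForm W) {f : L →ₗ[Cher c] M} {g : M →ₗ[Cher c] N}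
    (H : IsSES f g) : IsSES (dualMap h B (LocNilp.of_objO H.right) g)
      (dualMap h B (LocNilp.of_objO H.mid) f) where
  inj := dualMap_injective _ H.surj
  exact := dualMap_exact _ _ H.surj H.exact
  surj := dualMap_surjective (LocNilp.of_objO H.left) _ H.inj
  left := objO_dualMod h B H.right
  mid := objO_dualMod h B H.mid
  right := objO_dualMod h B H.left

lemma dualMap_comp_eq_id (hM : LocNilp M) (hN : LocNilp N) {f : M →ₗ[Cher c] N}
    {g : N →ₗ[Cher c] M} (hgf : ∀ m, g (f m) = m) (φ : dualMod h B M) :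
    dualMap h B hN f (dualMap h B hM g φ) = φ := by
  refine dualMod_ext fun m => ?_
  rw [dualMap_form, dualMap_form, hgf]

end DualMod

section Injectives

variable {𝔥 : Type u} [AddCommGroup 𝔥] [Module ℂ 𝔥] [FiniteDimensional ℂ 𝔥]
  {W : Subgroup (𝔥 ≃ₗ[ℂ] 𝔥)} [Finite W] {c c' : Param W} (h : IsDual c c') (B : InvForm W)

/-- The contravariant dual of an object of `O_c`. -/
def dualObj (X : CatO c) : CatO c' := ⟨dualMod h B X.obj, objO_dualMod h B X.property⟩

lemma injective_dualObj (P : CatO c') [Projective P] : Injective (dualObj h.symm B P) where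
  factors {A A'} g f hf := by
    let Ψ : CPair B A.obj P.obj := (dualPair h.symm B P.obj).comp (homO g)
    let k : P ⟶ dualObj h B A := ofHomO (Ψ.flip.toDual h P.locNilp)
    let f' : dualObj h B A' ⟶ dualObj h B A := ofHomO (dualMap h B A'.locNilp (homO f))
    have hf' : Epi f' := (epi_catO_iff f').mpr
      (dualMap_surjective A.locNilp A'.locNilp ((mono_catO_iff f).mp hf))
    let t := Projective.factorThru k f'
    have ht : ∀ p, dualMap h B A'.locNilp (homO f) (homO t p) = Ψ.flip.toDual h P.locNilp p :=
      fun p => congrArg (fun q : P ⟶ dualObj h B A => homO q p) (Projective.factorThru_comp k f')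
    let Ψ' : CPair B A'.obj P.obj := ((dualPair h B A'.obj).comp (homO t)).flip
    refine ⟨ofHomO (Ψ'.toDual h.symm A'.locNilp), homO_ext fun a => dualMod_ext fun p => ?_⟩
    refine (Ψ'.toDual_form h.symm A'.locNilp (homO f a) p).trans ?_
    have h1 : (dualPair h B A'.obj).form (homO t p) (homO f a) = Ψ.flip.form p a :=
      (dualMap_form A'.locNilp (homO f) (homO t p) a).symm.trans
        ((congrArg (fun φ => (dualPair h B A.obj).form φ a) (ht p)).trans (Ψ.flip.toDual_form h _ p a))
    exact (congrArg (starRingEnd ℂ) h1).trans (Complex.conj_conj _)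

lemma exists_mono_dualObj (X : CatO c) : ∃ (P : CatO c') (_ : Projective P)
    (f : X ⟶ dualObj h.symm B P), Mono f := by
  let Y := dualObj h B X
  let e : Projective.over Y ⟶ Y := Projective.π Y
  have he := (epi_catO_iff e).mp inferInstance
  let Ψ : CPair B X.obj (Projective.over Y).obj := ((dualPair h B X.obj).comp (homO e)).flip
  refine ⟨Projective.over Y, inferInstance, ofHomO (Ψ.toDual h.symm X.locNilp),
    (mono_catO_iff _).mpr (Ψ.toDual_injective h.symm X.locNilp fun x hx => ?_)⟩
  by_contra hne
  obtain ⟨φ, hφ⟩ := exists_dualMod_ne_zero (h := h) (B := B) X.locNilp hne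
  obtain ⟨p, rfl⟩ := he φ
  exact hφ ((starRingEnd ℂ).injective ((hx p).trans (map_zero _).symm))

instance enoughInjectives_catO : EnoughInjectives (CatO c) where
  presentation X := by
    obtain ⟨P, hP, f, hf⟩ := exists_mono_dualObj (isDual_star c) (Classical.choice nonempty_invForm) X
    exact ⟨⟨_, injective_dualObj (isDual_star c) (Classical.choice nonempty_invForm) P, f, hf⟩⟩

lemma acyc_dual_of_injective (X : CatO c) [Injective X] : Acyc (linAct c' (dualMod h B X.obj)) := by
  obtain ⟨P, hP, i, hi⟩ := exists_mono_dualObj h B X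
  let r := Injective.factorThru (𝟙 X) i
  have hr : ∀ x, homO r (homO i x) = x := fun x =>
    congrArg (fun q : X ⟶ X => homO q x) (Injective.comp_factorThru (𝟙 X) i)
  have hD := (dualObj h.symm B P).locNilp
  let ev := LinearEquiv.ofBijective (evDual h.symm B P.locNilp)
    ⟨evDual_injective P.locNilp, evDual_surjective P.property⟩
  have h1 : Acyc (linAct c' (dualObj h B (dualObj h.symm B P)).obj) :=
    Acyc.of_retract_module (acyc_of_projective P) ev.symm.toLinearMap ev.toLinearMap
      ev.apply_symm_apply
  exact Acyc.of_retract_module h1 (dualMap h B X.locNilp (homO r)) (dualMap h B hD (homO i))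
    (dualMap_comp_eq_id X.locNilp hD hr)

end Injectives

section Cohomology

open Limits

variable {𝔥 : Type u} [AddCommGroup 𝔥] [Module ℂ 𝔥] [FiniteDimensional ℂ 𝔥]
  {W : Subgroup (𝔥 ≃ₗ[ℂ] 𝔥)} [Finite W] {c c' : Param W} (h : IsDual c c') (B : InvForm W)

lemma injShift_torDeg_dual (θ : Rep.{u} ℂ W) [FiniteDimensional ℂ θ] (d : ℂ) :
    InjShift fun i (X : CatO c) => mult θ.ρ (torDeg c' (dualMod h B X.obj) i d).ρ where
  succ S hS hI i := by
    have hA := acyc_dual_of_injective h B S.X₂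
    have hD := dualMod_locNilp (h := h) (B := B) S.X₂.locNilp
    exact mult_torDeg_succ θ ((IsSES.of_shortExact hS).dual h B) (i + 1) d
      (torDeg_subsingleton hD hA _ d) (torDeg_subsingleton hD hA _ d)
  zero S hS hI := by
    have hA := acyc_dual_of_injective h B S.X₂
    have hD := dualMod_locNilp (h := h) (B := B) S.X₂.locNilp
    exact (mult_torDeg_zero θ ((IsSES.of_shortExact hS).dual h B) d
      (torDeg_subsingleton hD hA 0 d)).trans (Nat.add_comm _ _)

variable {h B} in
/-- An element of the dual which vanishes on the vectors killed by the Dunkl operators lies in the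
subspace generated by the image of `𝔥*`. -/
lemma mem_hStar_of_vanishing {M : ModuleCat.{u} (Cher c)} (hM : LocNilp M) {d : ℂ} {φ : dualMod h B M}
    (hφ : φ ∈ wt c' (dualMod h B M) (starRingEnd ℂ d))
    (H : ∀ a ∈ invWt c M d, (dualPair h B M).form φ a = 0) : φ ∈ hStar c' (dualMod h B M) := by
  classical
  let b := Module.finBasis ℂ 𝔥
  let T : wt c M d →ₗ[ℂ] (Fin (Module.finrank ℂ 𝔥) → M) :=
    LinearMap.pi fun i => act c M (dun c (b i)) ∘ₗ (wt c M d).subtype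
  have hmem : (dualPair h B M).form φ ∘ₗ (wt c M d).subtype ∈ (LinearMap.ker T).dualAnnihilator := by
    rw [Submodule.mem_dualAnnihilator]
    intro a ha
    refine H a.1 (mem_invWt.mpr ⟨a.2, fun v => ?_⟩)
    rw [dun_eq_sum b v, Finset.sum_smul]
    refine Finset.sum_eq_zero fun i _ => ?_
    have hi : dun c (b i) • a.1 = 0 := congrFun (LinearMap.mem_ker.mp ha) i
    rw [smul_assoc, hi, smul_zero]
  rw [← LinearMap.range_dualMap_eq_dualAnnihilator_ker] at hmem
  obtain ⟨η, hη⟩ := hmem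
  choose ψ hψ hψη using fun i => exists_dualMod (h := h) (B := B) hM (d - 1)
    (η ∘ₗ LinearMap.single ℂ (fun _ => M) i)
  have hsum : φ - ∑ i, mulOp c' (lin (B.toDual (b i))) • ψ i = 0 := by
    refine dualMod_eq_zero_of_wt h hM (sub_mem hφ (sum_mem fun i _ => ?_)) fun a ha => ?_
    · have h1 := lin_wt (B.toDual (b i)) (hψ i)
      rwa [map_sub, map_one, sub_add_cancel] at h1
    · have h2 : (dualPair h B M).form φ a = η (T ⟨a, ha⟩) := (LinearMap.congr_fun hη ⟨a, ha⟩).symm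
      have h3 : T ⟨a, ha⟩ = ∑ i, LinearMap.single ℂ (fun _ => M) i (dun c (b i) • a) :=
        (LinearMap.sum_single_apply _ (T ⟨a, ha⟩)).symm
      rw [map_sub, LinearMap.sub_apply, map_sum, LinearMap.sum_apply, h2, h3, map_sum, sub_eq_zero]
      refine Finset.sum_congr rfl fun i _ => ?_
      rw [CPair.lin_left, hψη i _ (dun_wt _ ha)]
      rfl
  rw [sub_eq_zero.mp hsum]
  exact sum_mem fun i _ => Submodule.subset_span ⟨_, _, rfl⟩

/-- The invariants of a module have the same multiplicities as the coinvariants of its dual. -/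
lemma mult_coinvWt_dual {M : ModuleCat.{u} (Cher c)} (hM : objO c M) (θ : Rep.{u} ℂ W) (d : ℂ) :
    mult θ.ρ ((coinvRep c' (dualMod h B M)).subrepresentation
      (coinvWt c' (dualMod h B M) (starRingEnd ℂ d)) (coinvWt_stable c' (dualMod h B M) (starRingEnd ℂ d))) =
    mult θ.ρ ((wRep c M).subrepresentation (invWt c M d) (invWt_stable c M d)) := by
  have hL := LocNilp.of_objO hM
  have := hM.finite_wt d
  have h0 : FiniteDimensional ℂ (invWt c M d) := Submodule.finiteDimensional_of_le inf_le_left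
  have := (objO_dualMod h B hM).finite_wt (starRingEnd ℂ d)
  have h0' : FiniteDimensional ℂ (coinvWt c' (dualMod h B M) (starRingEnd ℂ d)) := Module.Finite.map _ _
  let Ψ₀ : dualMod h B M →ₗ⋆[ℂ] invWt c M d →ₗ[ℂ] ℂ :=
    { toFun := fun φ => (dualPair h B M).form φ ∘ₗ (invWt c M d).subtype
      map_add' := fun φ ψ => by rw [map_add, LinearMap.add_comp]
      map_smul' := fun z φ => by rw [LinearMap.map_smulₛₗ, LinearMap.smul_comp] }
  have hΨ₀ : hStar c' (dualMod h B M) ≤ LinearMap.ker Ψ₀ := by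
    refine Submodule.span_le.mpr ?_
    rintro _ ⟨x, φ, rfl⟩
    refine LinearMap.mem_ker.mpr (LinearMap.ext fun a => ?_)
    change (dualPair h B M).form _ a.1 = 0
    rw [CPair.lin_left', (mem_invWt.mp a.2).2, map_zero]
  let Ψ₁ := (hStar c' (dualMod h B M)).liftQ Ψ₀ hΨ₀
  have hΨ₁ : ∀ φ (a : invWt c M d), Ψ₁ ((hStar c' (dualMod h B M)).mkQ φ) a =
    (dualPair h B M).form φ a.1 := fun φ a => rfl
  let Ψ : coinvWt c' (dualMod h B M) (starRingEnd ℂ d) →ₗ⋆[ℂ] invWt c M d →ₗ[ℂ] ℂ :=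
    Ψ₁.comp (Submodule.subtype _)
  refine mult_congr (equiv_of_pairing _ _ Ψ ?_ ?_ ?_).some
  · rintro w ⟨_, φ, hφ, rfl⟩ a
    exact (dualPair h B M).grp_grp w φ a.1
  · rintro ⟨_, φ, hφ, rfl⟩ hu
    refine Subtype.ext ((Submodule.Quotient.mk_eq_zero _).mpr ?_)
    exact mem_hStar_of_vanishing hL hφ fun a ha => hu ⟨a, ha⟩
  · rintro a ha
    by_contra hne
    obtain ⟨ξ, hξ⟩ : ∃ ξ : M →ₗ[ℂ] ℂ, ξ a.1 ≠ 0 := by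
      by_contra! H
      exact hne (Subtype.ext ((Module.forall_dual_apply_eq_zero_iff ℂ _).mp H))
    obtain ⟨φ, hφ, hφξ⟩ := exists_dualMod (h := h) (B := B) hL d ξ
    refine hξ ?_
    rw [← hφξ _ (mem_invWt.mp a.2).1]
    exact ha ⟨_, φ, hφ, rfl⟩

lemma mult_cohomologyZero (E : Rep.{u} ℂ W) [FiniteDimensional ℂ E] (X : CatO c) (d : ℂ) :
    mult E.ρ (torDeg c' (dualMod h B X.obj) 0 (starRingEnd ℂ d)).ρ =
      mult E.ρ (((cohomologyZero c).obj X).obj ⟨d⟩).ρ :=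
  (mult_torDeg_coinvWt _ E (objO_dualMod h B X.property) _).trans
    (mult_coinvWt_dual h B X.property E d)

instance : PreservesFiniteLimits (cohomologyZero c) := by
  refine ((Functor.preservesFiniteLimits_tfae (cohomologyZero c)).out 0 3).mp fun S hS => ?_
  have h := IsSES.of_shortExact hS
  refine ⟨(exact_graded_iff _).mpr fun d => ?_, (mono_graded_iff _).mpr fun d => ?_⟩
  · rintro ⟨m, hm⟩ hx
    obtain ⟨l, hl⟩ := (h.exact m).mp (congrArg Subtype.val hx)
    rw [mem_invWt] at hm
    have h1 : homO S.f (S.X₁.locNilp.pr d l) = m := by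
      rw [← LocNilp.pr_map S.X₁.locNilp S.X₂.locNilp, hl, S.X₂.locNilp.pr_of_mem hm.1]
    refine ⟨⟨S.X₁.locNilp.pr d l, mem_invWt.mpr ⟨S.X₁.locNilp.pr_mem d l, fun v => h.inj ?_⟩⟩,
      Subtype.ext h1⟩
    rw [map_smul, h1, hm.2, map_zero]
  · intro x y hxy
    exact Subtype.ext (h.inj (congrArg Subtype.val hxy))

lemma finite_cohomologyZero (X : CatO c) (d : ℂ) :
    FiniteDimensional ℂ (((cohomologyZero c).obj X).obj ⟨d⟩) := by
  have := objO.finite_wt X.property d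
  have : FiniteDimensional ℂ (invWt c X.obj d) := Submodule.finiteDimensional_of_le inf_le_left
  exact this

lemma mult_rightDerived_cohomologyZero (E : Rep.{u} ℂ W) [FiniteDimensional ℂ E] (M : CatO c) (i : ℕ)
    (d : ℂ) :
    (fun V : GrRep W => ∀ e, FiniteDimensional ℂ (V.obj ⟨e⟩))
      (((cohomologyZero c).rightDerived i).obj M) ∧
    (fun V : GrRep W => mult E.ρ (V.obj ⟨d⟩).ρ) (((cohomologyZero c).rightDerived i).obj M) =
      mult E.ρ (torDeg c' (dualMod h B M.obj) i (starRingEnd ℂ d)).ρ :=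
  rightDerived_numeric (cohomologyZero c) (isAdditiveFun_mult E d) finite_cohomologyZero
    (injShift_torDeg_dual h B E (starRingEnd ℂ d)) (fun X => mult_cohomologyZero h B E X d) i M

lemma hCohomology_eq (i : ℕ) : hCohomology c i = (cohomologyZero c).rightDerived i := rfl

lemma mult_hCohomology (E : Rep.{u} ℂ W) [FiniteDimensional ℂ E] (M : CatO c) (i : ℕ) (d : ℂ) :
    mult E.ρ (((hCohomology c i).obj M).obj ⟨d⟩).ρ =
      mult E.ρ (torDeg c' (dualMod h B M.obj) i (starRingEnd ℂ d)).ρ := by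
  rw [hCohomology_eq]
  exact (mult_rightDerived_cohomologyZero h B E M i d).2

lemma finite_hCohomology (M : CatO c) (i : ℕ) (d : ℂ) :
    FiniteDimensional ℂ (((hCohomology c i).obj M).obj ⟨d⟩) := by
  have : FiniteDimensional ℂ (Rep.of (Representation.trivial ℂ W PUnit.{u + 1})) :=
    inferInstanceAs (FiniteDimensional ℂ PUnit.{u + 1})
  rw [hCohomology_eq]
  exact (mult_rightDerived_cohomologyZero (isDual_star c) (Classical.choice nonempty_invForm)
    (Rep.of (Representation.trivial ℂ W PUnit.{u + 1})) M i 0).1 d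

end Cohomology

section

open Abelian Limits

section ExtDimension

variable {C : Type*} [Category* C] [Abelian C] [Linear ℂ C] [HasExt C]

lemma ext_extClass_surjective (X : C) {S : ShortComplex C} (hS : S.ShortExact)
    (hI : Injective S.X₂) (n : ℕ) : Function.Surjective
      (hS.extClass.postcompOfLinear ℂ X (rfl : n + 1 = n + 1)) := by
  intro x
  exact Ext.covariant_sequence_exact₁ X hS x (Ext.eq_zero_of_injective _) rfl

lemma ext_extClass_injective (X : C) {S : ShortComplex C} (hS : S.ShortExact)
    (hI : Injective S.X₂) (n : ℕ) : Function.Injective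
      (hS.extClass.postcompOfLinear ℂ X (rfl : n + 1 + 1 = n + 1 + 1)) := by
  rw [injective_iff_map_eq_zero]
  intro x hx
  obtain ⟨y, rfl⟩ := Ext.covariant_sequence_exact₃ X hS x rfl hx
  rw [Ext.eq_zero_of_injective y, Ext.zero_comp]

lemma finite_ext [EnoughInjectives C] (X : C) (hX : ∀ Y : C, FiniteDimensional ℂ (X ⟶ Y)) (n : ℕ)
    (Y : C) : FiniteDimensional ℂ (Ext X Y n) := by
  induction n generalizing Y with
  | zero => exact Module.Finite.equiv (Ext.linearEquiv₀ (R := ℂ)).symm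
  | succ n ih =>
    have := ih (cokernel (Injective.ι Y))
    exact Module.Finite.of_surjective _ (ext_extClass_surjective X
      (shortExact_cokernel (Injective.ι Y)) inferInstance n)

lemma injShift_ext (X : C) (hX : ∀ Y : C, FiniteDimensional ℂ (X ⟶ Y)) :
    InjShift fun i (Y : C) => Module.finrank ℂ (Ext X Y i) where
  succ S hS hI i := (LinearEquiv.ofBijective _
    ⟨ext_extClass_injective X hS hI i, ext_extClass_surjective X hS hI (i + 1)⟩).finrank_eq.symm
  zero S hS hI := by
    have hfin : ∀ Y : C, FiniteDimensional ℂ (Ext X Y 0) := fun Y =>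
      have := hX Y
      Module.Finite.equiv (Ext.linearEquiv₀ (R := ℂ)).symm
    have := hfin S.X₁
    have := hfin S.X₂
    have := hfin S.X₃
    let f := (Ext.mk₀ S.f).postcompOfLinear ℂ X (add_zero 0)
    let g := (Ext.mk₀ S.g).postcompOfLinear ℂ X (add_zero 0)
    let δ := hS.extClass.postcompOfLinear ℂ X (rfl : 0 + 1 = 0 + 1)
    have hδ : LinearMap.range δ = ⊤ :=
      LinearMap.range_eq_top.mpr (ext_extClass_surjective X hS hI 0)
    have hf : LinearMap.ker f = ⊥ := by
      have := hS.mono_f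
      exact LinearMap.ker_eq_bot.mpr (Ext.postcomp_mk₀_injective_of_mono X S.f)
    have hfg : LinearMap.range f = LinearMap.ker g := by
      ext x
      constructor
      · rintro ⟨y, rfl⟩
        change (y.comp (Ext.mk₀ S.f) (add_zero 0)).comp (Ext.mk₀ S.g) (add_zero 0) = 0
        rw [Ext.comp_assoc_of_second_deg_zero, Ext.mk₀_comp_mk₀, S.zero, Ext.mk₀_zero,
          Ext.comp_zero]
      · intro hx
        obtain ⟨y, hy⟩ := Ext.covariant_sequence_exact₂ X hS x hx
        exact ⟨y, hy⟩
    have hgδ : LinearMap.range g = LinearMap.ker δ := by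
      ext x
      constructor
      · rintro ⟨y, rfl⟩
        change (y.comp (Ext.mk₀ S.g) (add_zero 0)).comp hS.extClass rfl = 0
        rw [Ext.comp_assoc_of_second_deg_zero, hS.comp_extClass, Ext.comp_zero]
      · intro hx
        obtain ⟨y, hy⟩ := Ext.covariant_sequence_exact₃ X hS x rfl hx
        exact ⟨y, hy⟩
    have h1 := f.finrank_range_add_finrank_ker
    have h2 := g.finrank_range_add_finrank_ker
    have h3 := δ.finrank_range_add_finrank_ker
    rw [hf, finrank_bot] at h1
    rw [← hfg] at h2
    rw [← hgδ, hδ, finrank_top] at h3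
    change Module.finrank ℂ (Ext X S.X₁ (0 + 1)) + _ = _
    omega

end ExtDimension

section StdHom

variable {𝔥 : Type u} [AddCommGroup 𝔥] [Module ℂ 𝔥] [FiniteDimensional ℂ 𝔥]
  {W : Subgroup (𝔥 ≃ₗ[ℂ] 𝔥)} [Finite W] {c c' : Param W}

variable (c) in
/-- The inclusion of `E` in `Δ_c(E)`. -/
def stdIncl (E : Rep.{u} ℂ W) : E →ₗ[ℂ] Std c E where
  toFun := stdMk c
  map_add' a b := by
    rw [stdMk, TensorProduct.tmul_add, map_add]
    rfl
  map_smul' a b := by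
    rw [stdMk, TensorProduct.tmul_smul, stdMk]
    rfl

lemma zElt_stdMk (E : Rep.{u} ℂ W) [E.ρ.IsIrreducible] (e : E) :
    zElt c • stdMk c e = cFun c E • stdMk c e := by
  have h2 : zElt c • stdIncl c E e = stdIncl c E (zAct c E.ρ e) := by
    rw [zElt, Finset.sum_smul, zAct, LinearMap.sum_apply, map_sum (stdIncl c E)]
    refine Finset.sum_congr rfl fun r _ => ?_
    rw [LinearMap.smul_apply, map_smul (stdIncl c E), LinearMap.sub_apply, map_sub (stdIncl c E),
      smul_assoc, sub_smul, one_smul]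
    exact congrArg (fun t => c.val r • (stdMk c e - t)) (grp_stdMk c r.1 e)
  rw [cFun_spec] at h2
  exact h2.trans (map_smul (stdIncl c E) _ _)

lemma stdMk_mem_invWt (E : Rep.{u} ℂ W) [E.ρ.IsIrreducible] (e : E) :
    stdMk c e ∈ invWt c (ModuleCat.of (Cher c) (Std c E)) (cFun c E) := by
  refine (mem_invWt (M := ModuleCat.of (Cher c) (Std c E))).mpr
    ⟨(Module.End.mem_maxGenEigenspace _ _ _).mpr ⟨1, ?_⟩, fun v => dun_stdMk c v e⟩
  have h : euler c • stdMk c e = cFun c E • stdMk c e := by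
    rw [euler_eq, add_smul, Finset.sum_smul, zElt_stdMk]
    simp only [mul_smul, dun_stdMk, smul_zero, Finset.sum_const_zero, zero_add]
  rw [pow_one]
  exact sub_eq_zero.mpr h

variable (c) in
/-- The restriction of a homomorphism from `Δ_c(E)` to `E`. -/
def stdHomRes (E : Rep.{u} ℂ W) [E.ρ.IsIrreducible] (X : CatO c) :
    (stdObj c E ⟶ X) →ₗ[ℂ] E.ρ.IntertwiningMap
      ((wRep c X.obj).subrepresentation (invWt c X.obj (cFun c E)) (invWt_stable c X.obj _)) where
  toFun f :=
    { toLinearMap := ((homO f).restrictScalars ℂ ∘ₗ stdIncl c E).codRestrict _ fun e =>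
        invWt_map (M := ModuleCat.of (Cher c) (Std c E)) (homO f) _ _ (stdMk_mem_invWt E e)
      isIntertwining' := fun w => by
        ext e
        exact (congrArg (homO f) (grp_stdMk c w e).symm).trans (map_smul (homO f) _ _) }
  map_add' f g := rfl
  map_smul' a f := rfl

lemma exists_std_lift (E : Rep.{u} ℂ W) {M : ModuleCat.{u} (Cher c)} (φ : E →ₗ[ℂ] M)
    (hg : ∀ (w : W) e, φ (E.ρ w e) = grp c w • φ e) (hd : ∀ (v : 𝔥) e, dun c v • φ e = 0) :
    ∃ f : Std c E →ₗ[Cher c] M, ∀ e, f (stdMk c e) = φ e := by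
  let G : Cher c ⊗[ℂ] E →ₗ[ℂ] M := TensorProduct.lift (LinearMap.mk₂ ℂ (fun a e => a • φ e)
    (fun a b e => add_smul a b _) (fun k a e => smul_assoc k a _)
    (fun a e e' => by rw [map_add, smul_add])
    (fun k a e => by rw [map_smul]; exact (act c M a).map_smul k (φ e)))
  let G' : Cher c ⊗[ℂ] E →ₗ[Cher c] M :=
    { toFun := G
      map_add' := map_add G
      map_smul' := fun a t => by
        induction t using TensorProduct.induction_on with
        | zero => rw [smul_zero, map_zero, smul_zero]
        | add s t hs ht => rw [smul_add, map_add, hs, ht, map_add, smul_add]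
        | tmul b e => exact mul_smul a b (φ e) }
  have hG : ∀ a e, G' (a ⊗ₜ e) = a • φ e := fun a e => rfl
  refine ⟨(stdRel c E).liftQ G' (Submodule.span_le.mpr ?_), fun e => ?_⟩
  · rintro t (⟨w, e, rfl⟩ | ⟨v, e, rfl⟩)
    · rw [SetLike.mem_coe, LinearMap.mem_ker, map_sub, hG, hG, hg, one_smul, sub_self]
    · rw [SetLike.mem_coe, LinearMap.mem_ker, hG, hd]
  · exact (hG 1 e).trans (one_smul _ _)

lemma stdHomRes_bijective (E : Rep.{u} ℂ W) [E.ρ.IsIrreducible] (X : CatO c) :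
    Function.Bijective (stdHomRes c E X) := by
  constructor
  · intro f g h
    refine homO_ext fun x => ?_
    refine std_induction c (p := fun x => homO f x = homO g x) (fun s t hs ht => ?_)
      ((map_zero (homO f)).trans (map_zero (homO g)).symm) (fun a e => ?_) x
    · exact (map_add (homO f) _ _).trans ((congrArg₂ _ hs ht).trans (map_add (homO g) _ _).symm)
    · have h1 : homO f (stdMk c e) = homO g (stdMk c e) :=
        congrArg Subtype.val (DFunLike.congr_fun h e)
      exact (map_smul (homO f) _ _).trans ((congrArg (a • ·) h1).trans
        (map_smul (homO g) _ _).symm)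
  · intro φ
    obtain ⟨f, hf⟩ := exists_std_lift E (M := X.obj) ((Submodule.subtype _) ∘ₗ φ.toLinearMap)
      (fun w e => congrArg Subtype.val (φ.isIntertwining _ _ w e))
      (fun v e => ((mem_invWt (M := X.obj)).mp (φ e).2).2 v)
    refine ⟨ofHomO f, Representation.IntertwiningMap.ext (LinearMap.ext fun e => Subtype.ext (hf e))⟩

lemma finite_stdHom (E : Rep.{u} ℂ W) [E.ρ.IsIrreducible] (X : CatO c) :
    FiniteDimensional ℂ (stdObj c E ⟶ X) := by
  have := finite_of_irreducible E
  have := X.property.finite_wt (cFun c E)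
  have : FiniteDimensional ℂ (invWt c X.obj (cFun c E)) :=
    Submodule.finiteDimensional_of_le (S₂ := wt c X.obj (cFun c E)) inf_le_left
  have : FiniteDimensional ℂ (E.ρ.IntertwiningMap ((wRep c X.obj).subrepresentation
      (invWt c X.obj (cFun c E)) (invWt_stable c X.obj _))) := inferInstance
  exact Module.Finite.of_injective _ (stdHomRes_bijective E X).1

lemma finite_ext_stdObj (E : Rep.{u} ℂ W) [E.ρ.IsIrreducible] (X : CatO c) (i : ℕ) :
    FiniteDimensional ℂ (Ext (stdObj c E) X i) :=
  finite_ext _ (finite_stdHom E) i X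

lemma finrank_ext_stdObj (h : IsDual c c') (B : InvForm W) (E : Rep.{u} ℂ W) [E.ρ.IsIrreducible]
    (X : CatO c) (i : ℕ) : Module.finrank ℂ (Ext (stdObj c E) X i) =
      mult E.ρ (torDeg c' (dualMod h B X.obj) i (starRingEnd ℂ (cFun c E))).ρ := by
  have := finite_of_irreducible E
  refine InjShift.unique (injShift_ext _ (finite_stdHom E))
    (injShift_torDeg_dual h B E (starRingEnd ℂ (cFun c E))) (fun X => ?_) i X
  rw [mult_cohomologyZero]
  refine ((Ext.linearEquiv₀ (R := ℂ)).finrank_eq).trans ?_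
  exact (LinearEquiv.ofBijective _ (stdHomRes_bijective E X)).finrank_eq

end StdHom

end

section

open Limits

section SimpleDual

variable {𝔥 : Type u} [AddCommGroup 𝔥] [Module ℂ 𝔥] [FiniteDimensional ℂ 𝔥]
  {W : Subgroup (𝔥 ≃ₗ[ℂ] 𝔥)} [Finite W] {c c' : Param W}

lemma mult_torDeg_congr {X Y : CatO c} (e : X ≅ Y) (θ : Rep.{u} ℂ W) [FiniteDimensional ℂ θ] (i : ℕ)
    (d : ℂ) : mult θ.ρ (torDeg c X.obj i d).ρ = mult θ.ρ (torDeg c Y.obj i d).ρ := by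
  rw [← mult_hStarHomology, ← mult_hStarHomology]
  exact (isAdditiveFun_mult θ d).iso ((hStarHomology c i).mapIso e)

/-- An isomorphism in the category `O_c` from a bijective homomorphism. -/
lemma nonempty_iso_of_bijective {X Y : CatO c} (f : X.obj →ₗ[Cher c] Y.obj)
    (hf : Function.Bijective f) : Nonempty (X ≅ Y) := by
  have h1 : Mono (ofHomO f) := (mono_catO_iff _).mpr hf.1
  have h2 : Epi (ofHomO f) := (epi_catO_iff _).mpr hf.2
  have := isIso_of_mono_of_epi (ofHomO f)
  exact ⟨asIso (ofHomO f)⟩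

lemma eq_bot_or_eq_top_of_simple (X : CatO c) [Simple X] (N : Submodule (Cher c) X.obj) :
    N = ⊥ ∨ N = ⊤ := by
  let i : ModuleCat.of (Cher c) N ⟶ X.obj := ModuleCat.ofHom N.subtype
  have hi : Mono i := (ModuleCat.mono_iff_injective i).mpr N.subtype_injective
  let Y : CatO c := ⟨ModuleCat.of (Cher c) N, (objO c).prop_of_mono i X.property⟩
  let f : Y ⟶ X := ofHomO N.subtype
  have hf : Mono f := (mono_catO_iff f).mpr N.subtype_injective
  by_cases h0 : f = 0
  · refine Or.inl ((Submodule.eq_bot_iff _).mpr fun x hx => ?_)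
    exact congrArg (fun g : Y ⟶ X => homO g ⟨x, hx⟩) h0
  · have h1 : Epi f := by
      have := isIso_of_mono_of_nonzero h0
      infer_instance
    refine Or.inr (eq_top_iff.mpr fun x _ => ?_)
    obtain ⟨y, rfl⟩ := (epi_catO_iff f).mp h1 x
    exact y.2

lemma exists_ne_zero_of_simple (X : CatO c) [Simple X] : ∃ x : X.obj, x ≠ 0 := by
  by_contra! H
  exact id_nonzero X (homO_ext fun x => (H x).trans (H _).symm)

/-- The submodule orthogonal to a submodule. -/
def CPair.perp {B : InvForm W} {A : ModuleCat.{u} (Cher c)} {D : ModuleCat.{u} (Cher c')}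
    (Ψ : CPair B D A) (P : Submodule (Cher c') D) : Submodule (Cher c) A where
  carrier := {a | ∀ χ ∈ P, Ψ.form χ a = 0}
  add_mem' ha hb χ hχ := by rw [map_add, ha χ hχ, hb χ hχ, add_zero]
  zero_mem' χ _ := map_zero _
  smul_mem' s a ha := by
    induction s using cherednik_induction generalizing a with
    | hgrp w =>
      intro χ hχ
      have h1 := Ψ.grp_grp w (grp c' w⁻¹ • χ) a
      rw [← mul_smul, ← map_mul, mul_inv_cancel, map_one, one_smul] at h1
      rw [h1]
      exact ha _ (P.smul_mem _ hχ)
    | hmulOp f =>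
      induction f using polyFun_induction generalizing a with
      | hlin x =>
        intro χ hχ
        rw [← B.toDual_equiv_symm x, ← Ψ.dun_left]
        exact ha _ (P.smul_mem _ hχ)
      | hconst z =>
        intro χ hχ
        rw [AlgHom.commutes, algebraMap_smul, map_smul, ha χ hχ, smul_zero]
      | hadd f g hf hg =>
        intro χ hχ
        rw [map_add, add_smul, map_add, hf a ha χ hχ, hg a ha χ hχ, add_zero]
      | hmul f g hf hg =>
        rw [map_mul, mul_smul]
        exact hf _ (hg a ha)
    | hdun v =>
      intro χ hχ
      rw [← Ψ.lin_left]
      exact ha _ (P.smul_mem _ hχ)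
    | hadd s t hs ht =>
      intro χ hχ
      rw [add_smul, map_add, hs a ha χ hχ, ht a ha χ hχ, add_zero]
    | hmul s t hs ht =>
      rw [mul_smul]
      exact hs _ (ht a ha)

lemma eq_bot_or_eq_top_dualMod (h : IsDual c c') (B : InvForm W) {M : ModuleCat.{u} (Cher c)}
    (hM : objO c M) (hS : ∀ N : Submodule (Cher c) M, N = ⊥ ∨ N = ⊤)
    (P : Submodule (Cher c') (dualMod h B M)) : P = ⊥ ∨ P = ⊤ := by
  by_contra! H
  have hD := objO_dualMod h B hM
  have hL := LocNilp.of_objO hM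
  have hDL := LocNilp.of_objO hD
  obtain ⟨ψ, -, hψ⟩ := SetLike.exists_of_lt (lt_top_iff_ne_top.mpr H.2)
  let Q : ModuleCat.{u} (Cher c') := ModuleCat.of (Cher c') (dualMod h B M ⧸ P)
  let q : dualMod h B M →ₗ[Cher c'] Q := P.mkQ
  have hQ : LocNilp Q := hDL.of_surjective (N := Q) (f := q) P.mkQ_surjective
  have hqψ : q ψ ≠ 0 := fun h0 => hψ ((Submodule.Quotient.mk_eq_zero P).mp h0)
  obtain ⟨φ, hφ⟩ := exists_dualMod_ne_zero (h := h.symm) (B := B) hQ hqψ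
  obtain ⟨a, ha⟩ := evDual_surjective (h := h) (B := B) hM (dualMap h.symm B hQ q φ)
  have key : ∀ χ, starRingEnd ℂ ((dualPair h B M).form χ a) =
      (dualPair h.symm B Q).form φ (q χ) := fun χ => by
    rw [← dualMap_form (h := h.symm) hQ q φ χ, ← ha]
    exact (evDual_form hL a χ).symm
  have haN : a ∈ (dualPair h B M).perp P := fun χ hχ => by
    refine (starRingEnd ℂ).injective ((key χ).trans ?_)
    have h0 : q χ = 0 := (Submodule.Quotient.mk_eq_zero P).mpr hχ
    rw [h0, map_zero, map_zero]
  rcases hS ((dualPair h B M).perp P) with hN | hN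
  · rw [hN, Submodule.mem_bot] at haN
    refine hφ ((key ψ).symm.trans ?_)
    rw [haN, map_zero, map_zero]
  · refine H.1 ((Submodule.eq_bot_iff P).mpr fun χ hχ => dualMod_ext fun m => ?_)
    have hm : m ∈ (dualPair h B M).perp P := hN ▸ Submodule.mem_top
    rw [hm χ hχ, map_zero, LinearMap.zero_apply]

variable (c) in
/-- The subspace of `Δ_c(E)` spanned by `E` and the weights above `c_E`. -/
def stdAbove (E : Rep.{u} ℂ W) [E.ρ.IsIrreducible] : Submodule ℂ (ModuleCat.of (Cher c) (Std c E)) :=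
  LinearMap.range (stdIncl c E) ⊔
    ⨆ n : ℕ, wt c (ModuleCat.of (Cher c) (Std c E)) (cFun c E + n + 1)

lemma lin_iSup_wt (M : ModuleCat.{u} (Cher c)) (x : Module.Dual ℂ 𝔥) (d : ℂ) {m : M}
    (hm : m ∈ ⨆ n : ℕ, wt c M (d + n + 1)) :
    mulOp c (lin x) • m ∈ ⨆ n : ℕ, wt c M (d + n + 1) := by
  induction hm using Submodule.iSup_induction' with
  | mem n m hm =>
    refine Submodule.mem_iSup_of_mem (n + 1) ?_
    have := lin_wt (M := M) x hm
    rwa [add_assoc d, show (n : ℂ) + 1 = ((n + 1 : ℕ) : ℂ) by push_cast; ring] at this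
  | zero => rw [smul_zero]; exact zero_mem _
  | add a b _ _ ha hb => rw [smul_add]; exact add_mem ha hb

lemma mulOp_stdAbove (E : Rep.{u} ℂ W) [E.ρ.IsIrreducible] (f : Poly 𝔥) :
    ∀ t ∈ stdAbove c E, mulOp c f • t ∈ stdAbove c E := by
  induction f using polyFun_induction with
  | hlin x =>
    intro t ht
    obtain ⟨_, ⟨e, rfl⟩, s, hs, rfl⟩ := Submodule.mem_sup.mp ht
    rw [smul_add]
    refine Submodule.mem_sup_right (add_mem (Submodule.mem_iSup_of_mem 0 ?_)
      (lin_iSup_wt _ x _ hs))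
    have := lin_wt (M := ModuleCat.of (Cher c) (Std c E)) x (mem_invWt.mp (stdMk_mem_invWt E e)).1
    rwa [Nat.cast_zero, add_zero]
  | hconst a =>
    intro t ht
    rw [AlgHom.commutes, algebraMap_smul]
    exact Submodule.smul_mem _ _ ht
  | hadd f g hf hg =>
    intro t ht
    rw [map_add, add_smul]
    exact add_mem (hf t ht) (hg t ht)
  | hmul f g hf hg =>
    intro t ht
    rw [map_mul, mul_smul]
    exact hf _ (hg t ht)

lemma stdAbove_eq_top (E : Rep.{u} ℂ W) [E.ρ.IsIrreducible] : stdAbove c E = ⊤ := by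
  refine eq_top_iff.mpr fun t _ => ?_
  have hP : ∀ P (e : E), dunPoly c (Module.finBasis ℂ 𝔥) P • stdMk c e ∈
      LinearMap.range (stdIncl c E) := by
    intro P
    induction P using MvPolynomial.induction_on with
    | C a =>
      intro e
      have h1 : dunPoly c (Module.finBasis ℂ 𝔥) (MvPolynomial.C a) = algebraMap ℂ _ a :=
        AlgHom.commutes _ a
      rw [h1, algebraMap_smul]
      exact ⟨a • e, map_smul (stdIncl c E) a e⟩
    | add p q hp hq =>
      intro e
      rw [map_add, add_smul]
      exact add_mem (hp e) (hq e)
    | mul_X p i hp =>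
      intro e
      rw [map_mul, dunPoly_X, mul_smul, dun_stdMk, smul_zero]
      exact zero_mem _
  refine std_induction c (p := fun t => t ∈ stdAbove c E) (fun s t hs ht => add_mem hs ht)
    (zero_mem _) (fun a e => ?_) t
  induction a using CherGen.pbw_induction with
  | hadd a b ha hb => rw [add_smul]; exact add_mem ha hb
  | hzero => rw [zero_smul]; exact zero_mem _
  | hmk f w P =>
    rw [mul_smul, mul_smul]
    refine mulOp_stdAbove E f _ (Submodule.mem_sup_left ?_)
    obtain ⟨e', he'⟩ := hP P e
    rw [← he']
    exact ⟨E.ρ w e', (grp_stdMk c w e').symm⟩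

lemma wt_inf_above (M : ModuleCat.{u} (Cher c)) (d : ℂ) {m : M} (h1 : m ∈ wt c M d)
    (h2 : m ∈ ⨆ n : ℕ, wt c M (d + n + 1)) : m = 0 := by
  have h3 : (⨆ n : ℕ, wt c M (d + n + 1)) ≤ ⨆ e, ⨆ (_ : e ≠ d), wt c M e := by
    refine iSup_le fun n => ?_
    refine le_iSup₂_of_le (d + n + 1) (fun hd => ?_) le_rfl
    have : ((n + 1 : ℕ) : ℂ) = 0 := by
      push_cast
      linear_combination hd
    exact Nat.succ_ne_zero n (Nat.cast_eq_zero.mp this)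
  exact Submodule.disjoint_def.mp (iSupIndep_wt M d) m h1 (h3 h2)

lemma map_above {M N : ModuleCat.{u} (Cher c)} (f : M →ₗ[Cher c] N) (d : ℂ) {m : M}
    (hm : m ∈ ⨆ n : ℕ, wt c M (d + n + 1)) : f m ∈ ⨆ n : ℕ, wt c N (d + n + 1) := by
  induction hm using Submodule.iSup_induction' with
  | mem n m hm => exact Submodule.mem_iSup_of_mem n (wt_map f _ hm)
  | zero => rw [map_zero]; exact zero_mem _
  | add a b _ _ ha hb => rw [map_add]; exact add_mem ha hb

lemma exists_std_decomp (E : Rep.{u} ℂ W) [E.ρ.IsIrreducible] (t : Std c E) :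
    ∃ e, ∃ s ∈ ⨆ n : ℕ, wt c (ModuleCat.of (Cher c) (Std c E)) (cFun c E + n + 1),
      stdMk c e + s = t := by
  have : t ∈ stdAbove c E := stdAbove_eq_top E ▸ Submodule.mem_top
  obtain ⟨_, ⟨e, rfl⟩, s, hs, h⟩ := Submodule.mem_sup.mp this
  exact ⟨e, s, hs, h⟩

lemma map_stdMk_mem_wt (E : Rep.{u} ℂ W) [E.ρ.IsIrreducible] {M : ModuleCat.{u} (Cher c)}
    (f : Std c E →ₗ[Cher c] M) (e : E) : f (stdMk c e) ∈ wt c M (cFun c E) :=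
  wt_map (M := ModuleCat.of (Cher c) (Std c E)) f _ (mem_invWt.mp (stdMk_mem_invWt E e)).1

/-- Simple modules with isomorphic lowest weight spaces are isomorphic. -/
lemma exists_bijective_of_lowest (E : Rep.{u} ℂ W) [E.ρ.IsIrreducible] {M N : ModuleCat.{u} (Cher c)}
    (hM : ∀ P : Submodule (Cher c) M, P = ⊥ ∨ P = ⊤)
    (hN : ∀ P : Submodule (Cher c) N, P = ⊥ ∨ P = ⊤)
    (f : Std c E →ₗ[Cher c] M) (g : Std c E →ₗ[Cher c] N)
    (hf : Function.Injective fun e : E => f (stdMk c e)) {e₀ : E} (hg : g (stdMk c e₀) ≠ 0) :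
    ∃ φ : M →ₗ[Cher c] N, Function.Bijective φ := by
  have he₀ : f (stdMk c e₀) ≠ 0 := fun h0 => hg (by
    have : e₀ = 0 := hf (h0.trans ((congrArg f (map_zero (stdIncl c E))).trans (map_zero f)).symm)
    rw [this]
    exact (congrArg g (map_zero (stdIncl c E))).trans (map_zero g))
  have hfs : LinearMap.range f = ⊤ := (hM _).resolve_left fun h0 =>
    he₀ ((Submodule.eq_bot_iff _).mp h0 _ ⟨_, rfl⟩)
  have hgs : LinearMap.range g = ⊤ := (hN _).resolve_left fun h0 =>
    hg ((Submodule.eq_bot_iff _).mp h0 _ ⟨_, rfl⟩)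
  have hker : LinearMap.ker f ≤ LinearMap.ker g := by
    rcases hN ((LinearMap.ker f).map g) with h0 | h0
    · exact fun t ht => (Submodule.eq_bot_iff _).mp h0 _ (Submodule.mem_map_of_mem ht)
    · exfalso
      obtain ⟨t, ht, htg⟩ := (h0 ▸ Submodule.mem_top :
        g (stdMk c e₀) ∈ (LinearMap.ker f).map g)
      obtain ⟨e, s, hs, rfl⟩ := exists_std_decomp E t
      have h1 : f (stdMk c e) + f s = 0 := (map_add f _ _).symm.trans ht
      have h2 : f (stdMk c e) = 0 := wt_inf_above M _ (map_stdMk_mem_wt E f e) (by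
        rw [eq_neg_of_add_eq_zero_left h1]
        exact neg_mem (map_above (M := ModuleCat.of (Cher c) (Std c E)) f _ hs))
      have h3 : e = 0 :=
        hf (h2.trans ((congrArg f (map_zero (stdIncl c E))).trans (map_zero f)).symm)
      have h4 : stdMk c e = 0 := h3 ▸ map_zero (stdIncl c E)
      rw [h4, zero_add] at htg
      exact hg (wt_inf_above N _ (map_stdMk_mem_wt E g e₀) (htg ▸
        map_above (M := ModuleCat.of (Cher c) (Std c E)) g _ hs))
  let φ : M →ₗ[Cher c] N := (LinearMap.ker f).liftQ g hker ∘ₗ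
    (f.quotKerEquivOfSurjective (LinearMap.range_eq_top.mp hfs)).symm.toLinearMap
  have hφ : ∀ t, φ (f t) = g t := fun t => by
    have : (f.quotKerEquivOfSurjective (LinearMap.range_eq_top.mp hfs)).symm (f t) =
        (LinearMap.ker f).mkQ t := by
      rw [LinearEquiv.symm_apply_eq]
      rfl
    exact (congrArg ((LinearMap.ker f).liftQ g hker) this).trans rfl
  refine ⟨φ, ?_, fun n => ?_⟩
  · refine LinearMap.ker_eq_bot.mp ((hM _).resolve_right fun h0 => hg ?_)
    rw [← hφ]
    exact (h0 ▸ Submodule.mem_top : f (stdMk c e₀) ∈ LinearMap.ker φ)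
  · obtain ⟨t, rfl⟩ := LinearMap.range_eq_top.mp hgs n
    exact ⟨f t, hφ t⟩

lemma hStar_le_above (E : Rep.{u} ℂ W) [E.ρ.IsIrreducible] {M : ModuleCat.{u} (Cher c)}
    (f : Std c E →ₗ[Cher c] M) (hf : Function.Surjective f) :
    hStar c M ≤ ⨆ n : ℕ, wt c M (cFun c E + n + 1) := by
  refine Submodule.span_le.mpr ?_
  rintro _ ⟨x, m, rfl⟩
  obtain ⟨t, rfl⟩ := hf m
  obtain ⟨e, s, hs, rfl⟩ := exists_std_decomp E t
  have h1 : f (stdMk c e + s) = f (stdMk c e) + f s := map_add f _ _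
  rw [h1, smul_add]
  refine add_mem (Submodule.mem_iSup_of_mem 0 ?_) (lin_iSup_wt M x _
    (map_above (M := ModuleCat.of (Cher c) (Std c E)) f _ hs))
  have := lin_wt (M := M) x (map_stdMk_mem_wt E f e)
  rwa [Nat.cast_zero, add_zero]

lemma mult_pos_of_ne_zero {G V V' : Type u} [Group G] [AddCommGroup V] [Module ℂ V]
    [AddCommGroup V'] [Module ℂ V'] [FiniteDimensional ℂ V] [FiniteDimensional ℂ V']
    {ρ : Representation ℂ G V} {σ : Representation ℂ G V'} (f : ρ.IntertwiningMap σ) (v : V)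
    (hv : f v ≠ 0) : mult ρ σ ≠ 0 := by
  intro h0
  have h1 : Subsingleton (ρ.IntertwiningMap σ) := Module.finrank_zero_iff.mp h0
  exact hv (DFunLike.congr_fun (Subsingleton.elim f 0) v)

lemma exists_ne_zero_of_mult {G V V' : Type u} [Group G] [AddCommGroup V] [Module ℂ V]
    [AddCommGroup V'] [Module ℂ V']
    {ρ : Representation ℂ G V} {σ : Representation ℂ G V'} (h : mult ρ σ ≠ 0) :
    ∃ (f : ρ.IntertwiningMap σ) (v : V), f v ≠ 0 := by
  by_contra! H
  have : Subsingleton (ρ.IntertwiningMap σ) := ⟨fun f g =>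
    Representation.IntertwiningMap.ext (LinearMap.ext fun v => (H f v).trans (H g v).symm)⟩
  exact h Module.finrank_zero_of_subsingleton

lemma exists_ne_zero_of_irreducible {G : Type u} [Group G] (E : Rep.{u} ℂ G) [E.ρ.IsIrreducible] :
    ∃ e : E, e ≠ 0 := by
  by_contra! H
  refine bot_ne_top (α := Subrepresentation E.ρ) (SetLike.ext fun e => ?_)
  rw [H e]
  exact ⟨fun _ => zero_mem (⊤ : Subrepresentation E.ρ).toSubmodule,
    fun _ => zero_mem (⊥ : Subrepresentation E.ρ).toSubmodule⟩

/-- A simple object has a simple lowest weight representation of `W`. -/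
lemma exists_lowest_of_simple (X : CatO c) [Simple X] :
    ∃ (E : Rep.{u} ℂ W) (_ : E.ρ.IsIrreducible) (f : Std c E →ₗ[Cher c] X.obj),
      Function.Injective fun e : E => f (stdMk c e) := by
  obtain ⟨x, hx⟩ := exists_ne_zero_of_simple X
  obtain ⟨s, -, n, hn, hn0, hd⟩ := X.locNilp.exists_singular hx
  have := X.property.finite_wt s
  have : FiniteDimensional ℂ (invWt c X.obj s) :=
    Submodule.finiteDimensional_of_le (S₂ := wt c X.obj s) inf_le_left
  have : Nontrivial (invWt c X.obj s) :=
    ⟨⟨⟨n, (mem_invWt (M := X.obj)).mpr ⟨hn, hd⟩⟩, 0, fun h0 => hn0 (congrArg Subtype.val h0)⟩⟩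
  obtain ⟨E, hE, f, hf⟩ := exists_irreducible_sub
    ((wRep c X.obj).subrepresentation (invWt c X.obj s) (invWt_stable c X.obj s))
  obtain ⟨F, hF⟩ := exists_std_lift E (M := X.obj) (Submodule.subtype _ ∘ₗ f.toLinearMap)
    (fun w e => congrArg Subtype.val (f.isIntertwining _ _ w e))
    (fun v e => ((mem_invWt (M := X.obj)).mp (f e).2).2 v)
  refine ⟨E, hE, F, fun a b hab => hf (Subtype.ext ?_)⟩
  exact (hF a).symm.trans (hab.trans (hF b))

/-- For self-dual parameters, a simple object is isomorphic to its contravariant dual. -/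
theorem nonempty_dualObj_iso (h : IsDual c c) (B : InvForm W) (X : CatO c) [Simple X] :
    Nonempty (X ≅ dualObj h B X) := by
  have hS := eq_bot_or_eq_top_of_simple X
  obtain ⟨E, hE, f, hf⟩ := exists_lowest_of_simple X
  have := finite_of_irreducible E
  obtain ⟨e, he⟩ := exists_ne_zero_of_irreducible E
  have he' : f (stdMk c e) ≠ 0 := fun h0 =>
    he (hf (h0.trans ((congrArg f (map_zero (stdIncl c E))).trans (map_zero f)).symm))
  have hfs : Function.Surjective f := LinearMap.range_eq_top.mp ((hS _).resolve_left fun h0 =>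
    he' ((Submodule.eq_bot_iff _).mp h0 _ ⟨_, rfl⟩))
  let d := cFun c E
  have := X.property.finite_wt d
  have : FiniteDimensional ℂ (coinvWt c X.obj d) := Module.Finite.map _ _
  let θ : E.ρ.IntertwiningMap
      ((coinvRep c X.obj).subrepresentation (coinvWt c X.obj d) (coinvWt_stable c X.obj d)) :=
    { toLinearMap := ((hStar c X.obj).mkQ ∘ₗ f.restrictScalars ℂ ∘ₗ stdIncl c E).codRestrict _
        fun e => ⟨_, map_stdMk_mem_wt E f e, rfl⟩
      isIntertwining' := fun w => by
        ext e
        exact congrArg (hStar c X.obj).mkQ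
          ((congrArg f (grp_stdMk c w e).symm).trans (map_smul f _ _)) }
  have hθ : θ e ≠ 0 := fun h0 => by
    have h1 : (hStar c X.obj).mkQ (f (stdMk c e)) = 0 := congrArg Subtype.val h0
    rw [Submodule.mkQ_apply, Submodule.Quotient.mk_eq_zero] at h1
    exact he' (wt_inf_above X.obj _ (map_stdMk_mem_wt E f e) (hStar_le_above E f hfs h1))
  have h1 := mult_pos_of_ne_zero θ e hθ
  rw [← mult_torDeg_coinvWt _ E X.property d] at h1
  obtain ⟨ev⟩ := nonempty_iso_of_bijective (X := X) (Y := dualObj h.symm B (dualObj h B X))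
    (evDual h B X.locNilp) ⟨evDual_injective X.locNilp, evDual_surjective X.property⟩
  rw [mult_torDeg_congr ev E 0 d] at h1
  have h2 := mult_cohomologyZero h.symm B E (dualObj h B X) (starRingEnd ℂ d)
  rw [Complex.conj_conj] at h2
  obtain ⟨ψ, e₀, hψ⟩ := exists_ne_zero_of_mult (h2 ▸ h1)
  obtain ⟨g, hg⟩ := exists_std_lift E (M := dualMod h B X.obj) ((invWt c (dualMod h B X.obj) (starRingEnd ℂ d)).subtype ∘ₗ
      ψ.toLinearMap)
    (fun w e => congrArg Subtype.val (ψ.isIntertwining _ _ w e))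
    (fun v e => ((mem_invWt (M := dualMod h B X.obj)).mp (ψ e).2).2 v)
  obtain ⟨φ, hφ⟩ := exists_bijective_of_lowest E hS (eq_bot_or_eq_top_dualMod h B X.property hS) f g
    hf (e₀ := e₀) (fun h0 => hψ (Subtype.ext ((hg e₀).symm.trans h0)))
  exact nonempty_iso_of_bijective (Y := dualObj h B X) φ hφ

lemma conj_cFun (h : IsDual c c) (E : Rep.{u} ℂ W) [E.ρ.IsIrreducible] :
    starRingEnd ℂ (cFun c E) = cFun c E := by
  have := finite_of_irreducible E
  obtain ⟨Φ, h1, h2, h3⟩ := exists_invariant_form E.ρ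
  obtain ⟨e, he⟩ := exists_ne_zero_of_irreducible E
  have hinv : ∀ w : W, Φ (E.ρ w e) e = Φ e (E.ρ w⁻¹ e) := fun w => by
    rw [← h3 w⁻¹ (E.ρ w e) e, ← Module.End.mul_apply, ← map_mul, inv_mul_cancel, map_one,
      Module.End.one_apply]
  have hz : Φ (zAct c E.ρ e) e = Φ e (zAct c E.ρ e) := by
    rw [zAct, LinearMap.sum_apply, map_sum Φ, map_sum (Φ e), LinearMap.sum_apply]
    refine (Fintype.sum_equiv Refl.invEquiv _ _ fun r => ?_).symm
    change Φ e (c.val r • (e - E.ρ r.1 e)) = Φ (c.val r.inv • (e - E.ρ r.inv.1 e)) e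
    rw [h, LinearMap.map_smulₛₗ Φ, Complex.conj_conj, map_smul (Φ e), LinearMap.smul_apply,
      map_sub Φ, map_sub (Φ e), LinearMap.sub_apply, hinv, show r.inv.1⁻¹ = r.1 from inv_inv _]
  rw [cFun_spec, map_smul (Φ e), LinearMap.map_smulₛₗ Φ, LinearMap.smul_apply, smul_eq_mul,
    smul_eq_mul] at hz
  refine mul_right_cancel₀ (fun h0 => ?_) hz
  have := h2 e he
  rw [h0, Complex.zero_re] at this
  exact lt_irrefl _ this

end SimpleDual

end

section

open Limits MonoidalCategory

section TorSequence

variable {R : Type u} [CommRing R]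

lemma shortExact_whiskerRight {S : ShortComplex (ModuleCat.{u} R)} (hS : S.ShortExact)
    (P : ModuleCat.{u} R) (hP : Module.Flat R P) : (S.map (tensorRight P)).ShortExact where
  exact := Module.Flat.rTensor_shortComplex_exact P S hS.exact
  mono_f := by
    have h := hS.mono_f
    refine (ModuleCat.mono_iff_injective _).mpr ?_
    exact Module.Flat.rTensor_preserves_injective_linearMap (M := P) S.f.hom
      ((ModuleCat.mono_iff_injective _).mp h)
  epi_g := by
    have h := hS.epi_g
    refine (ModuleCat.epi_iff_surjective _).mpr ?_
    exact LinearMap.rTensor_surjective P ((ModuleCat.epi_iff_surjective _).mp h)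

/-- The complex computing `Tor`. -/
abbrev torComplex (X : ModuleCat.{u} R) {Y : ModuleCat.{u} R} (P : ProjectiveResolution Y) :
    ChainComplex (ModuleCat.{u} R) ℕ :=
  (((tensoringLeft (ModuleCat.{u} R)).obj X).mapHomologicalComplex _).obj P.complex

/-- The short complex of complexes computing the long exact sequence of `Tor`. -/
def torComplexSeq (S : ShortComplex (ModuleCat.{u} R)) {Y : ModuleCat.{u} R}
    (P : ProjectiveResolution Y) : ShortComplex (ChainComplex (ModuleCat.{u} R) ℕ) where
  X₁ := torComplex S.X₁ P
  X₂ := torComplex S.X₂ P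
  X₃ := torComplex S.X₃ P
  f := (NatTrans.mapHomologicalComplex ((tensoringLeft _).map S.f) _).app P.complex
  g := (NatTrans.mapHomologicalComplex ((tensoringLeft _).map S.g) _).app P.complex
  zero := by
    ext n : 1
    change S.f ▷ P.complex.X n ≫ S.g ▷ P.complex.X n = 0
    rw [← comp_whiskerRight, S.zero]
    exact MonoidalPreadditive.zero_whiskerRight

lemma shortExact_torComplexSeq {S : ShortComplex (ModuleCat.{u} R)} (hS : S.ShortExact)
    {Y : ModuleCat.{u} R} (P : ProjectiveResolution Y) : (torComplexSeq S P).ShortExact := by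
  refine HomologicalComplex.shortExact_of_degreewise_shortExact _ fun n => ?_
  have h1 : Projective (P.complex.X n) := P.projective n
  have h2 : Module.Projective R (P.complex.X n) := (IsProjective.iff_projective _).mpr h1
  exact shortExact_whiskerRight hS (P.complex.X n) inferInstance

/-- `Tor` is computed by a projective resolution. -/
def torIso (X : ModuleCat.{u} R) {Y : ModuleCat.{u} R} (P : ProjectiveResolution Y) (n : ℕ) :
    ((Tor (ModuleCat.{u} R) n).obj X).obj Y ≅ (torComplex X P).homology n :=
  P.isoLeftDerivedObj _ n

lemma isZero_homology_torComplex {X : ModuleCat.{u} R} (hX : Module.Flat R X)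
    {Y : ModuleCat.{u} R} (P : ProjectiveResolution Y) (n : ℕ) :
    IsZero ((torComplex X P).homology (n + 1)) := by
  refine (HomologicalComplex.exactAt_iff_isZero_homology _ _).mp ?_
  have h1 := P.exact_succ n
  have h2 := Module.Flat.lTensor_shortComplex_exact X _ h1
  exact ((torComplex X P).exactAt_iff' (n + 2) (n + 1) n (ChainComplex.prev ℕ (n + 1))
    (ChainComplex.next_nat_succ n)).mpr h2

end TorSequence

section FourTerm

variable {k : Type*} [Field k] {A B C D : Type*} [AddCommGroup A] [Module k A] [AddCommGroup B]
  [Module k B] [AddCommGroup C] [Module k C] [AddCommGroup D] [Module k D]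

lemma finrank_four [FiniteDimensional k B] [FiniteDimensional k C] (f : A →ₗ[k] B) (g : B →ₗ[k] C)
    (h : C →ₗ[k] D) (hf : Function.Injective f) (hfg : Function.Exact f g)
    (hgh : Function.Exact g h) (hh : Function.Surjective h) :
    Module.finrank k A + Module.finrank k C = Module.finrank k B + Module.finrank k D := by
  have h1 := LinearMap.finrank_range_of_inj hf
  have h2 := g.finrank_range_add_finrank_ker
  have h3 := h.finrank_range_add_finrank_ker
  rw [LinearMap.exact_iff.mp hfg] at h2
  rw [LinearMap.exact_iff.mp hgh, LinearMap.range_eq_top.mpr hh, finrank_top] at h3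
  omega

end FourTerm

section TorDimension

variable {A : Type u} [CommRing A] [Algebra ℂ A]

variable (Y : ModuleCat.{u} A)

lemma finrank_tor_succ {S : ShortComplex (ModuleCat.{u} A)} (hS : S.ShortExact)
    (hflat : Module.Flat A S.X₂) (i : ℕ) :
    Module.finrank ℂ (((Tor (ModuleCat.{u} A) (i + 2)).obj S.X₃).obj Y) =
      Module.finrank ℂ (((Tor (ModuleCat.{u} A) (i + 1)).obj S.X₁).obj Y) := by
  let P := projectiveResolution Y
  have h := shortExact_torComplexSeq hS P
  have hδ : IsIso (h.δ (i + 2) (i + 1) rfl) := h.isIso_δ (i + 2) (i + 1) rfl (isZero_homology_torComplex hflat P (i + 1))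
    (isZero_homology_torComplex hflat P i)
  let e := torIso S.X₃ P (i + 2) ≪≫ @asIso _ _ _ _ (h.δ (i + 2) (i + 1) rfl) hδ ≪≫ (torIso S.X₁ P (i + 1)).symm
  exact (e.toLinearEquiv.restrictScalars ℂ).finrank_eq

lemma finrank_tor_zero {S : ShortComplex (ModuleCat.{u} A)} (hS : S.ShortExact)
    (hflat : Module.Flat A S.X₂)
    (h1 : FiniteDimensional ℂ (((Tor (ModuleCat.{u} A) 0).obj S.X₁).obj Y))
    (h2 : FiniteDimensional ℂ (((Tor (ModuleCat.{u} A) 0).obj S.X₂).obj Y)) :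
    Module.finrank ℂ (((Tor (ModuleCat.{u} A) 1).obj S.X₃).obj Y) +
        Module.finrank ℂ (((Tor (ModuleCat.{u} A) 0).obj S.X₂).obj Y) =
      Module.finrank ℂ (((Tor (ModuleCat.{u} A) 0).obj S.X₁).obj Y) +
        Module.finrank ℂ (((Tor (ModuleCat.{u} A) 0).obj S.X₃).obj Y) := by
  let P := projectiveResolution Y
  have h := shortExact_torComplexSeq hS P
  have hE : ∀ (X : ModuleCat.{u} A) (n : ℕ), Nonempty
      (((Tor (ModuleCat.{u} A) n).obj X).obj Y ≃ₗ[ℂ] (torComplex X P).homology n) := fun X n =>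
    ⟨(torIso X P n).toLinearEquiv.restrictScalars ℂ⟩
  obtain ⟨e1⟩ := hE S.X₁ 0
  obtain ⟨e2⟩ := hE S.X₂ 0
  obtain ⟨e3⟩ := hE S.X₃ 0
  obtain ⟨e4⟩ := hE S.X₃ 1
  rw [e1.finrank_eq, e2.finrank_eq, e3.finrank_eq, e4.finrank_eq]
  have hδ : Function.Injective (h.δ 1 0 rfl).hom := (ModuleCat.mono_iff_injective _).mp
    (h.mono_δ 1 0 rfl (isZero_homology_torComplex hflat P 0))
  have hg : Epi (HomologicalComplex.homologyMap (torComplexSeq S P).g 0) := by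
    have := h.epi_g
    exact HomologicalComplex.epi_homologyMap_of_epi_of_not_rel _ _ (by simp)
  have hgs : Function.Surjective
      (HomologicalComplex.homologyMap (torComplexSeq S P).g 0).hom :=
    (ModuleCat.epi_iff_surjective _).mp hg
  have : FiniteDimensional ℂ ((torComplex S.X₁ P).homology 0) := Module.Finite.equiv e1
  have : FiniteDimensional ℂ ((torComplex S.X₂ P).homology 0) := Module.Finite.equiv e2
  exact finrank_four ((h.δ 1 0 rfl).hom.restrictScalars ℂ)
    ((HomologicalComplex.homologyMap (torComplexSeq S P).f 0).hom.restrictScalars ℂ)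
    ((HomologicalComplex.homologyMap (torComplexSeq S P).g 0).hom.restrictScalars ℂ)
    hδ ((ShortComplex.ShortExact.moduleCat_exact_iff_function_exact _).mp (h.homology_exact₁ 1 0 rfl))
    ((ShortComplex.ShortExact.moduleCat_exact_iff_function_exact _).mp (h.homology_exact₂ 0))
    hgs

lemma finite_tor_succ {S : ShortComplex (ModuleCat.{u} A)} (hS : S.ShortExact)
    (hflat : Module.Flat A S.X₂) (i : ℕ)
    (h1 : FiniteDimensional ℂ (((Tor (ModuleCat.{u} A) i).obj S.X₁).obj Y)) :
    FiniteDimensional ℂ (((Tor (ModuleCat.{u} A) (i + 1)).obj S.X₃).obj Y) := by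
  let P := projectiveResolution Y
  have h := shortExact_torComplexSeq hS P
  have hδ : Function.Injective (h.δ (i + 1) i rfl).hom := (ModuleCat.mono_iff_injective _).mp
    (h.mono_δ (i + 1) i rfl (isZero_homology_torComplex hflat P i))
  have : FiniteDimensional ℂ ((torComplexSeq S P).X₁.homology i) := Module.Finite.equiv ((torIso S.X₁ P i).toLinearEquiv.restrictScalars ℂ)
  have h2 : FiniteDimensional ℂ ((torComplex S.X₃ P).homology (i + 1)) :=
    Module.Finite.of_injective ((h.δ (i + 1) i rfl).hom.restrictScalars ℂ) hδ
  exact Module.Finite.equiv ((torIso S.X₃ P (i + 1)).toLinearEquiv.restrictScalars ℂ).symm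

end TorDimension

end

section

open Limits MonoidalCategory

section DirectSumDimension

variable {k : Type*} [Field k] {κ : Type*} [DecidableEq κ] {V : κ → Type*} [∀ d, AddCommGroup (V d)]
  [∀ d, Module k (V d)] (D : Finset κ)

lemma component_pi_bijective (hD : ∀ d ∉ D, Subsingleton (V d)) :
    Function.Bijective (LinearMap.pi fun d : D => DirectSum.component k κ V d.1) := by
  constructor
  · intro x y hxy
    refine DFinsupp.ext fun d => ?_
    by_cases hd : d ∈ D
    · exact congrFun hxy ⟨d, hd⟩
    · have := hD d hd
      exact Subsingleton.elim _ _
  · intro y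
    refine ⟨DFinsupp.mk D fun d => y d, funext fun d => ?_⟩
    exact (DFinsupp.mk_apply).trans (dif_pos d.2)

lemma finrank_directSum_of_support (hD : ∀ d ∉ D, Subsingleton (V d))
    (hV : ∀ d, FiniteDimensional k (V d)) :
    Module.finrank k (⨁ d, V d) = ∑ d ∈ D, Module.finrank k (V d) := by
  rw [(LinearEquiv.ofBijective _ (component_pi_bijective (k := k) D hD)).finrank_eq,
    Module.finrank_pi_fintype, ← Finset.sum_coe_sort D fun d => Module.finrank k (V d)]

lemma finite_directSum_of_support (hD : ∀ d ∉ D, Subsingleton (V d))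
    (hV : ∀ d, FiniteDimensional k (V d)) : FiniteDimensional k (⨁ d, V d) :=
  Module.Finite.equiv (LinearEquiv.ofBijective _ (component_pi_bijective (k := k) D hD)).symm

end DirectSumDimension

section TorComparison

variable {𝔥 : Type u} [AddCommGroup 𝔥] [Module ℂ 𝔥] [FiniteDimensional ℂ 𝔥]
  {W : Subgroup (𝔥 ≃ₗ[ℂ] 𝔥)} [Finite W] {c : Param W}

lemma finite_leftRegular (G : Type u) [Group G] [Finite G] :
    FiniteDimensional ℂ (Rep.of (Representation.leftRegular ℂ G)) := by
  have h : FiniteDimensional ℂ (MonoidAlgebra ℂ G) := inferInstance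
  exact h

lemma finrank_eq_mult_regular {V : Type u} [AddCommGroup V] [Module ℂ V]
    (ρ : Representation ℂ W V) :
    Module.finrank ℂ V = mult (Rep.of (Representation.leftRegular ℂ W)).ρ ρ :=
  (Representation.leftRegularMapEquiv ρ).finrank_eq.symm

variable (c) in
/-- A finite set containing all scalars `c_E`. -/
lemma exists_finset_cFun : ∃ D : Finset ℂ, ∀ (E : Rep.{u} ℂ W) [E.ρ.IsIrreducible], cFun c E ∈ D := by
  have : Fintype W := Fintype.ofFinite W
  let z : MonoidAlgebra ℂ W := ∑ r : Refl W, c.val r • (1 - MonoidAlgebra.of ℂ W r.1)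
  have hz : IsIntegral ℂ z := Algebra.IsIntegral.isIntegral z
  refine ⟨(minpoly ℂ z).roots.toFinset, fun E hE => ?_⟩
  rw [Multiset.mem_toFinset, Polynomial.mem_roots (minpoly.ne_zero hz), Polynomial.IsRoot.def]
  obtain ⟨e, he⟩ := exists_ne_zero_of_irreducible E
  have h1 : E.ρ.asAlgebraHom z = zAct c E.ρ := by
    simp only [z, zAct, map_sum, map_smul, map_sub, map_one, Representation.asAlgebraHom_of]
  have h2 : Polynomial.aeval (zAct c E.ρ) (minpoly ℂ z) e =
      (minpoly ℂ z).eval (cFun c E) • e :=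
    Module.End.aeval_apply_of_hasEigenvector (f := zAct c E.ρ)
      (Module.End.hasEigenvector_iff.mpr ⟨Module.End.mem_eigenspace_iff.mpr (cFun_spec c E e), he⟩)
  rw [← h1, Polynomial.aeval_algHom_apply, minpoly.aeval, map_zero, LinearMap.zero_apply] at h2
  exact (smul_eq_zero.mp h2.symm).resolve_right he

lemma torDeg_subsingleton_of_notMem {D : Finset ℂ}
    (hD : ∀ (E : Rep.{u} ℂ W) [E.ρ.IsIrreducible], cFun c E ∈ D) (X : CatO c) (i : ℕ) {d : ℂ}
    (hd : d ∉ D) : Subsingleton (torDeg c X.obj i d) := by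
  have := finite_torDeg X.property i d
  by_contra hne
  have := not_subsingleton_iff_nontrivial.mp hne
  obtain ⟨E, hE, f, hf⟩ := exists_irreducible_sub (torDeg c X.obj i d).ρ
  obtain ⟨e, he⟩ := exists_ne_zero_of_irreducible E
  have h0 := torDeg_hom_eq_zero (M := X.obj) E (fun h : d = cFun c E => hd (h ▸ hD E)) f
  refine he (hf ?_)
  rw [h0]
  rfl

variable (c) in
/-- The exact functor forgetting all but the action of `ℂ[𝔥]`. -/
abbrev polyFunctor : CatO c ⥤ ModuleCat.{u} (Poly 𝔥) :=
  (objO c).ι ⋙ ModuleCat.restrictScalars (mulOp c).toRingHom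

lemma shortExact_polyFunctor {S : ShortComplex (CatO c)} (hS : S.ShortExact) :
    (S.map (polyFunctor c)).ShortExact := by
  have h := IsSES.of_shortExact hS
  refine ShortComplex.ShortExact.mk' ((ShortComplex.ShortExact.moduleCat_exact_iff_function_exact _).mpr ?_)
    ((ModuleCat.mono_iff_injective _).mpr h.inj) ((ModuleCat.epi_iff_surjective _).mpr h.surj)
  exact h.exact

lemma flat_of_retract {M N : ModuleCat.{u} (Cher c)} (hN : Module.Flat (Poly 𝔥) (polyModule c N))
    (p : M →ₗ[Cher c] N) (q : N →ₗ[Cher c] M) (h : ∀ m, q (p m) = m) :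
    Module.Flat (Poly 𝔥) (polyModule c M) := by
  let p' : polyModule c M →ₗ[Poly 𝔥] polyModule c N :=
    { toFun := p, map_add' := p.map_add, map_smul' := fun f m => p.map_smul (mulOp c f) m }
  let q' : polyModule c N →ₗ[Poly 𝔥] polyModule c M :=
    { toFun := q, map_add' := q.map_add, map_smul' := fun f m => q.map_smul (mulOp c f) m }
  exact Module.Flat.of_retract p' q' (LinearMap.ext h)

lemma flat_cyc (n : ℕ) : Module.Flat (Poly 𝔥) (polyModule c (cyc c n)) := by
  obtain ⟨p, q, hp, hq, hpq⟩ := exists_cyc_retract (c := c) n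
  have hlin : ∀ (x : Module.Dual ℂ 𝔥) (t : (W × (Fin (Module.finrank ℂ 𝔥) →₀ ℕ)) →₀ Poly 𝔥),
      finsuppLin _ x t = lin x • t := fun x t => rfl
  have hp' : ∀ (f : Poly 𝔥) (m : cyc c n), p (mulOp c f • m) = f • p m := by
    intro f
    induction f using polyFun_induction with
    | hlin x => exact fun m => (hp x m).trans (hlin x _)
    | hconst a =>
      intro m
      rw [AlgHom.commutes, algebraMap_smul, algebraMap_smul, map_smul]
    | hadd f g hf hg => intro m; rw [map_add, add_smul, map_add, hf, hg, add_smul]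
    | hmul f g hf hg => intro m; rw [map_mul, mul_smul, hf, hg, mul_smul]
  have hq' : ∀ (f : Poly 𝔥) m, q (f • m) = mulOp c f • q m := by
    intro f
    induction f using polyFun_induction with
    | hlin x => exact fun m => hq x m
    | hconst a =>
      intro m
      rw [AlgHom.commutes, algebraMap_smul, algebraMap_smul, map_smul]
    | hadd f g hf hg => intro m; rw [map_add, add_smul, map_add, hf, hg, add_smul]
    | hmul f g hf hg => intro m; rw [map_mul, mul_smul, hf, hg, mul_smul]
  let p' : polyModule c (cyc c n) →ₗ[Poly 𝔥] ((W × (Fin (Module.finrank ℂ 𝔥) →₀ ℕ)) →₀ Poly 𝔥) :=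
    { toFun := p, map_add' := p.map_add, map_smul' := hp' }
  let q' : ((W × (Fin (Module.finrank ℂ 𝔥) →₀ ℕ)) →₀ Poly 𝔥) →ₗ[Poly 𝔥] polyModule c (cyc c n) :=
    { toFun := q, map_add' := q.map_add, map_smul' := hq' }
  exact Module.Flat.of_retract p' q' (LinearMap.ext hpq)

lemma flat_projSum {k : ℕ} (d : Fin k → ℂ) : Module.Flat (Poly 𝔥) (polyModule c (projSum (c := c) d)) := by
  have h : ∀ j, Module.Flat (Poly 𝔥) (polyModule c (projMod c (d j))) := fun j => by
    refine flat_of_retract (flat_cyc (nilpOrd c (d j))) (LinearMap.range (projIdem c (d j))).subtype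
      (projIdem c (d j)).rangeRestrict ?_
    rintro ⟨_, y, rfl⟩
    exact Subtype.ext (LinearMap.congr_fun (projIdem_comp_projIdem (d j)) y)
  let e : (Π₀ j, polyModule c (projMod c (d j))) ≃ₗ[Poly 𝔥] ∀ j, polyModule c (projMod c (d j)) :=
    DFinsupp.linearEquivFunOnFintype
  have h2 : Module.Flat (Poly 𝔥) (∀ j, polyModule c (projMod c (d j))) :=
    Module.Flat.of_linearEquiv e.symm
  exact h2

lemma flat_of_projective (P : CatO c) [Projective P] : Module.Flat (Poly 𝔥) (polyModule c P.obj) := by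
  obtain ⟨k, d, f, hf⟩ := exists_epi_projObj P
  refine flat_of_retract (flat_projSum d) (homO (Projective.factorThru (𝟙 P) f)) (homO f) ?_
  intro m
  have := Projective.factorThru_comp (𝟙 P) f
  exact congrArg (fun g => homO g m) this

variable (𝔥) in
/-- The dimension of `Tor_i(M, ℂ)`. -/
def torDim (i : ℕ) (M : ModuleCat.{u} (Poly 𝔥)) : ℕ := Module.finrank ℂ
  (((Tor (ModuleCat.{u} (Poly 𝔥)) i).obj M).obj (residue 𝔥))

lemma torDim_succ {S : ShortComplex (ModuleCat.{u} (Poly 𝔥))} (hS : S.ShortExact)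
    (hflat : Module.Flat (Poly 𝔥) S.X₂) (i : ℕ) : torDim 𝔥 (i + 2) S.X₃ = torDim 𝔥 (i + 1) S.X₁ :=
  finrank_tor_succ _ hS hflat i

lemma torDim_zero {S : ShortComplex (ModuleCat.{u} (Poly 𝔥))} (hS : S.ShortExact)
    (hflat : Module.Flat (Poly 𝔥) S.X₂)
    (h1 : FiniteDimensional ℂ (((Tor (ModuleCat.{u} (Poly 𝔥)) 0).obj S.X₁).obj (residue 𝔥)))
    (h2 : FiniteDimensional ℂ (((Tor (ModuleCat.{u} (Poly 𝔥)) 0).obj S.X₂).obj (residue 𝔥))) :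
    torDim 𝔥 1 S.X₃ + torDim 𝔥 0 S.X₂ = torDim 𝔥 0 S.X₁ + torDim 𝔥 0 S.X₃ :=
  finrank_tor_zero _ hS hflat h1 h2

lemma nonempty_coinv_equiv_tor (M : ModuleCat.{u} (Cher c)) :
    Nonempty ((M ⧸ hStar c M) ≃ₗ[ℂ]
      (((Tor (ModuleCat.{u} (Poly 𝔥)) 0).obj (polyModule c M)).obj (residue 𝔥))) := by
  let I : Ideal (Poly 𝔥) := RingHom.ker (evalZero 𝔥)
  let N : Submodule (Poly 𝔥) (polyModule c M) := I • ⊤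
  have e1 : ((Tor (ModuleCat.{u} (Poly 𝔥)) 0).obj (polyModule c M)).obj (residue 𝔥) ≅
      polyModule c M ⊗ residue 𝔥 :=
    ((tensorLeft (polyModule c M)).leftDerivedZeroIsoSelf).app (residue 𝔥)
  have e2 : TensorProduct (Poly 𝔥) (polyModule c M) (Poly 𝔥 ⧸ I) ≃ₗ[Poly 𝔥]
      (polyModule c M ⧸ N) :=
    TensorProduct.tensorQuotEquivQuotSMul _ I
  let j : M → polyModule c M := fun m => m
  let F : M →ₗ[ℂ] (polyModule c M ⧸ N) :=
    { toFun := fun m => N.mkQ (j m)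
      map_add' := fun a b => map_add N.mkQ (j a) (j b)
      map_smul' := fun z m => by
        have h : z • m = mulOp c (algebraMap ℂ _ z) • m := by
          rw [AlgHom.commutes, algebraMap_smul]
        rw [h]
        exact (map_smul N.mkQ (algebraMap ℂ _ z) (j m)).trans (algebraMap_smul _ _ _) }
  have hF : LinearMap.ker F = hStar c M := by
    apply le_antisymm
    · intro m hm
      have h1 : j m ∈ N := (Submodule.Quotient.mk_eq_zero _).mp hm
      have h4 : ∀ f ∈ I, ∀ n : M, mulOp c f • n ∈ hStar c M := fun f hf n => by
        have h2 := mulOp_sub_const_mem (M := M) f n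
        have h3 : f.1 0 = 0 := hf
        rwa [h3, zero_smul, sub_zero] at h2
      exact Submodule.smul_induction_on (p := fun m : polyModule c M => m ∈ hStar c M) h1
        (fun f hf n _ => h4 f hf n) fun a b ha hb => add_mem ha hb
    · refine Submodule.span_le.mpr ?_
      rintro _ ⟨x, n, rfl⟩
      refine (Submodule.Quotient.mk_eq_zero _).mpr ?_
      have hx : lin x ∈ I := by
        change (lin x).1 0 = 0
        simp
      exact Submodule.smul_mem_smul (n := j n) hx Submodule.mem_top
  have hFs : Function.Surjective F := N.mkQ_surjective
  exact ⟨(Submodule.quotEquivOfEq _ _ hF.symm).trans ((F.quotKerEquivOfSurjective hFs).trans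
    ((e2.symm.trans e1.toLinearEquiv.symm).restrictScalars ℂ))⟩

lemma finite_tor (X : CatO c) (i : ℕ) : FiniteDimensional ℂ
    (((Tor (ModuleCat.{u} (Poly 𝔥)) i).obj (polyModule c X.obj)).obj (residue 𝔥)) := by
  induction i generalizing X with
  | zero =>
    obtain ⟨e⟩ := nonempty_coinv_equiv_tor X.obj
    have := X.property.finite_coinv
    exact Module.Finite.equiv e
  | succ i ih =>
    have hS := shortExact_kernel (Projective.π X)
    exact finite_tor_succ _ (shortExact_polyFunctor hS)
      (flat_of_projective (Projective.over X)) i (ih _)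

lemma finite_tor_polyFunctor (X : CatO c) : FiniteDimensional ℂ
    (((Tor (ModuleCat.{u} (Poly 𝔥)) 0).obj ((polyFunctor c).obj X)).obj (residue 𝔥)) :=
  finite_tor X 0

variable (c) in
lemma projShift_torDim : ProjShift fun i (X : CatO c) => torDim 𝔥 i (polyModule c X.obj) where
  succ S hS hP i := by
    have h := torDim_succ (shortExact_polyFunctor hS) (flat_of_projective S.X₂) i
    exact h
  zero S hS hP := by
    have h1 := finite_tor_polyFunctor S.X₁
    have h2 := finite_tor_polyFunctor S.X₂
    have h := torDim_zero (shortExact_polyFunctor hS) (flat_of_projective S.X₂) h1 h2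
    exact h

lemma projShift_sum_torDeg (D : Finset ℂ) :
    ProjShift fun i (X : CatO c) => ∑ d ∈ D, Module.finrank ℂ (torDeg c X.obj i d) := by
  have h : ∀ d i (X : CatO c), Module.finrank ℂ (torDeg c X.obj i d) =
      mult (Rep.of (Representation.leftRegular ℂ W)).ρ (torDeg c X.obj i d).ρ := fun d i X =>
    finrank_eq_mult_regular _
  have hfin := finite_leftRegular W
  have h2 := fun d => projShift_torDeg (c := c) (Rep.of (Representation.leftRegular ℂ W)) d
  simp only [h]
  refine ⟨fun S hS hP i => Finset.sum_congr rfl fun d _ => (h2 d).succ S hS hP i,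
    fun S hS hP => ?_⟩
  simp only [← Finset.sum_add_distrib]
  exact Finset.sum_congr rfl fun d _ => (h2 d).zero S hS hP

variable (c) in
/-- The action of the Euler element on `M / 𝔥* M`. -/
lemma hStar_euler (M : ModuleCat.{u} (Cher c)) :
    hStar c M ≤ (hStar c M).comap (act c M (euler c)) := by
  refine Submodule.span_le.mpr ?_
  rintro _ ⟨x, n, rfl⟩
  change euler c • mulOp c (lin x) • n ∈ hStar c M
  rw [← mul_smul, euler_mul_lin, mul_smul]
  exact Submodule.subset_span ⟨x, _, rfl⟩

lemma iSupIndep_coinvWt (M : ModuleCat.{u} (Cher c)) : iSupIndep (coinvWt c M) := by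
  let T : Module.End ℂ (M ⧸ hStar c M) := (hStar c M).mapQ (hStar c M) _ (hStar_euler c M)
  refine (Module.End.independent_maxGenEigenspace T).mono fun d => ?_
  rintro _ ⟨m, hm, rfl⟩
  obtain ⟨k, hk⟩ := (Module.End.mem_maxGenEigenspace _ _ _).mp hm
  refine (Module.End.mem_maxGenEigenspace _ _ _).mpr ⟨k, ?_⟩
  have key : ∀ (k : ℕ) m, ((T - d • 1) ^ k) ((hStar c M).mkQ m) =
      (hStar c M).mkQ (((act c M (euler c) - d • 1) ^ k) m) := by
    intro k
    induction k with
    | zero => exact fun m => rfl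
    | succ k ih =>
      intro m
      rw [pow_succ, pow_succ, Module.End.mul_apply, Module.End.mul_apply, ← ih]
      rfl
  rw [key, hk, map_zero]

lemma sum_finrank_torDeg_zero {D : Finset ℂ}
    (hD : ∀ (E : Rep.{u} ℂ W) [E.ρ.IsIrreducible], cFun c E ∈ D) (X : CatO c) :
    ∑ d ∈ D, Module.finrank ℂ (torDeg c X.obj 0 d) = torDim 𝔥 0 (polyModule c X.obj) := by
  have hfin := finite_leftRegular W
  have h1 : ∀ d, Module.finrank ℂ (torDeg c X.obj 0 d) = Module.finrank ℂ (coinvWt c X.obj d) :=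
    fun d => (finrank_eq_mult_regular _).trans ((mult_torDeg_coinvWt X.obj _ X.property d).trans
      (finrank_eq_mult_regular _).symm)
  have hc := X.property.finite_coinv
  have hcd : ∀ d, FiniteDimensional ℂ (coinvWt c X.obj d) := fun d => inferInstance
  have h2 : ∀ d ∉ D, Subsingleton (coinvWt c X.obj d) := fun d hd => by
    have := torDeg_subsingleton_of_notMem hD X 0 hd
    exact Module.finrank_zero_iff.mp ((h1 d).symm.trans Module.finrank_zero_of_subsingleton)
  have h3 : DirectSum.IsInternal (coinvWt c X.obj) := by
    refine (DirectSum.isInternal_submodule_iff_iSupIndep_and_iSup_eq_top _).mpr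
      ⟨iSupIndep_coinvWt X.obj, ?_⟩
    have : ⨆ d, coinvWt c X.obj d = (⨆ d, wt c X.obj d).map (hStar c X.obj).mkQ :=
      (Submodule.map_iSup _ _).symm
    rw [this, X.locNilp.iSup_wt, Submodule.map_top, Submodule.range_mkQ]
  obtain ⟨e⟩ := nonempty_coinv_equiv_tor X.obj
  rw [Finset.sum_congr rfl fun d _ => h1 d, ← finrank_directSum_of_support D h2 hcd, torDim,
    ← e.finrank_eq]
  exact (LinearEquiv.ofBijective (DirectSum.coeLinearMap (coinvWt c X.obj)) h3).finrank_eq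

/-- The groups `Tor` are computed by the Koszul complex. -/
theorem nonempty_directSum_torDeg_equiv (X : CatO c) (i : ℕ) :
    Nonempty ((⨁ d : ℂ, torDeg c X.obj i d) ≃ₗ[ℂ]
      ((Tor (ModuleCat.{u} (Poly 𝔥)) i).obj (polyModule c X.obj)).obj (residue 𝔥)) := by
  obtain ⟨D, hD⟩ := exists_finset_cFun c
  have h1 := fun d (hd : d ∉ D) => torDeg_subsingleton_of_notMem hD X i hd
  have h2 := fun d => finite_torDeg X.property i d
  have := finite_directSum_of_support (k := ℂ) D h1 h2
  have := finite_tor X i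
  refine ⟨LinearEquiv.ofFinrankEq _ _ ?_⟩
  rw [finrank_directSum_of_support D h1 h2]
  exact ProjShift.unique (projShift_sum_torDeg D) (projShift_torDim c)
    (sum_finrank_torDeg_zero hD) i X

end TorComparison

end

section ContractionForm

variable {K V : Type*} [AddCommGroup K] [Module ℂ K] [AddCommGroup V] [Module ℂ V] {κ : Type*}
  [Fintype κ] (Φ : V →ₗ⋆[ℂ] V →ₗ[ℂ] ℂ) (C : κ → Module.End ℂ K) (ε : K →ₗ[ℂ] V)

/-- The form `∑ Φ(ε C_{a_1} ⋯ C_{a_i} s, ε C_{a_1} ⋯ C_{a_i} t)`. -/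
def contractionForm : ℕ → K →+ K →+ ℂ
  | 0 => AddMonoidHom.mk' (fun s => AddMonoidHom.mk' (fun t => Φ (ε s) (ε t))
      fun t t' => by rw [map_add, map_add]) fun s s' => by
        ext t
        exact (congrArg (fun f : V →ₗ[ℂ] ℂ => f (ε t))
          ((congrArg Φ (map_add ε s s')).trans (map_add Φ _ _)))
  | i + 1 => AddMonoidHom.mk' (fun s => AddMonoidHom.mk'
      (fun t => ∑ a, contractionForm i (C a s) (C a t)) fun t t' => by
        simp only [map_add, Finset.sum_add_distrib]) fun s s' => by
        ext t
        simp [Finset.sum_add_distrib]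

lemma contractionForm_zero (s t : K) : contractionForm Φ C ε 0 s t = Φ (ε s) (ε t) := rfl

lemma contractionForm_succ (i : ℕ) (s t : K) : contractionForm Φ C ε (i + 1) s t =
    ∑ a, contractionForm Φ C ε i (C a s) (C a t) := rfl

variable {Φ C ε}

lemma contractionForm_symm (hΦ : ∀ m n, Φ n m = starRingEnd ℂ (Φ m n)) (i : ℕ) (s t : K) :
    contractionForm Φ C ε i t s = starRingEnd ℂ (contractionForm Φ C ε i s t) := by
  induction i generalizing s t with
  | zero => exact hΦ _ _
  | succ i ih => simp only [contractionForm_succ, ih (C _ s), map_sum]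

lemma contractionForm_nonneg (hΦ : ∀ m, m ≠ 0 → 0 < (Φ m m).re) (i : ℕ) (t : K) :
    0 ≤ (contractionForm Φ C ε i t t).re := by
  induction i generalizing t with
  | zero =>
    rw [contractionForm_zero]
    by_cases h : ε t = 0
    · rw [h, map_zero]
      simp
    · exact (hΦ _ h).le
  | succ i ih =>
    rw [contractionForm_succ, Complex.re_sum]
    exact Finset.sum_nonneg fun a _ => ih _

lemma contractionForm_contr_eq_zero (hΦ : ∀ m, m ≠ 0 → 0 < (Φ m m).re) {i : ℕ} {t : K}
    (h : (contractionForm Φ C ε (i + 1) t t).re = 0) (a : κ) :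
    (contractionForm Φ C ε i (C a t) (C a t)).re = 0 := by
  rw [contractionForm_succ, Complex.re_sum] at h
  exact (Finset.sum_eq_zero_iff_of_nonneg fun a _ => contractionForm_nonneg hΦ i _).mp h a
    (Finset.mem_univ a)

lemma contractionForm_adjoint {P Q : Module.End ℂ K} {p q : Module.End ℂ V}
    (h : ∀ m n, Φ (p m) n = Φ m (q n)) (hP : ∀ a s, C a (P s) = P (C a s))
    (hQ : ∀ a s, C a (Q s) = Q (C a s)) (hp : ∀ s, ε (P s) = p (ε s)) (hq : ∀ s, ε (Q s) = q (ε s))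
    (i : ℕ) (s t : K) :
    contractionForm Φ C ε i (P s) t = contractionForm Φ C ε i s (Q t) := by
  induction i generalizing s t with
  | zero => rw [contractionForm_zero, contractionForm_zero, hp, hq, h]
  | succ i ih => simp only [contractionForm_succ, hP, hQ, ih]

lemma contractionForm_koszul {X D : κ → Module.End ℂ K} {x y : κ → Module.End ℂ V}
    {d δ : Module.End ℂ K} (h : ∀ a m n, Φ (x a m) n = Φ m (y a n))
    (hX : ∀ b a s, C a (X b s) = X b (C a s)) (hD : ∀ b a s, C a (D b s) = D b (C a s))
    (hx : ∀ a s, ε (X a s) = x a (ε s)) (hy : ∀ a s, ε (D a s) = y a (ε s))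
    (hd : ∀ s, d s = ∑ a, X a (C a s)) (hCd : ∀ a s, C a (d s) = -d (C a s))
    (hCδ : ∀ a s, C a (δ s) = D a s - δ (C a s)) (hδ : ∀ s, ε (δ s) = 0) (i : ℕ) (s t : K) :
    contractionForm Φ C ε (i + 1) s (δ t) = (i + 1) * contractionForm Φ C ε i (d s) t := by
  have key : ∀ i s t, contractionForm Φ C ε (i + 1) s (δ t) = contractionForm Φ C ε i (d s) t -
      ∑ a, contractionForm Φ C ε i (C a s) (δ (C a t)) := fun i s t => by
    simp only [contractionForm_succ, hCδ, map_sub, Finset.sum_sub_distrib, hd, map_sum,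
      AddMonoidHom.finsetSum_apply]
    congr 1
    refine Finset.sum_congr rfl fun a _ => ?_
    exact (contractionForm_adjoint (h a) (hX a) (hD a) (hx a) (hy a) i _ _).symm
  induction i generalizing s t with
  | zero =>
    rw [key, Finset.sum_eq_zero fun a _ => by rw [contractionForm_zero, hδ, map_zero]]
    simp
  | succ i ih =>
    rw [key]
    simp only [ih, hCd, contractionForm_succ, map_neg, AddMonoidHom.neg_apply,
      Finset.sum_neg_distrib, ← Finset.mul_sum]
    push_cast
    ring

end ContractionForm

section DualBases

variable {U : Type u} {Z : Type*} [AddCommGroup U] [Module ℂ U]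
  [FiniteDimensional ℂ U] [AddCommGroup Z] [Module ℂ Z]

/-- The contraction of a bilinear map does not depend on the basis. -/
lemma sum_bilin_coord_eq {ι ι' : Type*} [Fintype ι] [Fintype ι'] (b : Module.Basis ι ℂ U)
    (b' : Module.Basis ι' ℂ U) (f : U →ₗ[ℂ] Module.Dual ℂ U →ₗ[ℂ] Z) :
    ∑ i, f (b i) (b.coord i) = ∑ j, f (b' j) (b'.coord j) := by
  have h : ∀ j, ∑ i, b'.coord j (b i) • b.coord i = b'.coord j := fun j =>
    (dual_eq_sum b (b'.coord j)).symm
  have h1 : ∀ i, f (b i) (b.coord i) = ∑ j, f (b' j) (b'.coord j (b i) • b.coord i) := fun i => by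
    conv_lhs => rw [← b'.sum_repr (b i)]
    simp only [map_sum, map_smul, LinearMap.sum_apply, LinearMap.smul_apply]
    rfl
  simp only [h1]
  rw [Finset.sum_comm]
  simp only [← map_sum, h]

end DualBases

section Orthonormal

variable {𝔥 : Type u} [AddCommGroup 𝔥] [Module ℂ 𝔥] [FiniteDimensional ℂ 𝔥]
  {W : Subgroup (𝔥 ≃ₗ[ℂ] 𝔥)}

lemma InvForm.exists_orthonormal (B : InvForm W) :
    ∃ b : Module.Basis (Fin (Module.finrank ℂ 𝔥)) ℂ 𝔥, ∀ i, B.toDual (b i) = b.coord i := by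
  let core : InnerProductSpace.Core ℂ 𝔥 :=
    { inner := fun u v => B.toDual u v
      conj_inner_symm := fun u v => (B.symm v u).symm
      re_inner_nonneg := fun v => by
        by_cases h : v = 0
        · simp [h]
        · exact (B.pos v h).le
      add_left := fun u v w => by rw [map_add]; rfl
      smul_left := fun u v a => by rw [LinearMap.map_smulₛₗ]; rfl
      definite := fun v hv => by
        by_contra h
        have := B.pos v h
        rw [show B.toDual v v = 0 from hv] at this
        exact lt_irrefl _ this }
  let i1 : NormedAddCommGroup 𝔥 := core.toNormedAddCommGroup
  let i2 : InnerProductSpace ℂ 𝔥 := InnerProductSpace.ofCore core.toCore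
  let o := stdOrthonormalBasis ℂ 𝔥
  refine ⟨o.toBasis, fun i => o.toBasis.ext fun j => ?_⟩
  have h1 : B.toDual (o i) (o j) = if i = j then 1 else 0 := orthonormal_iff_ite.mp o.orthonormal i j
  rw [OrthonormalBasis.coe_toBasis, h1, ← OrthonormalBasis.coe_toBasis, Module.Basis.coord_apply,
    Module.Basis.repr_self, Finsupp.single_apply]
  simp only [eq_comm]

end Orthonormal

section KoszulForm

variable {𝔥 : Type u} [AddCommGroup 𝔥] [Module ℂ 𝔥] [FiniteDimensional ℂ 𝔥]
  {V : Type*} [AddCommGroup V] [Module ℂ V] {κ : Type*} [Fintype κ] (b : Module.Basis κ ℂ 𝔥)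

lemma contr_contr (y z : 𝔥) (ω : ExteriorAlgebra ℂ (Module.Dual ℂ 𝔥)) :
    contr y (contr z ω) = -contr z (contr y ω) :=
  CliffordAlgebra.contractLeft_comm (Q := (0 : QuadraticForm ℂ (Module.Dual ℂ 𝔥))) _ _ ω

lemma kosD_basis (A : Module.Dual ℂ 𝔥 →ₗ[ℂ] Module.End ℂ V) :
    kosD A = ∑ a, TensorProduct.map (A (b.coord a)) (contr (b a)) :=
  sum_bilin_coord_eq (Module.finBasis ℂ 𝔥) b (LinearMap.mk₂ ℂ
    (fun y x => TensorProduct.map (A x) (contr y))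
    (fun y z x => by rw [map_add, TensorProduct.map_add_right])
    (fun r y x => by rw [map_smul, TensorProduct.map_smul_right])
    (fun y x z => by rw [map_add, TensorProduct.map_add_left])
    (fun r y x => by rw [map_smul, TensorProduct.map_smul_left]))

lemma kosDelta_basis (A : 𝔥 →ₗ[ℂ] Module.End ℂ V) :
    kosDelta A = ∑ a, TensorProduct.map (A (b a)) (wedge (b.coord a)) :=
  sum_bilin_coord_eq (Module.finBasis ℂ 𝔥) b (LinearMap.mk₂ ℂ
    (fun y x => TensorProduct.map (A y) (wedge x))
    (fun y z x => by rw [map_add, TensorProduct.map_add_left])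
    (fun r y x => by rw [map_smul, TensorProduct.map_smul_left])
    (fun y x z => by rw [map_add, TensorProduct.map_add_right])
    (fun r y x => by rw [map_smul, TensorProduct.map_smul_right]))

lemma degOp_basis : degOp = ∑ a, wedge (b.coord a) * contr (b a) :=
  sum_bilin_coord_eq (Module.finBasis ℂ 𝔥) b (LinearMap.mk₂ ℂ (fun y x => wedge x * contr y)
    (fun y z x => by rw [map_add, mul_add])
    (fun r y x => by rw [map_smul, mul_smul_comm])
    (fun y x z => by rw [map_add, add_mul])
    (fun r y x => by rw [map_smul, smul_mul_assoc]))

variable (𝔥 V) in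
/-- The projection of `V ⊗ Λ 𝔥*` onto `V`. -/
def lamAug : V ⊗[ℂ] ExteriorAlgebra ℂ (Module.Dual ℂ 𝔥) →ₗ[ℂ] V :=
  (TensorProduct.rid ℂ V).toLinearMap ∘ₗ
    (ExteriorAlgebra.algebraMapInv (R := ℂ) (M := Module.Dual ℂ 𝔥)).toLinearMap.lTensor V

lemma lamAug_tmul (v : V) (ω : ExteriorAlgebra ℂ (Module.Dual ℂ 𝔥)) :
    lamAug 𝔥 V (v ⊗ₜ ω) = ExteriorAlgebra.algebraMapInv ω • v := by
  simp [lamAug]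

/-- The form on `V ⊗ Λ^i 𝔥*` induced by a form on `V` and a basis of `𝔥`. -/
def koszulForm (Φ : V →ₗ⋆[ℂ] V →ₗ[ℂ] ℂ) (i : ℕ) :
    V ⊗[ℂ] ExteriorAlgebra ℂ (Module.Dual ℂ 𝔥) →+ V ⊗[ℂ] ExteriorAlgebra ℂ (Module.Dual ℂ 𝔥) →+ ℂ :=
  contractionForm Φ (fun a => (contr (b a)).lTensor V) (lamAug 𝔥 V) i

variable {b} {Φ : V →ₗ⋆[ℂ] V →ₗ[ℂ] ℂ}

lemma eq_zero_of_koszulForm (hΦ : ∀ m, m ≠ 0 → 0 < (Φ m m).re) {i : ℕ}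
    {t : V ⊗[ℂ] ExteriorAlgebra ℂ (Module.Dual ℂ 𝔥)} (ht : t ∈ lamPart 𝔥 V i)
    (h : (koszulForm b Φ i t t).re = 0) : t = 0 := by
  induction i generalizing t with
  | zero =>
    have h1 : lamAug 𝔥 V t ⊗ₜ (1 : ExteriorAlgebra ℂ (Module.Dual ℂ 𝔥)) = t := by
      have := lamPart_map (U := ⊥) ((TensorProduct.mk ℂ V _).flip
        (1 : ExteriorAlgebra ℂ (Module.Dual ℂ 𝔥)) ∘ₗ lamAug 𝔥 V - LinearMap.id)
        (fun v ω hω => ?_) ht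
      · exact sub_eq_zero.mp this
      · obtain ⟨z, rfl⟩ := Submodule.mem_one.mp hω
        change lamAug 𝔥 V (v ⊗ₜ algebraMap ℂ _ z) ⊗ₜ[ℂ] (1 : ExteriorAlgebra ℂ (Module.Dual ℂ 𝔥)) -
          v ⊗ₜ algebraMap ℂ _ z = 0
        rw [lamAug_tmul, ExteriorAlgebra.algebraMap_leftInverse, TensorProduct.smul_tmul,
          Algebra.algebraMap_eq_smul_one, sub_self]
    have h2 : lamAug 𝔥 V t = 0 := by
      by_contra h0
      exact (hΦ _ h0).ne' h
    rw [← h1, h2, TensorProduct.zero_tmul]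
  | succ i ih =>
    have h1 : ∀ a, (contr (b a)).lTensor V t = 0 := fun a =>
      ih (lamPart_map ((contr (b a)).lTensor V)
        (fun v ω hω => tmul_mem_lamPart v (contr_mem (b a) hω)) ht)
        (contractionForm_contr_eq_zero hΦ h a)
    have h2 : (degOp (𝔥 := 𝔥)).lTensor V t = ((i + 1 : ℕ) : ℂ) • t := by
      have := lamPart_map (U := ⊥) ((degOp (𝔥 := 𝔥)).lTensor V - ((i + 1 : ℕ) : ℂ) • LinearMap.id)
        (fun v ω hω => ?_) ht
      · exact sub_eq_zero.mp this
      · change v ⊗ₜ degOp ω - ((i + 1 : ℕ) : ℂ) • v ⊗ₜ[ℂ] ω = 0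
        rw [degOp_of_mem hω, TensorProduct.tmul_smul, sub_self]
    have h3 : (degOp (𝔥 := 𝔥)).lTensor V t =
        ∑ a, (wedge (b.coord a)).lTensor V ((contr (b a)).lTensor V t) := by
      rw [degOp_basis b]
      have := map_sum (LinearMap.lTensorHom (R := ℂ) (M := V))
        (fun a => wedge (b.coord a) * contr (b a)) Finset.univ
      refine (LinearMap.congr_fun this t).trans ?_
      rw [LinearMap.sum_apply]
      exact Finset.sum_congr rfl fun a _ => LinearMap.lTensor_comp_apply _ _ _ _
    rw [h3, Finset.sum_eq_zero fun a _ => by rw [h1, map_zero]] at h2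
    exact (smul_eq_zero.mp h2.symm).resolve_left (Nat.cast_ne_zero.mpr i.succ_ne_zero)

variable {A : Module.Dual ℂ 𝔥 →ₗ[ℂ] Module.End ℂ V} {D : 𝔥 →ₗ[ℂ] Module.End ℂ V}

/-- The two Koszul differentials are adjoint up to a factor. -/
lemma koszulForm_kosDelta (h : ∀ a m n, Φ (A (b.coord a) m) n = Φ m (D (b a) n)) (i : ℕ)
    (s t : V ⊗[ℂ] ExteriorAlgebra ℂ (Module.Dual ℂ 𝔥)) :
    koszulForm b Φ (i + 1) s (kosDelta D t) = (i + 1) * koszulForm b Φ i (kosD A s) t := by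
  have hcomm : ∀ (y : 𝔥) (f : Module.End ℂ V) (s : V ⊗[ℂ] ExteriorAlgebra ℂ (Module.Dual ℂ 𝔥)),
      (contr y).lTensor V (f.rTensor _ s) = f.rTensor _ ((contr y).lTensor V s) := fun y f s => by
    rw [← LinearMap.comp_apply, ← LinearMap.comp_apply, LinearMap.lTensor_comp_rTensor,
      LinearMap.rTensor_comp_lTensor]
  have haug : ∀ (f : Module.End ℂ V) (s : V ⊗[ℂ] ExteriorAlgebra ℂ (Module.Dual ℂ 𝔥)),
      lamAug 𝔥 V (f.rTensor _ s) = f (lamAug 𝔥 V s) := fun f s => by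
    induction s using TensorProduct.induction_on with
    | zero => simp only [map_zero]
    | add x y hx hy => simp only [map_add, hx, hy]
    | tmul v ω => rw [LinearMap.rTensor_tmul, lamAug_tmul, lamAug_tmul, map_smul]
  refine contractionForm_koszul (X := fun a => (A (b.coord a)).rTensor _)
    (D := fun a => (D (b a)).rTensor _) (x := fun a => A (b.coord a)) (y := fun a => D (b a))
    h (fun _ _ => hcomm _ _) (fun _ _ => hcomm _ _) (fun _ => haug _) (fun _ => haug _)
    (fun s => ?_) (fun a s => ?_) (fun a s => ?_) (fun s => ?_) i s t
  · rw [kosD_basis b, LinearMap.sum_apply]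
    refine Finset.sum_congr rfl fun a _ => ?_
    rw [← LinearMap.comp_apply, LinearMap.rTensor_comp_lTensor]
  · rw [kosD_basis b, LinearMap.sum_apply, LinearMap.sum_apply, map_sum, ← Finset.sum_neg_distrib]
    refine Finset.sum_congr rfl fun k _ => ?_
    induction s using TensorProduct.induction_on with
    | zero => simp only [map_zero, neg_zero]
    | add x y hx hy => simp only [map_add, hx, hy, neg_add]
    | tmul v ω =>
      simp only [TensorProduct.map_tmul, LinearMap.lTensor_tmul]
      rw [contr_contr, TensorProduct.tmul_neg]
  · induction s using TensorProduct.induction_on with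
    | zero => simp only [map_zero, sub_zero]
    | add x y hx hy => simp only [map_add, hx, hy]; abel
    | tmul v ω =>
      rw [kosDelta_basis b, LinearMap.sum_apply, LinearMap.sum_apply, map_sum]
      simp only [TensorProduct.map_tmul, LinearMap.lTensor_tmul, LinearMap.rTensor_tmul, wedge_apply,
        contr_ι_mul, TensorProduct.tmul_sub, Finset.sum_sub_distrib, TensorProduct.tmul_smul]
      congr 1
      classical
      rw [Finset.sum_eq_single a]
      · simp
      · intro k _ hk
        simp [hk.symm]
      · intro h; exact absurd (Finset.mem_univ a) h
  · induction s using TensorProduct.induction_on with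
    | zero => simp only [map_zero]
    | add x y hx hy => simp only [map_add, hx, hy, add_zero]
    | tmul v ω =>
      rw [kosDelta_basis b, LinearMap.sum_apply, map_sum]
      refine Finset.sum_eq_zero fun a _ => ?_
      rw [TensorProduct.map_tmul, lamAug_tmul, wedge_apply, map_mul,
        show ExteriorAlgebra.algebraMapInv (ExteriorAlgebra.ι ℂ (b.coord a)) = 0 by
          simp [ExteriorAlgebra.algebraMapInv], zero_mul, zero_smul]

/-- Harmonic elements of the Koszul complex are cycles. -/
lemma kosD_eq_zero_of_harmonic (h : ∀ a m n, Φ (A (b.coord a) m) n = Φ m (D (b a) n))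
    (hs : ∀ m n, Φ n m = starRingEnd ℂ (Φ m n)) (hp : ∀ m, m ≠ 0 → 0 < (Φ m m).re) {i : ℕ}
    {t : V ⊗[ℂ] ExteriorAlgebra ℂ (Module.Dual ℂ 𝔥)} (ht : t ∈ lamPart 𝔥 V i)
    (h0 : kosD A (kosDelta D t) + kosDelta D (kosD A t) = 0) : kosD A t = 0 := by
  obtain _ | i := i
  · refine lamPart_map (U := ⊥) (kosD A) (fun v ω hω => ?_) ht
    rw [kosD_tmul]
    exact Finset.sum_eq_zero fun j _ => by rw [contr_mem_zero _ hω, TensorProduct.tmul_zero]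
  · refine eq_zero_of_koszulForm (b := b) hp (kosD_mem A ht) ?_
    have h1 := koszulForm_kosDelta h i t (kosD A t)
    have h2 := koszulForm_kosDelta h (i + 1) (kosDelta D t) t
    have h3 : koszulForm b Φ (i + 1) t (kosD A (kosDelta D t)) =
        starRingEnd ℂ (koszulForm b Φ (i + 1) (kosD A (kosDelta D t)) t) :=
      contractionForm_symm hs _ _ _
    have h4 : koszulForm b Φ (i + 1) t (kosD A (kosDelta D t)) +
        koszulForm b Φ (i + 1) t (kosDelta D (kosD A t)) = 0 := by
      rw [← map_add, h0, map_zero]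
    have h5 : 0 ≤ (koszulForm b Φ (i + 1 + 1) (kosDelta D t) (kosDelta D t)).re :=
      contractionForm_nonneg hp _ _
    have h6 : 0 ≤ (koszulForm b Φ i (kosD A t) (kosD A t)).re := contractionForm_nonneg hp _ _
    rw [h1, h3] at h4
    have h7 := congrArg Complex.re h4
    have h8 := congrArg Complex.re h2
    rw [show (((i + 1 : ℕ) : ℂ) + 1) = ((i + 2 : ℝ) : ℂ) by push_cast; ring,
      Complex.re_ofReal_mul] at h8
    rw [Complex.add_re, Complex.conj_re, show ((i : ℂ) + 1) = ((i + 1 : ℝ) : ℂ) by push_cast; ring,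
      Complex.re_ofReal_mul, Complex.zero_re] at h7
    have hi : (0 : ℝ) ≤ i := Nat.cast_nonneg i
    rw [h8] at h5
    have h9 := (mul_nonneg_iff_of_pos_left (by linarith : (0 : ℝ) < i + 2)).mp h5
    have h10 := mul_nonneg (by linarith : (0 : ℝ) ≤ i + 1) h6
    exact (mul_eq_zero.mp (by linarith :
      ((i : ℝ) + 1) * (koszulForm b Φ i (kosD A t) (kosD A t)).re = 0)).resolve_left (by linarith)

end KoszulForm

section Unitary

variable {𝔥 : Type u} [AddCommGroup 𝔥] [Module ℂ 𝔥] [FiniteDimensional ℂ 𝔥]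
  {W : Subgroup (𝔥 ≃ₗ[ℂ] 𝔥)} [Finite W] {c : Param W} {B : InvForm W} {M : ModuleCat.{u} (Cher c)}

/-- The degree `d` part of `M ⊗ Λ^i 𝔥*`. -/
def pieceRep (c : Param W) (M : ModuleCat.{u} (Cher c)) (i : ℕ) (d : ℂ) :
    Representation ℂ W (koszulPiece c M i d) :=
  (koszulRep c M).subrepresentation _ (koszulPiece_stable c M i d)

lemma zAct_intertwining {V V' : Type*} [AddCommGroup V] [Module ℂ V] [AddCommGroup V'] [Module ℂ V']
    {ρ : Representation ℂ W V} {σ : Representation ℂ W V'} (f : V →ₗ[ℂ] V')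
    (hf : ∀ w v, f (ρ w v) = σ w (f v)) (v : V) : f (zAct c ρ v) = zAct c σ (f v) := by
  rw [zAct, zAct, LinearMap.sum_apply, LinearMap.sum_apply, map_sum f]
  refine Finset.sum_congr rfl fun r _ => ?_
  rw [LinearMap.smul_apply, LinearMap.smul_apply, map_smul f, LinearMap.sub_apply,
    LinearMap.sub_apply, map_sub f, hf]
  rfl

lemma wtRep_tprod_equiv (c : Param W) (M : ModuleCat.{u} (Cher c)) (i : ℕ) (d : ℂ) :
    Nonempty (((wtRep c M (d - i)).tprod (extPowRep W i)).Equiv (pieceRep c M i d)) := by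
  have hinj : Function.Injective (TensorProduct.map (wt c M (d - i)).subtype
      (⋀[ℂ]^i (Module.Dual ℂ 𝔥)).subtype) :=
    TensorProduct.map_injective_of_flat_flat _ _ Subtype.val_injective Subtype.val_injective
  refine ⟨Representation.Equiv.mk (LinearEquiv.ofInjective _ hinj) fun w => ?_⟩
  refine TensorProduct.ext' fun m ω => Subtype.ext ?_
  change (grp c w • m.1) ⊗ₜ[ℂ] (extPowRep W i w ω).1 = (grp c w • m.1) ⊗ₜ[ℂ] extRep W w ω.1
  rw [extPowRep_coe]

lemma IsUnitary.exists_pair (h : IsUnitary B M) : ∃ Ψ : CPair B M M,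
    (∀ m n, Ψ.form n m = starRingEnd ℂ (Ψ.form m n)) ∧ ∀ m, m ≠ 0 → 0 < (Ψ.form m m).re := by
  obtain ⟨Φ, h1, h2, h3, h4⟩ := h
  exact ⟨⟨Φ, h3, h4, fun v m n => by rw [h1, ← h4, ← h1]⟩, h1, h2⟩

lemma CPair.euler_smul (h : IsDual c c) (Ψ : CPair B M M)
    (hp : ∀ m, m ≠ 0 → 0 < (Ψ.form m m).re) {d : ℂ} {m : M} (hm : m ∈ wt c M d) :
    euler c • m = d • m := by
  have hz : ∀ m, Ψ.form m m = 0 → m = 0 := fun m h0 => by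
    by_contra hm
    have := hp m hm
    rw [h0, Complex.zero_re] at this
    exact lt_irrefl _ this
  by_cases hd : starRingEnd ℂ d = d
  · have h2 : ∀ m : M, ((act c M (euler c) - d • 1 : Module.End ℂ M) ^ 2) m = 0 →
        ((act c M (euler c) - d • 1 : Module.End ℂ M) ^ 1) m = 0 := fun m h0 => hz _ <| by
      rw [Ψ.euler_pow_left h, hd, ← Module.End.mul_apply, ← pow_add, h0, map_zero]
    have h3 : ∀ k, ∀ m : M, ((act c M (euler c) - d • 1 : Module.End ℂ M) ^ (k + 1)) m = 0 →
        ((act c M (euler c) - d • 1 : Module.End ℂ M) ^ 1) m = 0 := fun k => by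
      induction k with
      | zero => exact fun m h0 => h0
      | succ k ih =>
        intro m h0
        refine ih m ?_
        rw [add_comm k 1, pow_add, Module.End.mul_apply]
        refine h2 _ ?_
        rw [← Module.End.mul_apply, ← pow_add, add_comm 2 k]
        exact h0
    rw [wt, Module.End.mem_maxGenEigenspace] at hm
    obtain ⟨k, hk⟩ := hm
    have h4 := h3 k m (by rw [pow_succ', Module.End.mul_apply, hk, map_zero])
    rw [pow_one] at h4
    exact sub_eq_zero.mp h4
  · rw [hz m (Ψ.form_eq_zero h hd hm hm), smul_zero, smul_zero]

lemma CPair.koszulEuler_smul (h : IsDual c c) (Ψ : CPair B M M)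
    (hp : ∀ m, m ≠ 0 → 0 < (Ψ.form m m).re) {i : ℕ} {d : ℂ} {t : Koszul c M}
    (ht : t ∈ koszulPiece c M i d) : koszulEuler c M t = d • t := by
  have := koszulPiece_map (U := ⊥) (koszulEuler c M - d • LinearMap.id) (fun m hm ω hω => ?_) ht
  · exact sub_eq_zero.mp this
  · change koszulEuler c M (m ⊗ₜ ω) - d • m ⊗ₜ[ℂ] ω = 0
    rw [koszulEuler_tmul, Ψ.euler_smul h hp hm, degOp_of_mem hω, TensorProduct.tmul_smul,
      ← TensorProduct.smul_tmul', ← add_smul, sub_add_cancel, sub_self]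

/-- In a unitary module, occurrences of `E` in the Koszul complex in degree `c_E` consist of
cycles. -/
lemma IsUnitary.koszulD_eq_zero (h : IsDual c c) (hu : IsUnitary B M) (E : Rep.{u} ℂ W)
    [E.ρ.IsIrreducible] {i : ℕ} (f : E.ρ.IntertwiningMap (pieceRep c M i (cFun c E))) (e : E) :
    koszulD c M (f e).1 = 0 := by
  obtain ⟨Ψ, hs, hp⟩ := hu.exists_pair
  obtain ⟨b, hb⟩ := B.exists_orthonormal
  refine kosD_eq_zero_of_harmonic (b := b) (Φ := Ψ.form) (A := linAct c M) (D := dunAct c M)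
    (fun a m n => ?_) hs hp (koszulPiece_le_lamPart _ _ (f e).2) ?_
  · change Ψ.form (mulOp c (lin (b.coord a)) • m) n = Ψ.form m (dun c (b a) • n)
    rw [← hb, Ψ.lin_left]
  · refine (koszulD_koszulDelta (f e).1).trans ?_
    rw [Ψ.koszulEuler_smul h hp (f e).2]
    have h1 := zAct_intertwining (c := c) (ρ := E.ρ) (σ := koszulRep c M)
      ((koszulPiece c M i (cFun c E)).subtype ∘ₗ f.toLinearMap)
      (fun w v => congrArg Subtype.val (f.isIntertwining _ _ w v)) e
    rw [cFun_spec, map_smul] at h1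
    exact sub_eq_zero.mpr h1

/-- The projection of the cycles onto `Tor`. -/
def cyclesProj (c : Param W) (M : ModuleCat.{u} (Cher c)) (i : ℕ) (d : ℂ) :
    (cyclesRep c M i d).IntertwiningMap (torDeg c M i d).ρ where
  toLinearMap := torMk c M i d
  isIntertwining' w := LinearMap.ext fun t => (torMk_rep i d w t).symm

/-- The inclusion of the cycles into the Koszul complex. -/
def cyclesIncl (c : Param W) (M : ModuleCat.{u} (Cher c)) (i : ℕ) (d : ℂ) :
    (cyclesRep c M i d).IntertwiningMap (pieceRep c M i d) where
  toLinearMap := Submodule.inclusion (koszulCycles_le i d)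
  isIntertwining' _ := rfl

theorem IsUnitary.mult_torDeg (h : IsDual c c) (hu : IsUnitary B M) (E : Rep.{u} ℂ W)
    [E.ρ.IsIrreducible] (i : ℕ) : mult E.ρ (torDeg c M i (cFun c E)).ρ =
      mult E.ρ ((wtRep c M (cFun c E - i)).tprod (extPowRep W i)) := by
  obtain ⟨φ⟩ := wtRep_tprod_equiv c M i (cFun c E)
  rw [mult_congr φ]
  have h1 : Function.Bijective (homMap E.ρ (cyclesProj c M i (cFun c E))) := by
    refine ⟨(injective_iff_map_eq_zero _).mpr fun f hf => ?_,
      homMap_surjective E.ρ (torMk_surjective i _)⟩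
    rw [homMap_eq_zero] at hf
    let g : (pieceRep c M (i + 1) (cFun c E)).IntertwiningMap (cyclesRep c M i (cFun c E)) :=
      { toLinearMap := (koszulD c M).restrict (p := koszulPiece c M (i + 1) (cFun c E))
          (q := koszulCycles c M i (cFun c E)) fun t ht => koszulBoundaries_le _ _ ⟨t, ht, rfl⟩
        isIntertwining' := fun w => LinearMap.ext fun t =>
          Subtype.ext (koszulRep_koszulD c M w t.1).symm }
    obtain ⟨k, hk⟩ := exists_lift_of_forall g f fun e => by
      obtain ⟨s, hs, hst⟩ := torMk_eq_zero.mp (hf e)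
      exact ⟨⟨s, hs⟩, Subtype.ext hst⟩
    refine Representation.IntertwiningMap.ext (LinearMap.ext fun e => ?_)
    exact (hk e).symm.trans (Subtype.ext (hu.koszulD_eq_zero h E k e))
  have h2 : Function.Bijective (homMap E.ρ (cyclesIncl c M i (cFun c E))) := by
    refine ⟨(injective_iff_map_eq_zero _).mpr fun f hf => ?_, fun f => ?_⟩
    · rw [homMap_eq_zero] at hf
      refine Representation.IntertwiningMap.ext (LinearMap.ext fun e => Subtype.ext ?_)
      exact congrArg (fun t : koszulPiece c M i (cFun c E) => t.1) (hf e)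
    · obtain ⟨k, hk⟩ := exists_lift_of_forall (cyclesIncl c M i (cFun c E)) f fun e =>
        ⟨⟨(f e).1, (f e).2, LinearMap.mem_ker.mpr (hu.koszulD_eq_zero h E f e)⟩, rfl⟩
      exact ⟨k, Representation.IntertwiningMap.ext (LinearMap.ext hk)⟩
  exact (LinearEquiv.ofBijective _ h1).finrank_eq.symm.trans
    (LinearEquiv.ofBijective _ h2).finrank_eq

open Abelian

lemma nonempty_linearEquiv_of_finrank {X Y : Type*} [AddCommMonoid X] [Module ℂ X]
    [AddCommMonoid Y] [Module ℂ Y] [Module.Finite ℂ X] [Module.Finite ℂ Y]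
    (h : Module.finrank ℂ X = Module.finrank ℂ Y) : Nonempty (X ≃ₗ[ℂ] Y) := by
  let _ := Module.addCommMonoidToAddCommGroup ℂ (M := X)
  let _ := Module.addCommMonoidToAddCommGroup ℂ (M := Y)
  exact ⟨LinearEquiv.ofFinrankEq _ _ h⟩

lemma finrank_ext_stdObj_of_simple (h : IsDual c c) (X : CatO c) [Simple X] (E : Rep.{u} ℂ W)
    [E.ρ.IsIrreducible] (i : ℕ) :
    Module.finrank ℂ (Ext (stdObj c E) X i) = mult E.ρ (torDeg c X.obj i (cFun c E)).ρ := by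
  have := finite_of_irreducible E
  obtain ⟨B⟩ := nonempty_invForm (W := W)
  obtain ⟨e⟩ := nonempty_dualObj_iso h B X
  rw [finrank_ext_stdObj h B E X i, conj_cFun h]
  exact (mult_torDeg_congr e E i (cFun c E)).symm

theorem nonempty_ext_equiv_of_isUnitary (h : IsDual c c) (X : CatO c) [Simple X]
    (hu : IsUnitary B X.obj) (E : Rep.{u} ℂ W) [E.ρ.IsIrreducible] (i : ℕ) :
    Nonempty (Ext (stdObj c E) X i ≃ₗ[ℂ] E.ρ.IntertwiningMap
      ((wtRep c X.obj (cFun c E - i)).tprod (extPowRep W i))) := by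
  have := finite_of_irreducible E
  have := X.property.finite_wt (cFun c E - i)
  have := finite_ext_stdObj E X i
  have : FiniteDimensional ℂ (⋀[ℂ]^i (Module.Dual ℂ 𝔥)) := inferInstance
  exact nonempty_linearEquiv_of_finrank ((finrank_ext_stdObj_of_simple h X E i).trans
    (hu.mult_torDeg h E i))

end Unitary

section IsotypicDecomposition

variable {G : Type u} [Group G] [Finite G] {T : Type u} [AddCommGroup T] [Module ℂ T]
  [FiniteDimensional ℂ T] (ρ : Representation ℂ G T) {ι : Type*} (E : ι → Rep.{u} ℂ G)
  {A : ι → Type*} [∀ j, AddCommGroup (A j)] [∀ j, Module ℂ (A j)]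
  (φ : ∀ j, A j ≃ₗ[ℂ] (E j).ρ.IntertwiningMap ρ)

/-- The evaluation map `Hom(E_j, T) ⊗ E_j → T`. -/
def isotypicEvalAt (j : ι) : A j ⊗[ℂ] E j →ₗ[ℂ] T :=
  TensorProduct.lift (LinearMap.mk₂ ℂ (fun a e => φ j a e)
    (fun a b e => by rw [map_add]; rfl) (fun z a e => by rw [map_smul]; rfl)
    (fun a e e' => map_add (φ j a) e e') (fun z a e => map_smul (φ j a) z e))

section

variable [DecidableEq ι]

/-- The evaluation map `⨁ Hom(E_j, T) ⊗ E_j → T`. -/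
def isotypicEval : (⨁ j, A j ⊗[ℂ] E j) →ₗ[ℂ] T :=
  DirectSum.toModule ℂ ι T (isotypicEvalAt ρ E φ)

lemma isotypicEval_of (j : ι) (a : A j) (e : E j) :
    isotypicEval ρ E φ (DirectSum.of (fun j => A j ⊗[ℂ] E j) j (a ⊗ₜ e)) = φ j a e :=
  DirectSum.toModule_lof ℂ (M := fun j => A j ⊗[ℂ] E j) (φ := isotypicEvalAt ρ E φ) j (a ⊗ₜ[ℂ] e)

/-- The evaluation map as a homomorphism of representations. -/
def isotypicEvalHom : (Representation.directSum fun j =>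
    (Representation.trivial ℂ G (A j)).tprod (E j).ρ).IntertwiningMap ρ where
  toLinearMap := isotypicEval ρ E φ
  isIntertwining' w := by
    refine DirectSum.linearMap_ext ℂ fun j => TensorProduct.ext' fun a e => ?_
    change isotypicEval ρ E φ (DirectSum.lmap _ (DirectSum.lof ℂ ι (fun j => A j ⊗[ℂ] E j) j (a ⊗ₜ e))) =
      ρ w (isotypicEval ρ E φ (DirectSum.of (fun j => A j ⊗[ℂ] E j) j (a ⊗ₜ e)))
    rw [DirectSum.lmap_lof, isotypicEval_of]
    refine (isotypicEval_of ρ E φ j a ((E j).ρ w e)).trans ?_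
    exact (φ j a).isIntertwining _ _ w e

lemma isotypicEval_surjective (hex : ∀ (X : Rep.{u} ℂ G) [X.ρ.IsIrreducible]
    (f : X.ρ.IntertwiningMap ρ), f ≠ 0 → ∃ j, Nonempty (X ≅ E j)) :
    Function.Surjective (isotypicEval ρ E φ) := by
  rw [← LinearMap.range_eq_top]
  by_contra hS
  let S := LinearMap.range (isotypicEval ρ E φ)
  have hst : ∀ g, S ≤ S.comap (ρ g) := by
    rintro g _ ⟨x, rfl⟩
    exact ⟨_, (isotypicEvalHom ρ E φ).isIntertwining _ _ g x⟩
  have : Nontrivial (T ⧸ S) := Submodule.Quotient.nontrivial_iff.mpr hS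
  obtain ⟨X, hX, f, hf⟩ := exists_irreducible_sub (ρ.quotient S hst)
  let π : ρ.IntertwiningMap (ρ.quotient S hst) := ⟨S.mkQ, fun g => rfl⟩
  obtain ⟨k, hk⟩ := exists_lift (π := π) S.mkQ_surjective f
  obtain ⟨x, hx⟩ := exists_ne_zero_of_irreducible X
  have hfx : f x ≠ 0 := fun h => hx (hf (h.trans (map_zero f).symm))
  obtain ⟨j, ⟨e⟩⟩ := hex X k fun h => hfx (by rw [← hk, h]; exact map_zero π)
  let e' := Representation.equivOfIso e
  obtain ⟨a, ha⟩ := (φ j).surjective (k.comp e'.symm.toIntertwiningMap)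
  have h1 : k x ∈ S := ⟨DirectSum.of (fun j => A j ⊗[ℂ] E j) j (a ⊗ₜ e' x), by
    rw [isotypicEval_of, ha]
    exact congrArg k (e'.toLinearEquiv.symm_apply_apply x)⟩
  exact hfx ((hk x).symm.trans ((Submodule.Quotient.mk_eq_zero S).mpr h1))

lemma exists_smul_of_irreducible {X : Rep.{u} ℂ G} [X.ρ.IsIrreducible]
    [FiniteDimensional ℂ X] (f : X.ρ.IntertwiningMap X.ρ) : ∃ z : ℂ, ∀ e, f e = z • e := by
  obtain ⟨z, rfl⟩ :=
    Representation.IsIrreducible.algebraMap_intertwiningMap_bijective_of_isAlgClosed.2 f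
  exact ⟨z, fun e => rfl⟩

lemma isotypicEval_injective [∀ j, (E j).ρ.IsIrreducible] [∀ j, FiniteDimensional ℂ (E j)]
    (hne : ∀ i j, Nonempty (E i ≅ E j) → i = j) :
    Function.Injective (isotypicEval ρ E φ) := by
  refine (injective_iff_map_eq_zero _).mpr fun x hx => DFinsupp.ext fun j => ?_
  obtain ⟨e₀, he₀⟩ := exists_ne_zero_of_irreducible (E j)
  obtain ⟨ξ, hξ⟩ : ∃ ξ : Module.Dual ℂ (E j), ξ e₀ = 1 := by
    by_contra! h
    refine he₀ ((Module.forall_dual_apply_eq_zero_iff ℂ e₀).mp fun ξ => ?_)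
    by_contra h0
    exact h ((ξ e₀)⁻¹ • ξ) (inv_mul_cancel₀ h0)
  let L : A j →ₗ[ℂ] Module.Dual ℂ (ρ.IntertwiningMap (E j).ρ) :=
    LinearMap.mk₂ ℂ (fun a ψ => ξ (ψ (φ j a e₀)))
      (fun a b ψ => by rw [map_add, ← map_add ξ, ← map_add ψ]; rfl)
      (fun z a ψ => by rw [map_smul, ← map_smul ξ, ← map_smul ψ]; rfl)
      (fun a ψ ψ' => (map_add ξ _ _)) (fun z a ψ => (map_smul ξ _ _))
  have hL : Function.Injective L := by
    refine (injective_iff_map_eq_zero _).mpr fun a ha => ?_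
    by_contra h0
    have h1 := (Representation.IsIrreducible.injective_or_eq_zero (φ j a)).resolve_right
      fun h => h0 ((φ j).map_eq_zero_iff.mp h)
    obtain ⟨k, hk⟩ := exists_retract h1
    have h2 : ξ (k (φ j a e₀)) = 0 := LinearMap.congr_fun ha k
    rw [hk, hξ] at h2
    exact one_ne_zero h2
  have hinj : Function.Injective (dualTensorHom ℂ (ρ.IntertwiningMap (E j).ρ) (E j) ∘ₗ
      L.rTensor (E j)) := by
    exact (dualTensorHomEquiv ℂ (ρ.IntertwiningMap (E j).ρ) (E j)).injective.comp
      (Module.Flat.rTensor_preserves_injective_linearMap L hL)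
  refine hinj ?_
  rw [DirectSum.zero_apply, map_zero]
  have key : ∀ (ψ : ρ.IntertwiningMap (E j).ρ) (x : ⨁ j, A j ⊗[ℂ] E j),
      (dualTensorHom ℂ (ρ.IntertwiningMap (E j).ρ) (E j) ∘ₗ L.rTensor (E j)) (x j) ψ =
        ψ (isotypicEval ρ E φ x) := fun ψ x => by
    induction x using DirectSum.induction_on with
    | zero => rw [DirectSum.zero_apply, map_zero, map_zero]; exact (map_zero ψ).symm
    | add x y hx hy =>
      rw [DirectSum.add_apply, map_add, LinearMap.add_apply, hx, hy, map_add]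
      exact (map_add ψ _ _).symm
    | of k t =>
      induction t using TensorProduct.induction_on with
      | zero =>
        rw [map_zero, DirectSum.zero_apply, map_zero, map_zero]
        exact (map_zero ψ).symm
      | add x y hx hy =>
        rw [map_add, DirectSum.add_apply, map_add, LinearMap.add_apply, hx, hy, map_add]
        exact (map_add ψ _ _).symm
      | tmul a e =>
        rw [isotypicEval_of]
        by_cases hk : k = j
        · subst hk
          rw [DirectSum.of_eq_same]
          obtain ⟨z, hz⟩ := exists_smul_of_irreducible (ψ.comp (φ k a))
          have hz' : ∀ e, ψ (φ k a e) = z • e := hz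
          change ξ (ψ (φ k a e₀)) • e = ψ (φ k a e)
          rw [hz', hz', map_smul, hξ, smul_eq_mul, mul_one]
        · rw [DirectSum.of_eq_of_ne _ _ _ (Ne.symm hk), map_zero, LinearMap.zero_apply]
          have h1 := (Representation.IsIrreducible.bijective_or_eq_zero
            (ψ.comp (φ k a))).resolve_left fun h => hk (hne k j
              ⟨Rep.mkIso (Representation.IntertwiningMap.ofBijective _ h)⟩)
          exact (congrArg (fun f : (E k).ρ.IntertwiningMap (E j).ρ => f e) h1).symm
  ext ψ
  rw [key, hx]
  exact map_zero ψ

end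

/-- A representation is the direct sum of its isotypic parts. -/
theorem nonempty_equiv_directSum [∀ j, (E j).ρ.IsIrreducible] [∀ j, FiniteDimensional ℂ (E j)]
    (φ : ∀ j, A j ≃ₗ[ℂ] (E j).ρ.IntertwiningMap ρ) (hne : ∀ i j, Nonempty (E i ≅ E j) → i = j)
    (hex : ∀ (X : Rep.{u} ℂ G) [X.ρ.IsIrreducible]
      (f : X.ρ.IntertwiningMap ρ), f ≠ 0 → ∃ j, Nonempty (X ≅ E j)) :
    Nonempty (ρ.Equiv (Representation.directSum fun j =>
      (Representation.trivial ℂ G (A j)).tprod (E j).ρ)) :=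
  open Classical in ⟨((isotypicEvalHom ρ E φ).ofBijective
    ⟨isotypicEval_injective ρ E φ hne, isotypicEval_surjective ρ E φ hex⟩).symm⟩

end IsotypicDecomposition

section HodgeDecomposition

open Abelian

variable {𝔥 : Type u} [AddCommGroup 𝔥] [Module ℂ 𝔥] [FiniteDimensional ℂ 𝔥]
  {W : Subgroup (𝔥 ≃ₗ[ℂ] 𝔥)} [Finite W] {c : Param W}

lemma mult_torDeg_eq_zero (E : Rep.{u} ℂ W) [E.ρ.IsIrreducible] {M : ModuleCat.{u} (Cher c)} {i : ℕ}
    {d : ℂ} (hd : d ≠ cFun c E) : mult E.ρ (torDeg c M i d).ρ = 0 := by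
  have : Subsingleton (E.ρ.IntertwiningMap (torDeg c M i d).ρ) :=
    ⟨fun f g => (torDeg_hom_eq_zero E hd f).trans (torDeg_hom_eq_zero E hd g).symm⟩
  exact Module.finrank_zero_of_subsingleton

/-- Homology and cohomology of a simple object agree. -/
theorem nonempty_hStarHomology_iso_hCohomology (h : IsDual c c) (X : CatO c) [Simple X] (i : ℕ) :
    Nonempty ((hStarHomology c i).obj X ≅ (hCohomology c i).obj X) := by
  obtain ⟨B⟩ := nonempty_invForm (W := W)
  obtain ⟨e⟩ := nonempty_dualObj_iso h B X
  refine nonempty_iso_of_mult (finite_hStarHomology X i) (finite_hCohomology X i)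
    fun d E _ _ => ?_
  rw [mult_hStarHomology, mult_hCohomology h B]
  refine Eq.trans ?_ (mult_torDeg_congr e E i (starRingEnd ℂ d))
  by_cases hd : d = cFun c E
  · rw [hd, conj_cFun h]
  · rw [mult_torDeg_eq_zero E hd, mult_torDeg_eq_zero E fun h' => hd ?_]
    rw [← Complex.conj_conj d, h', conj_cFun h]

/-- The decomposition of `Tor` of a simple object in terms of extensions by standard objects. -/
theorem nonempty_torDeg_equiv_extDeg (h : IsDual c c) (X : CatO c) [Simple X] {ι : Type*}
    (E : ι → Rep.{u} ℂ W) [∀ j, (E j).ρ.IsIrreducible]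
    (hE : ∀ X : Rep.{u} ℂ W, X.ρ.IsIrreducible → ∃! j, Nonempty (X ≅ E j)) (i : ℕ) (d : ℂ) :
    Nonempty ((torDeg c X.obj i d).ρ.Equiv (extDeg c E X i d)) := by
  have := finite_torDeg X.property i d
  have : ∀ j, FiniteDimensional ℂ (E j) := fun j => finite_of_irreducible (E j)
  have hφ : ∀ j : {j : ι // cFun c (E j) = d}, Nonempty
      (Ext (stdObj c (E j)) X i ≃ₗ[ℂ] (E j).ρ.IntertwiningMap (torDeg c X.obj i d).ρ) :=
    fun ⟨j, hj⟩ => by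
      subst hj
      have := finite_ext_stdObj (E j) X i
      exact nonempty_linearEquiv_of_finrank (finrank_ext_stdObj_of_simple h X (E j) i)
  refine nonempty_equiv_directSum (torDeg c X.obj i d).ρ
    (fun j : {j : ι // cFun c (E j) = d} => E j) (fun j => (hφ j).some) ?_ ?_
  · rintro ⟨j, _⟩ ⟨k, _⟩ ⟨e⟩
    obtain ⟨l, -, hl⟩ := hE (E j) inferInstance
    exact Subtype.ext ((hl j ⟨Iso.refl _⟩).trans (hl k ⟨e⟩).symm)
  · intro Y _ f hf
    obtain ⟨j, ⟨e⟩, -⟩ := hE Y inferInstance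
    have hd : d = cFun c (E j) := by
      by_contra hd
      refine hf (Representation.IntertwiningMap.ext (LinearMap.ext fun y => ?_))
      have h1 := torDeg_hom_eq_zero (E j) hd
        (f.comp (Representation.equivOfIso e).symm.toIntertwiningMap)
      have h2 := DFunLike.congr_fun h1 (Representation.equivOfIso e y)
      exact (congrArg f ((Representation.equivOfIso e).toLinearEquiv.symm_apply_apply y)).symm.trans
        h2
    exact ⟨⟨j, hd.symm⟩, ⟨e⟩⟩

end HodgeDecomposition

end Cherednik

end

theorem theorem1p4 {𝔥 : Type u} [AddCommGroup 𝔥] [Module ℂ 𝔥] [FiniteDimensional ℂ 𝔥]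
    (W : Subgroup (𝔥 ≃ₗ[ℂ] 𝔥)) [Finite W] (c : Cherednik.Param W) :
    -- the groups `Tor_i(M, ℂ)` with their grading and their action of `W`
    (∀ (M : Cherednik.CatO c) (i : ℕ),
      Nonempty ((⨁ d : ℂ, Cherednik.torDeg c M.obj i d) ≃ₗ[ℂ]
        ((Tor (ModuleCat.{u} (Cherednik.Poly 𝔥)) i).obj (Cherednik.polyModule c M.obj)).obj
          (Cherednik.residue 𝔥))) ∧
    -- equivariant purity
    (∀ (M : Cherednik.CatO c) (i : ℕ) (d : ℂ) (E : Rep.{u} ℂ W) [E.ρ.IsIrreducible],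
      Cherednik.isotypicPart E (Cherednik.torDeg c M.obj i d) ≠ ⊥ → d = Cherednik.cFun c E) ∧
    ∃ (_ : EnoughProjectives (Cherednik.CatO c)) (_ : EnoughInjectives (Cherednik.CatO c)),
      -- `𝔥*`-homology is `Tor`
      (∀ (M : Cherednik.CatO c) (i : ℕ),
        Nonempty ((Cherednik.hStarHomology c i).obj M ≅ Cherednik.torGr c M.obj i)) ∧
      (c.IsReal → ∀ (L : Cherednik.CatO c) [Simple L],
        (∀ i : ℕ, Nonempty ((Cherednik.hStarHomology c i).obj L ≅
          (Cherednik.hCohomology c i).obj L)) ∧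
        (∀ {ι : Type*} (E : ι → Rep.{u} ℂ W) [∀ j, (E j).ρ.IsIrreducible],
          (∀ X : Rep.{u} ℂ W, X.ρ.IsIrreducible → ∃! j, Nonempty (X ≅ E j)) →
          ∀ (i : ℕ) (d : ℂ), Nonempty
            ((Cherednik.torDeg c L.obj i d).ρ.Equiv (Cherednik.extDeg c E L i d))) ∧
        (∀ B : Cherednik.InvForm W, Cherednik.IsUnitary B L.obj →
          ∀ (E : Rep.{u} ℂ W) [E.ρ.IsIrreducible] (i : ℕ), Nonempty
            (Abelian.Ext (Cherednik.stdObj c E) L i ≃ₗ[ℂ]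
              E.ρ.IntertwiningMap ((Cherednik.wtRep c L.obj (Cherednik.cFun c E - i)).tprod
                (Cherednik.extPowRep W i))))) :=
  ⟨fun M i => Cherednik.nonempty_directSum_torDeg_equiv M i,
    fun _ _ _ E _ h => Cherednik.eq_cFun_of_isotypicPart E h,
    Cherednik.enoughProjectives_catO, Cherednik.enoughInjectives_catO,
    fun M i => Cherednik.nonempty_hStarHomology_iso M i,
    fun hc L _ => ⟨fun i => Cherednik.nonempty_hStarHomology_iso_hCohomology hc.isDual L i,
      fun E _ hE i d => Cherednik.nonempty_torDeg_equiv_extDeg hc.isDual L E hE i d,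
      fun _ hu E _ i => Cherednik.nonempty_ext_equiv_of_isUnitary hc.isDual L hu E i⟩⟩
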